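/- **Setting.** Put $S^1=\mathbb R/2\mathbb Z$ and $\mathcal L E=C^\infty(S^1,E)$; let $\mathcal A E$ be the space of smooth $f:\mathbb R\to E$ with $f(t+2)=-f(t)$. *Framed loops.* A framed loop is a pair $(\gamma,V)$ of maps in $\mathcal L\mathbb R^3$ with $\gamma$ an immersion and $V$ a unit normal field along $\gamma$; put $T=\gamma'/\|\gamma'\|$ and $W=T\times V$. Let $\mathcal M$ be the Fréchet manifold of framed loops modulo orientation-preserving Euclidean similarities of $\mathbb R^3$ and constant frame twists $(\gamma,V)\mapsto(\gamma,\cos\theta\,V+\sin\theta\,W)$. Every class is represented by framed loops of length $2$. On variations of a framed loop let $$g\big((\delta\gamma_1,\delta V_1),(\delta\gamma_2,\delta V_2)\big)=\tfrac14\int_0^2\Big(\big\langle\tfrac{d}{ds}\delta\gamma_1,\tfrac{d}{ds}\delta\gamma_2\big\rangle+\langle\delta V_1,W\rangle\langle\delta V_2,W\rangle\Big)\,ds$$ with $s$ the arclength, let $J$ be the complex structure which, in terms of the pairs $(\frac{d}{ds}\delta\gamma,\delta V)$, sends $(T,0)\mapsto(0,-W)$ and $(W,0)\mapsto(-V,T)$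 pointwise, and let $\omega=g(J\cdot,\cdot)$. $\mathcal M$ carries the induced metric (the quotient metric from framed loops of length $2$) and the induced symplectic form: at a framed loop of length $2$, $T\mathcal M$ is the space of variations through framed loops of length $2$ modulo the tangent space of the orbit, and $\omega$ descends to it. Geodesics are critical points of the energy under smooth variations with compact support. *Planar loops.* Let $\mathcal N$ be the space of smooth immersions $S^1\to\mathbb R^2$ modulo all similarities of the plane (translations, scalings, rotations and reflections), and $\mathcal N^+$ the space of smooth immersions $S^1\to\mathbb R^2$ modulo orientation-preserving similarities. *Grassmannians.* For $\mathbb K=\mathbb R,\mathbb C$ and $\mathcal V=\mathcal L\mathbb K$ or $\mathcal A\mathbb K$, let $\mathrm{Gr}_2^\circ(\mathcal V)$ be the space of $\mathbb K$-planes in $\mathcal V$ spanned by $L^2([0,2])$-orthonormal pairs $\Phi=(\phi,\psi)$ without common zeros, that is, the set of these pairs modulo $\mathrm U(2)$ (for $\mathbb K=\mathbb C$) or $\mathrm O(2)$ (for $\mathbb K=\mathbb R$). **Proposition.** The assignment $[(\gamma^1,\gamma^2)]\mapsto[(\gamma^1,0,\gamma^2),V]$, with $V\equiv(0,1,0)$,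 is a well-defined map $\iota:\mathcal N\to\mathcal M$, with the following properties. 1. $\iota$ is an embedding of a split submanifold: it is a diffeomorphism and a homeomorphism onto its image, and near every point of the image there is a chart of $\mathcal M$ in a product $F\times F'$ of Fréchet spaces that takes $\iota(\mathcal N)$ to $F\times\{0\}$. 2. $\iota(\mathcal N)$ is totally geodesic. A smooth curve in $\mathcal N$ is a geodesic of $\mathcal N$ (for the induced metric) if and only if its image is a geodesic of $\mathcal M$. Every tangent vector of $\mathcal N$ is the initial velocity of a geodesic in $\mathcal N$. A geodesic of $\mathcal M$ on an open interval that is tangent to $\iota(\mathcal N)$ at one time lies in $\iota(\mathcal N)$ at all times. 3. $\iota(\mathcal N)$ is Lagrangian: at each of its points its tangent space equals its own $\omega$-orthogonal complement in $T\mathcal M$, and has an isotropic complement there. 4. In complex coordinates $\iota$ is the inclusion of the real Grassmannians in the complex ones. There are diffeomorphisms $$\Theta_{\mathbb C}:\mathrm{Gr}_2^\circ(\mathcal L\mathbb C)\sqcup\mathrm{Gr}_2^\circ(\mathcal A\mathbb C)\to\mathcal M,\qquad \Theta_{\mathbb R}:\mathrm{Gr}_2^\circ(\mathcal L\mathbb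 R)\sqcup\mathrm{Gr}_2^\circ(\mathcal A\mathbb R)\to\mathcal N$$ such that $\Theta_{\mathbb C}[\phi,\psi]$ is the class of the framed loop with $$\gamma(t)=\int_0^t\big(|\phi|^2-|\psi|^2,\;2\,\mathrm{Im}(\phi\bar\psi),\;2\,\mathrm{Re}(\phi\bar\psi)\big)\,d\tau,$$ $$V=\frac{\big(2\,\mathrm{Im}(\phi\psi),\;\mathrm{Re}(\phi^2+\psi^2),\;\mathrm{Im}(-\phi^2+\psi^2)\big)}{|\phi|^2+|\psi|^2},$$ $\Theta_{\mathbb R}[\phi,\psi]$ is the class of the planar loop $\gamma(t)=\int_0^t(\phi^2-\psi^2,\,2\phi\psi)\,d\tau$, and $\iota\circ\Theta_{\mathbb R}=\Theta_{\mathbb C}\circ j$, where $j$ takes a real plane to its complex span. 5. The natural projection $\mathcal N^+\to\mathcal N$ is a local diffeomorphism, and it is exactly two-to-one: its fibres are the pairs $\{[\gamma],[\bar\gamma]\}$, where $\bar\gamma$ is the mirror image of $\gamma$, and always $[\gamma]\ne[\bar\gamma]$ in $\mathcal N^+$. Hence the map $\mathcal N^+\to\mathcal M$ given by the same formula is a local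 embedding onto the same submanifold $\iota(\mathcal N)$, and it is two-to-one. -/

import Mathlib

open Set Filter Topology MeasureTheory Diffeology
open scoped ContDiff InnerProductSpace

noncomputable section

/-! ## Smoothness on spaces of loops

Every space below carries a diffeology: the plots are the smooth finite-dimensional families.
Fréchet spaces and Fréchet manifolds sit fully faithfully inside diffeological spaces, and the
D-topology of a Fréchet manifold is its usual topology. -/

/-- The subset diffeology. -/
instance subtypeDiffeology {X : Type*} [DiffeologicalSpace X] (P : X → Prop) :
    DiffeologicalSpace {x : X // P x} where
  plots n := {p | IsPlot (fun y => (p y : X))}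
  constant_plots x := isPlot_const (x := (x : X))
  plot_reparam hp hf := isPlot_reparam hp hf
  locality {n p} h := DiffeologicalSpace.locality (X := X) (p := fun y => (p y : X)) h

/-- The product diffeology. -/
instance prodDiffeology {X Y : Type*} [DiffeologicalSpace X] [DiffeologicalSpace Y] :
    DiffeologicalSpace (X × Y) where
  plots n := {p | IsPlot (fun y => (p y).1) ∧ IsPlot (fun y => (p y).2)}
  constant_plots x := ⟨isPlot_const (x := x.1), isPlot_const (x := x.2)⟩
  plot_reparam hp hf := ⟨isPlot_reparam hp.1 hf, isPlot_reparam hp.2 hf⟩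
  locality {n p} h := by
    refine ⟨DiffeologicalSpace.locality fun x => ?_, DiffeologicalSpace.locality fun x => ?_⟩
    · obtain ⟨u, hu, hx, H⟩ := h x
      exact ⟨u, hu, hx, fun {m f} h1 h2 => (H h1 h2).1⟩
    · obtain ⟨u, hu, hx, H⟩ := h x
      exact ⟨u, hu, hx, fun {m f} h1 h2 => (H h1 h2).2⟩

/-- A smooth map into a given open set that is the identity near a given point. -/
theorem exists_smooth_retract {n : ℕ} {u : Set (EuclideanSpace ℝ (Fin n))} (hu : IsOpen u)
    {x : EuclideanSpace ℝ (Fin n)} (hx : x ∈ u) :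
    ∃ f : EuclideanSpace ℝ (Fin n) → EuclideanSpace ℝ (Fin n), ContDiff ℝ ∞ f ∧
      (∀ y, f y ∈ u) ∧ ∀ᶠ y in 𝓝 x, f y = y := by
  obtain ⟨ε, hε, hb⟩ := Metric.isOpen_iff.1 hu x hx
  let b : ContDiffBump x := ⟨ε / 3, ε / 2, by positivity, by linarith⟩
  refine ⟨fun y => x + b y • (y - x), ?_, fun y => hb ?_, ?_⟩
  · exact contDiff_const.add (b.contDiff.smul (contDiff_id.sub contDiff_const))
  · rw [Metric.mem_ball, dist_eq_norm, add_sub_cancel_left, norm_smul, Real.norm_eq_abs,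
      abs_of_nonneg b.nonneg]
    by_cases hy : dist y x < ε / 2
    · rw [dist_eq_norm] at hy
      nlinarith [b.le_one (x := y), b.nonneg (x := y), norm_nonneg (y - x)]
    · rw [b.zero_of_le_dist (not_lt.1 hy), zero_mul]
      exact hε
  · filter_upwards [b.eventuallyEq_one] with y hy
    simp [hy]

/-- The quotient diffeology: the plots are the maps that locally lift to plots. -/
instance quotientDiffeology {X : Type*} [DiffeologicalSpace X] (s : Setoid X) :
    DiffeologicalSpace (Quotient s) where
  plots n := {p | ∀ x, ∃ q : EuclideanSpace ℝ (Fin n) → X, IsPlot q ∧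
    ∀ᶠ y in 𝓝 x, p y = Quotient.mk s (q y)}
  constant_plots c := fun x => by
    obtain ⟨a, rfl⟩ := Quotient.exists_rep c
    exact ⟨fun _ => a, isPlot_const, Eventually.of_forall fun _ => rfl⟩
  plot_reparam {n m p f} hp hf := fun x => by
    obtain ⟨q, hq, h⟩ := hp (f x)
    exact ⟨q ∘ f, isPlot_reparam hq hf, hf.continuous.continuousAt.eventually h⟩
  locality {n p} h := fun x => by
    obtain ⟨u, hu, hx, H⟩ := h x
    obtain ⟨f, hf, hfu, hfx⟩ := exists_smooth_retract hu hx
    obtain ⟨q, hq, hq'⟩ := H hfu hf x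
    refine ⟨q, hq, ?_⟩
    filter_upwards [hq', hfx] with y h1 h2
    rw [← h1, Function.comp_apply, h2]

/-- Smooth maps `f : ℝ → E` with `f (t + 2) = σ f t`. For `σ = 1` these are the loops
`C^∞(S¹, E)` with `S¹ = ℝ / 2ℤ`, for `σ = -1` the smoothly antiperiodic paths. -/
def loops (σ : ℤˣ) (E : Type*) [NormedAddCommGroup E] [NormedSpace ℝ E] :
    Submodule ℝ (ℝ → E) where
  carrier := {f | ContDiff ℝ ∞ f ∧ ∀ t, f (t + 2) = σ • f t}
  zero_mem' := ⟨contDiff_const, fun t => by simp⟩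
  add_mem' := fun ⟨h1, h2⟩ ⟨h3, h4⟩ =>
    ⟨h1.add h3, fun t => by simp only [Pi.add_apply, h2, h4, smul_add]⟩
  smul_mem' := fun c f ⟨h1, h2⟩ =>
    ⟨h1.const_smul c, fun t => by simp only [Pi.smul_apply, h2, smul_comm c σ]⟩

/-- A family of loops is smooth if it is jointly smooth in the parameters and in `t`; this is
smoothness for the `C^∞` Fréchet topology. -/
instance loopsDiffeology (σ : ℤˣ) (E : Type*) [NormedAddCommGroup E] [NormedSpace ℝ E] :
    DiffeologicalSpace (loops σ E) :=
  .ofCorePlotsOn {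
    isPlotOn := fun {n u} _ p => ContDiffOn ℝ ∞
      (fun q : EuclideanSpace ℝ (Fin n) × ℝ => (p q.1 : ℝ → E) q.2) (u ×ˢ univ)
    isPlotOn_congr := fun _ _ _ h => contDiffOn_congr fun q hq => by rw [h hq.1]
    isPlot := fun {n} p => ContDiff ℝ ∞
      (fun q : EuclideanSpace ℝ (Fin n) × ℝ => (p q.1 : ℝ → E) q.2)
    isPlotOn_univ := by simp [contDiffOn_univ]
    isPlot_const := fun f => f.2.1.comp contDiff_snd
    isPlotOn_reparam := fun {n m u v _} _ {p f} h hp hf =>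
      hp.comp (g := fun q : EuclideanSpace ℝ (Fin n) × ℝ => (p q.1 : ℝ → E) q.2)
        (f := fun q : EuclideanSpace ℝ (Fin m) × ℝ => (f q.1, q.2))
        ((hf.comp contDiff_fst.contDiffOn fun q hq => hq.1).prodMk contDiff_snd.contDiffOn)
        fun q hq => ⟨h hq.1, mem_univ _⟩
    locality := fun _ p h => fun q hq => by
      obtain ⟨v, hv, hxv, hv'⟩ := h q.1 hq.1
      exact ((hv' q ⟨hxv, mem_univ _⟩).contDiffAt
        ((hv.prod isOpen_univ).mem_nhds ⟨hxv, mem_univ _⟩)).contDiffWithinAt }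

/-! ## Embeddings and submanifolds -/

/-- `f` is a diffeomorphism onto its image, the image carrying the subset diffeology. -/
def IsInduction {X Y : Type*} [DiffeologicalSpace X] [DiffeologicalSpace Y] (f : X → Y) : Prop :=
  Function.Injective f ∧
    ∀ (n : ℕ) (p : EuclideanSpace ℝ (Fin n) → X), IsPlot p ↔ IsPlot (f ∘ p)

/-- `f` is a diffeomorphism onto an open subset. -/
def IsOpenInduction {X Y : Type*} [DiffeologicalSpace X] [DiffeologicalSpace Y] (f : X → Y) :
    Prop :=
  IsInduction f ∧ ∀ U : Set X, IsOpen[dTopology] U → IsOpen[dTopology] (f '' U)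

/-- Near `p` the set `S` is a split submanifold: there is a diffeomorphism `χ` from an open
neighbourhood of the origin in the Fréchet space `F × F'` (with `F`, `F'` closed linear subspaces
of a space of smooth `ℝᵈ`-valued loops or antiperiodic paths) onto an open neighbourhood of `p`
that takes the origin to `p` and the slice `F × {0}` to `S`. -/
def HasSubmanifoldChart {X : Type*} [DiffeologicalSpace X] (S : Set X) (p : X) : Prop :=
  ∃ (σ : ℤˣ) (d : ℕ) (F F' : Submodule ℝ (loops σ (EuclideanSpace ℝ (Fin d)))),
    IsClosed[dTopology] (F : Set (loops σ (EuclideanSpace ℝ (Fin d)))) ∧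
    IsClosed[dTopology] (F' : Set (loops σ (EuclideanSpace ℝ (Fin d)))) ∧
    ∃ (O : Set (F × F')) (h0 : (0 : F × F') ∈ O) (χ : O → X),
      IsOpen[dTopology] O ∧ IsOpenInduction χ ∧ χ ⟨0, h0⟩ = p ∧
      ∀ z : O, χ z ∈ S ↔ (z : F × F').2 = 0

/-- `f` embeds `X` as a submanifold of `Y`: its image is a split submanifold, and `f` is a
diffeomorphism and a homeomorphism onto its image. -/
def IsSubmanifoldEmbedding {X Y : Type*} [DiffeologicalSpace X] [DiffeologicalSpace Y]
    (f : X → Y) : Prop :=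
  IsInduction f ∧ @Topology.IsEmbedding X Y dTopology dTopology f ∧
    ∀ x, HasSubmanifoldChart (range f) (f x)

/-! ## Planar loops -/

/-- The plane. -/
abbrev E2 := EuclideanSpace ℝ (Fin 2)

/-- Euclidean three-space. -/
abbrev E3 := EuclideanSpace ℝ (Fin 3)

/-- The linear map given by a matrix. -/
abbrev matAct {n : ℕ} (A : Matrix (Fin n) (Fin n) ℝ) :
    EuclideanSpace ℝ (Fin n) →L[ℝ] EuclideanSpace ℝ (Fin n) :=
  Matrix.toEuclideanCLM (𝕜 := ℝ) A

/-- Smooth immersed planar loops, `Imm(S¹, ℝ²)`. -/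
abbrev PlanarLoop := {γ : loops 1 E2 // ∀ t, deriv γ.1 t ≠ 0}

/-- `η` is the image of `γ` under a similarity of the plane whose linear part is a positive
multiple of an element of `G`. -/
def PlanarSimilar (G : Submonoid (Matrix (Fin 2) (Fin 2) ℝ)) (γ η : PlanarLoop) : Prop :=
  ∃ A ∈ G, ∃ r : ℝ, 0 < r ∧ ∃ b : E2, ∀ t, η.1.1 t = r • matAct A (γ.1.1 t) + b

theorem matAct_mul {n : ℕ} (A B : Matrix (Fin n) (Fin n) ℝ) (v : EuclideanSpace ℝ (Fin n)) :
    matAct (A * B) v = matAct A (matAct B v) := by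
  simp only [matAct, map_mul, mul_apply_eq_comp]

theorem matAct_transpose_matAct {n : ℕ} {A : Matrix (Fin n) (Fin n) ℝ}
    (hA : A ∈ Matrix.orthogonalGroup (Fin n) ℝ) (v : EuclideanSpace ℝ (Fin n)) :
    matAct A.transpose (matAct A v) = v := by
  have h := (Matrix.mem_orthogonalGroup_iff' (Fin n) ℝ).1 hA
  rw [← matAct_mul, h]
  simp

theorem planarSimilar_equivalence (G : Submonoid (Matrix (Fin 2) (Fin 2) ℝ))
    (hG : G ≤ Matrix.orthogonalGroup (Fin 2) ℝ) (hT : ∀ A ∈ G, A.transpose ∈ G) :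
    Equivalence (PlanarSimilar G) where
  refl γ := ⟨1, G.one_mem, 1, one_pos, 0, fun t => by simp⟩
  symm := by
    rintro γ η ⟨A, hA, r, hr, b, h⟩
    refine ⟨A.transpose, hT A hA, r⁻¹, inv_pos.2 hr, -(r⁻¹ • matAct A.transpose b), fun t => ?_⟩
    rw [h, map_add, map_smul, matAct_transpose_matAct (hG hA), smul_add, smul_smul,
      inv_mul_cancel₀ hr.ne', one_smul, add_neg_cancel_right]
  trans := by
    rintro γ η ζ ⟨A, hA, r, hr, b, h⟩ ⟨B, hB, s, hs, c, h'⟩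
    refine ⟨B * A, G.mul_mem hB hA, s * r, mul_pos hs hr, s • matAct B b + c, fun t => ?_⟩
    rw [h', h, map_add, map_smul, smul_add, smul_smul, matAct_mul, add_assoc]

theorem transpose_mem_orthogonal {n : ℕ} {A : Matrix (Fin n) (Fin n) ℝ}
    (hA : A ∈ Matrix.orthogonalGroup (Fin n) ℝ) :
    A.transpose ∈ Matrix.orthogonalGroup (Fin n) ℝ := by
  rw [Matrix.mem_orthogonalGroup_iff, Matrix.transpose_transpose]
  exact (Matrix.mem_orthogonalGroup_iff' (Fin n) ℝ).1 hA

theorem transpose_mem_specialOrthogonal {n : ℕ} {A : Matrix (Fin n) (Fin n) ℝ}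
    (hA : A ∈ Matrix.specialOrthogonalGroup (Fin n) ℝ) :
    A.transpose ∈ Matrix.specialOrthogonalGroup (Fin n) ℝ := by
  rw [Matrix.mem_specialOrthogonalGroup_iff] at hA ⊢
  exact ⟨transpose_mem_orthogonal hA.1, by rw [Matrix.det_transpose, hA.2]⟩

/-- Planar loops up to all similarities of the plane. -/
instance planarSetoid : Setoid PlanarLoop :=
  ⟨PlanarSimilar (Matrix.orthogonalGroup (Fin 2) ℝ),
    planarSimilar_equivalence _ le_rfl fun _ => transpose_mem_orthogonal⟩

/-- Planar loops up to the orientation-preserving similarities of the plane. -/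
def orientedPlanarSetoid : Setoid PlanarLoop :=
  ⟨PlanarSimilar (Matrix.specialOrthogonalGroup (Fin 2) ℝ),
    planarSimilar_equivalence _
      (fun _ hA => ((Matrix.mem_specialOrthogonalGroup_iff).1 hA).1)
      fun _ => transpose_mem_specialOrthogonal⟩

/-- The moduli space `N` of planar loops, `Imm(S¹, ℝ²)` modulo similarities. -/
abbrev PlanarModuli := Quotient planarSetoid

/-- The moduli space of planar loops modulo orientation-preserving similarities. -/
abbrev OrientedPlanarModuli := Quotient orientedPlanarSetoid

/-- The natural projection that identifies mirror images. -/
def forgetOrientation : OrientedPlanarModuli → PlanarModuli :=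
  Quotient.map' id fun _ _ ⟨A, hA, h⟩ =>
    ⟨A, ((Matrix.mem_specialOrthogonalGroup_iff).1 hA).1, h⟩

/-- Composition of loops with a linear map. -/
def loopMap {E F : Type*} [NormedAddCommGroup E] [NormedSpace ℝ E] [NormedAddCommGroup F]
    [NormedSpace ℝ F] (L : E →L[ℝ] F) : loops 1 E →ₗ[ℝ] loops 1 F where
  toFun f := ⟨fun t => L (f.1 t), L.contDiff.comp f.2.1, fun t => by
    have := f.2.2 t
    simp only [one_smul] at this ⊢
    rw [this]⟩
  map_add' f g := by ext t; simp
  map_smul' c f := by ext t; simp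

theorem deriv_loopMap {E F : Type*} [NormedAddCommGroup E] [NormedSpace ℝ E]
    [NormedAddCommGroup F] [NormedSpace ℝ F] (L : E →L[ℝ] F) (f : loops 1 E) (t : ℝ) :
    deriv (loopMap L f).1 t = L (deriv f.1 t) :=
  (L.hasFDerivAt.comp_hasDerivAt t
    ((f.2.1.differentiable (by simp)).differentiableAt.hasDerivAt)).deriv

/-- The reflection `(x, y) ↦ (x, -y)` of the plane. -/
def reflPlane : E2 →L[ℝ] E2 :=
  LinearMap.toContinuousLinearMap
    { toFun := fun v => !₂[v 0, -v 1]
      map_add' := fun v w => by ext i; fin_cases i <;> simp [add_comm]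
      map_smul' := fun c v => by ext i; fin_cases i <;> simp }

theorem reflPlane_apply (v : E2) : reflPlane v = !₂[v 0, -v 1] := rfl

/-- The mirror image of a planar loop. -/
def PlanarLoop.reflect (γ : PlanarLoop) : PlanarLoop :=
  ⟨loopMap reflPlane γ.1, fun t h => γ.2 t <| by
    rw [deriv_loopMap, reflPlane_apply] at h
    have h0 := congrFun (congrArg WithLp.ofLp h) 0
    have h1 := congrFun (congrArg WithLp.ofLp h) 1
    ext i; fin_cases i
    · simpa using h0
    · simpa using h1⟩

/-! ## Framed loops in three-space -/

/-- The cross product. -/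
def cross (u v : E3) : E3 := WithLp.toLp 2 (crossProduct u.ofLp v.ofLp)

/-- Framed loops: pairs `(γ, V)` of an immersed loop `γ` and a unit normal field `V` along it. -/
abbrev FramedLoop := {x : loops 1 E3 × loops 1 E3 //
  (∀ t, deriv x.1.1 t ≠ 0) ∧ (∀ t, ‖x.2.1 t‖ = 1) ∧ ∀ t, ⟪deriv x.1.1 t, x.2.1 t⟫_ℝ = 0}

namespace FramedLoop

/-- The base curve. -/
def γ (x : FramedLoop) : ℝ → E3 := x.1.1.1

/-- The framing. -/
def V (x : FramedLoop) : ℝ → E3 := x.1.2.1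

/-- The unit tangent. -/
def T (x : FramedLoop) (t : ℝ) : E3 := ‖deriv x.γ t‖⁻¹ • deriv x.γ t

/-- The binormal `T × V`. -/
def W (x : FramedLoop) (t : ℝ) : E3 := cross (x.T t) (x.V t)

/-- The length of the base curve. -/
def length (x : FramedLoop) : ℝ := ∫ t in (0 : ℝ)..2, ‖deriv x.γ t‖

/-- `y` is obtained from `x` by a constant frame twist followed by an orientation-preserving
similarity of three-space. -/
def Similar (x y : FramedLoop) : Prop :=
  ∃ A ∈ Matrix.specialOrthogonalGroup (Fin 3) ℝ, ∃ r : ℝ, 0 < r ∧ ∃ (b : E3) (θ : ℝ),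
    (∀ t, y.γ t = r • matAct A (x.γ t) + b) ∧
    ∀ t, y.V t = matAct A (Real.cos θ • x.V t + Real.sin θ • x.W t)

theorem cross_matAct {A : Matrix (Fin 3) (Fin 3) ℝ}
    (hA : A ∈ Matrix.specialOrthogonalGroup (Fin 3) ℝ) (u v : E3) :
    cross (matAct A u) (matAct A v) = matAct A (cross u v) := by
  obtain ⟨h1, h2⟩ := (Matrix.mem_specialOrthogonalGroup_iff).1 hA
  have h3 : A.adjugate = A.transpose := by
    have h := (Matrix.mem_orthogonalGroup_iff' (Fin 3) ℝ).1 h1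
    calc A.adjugate = A.transpose * A * A.adjugate := by rw [h, one_mul]
      _ = A.transpose := by rw [mul_assoc, Matrix.mul_adjugate, h2, one_smul, mul_one]
  have h4 : ∀ i j, A i j = A.adjugate j i := fun i j => by rw [h3, Matrix.transpose_apply]
  have h5 := Matrix.adjugate_fin_three A
  ext i
  have key : (cross (matAct A u) (matAct A v)) i =
      ∑ j, A.adjugate j i * (cross u v) j := by
    rw [h5]
    fin_cases i <;>
      simp [cross, cross_apply, Fin.sum_univ_three, Matrix.mulVec, dotProduct] <;> ring
  rw [key]
  simp only [← h4]
  simp [Matrix.mulVec, dotProduct]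

theorem norm_matAct {n : ℕ} {A : Matrix (Fin n) (Fin n) ℝ}
    (hA : A ∈ Matrix.orthogonalGroup (Fin n) ℝ) (v : EuclideanSpace ℝ (Fin n)) :
    ‖matAct A v‖ = ‖v‖ := by
  have h := (Matrix.mem_orthogonalGroup_iff' (Fin n) ℝ).1 hA
  rw [EuclideanSpace.norm_eq, EuclideanSpace.norm_eq]
  congr 1
  have e : ∀ w : EuclideanSpace ℝ (Fin n), ∑ i, ‖w i‖ ^ 2 = w.ofLp ⬝ᵥ w.ofLp := fun w => by
    simp [dotProduct, sq]
  rw [e, e]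
  change (A.mulVec v.ofLp) ⬝ᵥ (A.mulVec v.ofLp) = _
  rw [Matrix.dotProduct_mulVec, Matrix.vecMul_mulVec, h, Matrix.vecMul_one]

theorem cross_add_smul (u v w : E3) (a b : ℝ) :
    cross u (a • v + b • w) = a • cross u v + b • cross u w := by
  simp [cross]

theorem continuous_T (x : FramedLoop) : Continuous x.T := by
  have h : Continuous (deriv x.γ) := x.1.1.2.1.continuous_deriv (by simp)
  exact (h.norm.inv₀ fun t => norm_ne_zero_iff.2 (x.2.1 t)).smul h

theorem norm_T (x : FramedLoop) (t : ℝ) : ‖x.T t‖ = 1 := by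
  have h : ‖deriv x.γ t‖ ≠ 0 := norm_ne_zero_iff.2 (x.2.1 t)
  rw [T, norm_smul, norm_inv, norm_norm, inv_mul_cancel₀ h]

theorem cross_T_W (x : FramedLoop) (t : ℝ) : cross (x.T t) (x.W t) = -x.V t := by
  have h1 : ⟪x.T t, x.V t⟫_ℝ = 0 := by
    rw [T, real_inner_smul_left, show ⟪deriv x.γ t, x.V t⟫_ℝ = 0 from x.2.2.2 t, mul_zero]
  have h2 : ⟪x.T t, x.T t⟫_ℝ = 1 := by rw [real_inner_self_eq_norm_sq, norm_T, one_pow]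
  have e : ∀ u v : E3, cross u (cross u v) = ⟪u, v⟫_ℝ • u - ⟪u, u⟫_ℝ • v := fun u v => by
    have hi : ∀ a b : E3, ⟪a, b⟫_ℝ = a 0 * b 0 + a 1 * b 1 + a 2 * b 2 := fun a b => by
      simp only [PiLp.inner_apply, Fin.sum_univ_three, RCLike.inner_apply, conj_trivial]
      ring
    rw [hi, hi]
    ext i
    fin_cases i <;> simp [cross, cross_apply] <;> ring
  rw [W, e, h1, h2, zero_smul, one_smul, zero_sub]

theorem deriv_similar {x y : FramedLoop} {A : Matrix (Fin 3) (Fin 3) ℝ} {r : ℝ} {b : E3}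
    (h : ∀ t, y.γ t = r • matAct A (x.γ t) + b) (t : ℝ) :
    deriv y.γ t = r • matAct A (deriv x.γ t) := by
  have h1 : HasDerivAt x.γ (deriv x.γ t) t :=
    ((x.1.1.2.1.differentiable (by simp)).differentiableAt).hasDerivAt
  rw [funext h]
  exact ((((matAct A).hasFDerivAt.comp_hasDerivAt t h1).const_smul r).add_const b).deriv

theorem frame_similar {x y : FramedLoop} {A : Matrix (Fin 3) (Fin 3) ℝ}
    (hA : A ∈ Matrix.specialOrthogonalGroup (Fin 3) ℝ) {r : ℝ} (hr : 0 < r) {b : E3} {θ : ℝ}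
    (h : ∀ t, y.γ t = r • matAct A (x.γ t) + b)
    (hV : ∀ t, y.V t = matAct A (Real.cos θ • x.V t + Real.sin θ • x.W t)) (t : ℝ) :
    y.W t = matAct A (Real.cos θ • x.W t - Real.sin θ • x.V t) := by
  have hT : y.T t = matAct A (x.T t) := by
    rw [T, T, deriv_similar h, norm_smul, norm_matAct ((Matrix.mem_specialOrthogonalGroup_iff).1 hA).1,
      Real.norm_of_nonneg hr.le, smul_smul, map_smul, mul_inv, mul_comm r⁻¹, mul_assoc,
      inv_mul_cancel₀ hr.ne', mul_one]
  rw [W, hT, hV, cross_matAct hA, cross_add_smul, cross_T_W, smul_neg, ← sub_eq_add_neg]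
  rfl

theorem similar_equivalence : Equivalence Similar where
  refl x := ⟨1, one_mem _, 1, one_pos, 0, 0, fun t => by simp, fun t => by simp⟩
  symm := by
    rintro x y ⟨A, hA, r, hr, b, θ, h, hV⟩
    have hO := ((Matrix.mem_specialOrthogonalGroup_iff).1 hA).1
    refine ⟨A.transpose, transpose_mem_specialOrthogonal hA, r⁻¹, inv_pos.2 hr,
      -(r⁻¹ • matAct A.transpose b), -θ, fun t => ?_, fun t => ?_⟩
    · rw [h, map_add, map_smul, matAct_transpose_matAct hO, smul_add, smul_smul,
        inv_mul_cancel₀ hr.ne', one_smul, add_neg_cancel_right]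
    · rw [frame_similar hA hr h hV, hV, ← map_smul, ← map_smul, ← map_add,
        matAct_transpose_matAct hO, Real.cos_neg, Real.sin_neg]
      have := Real.sin_sq_add_cos_sq θ
      have e : Real.cos θ • (Real.cos θ • x.V t + Real.sin θ • x.W t) +
          -Real.sin θ • (Real.cos θ • x.W t - Real.sin θ • x.V t) =
          (Real.sin θ ^ 2 + Real.cos θ ^ 2) • x.V t := by module
      rw [e, this, one_smul]
  trans := by
    rintro x y z ⟨A, hA, r, hr, b, θ, h, hV⟩ ⟨B, hB, s, hs, c, τ, h', hV'⟩
    refine ⟨B * A, mul_mem hB hA, s * r, mul_pos hs hr, s • matAct B b + c, θ + τ,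
      fun t => ?_, fun t => ?_⟩
    · rw [h', h, map_add, map_smul, smul_add, smul_smul, matAct_mul, add_assoc]
    · rw [hV', frame_similar hA hr h hV, hV, ← map_smul, ← map_smul, ← map_add, matAct_mul,
        Real.cos_add, Real.sin_add]
      congr 2
      module

/-- Framed loops up to similarities of three-space and constant frame twists. -/
instance setoid : Setoid FramedLoop := ⟨Similar, similar_equivalence⟩

end FramedLoop

/-- The moduli space `M` of (relatively) framed loops. -/
abbrev FramedModuli := Quotient FramedLoop.setoid

/-- The linear embedding `(x, y) ↦ (x, 0, y)` of the plane in three-space. -/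
def planeToSpace : E2 →L[ℝ] E3 :=
  LinearMap.toContinuousLinearMap
    { toFun := fun v => !₂[v 0, 0, v 1]
      map_add' := fun v w => by ext i; fin_cases i <;> simp
      map_smul' := fun c v => by ext i; fin_cases i <;> simp }

theorem planeToSpace_apply (v : E2) : planeToSpace v = !₂[v 0, 0, v 1] := rfl

/-- A planar loop, placed in the `xz`-plane and framed by the unit vector in the `y`-direction. -/
def PlanarLoop.framed (γ : PlanarLoop) : FramedLoop :=
  ⟨(loopMap planeToSpace γ.1,
    ⟨fun _ => !₂[0, 1, 0], contDiff_const, fun _ => (one_smul ℤˣ _).symm⟩),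
    fun t h => γ.2 t <| by
      rw [deriv_loopMap, planeToSpace_apply] at h
      have h0 := congrFun (congrArg WithLp.ofLp h) 0
      have h1 := congrFun (congrArg WithLp.ofLp h) 2
      ext i; fin_cases i
      · simpa using h0
      · simpa using h1,
    fun t => by simp [EuclideanSpace.norm_eq, Fin.sum_univ_three],
    fun t => by
      rw [deriv_loopMap, planeToSpace_apply]
      simp [PiLp.inner_apply, Fin.sum_univ_three]⟩

/-! ## The Kähler structure

A tangent vector of framed loop space is a variation `(δγ, δV)`. -/

/-- The pair `(d(δγ)/ds, δV)`, where `s` is arclength along the base curve of `x`. -/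
def jet (x : FramedLoop) (v : (ℝ → E3) × (ℝ → E3)) (t : ℝ) : E3 × E3 :=
  (‖deriv x.γ t‖⁻¹ • deriv v.1 t, v.2 t)

/-- The complex structure, in terms of the pairs `(d(δγ)/ds, δV)`: it takes the stretch `(T, 0)` to
the twist `(0, -W)`, and the bend `(W, 0)` to the bend `(-V, T)`. -/
def complexStructure (x : FramedLoop) (a : ℝ → E3 × E3) (t : ℝ) : E3 × E3 :=
  (⟪(a t).2, x.W t⟫_ℝ • x.T t + ⟪(a t).1, x.V t⟫_ℝ • x.W t - ⟪(a t).1, x.W t⟫_ℝ • x.V t,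
    ⟪(a t).1, x.W t⟫_ℝ • x.T t - ⟪(a t).1, x.T t⟫_ℝ • x.W t)

/-- The metric, in terms of the pairs `(d(δγ)/ds, δV)`. -/
def jetMetric (x : FramedLoop) (a b : ℝ → E3 × E3) : ℝ :=
  1 / 4 * ∫ t in (0 : ℝ)..2,
    (⟪(a t).1, (b t).1⟫_ℝ + ⟪(a t).2, x.W t⟫_ℝ * ⟪(b t).2, x.W t⟫_ℝ) * ‖deriv x.γ t‖

/-- The Riemannian metric
`g(v, w) = 1/4 ∫ ⟨d(δγ₁)/ds, d(δγ₂)/ds⟩ + ⟨δV₁, W⟩ ⟨δV₂, W⟩ ds`. -/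
def metric (x : FramedLoop) (v w : (ℝ → E3) × (ℝ → E3)) : ℝ := jetMetric x (jet x v) (jet x w)

/-- The symplectic form `ω(v, w) = g(J v, w)`. -/
def symplecticForm (x : FramedLoop) (v w : (ℝ → E3) × (ℝ → E3)) : ℝ :=
  jetMetric x (complexStructure x (jet x v)) (jet x w)

/-- The linear space of variations `(δγ, δV)` through pairs of smooth loops. -/
abbrev Variation := loops 1 E3 × loops 1 E3

/-- The underlying pair of vector fields of a variation. -/
def Variation.fields (v : Variation) : (ℝ → E3) × (ℝ → E3) := (v.1.1, v.2.1)

/-- The tangent space at `x` of the space of framed loops of fixed length: orthogonality, normality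
and length are preserved to first order. -/
def tangentSpace (x : FramedLoop) : Submodule ℝ Variation where
  carrier := {v |
    (∀ t, ⟪deriv v.1.1 t, x.V t⟫_ℝ + ⟪deriv x.γ t, v.2.1 t⟫_ℝ = 0) ∧
    (∀ t, ⟪v.2.1 t, x.V t⟫_ℝ = 0) ∧
    ∫ t in (0 : ℝ)..2, ⟪deriv v.1.1 t, x.T t⟫_ℝ = 0}
  zero_mem' := by
    refine ⟨fun t => ?_, fun t => ?_, ?_⟩ <;> simp
  add_mem' := by
    rintro v w ⟨h1, h2, h3⟩ ⟨k1, k2, k3⟩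
    have hd : ∀ t, deriv (v + w).1.1 t = deriv v.1.1 t + deriv w.1.1 t := fun t =>
      deriv_add ((v.1.2.1.differentiable (by simp)).differentiableAt)
        ((w.1.2.1.differentiable (by simp)).differentiableAt)
    have hc : ∀ f : loops 1 E3, IntervalIntegrable (fun t => ⟪deriv f.1 t, x.T t⟫_ℝ) volume 0 2 :=
      fun f => (((f.2.1.continuous_deriv (by simp))).inner (x.continuous_T)).intervalIntegrable _ _
    refine ⟨fun t => ?_, fun t => ?_, ?_⟩
    · rw [hd, inner_add_left]
      have : (v + w).2.1 t = v.2.1 t + w.2.1 t := rfl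
      rw [this, inner_add_right]
      linarith [h1 t, k1 t]
    · have : (v + w).2.1 t = v.2.1 t + w.2.1 t := rfl
      rw [this, inner_add_left, h2, k2, add_zero]
    · simp only [hd, inner_add_left]
      rw [intervalIntegral.integral_add (hc _) (hc _), h3, k3, add_zero]
  smul_mem' := by
    rintro c v ⟨h1, h2, h3⟩
    have hd : ∀ t, deriv (c • v).1.1 t = c • deriv v.1.1 t := fun t =>
      deriv_const_smul c ((v.1.2.1.differentiable (by simp)).differentiableAt)
    refine ⟨fun t => ?_, fun t => ?_, ?_⟩
    · have : (c • v).2.1 t = c • v.2.1 t := rfl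
      rw [hd, this, inner_smul_left, inner_smul_right, conj_trivial, ← mul_add, h1, mul_zero]
    · have : (c • v).2.1 t = c • v.2.1 t := rfl
      rw [this, inner_smul_left, h2, mul_zero]
    · simp only [hd, inner_smul_left, conj_trivial]
      rw [intervalIntegral.integral_const_mul, h3, mul_zero]

/-- The tangent space of the orbit of `x`, spanned by the translations, the infinitesimal rotations
and the constant frame twist. For `x` of length 2, the tangent space of the moduli space of framed
loops at the class of `x` is `tangentSpace x ⧸ verticalSpace x`. -/
def verticalSpace (x : FramedLoop) : Submodule ℝ Variation :=
  Submodule.span ℝ {v | ∃ (a b : E3) (c : ℝ), (∀ t, v.1.1 t = cross a (x.γ t) + b) ∧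
    ∀ t, v.2.1 t = cross a (x.V t) + c • x.W t}

/-- The variation of a framed planar loop induced by a variation of the planar loop. -/
def planarVariation : loops 1 E2 →ₗ[ℝ] Variation :=
  LinearMap.prod (loopMap planeToSpace) 0

/-- The variations of `γ.framed` that represent tangent vectors of planar loop space: variations
through planar loops of fixed length, up to the tangent space of the orbit. -/
def planarTangentSpace (γ : PlanarLoop) : Submodule ℝ Variation :=
  ((tangentSpace γ.framed).comap planarVariation).map planarVariation ⊔ verticalSpace γ.framed

/-- Let `form` be a skew form on `T` with radical containing `R`. The subspace `L / R` of `T / R` is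
Lagrangian: it equals its symplectic orthogonal, and it has an isotropic complement. -/
def IsLagrangian (T R L : Submodule ℝ Variation) (form : Variation → Variation → ℝ) :
    Prop :=
  R ≤ L ∧ L ≤ T ∧ (∀ v ∈ T, (∀ w ∈ L, form v w = 0) ↔ v ∈ L) ∧
    ∃ K : Submodule ℝ Variation, R ≤ K ∧ K ≤ T ∧ (∀ v ∈ K, ∀ w ∈ K, form v w = 0) ∧
      L ⊔ K = T ∧ L ⊓ K = R

/-! ## Geodesics -/

/-- The smooth family `Γ` of framed loops of length 2 represents the curve `c` near `u`. -/
def IsLift (Γ : ℝ → FramedLoop) (c : ℝ → FramedModuli) (u : ℝ) : Prop :=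
  DSmooth Γ ∧ (∀ w, (Γ w).length = 2) ∧ ∀ᶠ w in 𝓝 u, c w = Quotient.mk _ (Γ w)

/-- The velocity of a family of framed loops. -/
def velocity (Γ : ℝ → FramedLoop) (u : ℝ) : (ℝ → E3) × (ℝ → E3) :=
  (fun t => deriv (fun w => (Γ w).γ t) u, fun t => deriv (fun w => (Γ w).V t) u)

/-- The squared speed of a curve in the moduli space of framed loops, for the quotient metric: the
infimum over all representing families. -/
def speedSq (c : ℝ → FramedModuli) (u : ℝ) : ℝ :=
  sInf {e | ∃ Γ, IsLift Γ c u ∧ e = metric (Γ u) (velocity Γ u) (velocity Γ u)}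

/-- Two curves in the moduli space of framed loops have the same position and the same velocity
at `u`. -/
def SameVelocity (c d : ℝ → FramedModuli) (u : ℝ) : Prop :=
  ∃ Γ Δ, IsLift Γ c u ∧ IsLift Δ d u ∧ Γ u = Δ u ∧ velocity Γ u = velocity Δ u

/-- `c` is a geodesic of `X` on the interval `(a, b)`, for the metric induced on `X` by the map
`f` to the moduli space of framed loops: it is a critical point of the energy under all smooth
variations in `X` that are supported in a compact subinterval. -/
def IsGeodesic {X : Type*} [DiffeologicalSpace X] (f : X → FramedModuli) (a b : ℝ) (c : ℝ → X) :
    Prop :=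
  DSmooth (fun u : Ioo a b => c u) ∧
    ∀ C : ℝ → ℝ → X, DSmooth (fun p : ℝ × Ioo a b => C p.1 p.2) → C 0 = c →
      ∀ a' b', a < a' → a' ≤ b' → b' < b → (∀ s, ∀ u ∈ Ioo a b, u ∉ Icc a' b' → C s u = c u) →
        HasDerivAt (fun s => ∫ u in a'..b', speedSq (fun w => f (C s w)) u) 0 0

/-- The image of `f` is totally geodesic: the geodesics of `X` are the curves of `X` that are
geodesics of the moduli space of framed loops; every tangent vector of `X` is the initial velocity
of a geodesic; and every geodesic of the ambient space that is tangent to `X` at one time stays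
in `X`. -/
def IsTotallyGeodesic {X : Type*} [DiffeologicalSpace X] (f : X → FramedModuli) : Prop :=
  (∀ a b c, IsGeodesic f a b c ↔
    DSmooth (fun u : Ioo a b => c u) ∧ IsGeodesic id a b (f ∘ c)) ∧
  (∀ d : ℝ → X, DSmooth d → ∃ ε > 0, ∃ c : ℝ → X, IsGeodesic f (-ε) ε c ∧ c 0 = d 0 ∧
    SameVelocity (f ∘ c) (f ∘ d) 0) ∧
  ∀ a b c, IsGeodesic id a b c → ∀ u ∈ Ioo a b, ∀ d : ℝ → X, DSmooth d →
    SameVelocity c (f ∘ d) u → ∀ w ∈ Ioo a b, c w ∈ range f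

/-! ## Complex coordinates -/

/-- `L²`-orthonormal pairs `(φ, ψ)` of `𝕜`-valued loops (`σ = 1`) or antiperiodic paths (`σ = -1`)
without common zeros. -/
abbrev Stiefel (𝕜 : Type) [RCLike 𝕜] (σ : ℤˣ) := {Φ : loops σ 𝕜 × loops σ 𝕜 //
  (∫ t in (0 : ℝ)..2, ‖Φ.1.1 t‖ ^ 2) = 1 ∧ (∫ t in (0 : ℝ)..2, ‖Φ.2.1 t‖ ^ 2) = 1 ∧
  (∫ t in (0 : ℝ)..2, Φ.1.1 t * (starRingEnd 𝕜) (Φ.2.1 t)) = 0 ∧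
  ∀ t, ¬(Φ.1.1 t = 0 ∧ Φ.2.1 t = 0)}

/-- The values of an orthonormal pair, as row vectors. -/
def Stiefel.row {𝕜 : Type} [RCLike 𝕜] {σ : ℤˣ} (Φ : Stiefel 𝕜 σ) (t : ℝ) : Fin 2 → 𝕜 :=
  ![Φ.1.1.1 t, Φ.1.2.1 t]

/-- Orthonormal pairs up to the right action of the unitary group, that is, up to having the same
`𝕜`-linear span. -/
instance stiefelSetoid (𝕜 : Type) [RCLike 𝕜] (σ : ℤˣ) : Setoid (Stiefel 𝕜 σ) where
  r Φ Ψ := ∃ U ∈ Matrix.unitaryGroup (Fin 2) 𝕜, ∀ t, Ψ.row t = Matrix.vecMul (Φ.row t) U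
  iseqv :=
    { refl := fun Φ => ⟨1, one_mem _, fun t => (Matrix.vecMul_one _).symm⟩
      symm := by
        rintro Φ Ψ ⟨U, hU, h⟩
        refine ⟨star U, Unitary.star_mem hU, fun t => ?_⟩
        rw [h, Matrix.vecMul_vecMul, Unitary.mul_star_self_of_mem hU, Matrix.vecMul_one]
      trans := by
        rintro Φ Ψ Ξ ⟨U, hU, h⟩ ⟨U', hU', h'⟩
        exact ⟨U * U', mul_mem hU hU', fun t => by rw [h', h, Matrix.vecMul_vecMul]⟩ }

/-- The open subset `Gr₂°` of the Grassmannian of `𝕜`-planes in the space of `𝕜`-valued loops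
(`σ = 1`) or antiperiodic paths (`σ = -1`). -/
abbrev Grassmannian (𝕜 : Type) [RCLike 𝕜] (σ : ℤˣ) := Quotient (stiefelSetoid 𝕜 σ)

/-- A real-valued loop as a complex-valued one. -/
def loopToComplex {σ : ℤˣ} (f : loops σ ℝ) : loops σ ℂ :=
  ⟨fun t => (f.1 t : ℂ), Complex.ofRealCLM.contDiff.comp f.2.1, fun t => by
    have h := f.2.2 t
    change ((f.1 (t + 2) : ℝ) : ℂ) = σ • ((f.1 t : ℝ) : ℂ)
    rw [h]
    rcases Int.units_eq_one_or σ with rfl | rfl <;> simp [Units.smul_def]⟩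

/-- A real orthonormal pair as a complex one. -/
def Stiefel.toComplex {σ : ℤˣ} (Φ : Stiefel ℝ σ) : Stiefel ℂ σ :=
  ⟨(loopToComplex Φ.1.1, loopToComplex Φ.1.2),
    by simpa [loopToComplex] using Φ.2.1,
    by simpa [loopToComplex] using Φ.2.2.1,
    by
      have h := congrArg (fun r : ℝ => (r : ℂ)) Φ.2.2.2.1
      simpa [loopToComplex, ← intervalIntegral.integral_ofReal] using h,
    fun t h => Φ.2.2.2.2 t (by simpa [loopToComplex] using h)⟩

/-- The inclusion of the real Grassmannian in the complex one, which takes a real plane of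
real-valued functions to its complex span. -/
def Grassmannian.inclusion (σ : ℤˣ) : Grassmannian ℝ σ → Grassmannian ℂ σ :=
  Quotient.map Stiefel.toComplex <| by
    rintro Φ Ψ ⟨U, hU, h⟩
    refine ⟨U.map Complex.ofRealHom, ?_, fun t => ?_⟩
    · have hU' := Matrix.mem_unitaryGroup_iff.1 hU
      rw [Matrix.mem_unitaryGroup_iff]
      have e : star (U.map Complex.ofRealHom) = (star U).map Complex.ofRealHom := by
        ext i j; simp [Matrix.star_apply]
      rw [e, ← Matrix.map_mul, hU']
      simp
    · have h0 := congrFun (h t) 0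
      have h1 := congrFun (h t) 1
      simp only [Stiefel.row, Matrix.vecMul, dotProduct, Fin.sum_univ_two] at h0 h1
      ext i
      fin_cases i
      · have := congrArg (fun r : ℝ => (r : ℂ)) h0
        simpa [Stiefel.row, Stiefel.toComplex, loopToComplex, Matrix.vecMul, dotProduct,
          Fin.sum_univ_two] using this
      · have := congrArg (fun r : ℝ => (r : ℂ)) h1
        simpa [Stiefel.row, Stiefel.toComplex, loopToComplex, Matrix.vecMul, dotProduct,
          Fin.sum_univ_two] using this

/-- First column of the frame-Hopf map. -/
def hopf₁ (z w : ℂ) : E3 :=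
  !₂[‖z‖ ^ 2 - ‖w‖ ^ 2, 2 * (z * (starRingEnd ℂ) w).im, 2 * (z * (starRingEnd ℂ) w).re]

/-- Second column of the frame-Hopf map. -/
def hopf₂ (z w : ℂ) : E3 :=
  !₂[2 * (z * w).im, (z ^ 2 + w ^ 2).re, (-z ^ 2 + w ^ 2).im]

/-- The framed loop `x` has complex coordinates `Φ`: its base curve is `t ↦ ∫₀ᵗ hopf₁ Φ` and its
framing is `hopf₂ Φ / |Φ|²`. -/
def HasComplexCoordinates {σ : ℤˣ} (Φ : Stiefel ℂ σ) (x : FramedLoop) : Prop :=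
  (∀ t, x.γ t = ∫ s in (0 : ℝ)..t, hopf₁ (Φ.1.1.1 s) (Φ.1.2.1 s)) ∧
  ∀ t, x.V t = (‖Φ.1.1.1 t‖ ^ 2 + ‖Φ.1.2.1 t‖ ^ 2)⁻¹ • hopf₂ (Φ.1.1.1 t) (Φ.1.2.1 t)

/-- The planar loop `γ` has real coordinates `(φ, ψ)`: as a complex-valued function it is
`t ↦ ∫₀ᵗ (φ + i ψ)²`. -/
def HasRealCoordinates {σ : ℤˣ} (Φ : Stiefel ℝ σ) (γ : PlanarLoop) : Prop :=
  ∀ t, γ.1.1 t = ∫ s in (0 : ℝ)..t,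
    (!₂[Φ.1.1.1 s ^ 2 - Φ.1.2.1 s ^ 2, 2 * Φ.1.1.1 s * Φ.1.2.1 s] : E2)

/-- The family of maps `Θ σ`, for `σ = 1` and `σ = -1`, is a diffeomorphism from the disjoint union
of two spaces onto `X`. -/
def IsCoordinateSystem {Y : ℤˣ → Type} [∀ σ, DiffeologicalSpace (Y σ)] {X : Type}
    [DiffeologicalSpace X] (Θ : ∀ σ, Y σ → X) : Prop :=
  Function.Bijective (fun y : Σ σ, Y σ => Θ y.1 y.2) ∧ ∀ σ, IsOpenInduction (Θ σ)

end

/-!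
The frame-Hopf map sends a pair of complex numbers `(z, w) ≠ 0` to the orthogonal frame with columns
`hopf₁`, `hopf₂`, `hopf₃`, each of length `|z|² + |w|²`. It is a double covering of the scaled
positive frames, and it is equivariant: `U(2)` acts by rotations of space and twists of the frame
(`hopf_unitary`, `exists_unitary_of_rotation`). Square roots can be taken smoothly in families
(`exists_smooth_roots`, a lift through a double covering), so a smooth family of framed loops is the
image of a smooth family of pairs `Φ`, periodic or antiperiodic (`exists_stiefel_lift`). The curve
closes up and has length `2` exactly when the pair is orthonormal (`gram_eq_one_of_integral`). Hence
framed loops up to similarity and twist are orthonormal pairs up to `U(2)`: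
`isCoordinateSystem_complexCoordinates`. A planar loop with constant normal framing has coordinates
whose squares are nonnegative, hence real (`exists_real_stiefel_lift`), so that planar loops are the
real points of the Grassmannians: `isCoordinateSystem_realCoordinates`,
`planarInclusion_realCoordinates`.

The planes near a real plane `Φ₀` are spanned by unique pairs `Φ₀ + x + i y` with `x`, `y` real and
orthogonal to `Φ₀`. This is a chart (`isOpenInduction_chart`), in which the real planes are those with
`y = 0` (`chart_mem_range_iff`), because normalizing a real plane against `Φ₀` gives a real pair.
An induction with such charts is also a topological embedding (`isEmbedding_of_charts`).

At a planar loop the symplectic form becomes an explicit integral that pairs the planar components of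
the velocity of the curve with those of the framing (`symplecticForm_eq_planarForm`). It vanishes on
planar variations. A variation that pairs to zero with all planar ones has a framing component that
is, after a quarter turn, a constant plus a multiple of the unit tangent
(`exists_eq_const_add_smul`); those are rotations and twists, so the variation is planar up to
the orbit (`mem_planarTangentSpace_of_orthogonal`). The variations that move the curve in the normal
direction of the plane, together with the orbit, form an isotropic complement.

For geodesics, the metric is the `L²` metric of the velocity of the pair
(`Represents.metric_velocity`), and the infimum over lifts is attained at horizontal ones, for which
`Φ* Φ' = 0` (`speedSq_eq`, `exists_horizontal`). The first variation of the energy is the pairing of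
the variation field with the acceleration `Φ'' + Φ (Φ'* Φ')` (`firstVariation_eq`), so that a curve
is a geodesic if and only if the acceleration of its horizontal lifts vanishes
(`isGeodesic_of_geodesicEquation`, `acceleration_eq_zero_of_isGeodesic`). The acceleration of a real
curve is real, and therefore criticality among real curves is criticality among all curves
(`isGeodesic_planarInclusion_iff`). Along a solution `Φ'* Φ'` is constant, so that `Φ'' = -Φ Q` is a
linear equation with real coefficients for real initial data; its solutions stay real
(`realValued_of_geodesic`), and being tangent to the real locus is an open and closed
condition in time (`isPlanarAt_of_isPlanarAt`). Geodesics exist in closed form: after a rotation that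
diagonalizes `Q` they are `φᵢ cos (mᵢ u) + ξᵢ sin (mᵢ u) / mᵢ` (`exists_geodesic_of_diagonal`).

For the orientation cover, the loops `η` that correlate with `γ` more than with its mirror image form
an open set on which at most one of `η` and its mirror image lies. It contains `γ`, because a closed
curve is not contained in a line (`favours_self`). So the projection is injective there, and a loop
never equals its mirror image.
-/


/-! ### Calculus of smooth families -/

section Calculus

variable {E W : Type} [NormedAddCommGroup E] [NormedSpace ℝ E] [NormedAddCommGroup W]
  [NormedSpace ℝ W]

/-- The derivative of a family `F` of functions of `t` in the direction `v` of the parameter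
space. -/
noncomputable def parDeriv (v : E) (F : E → ℝ → W) (x : E) (t : ℝ) : W :=
  fderiv ℝ (fun y => F y t) x v

theorem hasFDerivAt_family {F : E → ℝ → W} (hF : ContDiff ℝ ∞ (Function.uncurry F)) (x : E)
    (t : ℝ) : HasFDerivAt (fun y => F y t)
      ((fderiv ℝ (Function.uncurry F) (x, t)).comp (ContinuousLinearMap.inl ℝ E ℝ)) x := by
  have h := ((hF.differentiable (by simp)) (x, t)).hasFDerivAt
  exact HasFDerivAt.comp x (g := Function.uncurry F) (f := fun y : E => (y, t)) h
    (hasFDerivAt_prodMk_left x t)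

theorem parDeriv_eq {F : E → ℝ → W} (hF : ContDiff ℝ ∞ (Function.uncurry F)) (v x : E) (t : ℝ) :
    parDeriv v F x t = fderiv ℝ (Function.uncurry F) (x, t) (v, 0) := by
  rw [parDeriv, (hasFDerivAt_family hF x t).fderiv]
  simp

theorem hasDerivAt_slice {F : E → ℝ → W} (hF : ContDiff ℝ ∞ (Function.uncurry F)) (x : E) (t : ℝ) :
    HasDerivAt (F x) (fderiv ℝ (Function.uncurry F) (x, t) (0, 1)) t := by
  have h := ((hF.differentiable (by simp)) (x, t)).hasFDerivAt
  have h2 : HasDerivAt (fun s : ℝ => (x, s)) ((0 : E), (1 : ℝ)) t :=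
    (hasDerivAt_const t x).prodMk (hasDerivAt_id t)
  exact h.comp_hasDerivAt t h2

theorem contDiff_fderiv_apply {X : Type} [NormedAddCommGroup X] [NormedSpace ℝ X] {G : X → W}
    (hG : ContDiff ℝ ∞ G) (v : X) : ContDiff ℝ ∞ (fun x => fderiv ℝ G x v) :=
  (hG.fderiv_right (m := ∞) (by simp)).clm_apply contDiff_const

theorem contDiff_parDeriv {F : E → ℝ → W} (hF : ContDiff ℝ ∞ (Function.uncurry F)) (v : E) :
    ContDiff ℝ ∞ (Function.uncurry (parDeriv v F)) := by
  have : Function.uncurry (parDeriv v F) =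
      fun q : E × ℝ => fderiv ℝ (Function.uncurry F) q (v, 0) := by
    ext ⟨x, t⟩
    exact parDeriv_eq hF v x t
  rw [this]
  exact contDiff_fderiv_apply hF _

theorem contDiff_derivSlice {F : E → ℝ → W} (hF : ContDiff ℝ ∞ (Function.uncurry F)) :
    ContDiff ℝ ∞ (Function.uncurry fun x t => deriv (F x) t) := by
  have : (Function.uncurry fun x t => deriv (F x) t) =
      fun q : E × ℝ => fderiv ℝ (Function.uncurry F) q (0, 1) := by
    ext ⟨x, t⟩
    exact (hasDerivAt_slice hF x t).deriv
  rw [this]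
  exact contDiff_fderiv_apply hF _

theorem fderiv_fderiv_apply_comm {X : Type} [NormedAddCommGroup X] [NormedSpace ℝ X] {G : X → W}
    (hG : ContDiff ℝ ∞ G) (x v w : X) :
    fderiv ℝ (fun y => fderiv ℝ G y v) x w = fderiv ℝ (fun y => fderiv ℝ G y w) x v := by
  have hd : DifferentiableAt ℝ (fderiv ℝ G) x :=
    ((hG.fderiv_right (m := ∞) (by simp)).differentiable (by simp)) x
  have hs : IsSymmSndFDerivAt ℝ G x := (hG.contDiffAt).isSymmSndFDerivAt <| by
    rw [minSmoothness_of_isRCLikeNormedField]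
    exact WithTop.coe_le_coe.2 le_top
  have e : ∀ v w : X, fderiv ℝ (fun y => fderiv ℝ G y v) x w = fderiv ℝ (fderiv ℝ G) x w v := by
    intro v w
    rw [fderiv_clm_apply hd (differentiableAt_const v)]
    simp
  rw [e, e]
  exact hs w v

theorem parDeriv_comm {F : E → ℝ → W} (hF : ContDiff ℝ ∞ (Function.uncurry F)) (v w : E) :
    parDeriv v (parDeriv w F) = parDeriv w (parDeriv v F) := by
  have e : ∀ w : E, Function.uncurry (parDeriv w F) =
      fun q : E × ℝ => fderiv ℝ (Function.uncurry F) q (w, 0) := fun w => by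
    ext ⟨x, t⟩
    exact parDeriv_eq hF w x t
  ext x t
  rw [parDeriv_eq (contDiff_parDeriv hF w), parDeriv_eq (contDiff_parDeriv hF v), e, e]
  exact fderiv_fderiv_apply_comm hF _ _ _

theorem deriv_parDeriv {F : E → ℝ → W} (hF : ContDiff ℝ ∞ (Function.uncurry F)) (v : E) (x : E)
    (t : ℝ) : deriv (parDeriv v F x) t = parDeriv v (fun y s => deriv (F y) s) x t := by
  have e : Function.uncurry (parDeriv v F) =
      fun q : E × ℝ => fderiv ℝ (Function.uncurry F) q (v, 0) := by
    ext ⟨x, t⟩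
    exact parDeriv_eq hF v x t
  have e' : (Function.uncurry fun x t => deriv (F x) t) =
      fun q : E × ℝ => fderiv ℝ (Function.uncurry F) q (0, 1) := by
    ext ⟨x, t⟩
    exact (hasDerivAt_slice hF x t).deriv
  rw [(hasDerivAt_slice (contDiff_parDeriv hF v) x t).deriv, parDeriv_eq (contDiff_derivSlice hF),
    e, e']
  exact fderiv_fderiv_apply_comm hF _ _ _

theorem hasDerivAt_parDeriv {F : ℝ → ℝ → W} (hF : ContDiff ℝ ∞ (Function.uncurry F)) (u t : ℝ) :
    HasDerivAt (fun w => F w t) (parDeriv 1 F u t) u := by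
  have h := hasFDerivAt_family hF u t
  have h2 := h.hasDerivAt
  rw [parDeriv, h.fderiv]
  exact h2

theorem contDiff_slice {F : E → ℝ → W} (hF : ContDiff ℝ ∞ (Function.uncurry F)) (x : E) :
    ContDiff ℝ ∞ (F x) :=
  hF.comp (contDiff_const.prodMk contDiff_id)

theorem hasFDerivAt_integral_family [ProperSpace E] [CompleteSpace W] {F : E → ℝ → W}
    (hF : ContDiff ℝ ∞ (Function.uncurry F)) (a b : ℝ) (x : E) :
    HasFDerivAt (fun x => ∫ t in a..b, F x t)
      (∫ t in a..b, (fderiv ℝ (Function.uncurry F) (x, t)).comp (ContinuousLinearMap.inl ℝ E ℝ))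
      x := by
  have hc : Continuous fun q : E × ℝ =>
      (fderiv ℝ (Function.uncurry F) q).comp (ContinuousLinearMap.inl ℝ E ℝ) :=
    (hF.continuous_fderiv (by simp)).clm_comp continuous_const
  obtain ⟨C, hC⟩ := ((isCompact_closedBall x 1).prod (isCompact_uIcc (a := a) (b :=
    b))).exists_bound_of_continuousOn
    hc.continuousOn
  refine (intervalIntegral.hasFDerivAt_integral_of_dominated_of_fderiv_le (𝕜 := ℝ)
    (F := F) (F' := fun y t => (fderiv ℝ (Function.uncurry F) (y, t)).comp
      (ContinuousLinearMap.inl ℝ E ℝ)) (bound := fun _ => C)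
    (s := Metric.ball x 1) (Metric.ball_mem_nhds x one_pos) ?_ ?_ ?_ ?_ ?_ ?_)
  · exact Eventually.of_forall fun y =>
      (contDiff_slice hF y).continuous.aestronglyMeasurable
  · exact (contDiff_slice hF x).continuous.intervalIntegrable _ _
  · exact (hc.comp (continuous_const.prodMk continuous_id)).aestronglyMeasurable
  · refine Eventually.of_forall fun t ht y hy => hC (y, t) ⟨Metric.ball_subset_closedBall hy, ?_⟩
    exact uIoc_subset_uIcc ht
  · exact intervalIntegrable_const
  · exact Eventually.of_forall fun t _ y _ => hasFDerivAt_family hF y t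

theorem fderiv_integral_family [ProperSpace E] [CompleteSpace W] {F : E → ℝ → W}
    (hF : ContDiff ℝ ∞ (Function.uncurry F)) (a b : ℝ) (x v : E) :
    fderiv ℝ (fun x => ∫ t in a..b, F x t) x v = ∫ t in a..b, parDeriv v F x t := by
  have hc : Continuous fun t : ℝ =>
      (fderiv ℝ (Function.uncurry F) (x, t)).comp (ContinuousLinearMap.inl ℝ E ℝ) :=
    ((hF.continuous_fderiv (by simp)).comp (continuous_const.prodMk continuous_id)).clm_comp
      continuous_const
  rw [(hasFDerivAt_integral_family hF a b x).fderiv,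
    ContinuousLinearMap.intervalIntegral_apply (hc.intervalIntegrable _ _)]
  refine intervalIntegral.integral_congr fun t _ => ?_
  simp [parDeriv_eq hF]

theorem contDiff_integral_family_nat [ProperSpace E] (n : ℕ) (a b : ℝ) : ∀ {W : Type}
    [NormedAddCommGroup W] [NormedSpace ℝ W] [CompleteSpace W] {F : E → ℝ → W},
    ContDiff ℝ ∞ (Function.uncurry F) → ContDiff ℝ n (fun x => ∫ t in a..b, F x t) := by
  induction n with
  | zero =>
    intro W _ _ _ F hF
    refine contDiff_zero.2 (Differentiable.continuous (𝕜 := ℝ) fun x =>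
      (hasFDerivAt_integral_family hF a b x).differentiableAt)
  | succ n ih =>
    intro W _ _ _ F hF
    have h : ContDiff ℝ ((n : WithTop ℕ∞) + 1) (fun x => ∫ t in a..b, F x t) := by
      refine contDiff_succ_iff_hasFDerivAt.2 ⟨_, ?_, fun x => hasFDerivAt_integral_family hF a b x⟩
      exact ih (F := fun x t => (fderiv ℝ (Function.uncurry F) (x, t)).comp
        (ContinuousLinearMap.inl ℝ E ℝ)) ((hF.fderiv_right (m := ∞) (by simp)).clm_comp
          contDiff_const)
    exact_mod_cast h

theorem contDiff_integral_family [ProperSpace E] [CompleteSpace W] {F : E → ℝ → W}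
    (hF : ContDiff ℝ ∞ (Function.uncurry F)) (a b : ℝ) :
    ContDiff ℝ ∞ (fun x => ∫ t in a..b, F x t) :=
  contDiff_infty.2 fun n => contDiff_integral_family_nat n a b hF

theorem contDiff_primitive_family [ProperSpace E] [CompleteSpace W] {F : E → ℝ → W}
    (hF : ContDiff ℝ ∞ (Function.uncurry F)) :
    ContDiff ℝ ∞ (fun q : E × ℝ => ∫ s in (0 : ℝ)..q.2, F q.1 s) := by
  have e : (fun q : E × ℝ => ∫ s in (0 : ℝ)..q.2, F q.1 s) =
      fun q : E × ℝ => q.2 • ∫ s in (0 : ℝ)..1, F q.1 (q.2 * s) := by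
    ext q
    rw [intervalIntegral.smul_integral_comp_mul_left]
    simp
  rw [e]
  refine contDiff_snd.smul (contDiff_integral_family
    (F := fun (q : E × ℝ) s => F q.1 (q.2 * s)) ?_ 0 1)
  exact hF.comp ((contDiff_fst.comp contDiff_fst).prodMk
    ((contDiff_snd.comp contDiff_fst).mul contDiff_snd))

/-- A smooth map into a given neighbourhood of a point that is the identity near the point. -/
theorem exists_smooth_retraction {E : Type} [NormedAddCommGroup E] [NormedSpace ℝ E]
    [FiniteDimensional ℝ E] {u : Set E} {x : E} (hu : u ∈ 𝓝 x) :
    ∃ f : E → E, ContDiff ℝ ∞ f ∧ (∀ y, f y ∈ u) ∧ ∀ᶠ y in 𝓝 x, f y = y := by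
  obtain ⟨ε, hε, hb⟩ := Metric.mem_nhds_iff.1 hu
  let b : ContDiffBump x := ⟨ε / 3, ε / 2, by positivity, by linarith⟩
  refine ⟨fun y => x + b y • (y - x), ?_, fun y => hb ?_, ?_⟩
  · exact contDiff_const.add (b.contDiff.smul (contDiff_id.sub contDiff_const))
  · rw [Metric.mem_ball, dist_eq_norm, add_sub_cancel_left, norm_smul, Real.norm_eq_abs,
      abs_of_nonneg b.nonneg]
    by_cases hy : dist y x < ε / 2
    · rw [dist_eq_norm] at hy
      nlinarith [b.le_one (x := y), b.nonneg (x := y), norm_nonneg (y - x)]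
    · rw [b.zero_of_le_dist (not_lt.1 hy), zero_mul]
      exact hε
  · filter_upwards [b.eventuallyEq_one] with y hy
    simp [hy]

/-- Local solutions of linear ordinary differential equations with smooth coefficients. -/
theorem exists_linear_ode {V : Type} [NormedAddCommGroup V] [NormedSpace ℝ V] [CompleteSpace V]
    {L : ℝ → V →L[ℝ] V} (hL : ContDiff ℝ ∞ L) (u₀ : ℝ) (y₀ : V) :
    ∃ (y : ℝ → V) (δ : ℝ), 0 < δ ∧ y u₀ = y₀ ∧ ContDiffOn ℝ ∞ y (Ioo (u₀ - δ) (u₀ + δ)) ∧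
      ∀ u ∈ Ioo (u₀ - δ) (u₀ + δ), HasDerivAt y (L u (y u)) u := by
  -- the equation is made autonomous by adjoining the time variable
  have hf : ContDiffAt ℝ 1 (fun z : ℝ × V => ((1 : ℝ), L z.1 z.2)) (u₀, y₀) :=
    (contDiff_const.prodMk ((hL.comp contDiff_fst).clm_apply contDiff_snd)).contDiffAt.of_le
      (mod_cast le_top)
  obtain ⟨α, h0, δ, hδ, hα⟩ :=
    hf.exists_forall_mem_closedBall_exists_eq_forall_mem_Ioo_hasDerivAt₀ u₀
  have hu₀ : u₀ ∈ Ioo (u₀ - δ) (u₀ + δ) := ⟨by linarith, by linarith⟩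
  have h1 : ∀ u ∈ Ioo (u₀ - δ) (u₀ + δ), HasDerivAt (fun u => (α u).1) 1 u := fun u hu =>
    (hasFDerivAt_fst (𝕜 := ℝ) (p := α u)).comp_hasDerivAt u (hα u hu)
  have h2 : ∀ u ∈ Ioo (u₀ - δ) (u₀ + δ), HasDerivAt (fun u => (α u).2) (L (α u).1 (α u).2) u :=
    fun u hu => (hasFDerivAt_snd (𝕜 := ℝ) (p := α u)).comp_hasDerivAt u (hα u hu)
  have htime : ∀ u ∈ Ioo (u₀ - δ) (u₀ + δ), (α u).1 = u := by
    intro u hu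
    have h3 : ∀ u ∈ Ioo (u₀ - δ) (u₀ + δ), HasDerivAt (fun u => (α u).1 - u) 0 u := fun u hu => by
      simpa using! (h1 u hu).fun_sub (hasDerivAt_id' u)
    have := isOpen_Ioo.is_const_of_deriv_eq_zero isPreconnected_Ioo
      (fun u hu => (h3 u hu).differentiableAt.differentiableWithinAt) (fun u hu => (h3 u hu).deriv)
      hu hu₀
    simp only [h0] at this
    linarith
  have h4 : ∀ u ∈ Ioo (u₀ - δ) (u₀ + δ), HasDerivAt (fun u => (α u).2) (L u (α u).2) u :=
    fun u hu => by simpa only [htime u hu] using h2 u hu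
  refine ⟨fun u => (α u).2, δ, hδ, by simp [h0], ?_, h4⟩
  refine contDiffOn_infty.2 fun n => ?_
  induction n with
  | zero =>
    exact contDiffOn_zero.2 fun u hu => (h4 u hu).continuousAt.continuousWithinAt
  | succ n ih =>
    have : ContDiffOn ℝ ((n : WithTop ℕ∞) + 1) (fun u => (α u).2) (Ioo (u₀ - δ) (u₀ + δ)) := by
      refine (contDiffOn_succ_iff_deriv_of_isOpen isOpen_Ioo).2
        ⟨fun u hu => (h4 u hu).differentiableAt.differentiableWithinAt, by simp, ?_⟩
      exact ((hL.of_le (mod_cast le_top)).contDiffOn.clm_apply ih).congr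
        fun u hu => (h4 u hu).deriv
    exact_mod_cast this

end Calculus

/-! ### Gram matrices of pairs of functions -/

section Gram

/-- The matrix `F* G` of `L²([0,2])`-inner products of two pairs of functions. -/
noncomputable def gram (F G : ℝ → Fin 2 → ℂ) : Matrix (Fin 2) (Fin 2) ℂ :=
  Matrix.of fun i j => ∫ t in (0 : ℝ)..2, star (F t i) * G t j

/-- The pair `F M` obtained from the pair `F` by a constant change of basis. -/
def rmul (F : ℝ → Fin 2 → ℂ) (M : Matrix (Fin 2) (Fin 2) ℂ) (t : ℝ) : Fin 2 → ℂ :=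
  Matrix.vecMul (F t) M

theorem rmul_apply (F : ℝ → Fin 2 → ℂ) (M : Matrix (Fin 2) (Fin 2) ℂ) (t : ℝ) (i : Fin 2) :
    rmul F M t i = F t 0 * M 0 i + F t 1 * M 1 i := by
  simp [rmul, Matrix.vecMul, dotProduct, Fin.sum_univ_two]

theorem rmul_rmul (F : ℝ → Fin 2 → ℂ) (M N : Matrix (Fin 2) (Fin 2) ℂ) :
    rmul (rmul F M) N = rmul F (M * N) := by
  ext1 t
  exact Matrix.vecMul_vecMul _ _ _

theorem rmul_one (F : ℝ → Fin 2 → ℂ) : rmul F 1 = F := by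
  ext1 t
  exact Matrix.vecMul_one _

variable {F G H : ℝ → Fin 2 → ℂ}

theorem continuous_rmul (hF : Continuous F) (M : Matrix (Fin 2) (Fin 2) ℂ) :
    Continuous (rmul F M) := by
  refine continuous_pi fun i => ?_
  simp only [rmul_apply]
  fun_prop

theorem contDiff_rmul (hF : ContDiff ℝ ∞ F) (M : Matrix (Fin 2) (Fin 2) ℂ) :
    ContDiff ℝ ∞ (rmul F M) := by
  rw [contDiff_pi]
  intro i
  simp only [rmul_apply]
  rw [contDiff_pi] at hF
  exact ((hF 0).mul contDiff_const).add ((hF 1).mul contDiff_const)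

theorem intervalIntegrable_gram (hF : Continuous F) (hG : Continuous G) (i j : Fin 2) :
    IntervalIntegrable (fun t => star (F t i) * G t j) volume 0 2 := by
  apply Continuous.intervalIntegrable
  fun_prop

theorem gram_conjTranspose (F G : ℝ → Fin 2 → ℂ) : (gram F G).conjTranspose = gram G F := by
  ext i j
  simp only [gram, Matrix.conjTranspose_apply, Matrix.of_apply, RCLike.star_def]
  rw [intervalIntegral.integral_of_le zero_le_two, intervalIntegral.integral_of_le zero_le_two,
    ← integral_conj]
  simp only [map_mul, Complex.conj_conj, mul_comm]

theorem gram_rmul_right (hF : Continuous F) (hG : Continuous G) (M : Matrix (Fin 2) (Fin 2) ℂ) :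
    gram F (rmul G M) = gram F G * M := by
  ext i j
  simp only [gram, Matrix.mul_apply, Fin.sum_univ_two, Matrix.of_apply, rmul_apply]
  rw [← intervalIntegral.integral_mul_const, ← intervalIntegral.integral_mul_const,
    ← intervalIntegral.integral_add ((intervalIntegrable_gram hF hG i 0).mul_const _)
      ((intervalIntegrable_gram hF hG i 1).mul_const _)]
  refine intervalIntegral.integral_congr fun t _ => ?_
  ring

theorem gram_rmul_left (hF : Continuous F) (hG : Continuous G) (M : Matrix (Fin 2) (Fin 2) ℂ) :
    gram (rmul F M) G = M.conjTranspose * gram F G := by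
  rw [← gram_conjTranspose, gram_rmul_right hG hF, Matrix.conjTranspose_mul, gram_conjTranspose]

theorem gram_add_right (hF : Continuous F) (hG : Continuous G) (hH : Continuous H) :
    gram F (G + H) = gram F G + gram F H := by
  ext i j
  simp only [gram, Matrix.add_apply, Matrix.of_apply, Pi.add_apply, mul_add]
  exact intervalIntegral.integral_add (intervalIntegrable_gram hF hG i j)
    (intervalIntegrable_gram hF hH i j)

theorem gram_add_left (hF : Continuous F) (hG : Continuous G) (hH : Continuous H) :
    gram (F + G) H = gram F H + gram G H := by
  rw [← gram_conjTranspose, gram_add_right hH hF hG, Matrix.conjTranspose_add, gram_conjTranspose,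
    gram_conjTranspose]

theorem gram_smul_right (c : ℝ) : gram F (c • G) = (c : ℂ) • gram F G := by
  ext i j
  simp only [gram, Matrix.smul_apply, Matrix.of_apply, Pi.smul_apply, Complex.real_smul,
    smul_eq_mul]
  rw [← intervalIntegral.integral_const_mul]
  refine intervalIntegral.integral_congr fun t _ => ?_
  ring

theorem gram_smul_left (c : ℝ) : gram (c • F) G = (c : ℂ) • gram F G := by
  rw [← gram_conjTranspose, gram_smul_right, Matrix.conjTranspose_smul, gram_conjTranspose]
  simp

theorem gram_self_apply (F : ℝ → Fin 2 → ℂ) (i : Fin 2) :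
    gram F F i i = ((∫ t in (0 : ℝ)..2, ‖F t i‖ ^ 2 : ℝ) : ℂ) := by
  rw [← intervalIntegral.integral_ofReal]
  refine intervalIntegral.integral_congr fun t _ => ?_
  simp [Complex.conj_mul']

theorem gram_self_re_pos {Ψ : ℝ → Fin 2 → ℂ} (hF : Continuous F)
    (hdet : (gram Ψ F).det ≠ 0) (i : Fin 2) : 0 < (gram F F i i).re := by
  rw [gram_self_apply, Complex.ofReal_re]
  by_contra hcon
  have hz : ∀ t ∈ Icc (0 : ℝ) 2, F t i = 0 := by
    intro t ht
    by_contra hne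
    refine hcon (intervalIntegral.integral_pos (by norm_num) (by fun_prop) (fun _ _ => by
      positivity)
      ⟨t, ht, by positivity⟩)
  have hcol : ∀ k, gram Ψ F k i = 0 := fun k => by
    simp only [gram, Matrix.of_apply]
    rw [intervalIntegral.integral_congr (g := fun _ => (0 : ℂ)), intervalIntegral.integral_zero]
    intro t ht
    rw [uIcc_of_le (by norm_num)] at ht
    simp [hz t ht]
  exact hdet (Matrix.det_eq_zero_of_column_eq_zero i hcol)

/-- The upper triangular matrix that orthonormalizes a pair with Gram matrix `G`, as in the
Gram–Schmidt process. -/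
noncomputable def gramSchmidtMatrix (G : Matrix (Fin 2) (Fin 2) ℂ) : Matrix (Fin 2) (Fin 2) ℂ :=
  !![(((Real.sqrt (G 0 0).re)⁻¹ : ℝ) : ℂ),
      -(G 0 1 * ((((G 0 0).re)⁻¹ * Real.sqrt ((G 0 0).re / G.det.re) : ℝ) : ℂ));
    0, (Real.sqrt ((G 0 0).re / G.det.re) : ℂ)]

theorem gramSchmidtMatrix_det {G : Matrix (Fin 2) (Fin 2) ℂ} (ha : 0 < (G 0 0).re)
    (hd : 0 < G.det.re) : (gramSchmidtMatrix G).det ≠ 0 := by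
  have h1 := (Real.sqrt_pos.2 ha).ne'
  have h2 := (Real.sqrt_pos.2 (div_pos ha hd)).ne'
  rw [gramSchmidtMatrix, Matrix.det_fin_two_of, mul_zero, sub_zero]
  exact mul_ne_zero (by exact_mod_cast inv_ne_zero h1) (by exact_mod_cast h2)

theorem gramSchmidtMatrix_spec {G : Matrix (Fin 2) (Fin 2) ℂ} (hG : G.conjTranspose = G)
    (ha : 0 < (G 0 0).re) (hd : 0 < G.det.re) :
    (gramSchmidtMatrix G).conjTranspose * G * gramSchmidtMatrix G = 1 := by
  have e : ∀ i j, star (G j i) = G i j := fun i j => by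
    conv_rhs => rw [← hG]
    rfl
  obtain ⟨a, ha'⟩ : ∃ a : ℝ, G 0 0 = a :=
    ⟨(G 0 0).re, (Complex.conj_eq_iff_re.1 (e 0 0)).symm⟩
  obtain ⟨d, hd'⟩ : ∃ d : ℝ, G 1 1 = d :=
    ⟨(G 1 1).re, (Complex.conj_eq_iff_re.1 (e 1 1)).symm⟩
  set b := G 0 1 with hb
  have hc : G 1 0 = star b := (e 1 0).symm
  have hdet : G.det = ((a * d - Complex.normSq b : ℝ) : ℂ) := by
    rw [Matrix.det_fin_two, ha', hd', hc, ← hb, RCLike.star_def, Complex.mul_conj]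
    push_cast
    ring
  rw [hdet, Complex.ofReal_re] at hd
  rw [ha', Complex.ofReal_re] at ha
  set p := (Real.sqrt a)⁻¹ with hp
  set q := Real.sqrt (a / (a * d - Complex.normSq b)) with hq
  have hp2 : (p : ℂ) * p * a = 1 := by
    have : p * p * a = 1 := by
      rw [hp, ← mul_inv, Real.mul_self_sqrt ha.le, inv_mul_cancel₀ ha.ne']
    exact_mod_cast this
  have hq2 : (q : ℂ) * q * (a * d - b * star b) = a := by
    have : q * q * (a * d - Complex.normSq b) = a := by
      rw [hq, Real.mul_self_sqrt (div_pos ha hd).le, div_mul_cancel₀ _ hd.ne']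
    rw [RCLike.star_def, Complex.mul_conj]
    exact_mod_cast this
  have hane : (a : ℂ) ≠ 0 := by exact_mod_cast ha.ne'
  have hgs : gramSchmidtMatrix G = !![(p : ℂ), -(b * ((a : ℂ)⁻¹ * q)); 0, (q : ℂ)] := by
    rw [gramSchmidtMatrix, hdet, ha', ← hb]
    simp [hp, hq]
  have hGm : G = !![(a : ℂ), b; star b, (d : ℂ)] := by
    rw [← ha', ← hd', ← hc]
    exact Matrix.eta_fin_two G
  rw [hgs]
  conv_lhs => rw [hGm]
  have hct : (!![(p : ℂ), -(b * ((a : ℂ)⁻¹ * q)); 0, (q : ℂ)]).conjTranspose =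
      !![(p : ℂ), 0; -(star b * ((a : ℂ)⁻¹ * q)), (q : ℂ)] := by
    ext i j
    fin_cases i <;> fin_cases j <;> simp
  rw [hct, Matrix.mul_fin_two, Matrix.mul_fin_two, Matrix.one_fin_two]
  congr 1
  ext i j
  fin_cases i <;> fin_cases j
  · simp
    linear_combination hp2
  · simp
    field_simp
    ring
  · simp
    field_simp
    simp
  · simp only [RCLike.star_def] at hq2 ⊢
    simp
    field_simp
    linear_combination hq2

theorem gram_self_det_pos {Ψ : ℝ → Fin 2 → ℂ} (hF : Continuous F) (hΨ : Continuous Ψ)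
    (hdet : (gram Ψ F).det ≠ 0) : 0 < (gram F F).det.re := by
  have ha := gram_self_re_pos hF hdet 0
  -- The second column of `F M` is the part of `F₁` orthogonal to `F₀`, times `‖F₀‖²`.
  set M : Matrix (Fin 2) (Fin 2) ℂ := !![1, -(gram F F 0 1); 0, gram F F 0 0] with hM
  have hMdet : M.det ≠ 0 := by
    rw [hM, Matrix.det_fin_two_of]
    intro h
    have := congrArg Complex.re h
    simp at this
    linarith
  have h := gram_self_re_pos (Ψ := Ψ) (continuous_rmul hF M)
    (by rw [gram_rmul_right hΨ hF, Matrix.det_mul]; exact mul_ne_zero hdet hMdet) 1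
  have e : gram (rmul F M) (rmul F M) 1 1 = gram F F 0 0 * (gram F F).det := by
    have h10 : gram F F 1 0 = star (gram F F 0 1) := by
      conv_lhs => rw [← gram_conjTranspose]
      rfl
    have h00 : star (gram F F 0 0) = gram F F 0 0 := by
      conv_rhs => rw [← gram_conjTranspose]
      rfl
    rw [gram_rmul_right (continuous_rmul hF M) hF, gram_rmul_left hF hF, Matrix.det_fin_two]
    simp only [Matrix.mul_apply, Fin.sum_univ_two, Matrix.conjTranspose_apply, hM, Matrix.of_apply,
      Matrix.cons_val', Matrix.cons_val_zero, Matrix.cons_val_one, Matrix.cons_val_fin_one, h10,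
      star_neg, h00]
    ring
  rw [e, gram_self_apply, Complex.re_ofReal_mul] at h
  rw [gram_self_apply, Complex.ofReal_re] at ha
  exact pos_of_mul_pos_right h ha.le

end Gram

/-! ### Smooth families of pairs -/

section GramFamilies

variable {E : Type} [NormedAddCommGroup E] [NormedSpace ℝ E]
  {F G : E → ℝ → Fin 2 → ℂ}

/-- Entrywise smoothness of a family of matrices. -/
def SmoothMatrix (M : E → Matrix (Fin 2) (Fin 2) ℂ) : Prop :=
  ∀ i j, ContDiff ℝ ∞ fun x => M x i j

theorem ContDiff.star_complex {X : Type} [NormedAddCommGroup X] [NormedSpace ℝ X] {f : X → ℂ}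
    {n : WithTop ℕ∞} (hf : ContDiff ℝ n f) : ContDiff ℝ n fun x => star (f x) :=
  (Complex.conjCLE : ℂ →L[ℝ] ℂ).contDiff.comp hf

theorem SmoothMatrix.mul {M N : E → Matrix (Fin 2) (Fin 2) ℂ} (hM : SmoothMatrix M)
    (hN : SmoothMatrix N) : SmoothMatrix fun x => M x * N x := fun i j => by
  simp only [Matrix.mul_apply, Fin.sum_univ_two]
  exact ((hM i 0).mul (hN 0 j)).add ((hM i 1).mul (hN 1 j))

theorem SmoothMatrix.conjTranspose {M : E → Matrix (Fin 2) (Fin 2) ℂ} (hM : SmoothMatrix M) :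
    SmoothMatrix fun x => (M x).conjTranspose := fun i j => (hM j i).star_complex

theorem SmoothMatrix.const (M : Matrix (Fin 2) (Fin 2) ℂ) : SmoothMatrix fun _ : E => M :=
  fun _ _ => contDiff_const

theorem SmoothMatrix.det {M : E → Matrix (Fin 2) (Fin 2) ℂ} (hM : SmoothMatrix M) :
    ContDiff ℝ ∞ fun x => (M x).det := by
  simp only [Matrix.det_fin_two]
  exact ((hM 0 0).mul (hM 1 1)).sub ((hM 0 1).mul (hM 1 0))

theorem SmoothMatrix.inv {M : E → Matrix (Fin 2) (Fin 2) ℂ} (hM : SmoothMatrix M)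
    (hd : ∀ x, (M x).det ≠ 0) : SmoothMatrix fun x => (M x)⁻¹ := fun i j => by
  have h : ContDiff ℝ ∞ fun x => ((M x).det)⁻¹ := hM.det.inv hd
  have hs : ∀ i j, ContDiff ℝ ∞ fun x => -M x i j := fun i j => (hM i j).neg
  simp only [Matrix.inv_def, Ring.inverse_eq_inv', Matrix.smul_apply, smul_eq_mul,
    Matrix.adjugate_fin_two]
  refine h.mul ?_
  fin_cases i <;> fin_cases j
  exacts [hM 1 1, hs 0 1, hs 1 0, hM 0 0]

theorem SmoothMatrix.comp {E' : Type} [NormedAddCommGroup E'] [NormedSpace ℝ E']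
    {M : E → Matrix (Fin 2) (Fin 2) ℂ} (hM : SmoothMatrix M) {f : E' → E} (hf : ContDiff ℝ ∞ f) :
    SmoothMatrix fun x => M (f x) := fun i j => (hM i j).comp hf

theorem SmoothMatrix.gramSchmidt {M : E → Matrix (Fin 2) (Fin 2) ℂ} (hM : SmoothMatrix M)
    (ha : ∀ x, 0 < (M x 0 0).re) (hd : ∀ x, 0 < (M x).det.re) :
    SmoothMatrix fun x => gramSchmidtMatrix (M x) := fun i j => by
  have hre : ContDiff ℝ ∞ fun x => (M x 0 0).re := Complex.reCLM.contDiff.comp (hM 0 0)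
  have hdre : ContDiff ℝ ∞ fun x => (M x).det.re := Complex.reCLM.contDiff.comp hM.det
  have h1 : ContDiff ℝ ∞ fun x => (Real.sqrt (M x 0 0).re)⁻¹ :=
    (hre.sqrt fun x => (ha x).ne').inv fun x => (Real.sqrt_pos.2 (ha x)).ne'
  have h2 : ContDiff ℝ ∞ fun x => Real.sqrt ((M x 0 0).re / (M x).det.re) :=
    (hre.div hdre fun x => (hd x).ne').sqrt fun x => (div_pos (ha x) (hd x)).ne'
  have h3 : ContDiff ℝ ∞ fun x => ((M x 0 0).re)⁻¹ := hre.inv fun x => (ha x).ne'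
  fin_cases i <;> fin_cases j
  · exact Complex.ofRealCLM.contDiff.comp h1
  · exact ((hM 0 1).mul (Complex.ofRealCLM.contDiff.comp (h3.mul h2))).neg
  · exact contDiff_const
  · exact Complex.ofRealCLM.contDiff.comp h2

theorem contDiff_coord (hF : ContDiff ℝ ∞ (Function.uncurry F)) (i : Fin 2) :
    ContDiff ℝ ∞ (Function.uncurry fun x t => F x t i) :=
  (contDiff_pi.1 hF) i

theorem parDeriv_coord (hF : ContDiff ℝ ∞ (Function.uncurry F)) (v x : E) (t : ℝ) (i : Fin 2) :
    parDeriv v (fun x t => F x t i) x t = parDeriv v F x t i := by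
  rw [parDeriv, parDeriv, fderiv_apply (hasFDerivAt_family hF x t).differentiableAt]
  rfl

theorem contDiff_gram_integrand (hF : ContDiff ℝ ∞ (Function.uncurry F))
    (hG : ContDiff ℝ ∞ (Function.uncurry G)) (i j : Fin 2) :
    ContDiff ℝ ∞ (Function.uncurry fun x t => star (F x t i) * G x t j) :=
  (contDiff_coord hF i).star_complex.mul (contDiff_coord hG j)

theorem smoothMatrix_gram [ProperSpace E] (hF : ContDiff ℝ ∞ (Function.uncurry F))
    (hG : ContDiff ℝ ∞ (Function.uncurry G)) : SmoothMatrix fun x => gram (F x) (G x) := fun i j =>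
  contDiff_integral_family (contDiff_gram_integrand hF hG i j) 0 2

theorem fderiv_gram [ProperSpace E] (hF : ContDiff ℝ ∞ (Function.uncurry F))
    (hG : ContDiff ℝ ∞ (Function.uncurry G)) (v x : E) (i j : Fin 2) :
    fderiv ℝ (fun x => gram (F x) (G x) i j) x v =
      gram (parDeriv v F x) (G x) i j + gram (F x) (parDeriv v G x) i j := by
  have h := fderiv_integral_family (contDiff_gram_integrand hF hG i j) 0 2 x v
  refine h.trans ?_
  have hc1 := (contDiff_slice (contDiff_parDeriv hF v) x).continuous
  have hc2 := (contDiff_slice (contDiff_parDeriv hG v) x).continuous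
  have e : ∀ t, parDeriv v (fun x t => star (F x t i) * G x t j) x t =
      star (parDeriv v F x t i) * G x t j + star (F x t i) * parDeriv v G x t j := by
    intro t
    have h1 := hasFDerivAt_family (contDiff_coord hF i) x t
    have h1' : HasFDerivAt (fun y => star (F y t i)) _ x :=
      (Complex.conjCLE : ℂ →L[ℝ] ℂ).hasFDerivAt.comp x h1
    have h2 := hasFDerivAt_family (contDiff_coord hG j) x t
    rw [← parDeriv_coord hF, ← parDeriv_coord hG, parDeriv, (h1'.fun_mul h2).fderiv, parDeriv,
      parDeriv,
      h1.fderiv, h2.fderiv]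
    simp
    ring
  simp only [e]
  exact intervalIntegral.integral_add
    (intervalIntegrable_gram hc1 (contDiff_slice hG x).continuous i j)
    (intervalIntegrable_gram (contDiff_slice hF x).continuous hc2 i j)

theorem contDiff_rmul_family (hF : ContDiff ℝ ∞ (Function.uncurry F))
    {M : E → Matrix (Fin 2) (Fin 2) ℂ} (hM : SmoothMatrix M) :
    ContDiff ℝ ∞ (Function.uncurry fun x => rmul (F x) (M x)) := by
  rw [contDiff_pi]
  intro i
  have : (fun q : E × ℝ => (Function.uncurry fun x => rmul (F x) (M x)) q i) =
      fun q : E × ℝ => F q.1 q.2 0 * M q.1 0 i + F q.1 q.2 1 * M q.1 1 i := by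
    ext q
    exact rmul_apply _ _ _ _
  rw [this]
  exact ((contDiff_coord hF 0).mul ((hM 0 i).comp contDiff_fst)).add
    ((contDiff_coord hF 1).mul ((hM 1 i).comp contDiff_fst))

theorem parDeriv_rmul (hF : ContDiff ℝ ∞ (Function.uncurry F))
    {M : E → Matrix (Fin 2) (Fin 2) ℂ} (hM : SmoothMatrix M) (v x : E) :
    parDeriv v (fun x => rmul (F x) (M x)) x =
      rmul (parDeriv v F x) (M x) +
        rmul (F x) (Matrix.of fun i j => fderiv ℝ (fun x => M x i j) x v) := by
  ext t i
  rw [← parDeriv_coord (contDiff_rmul_family hF hM)]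
  simp only [Pi.add_apply, rmul_apply, Matrix.of_apply]
  have h0 := hasFDerivAt_family (contDiff_coord hF 0) x t
  have h1 := hasFDerivAt_family (contDiff_coord hF 1) x t
  have k0 := (((hM 0 i).differentiable (by simp)) x).hasFDerivAt
  have k1 := (((hM 1 i).differentiable (by simp)) x).hasFDerivAt
  refine (congrArg (fun L => L v) ((h0.fun_mul k0).fun_add (h1.fun_mul k1)).fderiv).trans ?_
  rw [← parDeriv_coord hF, ← parDeriv_coord hF, parDeriv, parDeriv, h0.fderiv, h1.fderiv]
  simp
  ring

end GramFamilies

section Frames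

/-- `F` is an `L²`-orthonormal pair of smooth loops (`σ = 1`) or antiperiodic paths (`σ = -1`)
without common zeros. -/
structure IsFrame (σ : ℤˣ) (F : ℝ → Fin 2 → ℂ) : Prop where
  contDiff : ContDiff ℝ ∞ F
  period : ∀ t, F (t + 2) = σ • F t
  gram_self : gram F F = 1
  ne_zero : ∀ t, F t ≠ 0

theorem Stiefel.row_period {σ : ℤˣ} (Φ : Stiefel ℂ σ) (t : ℝ) : Φ.row (t + 2) = σ • Φ.row t := by
  ext i
  fin_cases i
  · exact Φ.1.1.2.2 t
  · exact Φ.1.2.2.2 t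

theorem Stiefel.isFrame {σ : ℤˣ} (Φ : Stiefel ℂ σ) : IsFrame σ Φ.row where
  contDiff := contDiff_pi.2 fun i => by
    fin_cases i
    · exact Φ.1.1.2.1
    · exact Φ.1.2.2.1
  period := Φ.row_period
  gram_self := by
    have h3 : gram Φ.row Φ.row 1 0 = 0 := by
      rw [← Φ.2.2.2.1]
      refine intervalIntegral.integral_congr fun t _ => ?_
      simp [Stiefel.row, mul_comm]
    have h4 : gram Φ.row Φ.row 0 1 = 0 := by
      rw [← gram_conjTranspose, Matrix.conjTranspose_apply, h3, star_zero]
    ext i j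
    fin_cases i <;> fin_cases j
    · have := gram_self_apply Φ.row 0
      rw [show (∫ t in (0 : ℝ)..2, ‖Φ.row t 0‖ ^ 2) = 1 from Φ.2.1] at this
      simpa using this
    · simpa using h4
    · simpa using h3
    · have := gram_self_apply Φ.row 1
      rw [show (∫ t in (0 : ℝ)..2, ‖Φ.row t 1‖ ^ 2) = 1 from Φ.2.2.1] at this
      simpa using this
  ne_zero t h := Φ.2.2.2.2 t ⟨congrFun h 0, congrFun h 1⟩

/-- An orthonormal pair without common zeros, as a point of the Stiefel manifold. -/
def IsFrame.toStiefel {σ : ℤˣ} {F : ℝ → Fin 2 → ℂ} (h : IsFrame σ F) : Stiefel ℂ σ :=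
  ⟨(⟨fun t => F t 0, (contDiff_pi.1 h.contDiff) 0, fun t => congrFun (h.period t) 0⟩,
    ⟨fun t => F t 1, (contDiff_pi.1 h.contDiff) 1, fun t => congrFun (h.period t) 1⟩), by
    have := gram_self_apply F 0
    rw [h.gram_self, Matrix.one_apply_eq] at this
    exact_mod_cast this.symm, by
    have := gram_self_apply F 1
    rw [h.gram_self, Matrix.one_apply_eq] at this
    exact_mod_cast this.symm, by
    have : gram F F 1 0 = 0 := by rw [h.gram_self]; simp
    rw [← this]
    refine intervalIntegral.integral_congr fun t _ => ?_
    simp [mul_comm], fun t ht => h.ne_zero t (by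
      ext i; fin_cases i
      exacts [ht.1, ht.2])⟩

@[simp] theorem IsFrame.row_toStiefel {σ : ℤˣ} {F : ℝ → Fin 2 → ℂ} (h : IsFrame σ F) :
    h.toStiefel.row = F := by
  ext t i
  fin_cases i <;> rfl

theorem Stiefel.row_injective {σ : ℤˣ} {Φ Ψ : Stiefel ℂ σ} (h : Φ.row = Ψ.row) : Φ = Ψ := by
  apply Subtype.ext
  refine Prod.ext (Subtype.ext ?_) (Subtype.ext ?_)
  · ext1 t
    exact congrFun (congrFun h t) 0
  · ext1 t
    exact congrFun (congrFun h t) 1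

/-- A family of points of the Stiefel manifold that is jointly smooth. -/
def SmoothFamily {E : Type} [NormedAddCommGroup E] [NormedSpace ℝ E] {σ : ℤˣ}
    (Φ : E → Stiefel ℂ σ) : Prop :=
  ContDiff ℝ ∞ (Function.uncurry fun x => (Φ x).row)

theorem SmoothFamily.comp {E E' : Type} [NormedAddCommGroup E] [NormedSpace ℝ E]
    [NormedAddCommGroup E'] [NormedSpace ℝ E'] {σ : ℤˣ} {Φ : E → Stiefel ℂ σ}
    (h : SmoothFamily Φ) {f : E' → E} (hf : ContDiff ℝ ∞ f) : SmoothFamily fun x => Φ (f x) :=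
  ContDiff.comp h ((hf.comp contDiff_fst).prodMk contDiff_snd)

theorem isPlot_stiefel_iff {σ : ℤˣ} {n : ℕ} {p : EuclideanSpace ℝ (Fin n) → Stiefel ℂ σ} :
    IsPlot p ↔ SmoothFamily p := by
  constructor
  · rintro ⟨h1, h2⟩
    refine contDiff_pi.2 fun i => ?_
    fin_cases i
    · exact h1
    · exact h2
  · intro h
    exact ⟨contDiff_coord h 0, contDiff_coord h 1⟩

theorem IsFrame.rmul {σ : ℤˣ} {F : ℝ → Fin 2 → ℂ} (h : IsFrame σ F)
    {U : Matrix (Fin 2) (Fin 2) ℂ} (hU : U ∈ Matrix.unitaryGroup (Fin 2) ℂ) :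
    IsFrame σ (rmul F U) where
  contDiff := contDiff_rmul h.contDiff U
  period t := by rw [_root_.rmul, h.period, Matrix.smul_vecMul]; rfl
  gram_self := by
    rw [gram_rmul_right (continuous_rmul h.contDiff.continuous U) h.contDiff.continuous,
      gram_rmul_left h.contDiff.continuous h.contDiff.continuous, h.gram_self, mul_one]
    exact Matrix.mem_unitaryGroup_iff'.1 hU
  ne_zero t ht := h.ne_zero t (by
    have : Matrix.vecMul (Matrix.vecMul (F t) U) (star U) = 0 := by
      rw [show Matrix.vecMul (F t) U = 0 from ht, Matrix.zero_vecMul]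
    rwa [Matrix.vecMul_vecMul, Matrix.mem_unitaryGroup_iff.1 hU, Matrix.vecMul_one] at this)

/-- `F` is a linearly independent pair of smooth loops or antiperiodic paths without common
zeros. -/
structure IsPreframe (σ : ℤˣ) (F : ℝ → Fin 2 → ℂ) : Prop where
  contDiff : ContDiff ℝ ∞ F
  period : ∀ t, F (t + 2) = σ • F t
  ne_zero : ∀ t, F t ≠ 0
  indep : ∃ Ψ : ℝ → Fin 2 → ℂ, Continuous Ψ ∧ (gram Ψ F).det ≠ 0

theorem IsPreframe.re_pos {σ : ℤˣ} {F : ℝ → Fin 2 → ℂ} (h : IsPreframe σ F) :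
    0 < (gram F F 0 0).re :=
  let ⟨_, _, hd⟩ := h.indep
  gram_self_re_pos h.contDiff.continuous hd 0

theorem IsPreframe.det_pos {σ : ℤˣ} {F : ℝ → Fin 2 → ℂ} (h : IsPreframe σ F) :
    0 < (gram F F).det.re :=
  let ⟨_, hΨ, hd⟩ := h.indep
  gram_self_det_pos h.contDiff.continuous hΨ hd

theorem IsPreframe.isFrame {σ : ℤˣ} {F : ℝ → Fin 2 → ℂ} (h : IsPreframe σ F) :
    IsFrame σ (rmul F (gramSchmidtMatrix (gram F F))) where
  contDiff := contDiff_rmul h.contDiff _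
  period t := by rw [_root_.rmul, h.period, Matrix.smul_vecMul]; rfl
  gram_self := by
    have hc := h.contDiff.continuous
    rw [gram_rmul_right (continuous_rmul hc _) hc, gram_rmul_left hc hc]
    exact gramSchmidtMatrix_spec (gram_conjTranspose _ _) h.re_pos h.det_pos
  ne_zero t ht := h.ne_zero t (by
    have hd := gramSchmidtMatrix_det h.re_pos h.det_pos
    exact Matrix.eq_zero_of_vecMul_eq_zero hd ht)

/-- The orthonormal pair obtained from a linearly independent pair by the Gram–Schmidt process. -/
noncomputable def IsPreframe.orthonormalize {σ : ℤˣ} {F : ℝ → Fin 2 → ℂ} (h : IsPreframe σ F) :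
    Stiefel ℂ σ := h.isFrame.toStiefel

theorem IsPreframe.row_orthonormalize {σ : ℤˣ} {F : ℝ → Fin 2 → ℂ} (h : IsPreframe σ F) :
    h.orthonormalize.row = rmul F (gramSchmidtMatrix (gram F F)) := IsFrame.row_toStiefel _

theorem smoothFamily_orthonormalize {E : Type} [NormedAddCommGroup E] [NormedSpace ℝ E]
    [ProperSpace E] {σ : ℤˣ} {F : E → ℝ → Fin 2 → ℂ} (hF : ContDiff ℝ ∞ (Function.uncurry F))
    (h : ∀ x, IsPreframe σ (F x)) : SmoothFamily fun x => (h x).orthonormalize := by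
  simp only [SmoothFamily, IsPreframe.row_orthonormalize]
  exact contDiff_rmul_family hF ((smoothMatrix_gram hF hF).gramSchmidt (fun x => (h x).re_pos)
    fun x => (h x).det_pos)

/-- Two orthonormal pairs with the same span differ by a unitary matrix, which is their matrix of
inner products. -/
theorem gram_unitary_of_rmul {F G : ℝ → Fin 2 → ℂ} (hF : Continuous F)
    (hFF : gram F F = 1) (hGG : gram G G = 1) {M : Matrix (Fin 2) (Fin 2) ℂ} (h : G = rmul F M) :
    M = gram F G ∧ M ∈ Matrix.unitaryGroup (Fin 2) ℂ := by
  have h1 : gram F G = M := by rw [h, gram_rmul_right hF hF, hFF, one_mul]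
  refine ⟨h1.symm, Matrix.mem_unitaryGroup_iff'.2 ?_⟩
  rw [← hGG]
  conv_rhs => rw [h]
  rw [gram_rmul_right (continuous_rmul hF M) hF, gram_rmul_left hF hF, hFF, mul_one]
  rfl

theorem Stiefel.mk_eq_iff {σ : ℤˣ} {Φ Ψ : Stiefel ℂ σ} :
    (Quotient.mk (stiefelSetoid ℂ σ) Φ = Quotient.mk (stiefelSetoid ℂ σ) Ψ) ↔
      ∃ U ∈ Matrix.unitaryGroup (Fin 2) ℂ, Ψ.row = _root_.rmul Φ.row U := by
  rw [Quotient.eq]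
  constructor
  · rintro ⟨U, hU, h⟩
    exact ⟨U, hU, funext h⟩
  · rintro ⟨U, hU, h⟩
    exact ⟨U, hU, congrFun h⟩

theorem Stiefel.mk_eq_of_rmul {σ : ℤˣ} {Φ Ψ : Stiefel ℂ σ} {M : Matrix (Fin 2) (Fin 2) ℂ}
    (h : Ψ.row = _root_.rmul Φ.row M) :
    Quotient.mk (stiefelSetoid ℂ σ) Φ = Quotient.mk (stiefelSetoid ℂ σ) Ψ :=
  Stiefel.mk_eq_iff.2 ⟨M, (gram_unitary_of_rmul Φ.isFrame.contDiff.continuous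
    Φ.isFrame.gram_self Ψ.isFrame.gram_self h).2, h⟩

end Frames

/-! ### Algebra of the frame-Hopf map -/

section Hopf

/-- Third column of the frame-Hopf map. -/
noncomputable def hopf₃ (z w : ℂ) : E3 :=
  !₂[-2 * (z * w).re, (z ^ 2 + w ^ 2).im, (z ^ 2 - w ^ 2).re]

theorem sq_re (z : ℂ) : (z ^ 2).re = z.re * z.re - z.im * z.im := by
  rw [pow_two, Complex.mul_re]

theorem sq_im (z : ℂ) : (z ^ 2).im = z.re * z.im + z.im * z.re := by
  rw [pow_two, Complex.mul_im]

theorem inner_E3 (a b : E3) : ⟪a, b⟫_ℝ = a 0 * b 0 + a 1 * b 1 + a 2 * b 2 := by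
  simp only [PiLp.inner_apply, Fin.sum_univ_three, RCLike.inner_apply, conj_trivial]
  ring

theorem norm_sq_E3 (a : E3) : ‖a‖ ^ 2 = a 0 ^ 2 + a 1 ^ 2 + a 2 ^ 2 := by
  rw [← real_inner_self_eq_norm_sq, inner_E3]
  ring

theorem cross_smul_left (c : ℝ) (u v : E3) : cross (c • u) v = c • cross u v := by
  simp [cross]

theorem cross_smul_right (c : ℝ) (u v : E3) : cross u (c • v) = c • cross u v := by
  simp [cross]

theorem cross_cross_self (u v : E3) : cross v (cross u v) = ⟪v, v⟫_ℝ • u - ⟪v, u⟫_ℝ • v := by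
  rw [inner_E3, inner_E3]
  ext i
  fin_cases i <;> simp [cross, cross_apply] <;> ring

theorem norm_hopf₁ (z w : ℂ) : ‖hopf₁ z w‖ = ‖z‖ ^ 2 + ‖w‖ ^ 2 := by
  have h : ‖hopf₁ z w‖ ^ 2 = (‖z‖ ^ 2 + ‖w‖ ^ 2) ^ 2 := by
    rw [norm_sq_E3]
    simp [hopf₁, Complex.sq_norm, Complex.normSq_apply]
    ring
  exact (sq_eq_sq₀ (norm_nonneg _) (by positivity)).1 h

theorem norm_hopf₂ (z w : ℂ) : ‖hopf₂ z w‖ = ‖z‖ ^ 2 + ‖w‖ ^ 2 := by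
  have h : ‖hopf₂ z w‖ ^ 2 = (‖z‖ ^ 2 + ‖w‖ ^ 2) ^ 2 := by
    rw [norm_sq_E3]
    simp [hopf₂, Complex.sq_norm, Complex.normSq_apply, sq_re, sq_im]
    ring
  exact (sq_eq_sq₀ (norm_nonneg _) (by positivity)).1 h

theorem inner_hopf₁_hopf₂ (z w : ℂ) : ⟪hopf₁ z w, hopf₂ z w⟫_ℝ = 0 := by
  rw [inner_E3]
  simp [hopf₁, hopf₂, Complex.sq_norm, Complex.normSq_apply, sq_re, sq_im]
  ring

theorem inner_hopf₂_hopf₃ (z w : ℂ) : ⟪hopf₂ z w, hopf₃ z w⟫_ℝ = 0 := by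
  rw [inner_E3]
  simp [hopf₃, hopf₂, pow_two]
  ring

theorem cross_hopf₁_hopf₂ (z w : ℂ) :
    cross (hopf₁ z w) (hopf₂ z w) = (‖z‖ ^ 2 + ‖w‖ ^ 2) • hopf₃ z w := by
  ext i
  fin_cases i <;>
    simp [cross, cross_apply, hopf₁, hopf₂, hopf₃, Complex.sq_norm, Complex.normSq_apply, sq_re,
      sq_im] <;> ring

theorem cross_hopf₂_hopf₃ (z w : ℂ) :
    cross (hopf₂ z w) (hopf₃ z w) = (‖z‖ ^ 2 + ‖w‖ ^ 2) • hopf₁ z w := by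
  ext i
  fin_cases i <;>
    simp [cross, cross_apply, hopf₁, hopf₂, hopf₃, Complex.sq_norm, Complex.normSq_apply, sq_re,
      sq_im] <;> ring

theorem sq_add_sq_pos {z w : ℂ} (h : ¬(z = 0 ∧ w = 0)) : 0 < ‖z‖ ^ 2 + ‖w‖ ^ 2 := by
  by_cases hz : z = 0
  · have hw : w ≠ 0 := fun hw => h ⟨hz, hw⟩
    positivity
  · positivity

theorem eq_or_neg_of_products {z w z' w' : ℂ} (h1 : z ^ 2 = z' ^ 2) (h2 : z * w = z' * w')
    (h3 : w ^ 2 = w' ^ 2) : (z = z' ∧ w = w') ∨ (z = -z' ∧ w = -w') := by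
  rcases sq_eq_sq_iff_eq_or_eq_neg.1 h1 with rfl | rfl
  · by_cases hz : z = 0
    · subst hz
      rcases sq_eq_sq_iff_eq_or_eq_neg.1 h3 with h | h
      · exact Or.inl ⟨rfl, h⟩
      · exact Or.inr ⟨by simp, h⟩
    · exact Or.inl ⟨rfl, mul_left_cancel₀ hz h2⟩
  · by_cases hz : z' = 0
    · subst hz
      rcases sq_eq_sq_iff_eq_or_eq_neg.1 h3 with h | h
      · exact Or.inl ⟨by simp, h⟩
      · exact Or.inr ⟨rfl, h⟩
    · refine Or.inr ⟨rfl, mul_left_cancel₀ hz ?_⟩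
      linear_combination -h2

/-- The products `(z², zw, w²)` in terms of the last two columns `b`, `c` of the frame-Hopf map. -/
noncomputable def hopfProducts (b c : E3) : ℂ × ℂ × ℂ :=
  (((b 1 + c 2) / 2 : ℝ) + ((c 1 - b 2) / 2 : ℝ) * Complex.I,
    ((-c 0) / 2 : ℝ) + ((b 0) / 2 : ℝ) * Complex.I,
    ((b 1 - c 2) / 2 : ℝ) + ((c 1 + b 2) / 2 : ℝ) * Complex.I)

theorem hopfProducts_hopf (z w : ℂ) :
    hopfProducts (hopf₂ z w) (hopf₃ z w) = (z ^ 2, z * w, w ^ 2) := by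
  refine Prod.ext ?_ (Prod.ext ?_ ?_) <;> apply Complex.ext <;>
    simp [hopfProducts, hopf₂, hopf₃, sq_re, sq_im] <;> ring

theorem hopf_of_products {b c : E3} {z w : ℂ} (h : hopfProducts b c = (z ^ 2, z * w, w ^ 2)) :
    hopf₂ z w = b ∧ hopf₃ z w = c := by
  have h1 := congrArg (fun p => p.1) h
  have h2 := congrArg (fun p => p.2.1) h
  have h3 := congrArg (fun p => p.2.2) h
  simp only [hopfProducts] at h1 h2 h3
  have h1r := congrArg Complex.re h1
  have h1i := congrArg Complex.im h1
  have h2r := congrArg Complex.re h2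
  have h2i := congrArg Complex.im h2
  have h3r := congrArg Complex.re h3
  have h3i := congrArg Complex.im h3
  simp [pow_two] at h1r h1i h2r h2i h3r h3i
  constructor
  · ext i
    fin_cases i <;> simp [hopf₂, pow_two] <;> linarith
  · ext i
    fin_cases i <;> simp [hopf₃, sq_re, sq_im] <;> linarith

theorem hopfProducts_mul {b c : E3} (h1 : ‖b‖ = ‖c‖) (h2 : ⟪b, c⟫_ℝ = 0) :
    (hopfProducts b c).1 * (hopfProducts b c).2.2 = (hopfProducts b c).2.1 ^ 2 := by
  have h1' : b 0 ^ 2 + b 1 ^ 2 + b 2 ^ 2 = c 0 ^ 2 + c 1 ^ 2 + c 2 ^ 2 := by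
    rw [← norm_sq_E3, ← norm_sq_E3, h1]
  rw [inner_E3] at h2
  apply Complex.ext
  · simp [hopfProducts, pow_two]
    linarith
  · simp [hopfProducts, pow_two]
    linarith

theorem hopfProducts_ne_zero {b c : E3} (h1 : ‖b‖ = ‖c‖) (h2 : ⟪b, c⟫_ℝ = 0) (hb : b ≠ 0) :
    ¬((hopfProducts b c).1 = 0 ∧ (hopfProducts b c).2.2 = 0) := by
  rintro ⟨h3, h4⟩
  have h5 : (hopfProducts b c).2.1 = 0 := by
    have := hopfProducts_mul h1 h2
    rw [h3, zero_mul] at this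
    exact pow_eq_zero_iff (two_ne_zero) |>.1 this.symm
  have h : hopfProducts b c = ((0 : ℂ) ^ 2, (0 : ℂ) * 0, (0 : ℂ) ^ 2) := by
    simp only [ne_eq, OfNat.ofNat_ne_zero, not_false_eq_true, zero_pow, mul_zero]
    exact Prod.ext h3 (Prod.ext h5 h4)
  apply hb
  rw [← (hopf_of_products h).1, ← norm_eq_zero, norm_hopf₂]
  simp

theorem exists_roots {α β δ : ℂ} (h : α * δ = β ^ 2) :
    ∃ z w : ℂ, z ^ 2 = α ∧ z * w = β ∧ w ^ 2 = δ := by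
  by_cases hα : α = 0
  · obtain ⟨w, hw⟩ := IsAlgClosed.exists_pow_nat_eq δ two_pos
    refine ⟨0, w, by simp [hα], ?_, hw⟩
    rw [hα, zero_mul] at h
    rw [zero_mul, (pow_eq_zero_iff two_ne_zero).1 h.symm]
  · obtain ⟨z, hz⟩ := IsAlgClosed.exists_pow_nat_eq α two_pos
    have hz0 : z ≠ 0 := by rintro rfl; exact hα (by simpa using hz.symm)
    refine ⟨z, β / z, hz, by field_simp, ?_⟩
    rw [div_pow, hz, div_eq_iff hα, ← h, mul_comm]

/-- The frame-Hopf map takes the value `(a, ‖a‖ v, a × v)` as soon as its last two columns are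
right. -/
theorem hopf_of_frame {a v : E3} (ha : a ≠ 0) (hv : ‖v‖ = 1) (hav : ⟪a, v⟫_ℝ = 0) {z w : ℂ}
    (h : hopfProducts (‖a‖ • v) (cross a v) = (z ^ 2, z * w, w ^ 2)) :
    hopf₁ z w = a ∧ ‖z‖ ^ 2 + ‖w‖ ^ 2 = ‖a‖ ∧ (‖z‖ ^ 2 + ‖w‖ ^ 2)⁻¹ • hopf₂ z w = v := by
  obtain ⟨h2, h3⟩ := hopf_of_products h
  have hn : ‖z‖ ^ 2 + ‖w‖ ^ 2 = ‖a‖ := by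
    rw [← norm_hopf₂, h2, norm_smul, hv, norm_norm, mul_one]
  have ha' : ‖a‖ ≠ 0 := norm_ne_zero_iff.2 ha
  refine ⟨?_, hn, ?_⟩
  · have := cross_hopf₂_hopf₃ z w
    rw [h2, h3, hn, cross_smul_left, cross_cross_self, real_inner_self_eq_norm_sq, hv,
      real_inner_comm, hav, zero_smul, sub_zero, one_pow, one_smul] at this
    exact (smul_right_injective E3 ha' this).symm
  · rw [hn, h2, smul_smul, inv_mul_cancel₀ ha', one_smul]

theorem cross_norm_of_frame {a v : E3} (hv : ‖v‖ = 1) (hav : ⟪a, v⟫_ℝ = 0) :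
    ‖‖a‖ • v‖ = ‖cross a v‖ := by
  rw [norm_smul, hv, norm_norm, mul_one]
  refine (sq_eq_sq₀ (norm_nonneg _) (norm_nonneg _)).1 ?_
  have h1 : v 0 ^ 2 + v 1 ^ 2 + v 2 ^ 2 = 1 := by rw [← norm_sq_E3, hv, one_pow]
  rw [inner_E3] at hav
  rw [norm_sq_E3, norm_sq_E3]
  simp [cross, cross_apply]
  linear_combination (- (a 0 ^ 2 + a 1 ^ 2 + a 2 ^ 2)) * h1 +
    (a 0 * v 0 + a 1 * v 1 + a 2 * v 2) * hav

theorem inner_cross_of_frame (a v : E3) (c : ℝ) : ⟪c • v, cross a v⟫_ℝ = 0 := by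
  rw [real_inner_smul_left, inner_E3]
  simp [cross, cross_apply]
  ring_nf
  simp

theorem hopf_frame_unique {z w z' w' : ℂ} (h1 : hopf₁ z w = hopf₁ z' w')
    (h2 : hopf₂ z w = hopf₂ z' w') : (z = z' ∧ w = w') ∨ (z = -z' ∧ w = -w') := by
  have hn : ‖z‖ ^ 2 + ‖w‖ ^ 2 = ‖z'‖ ^ 2 + ‖w'‖ ^ 2 := by rw [← norm_hopf₁, h1, norm_hopf₁]
  by_cases hz : z' = 0 ∧ w' = 0
  · obtain ⟨rfl, rfl⟩ := hz
    left
    simp at hn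
    have e1 : ‖z‖ ^ 2 = 0 := by nlinarith [sq_nonneg ‖z‖, sq_nonneg ‖w‖]
    have e2 : ‖w‖ ^ 2 = 0 := by nlinarith [sq_nonneg ‖z‖, sq_nonneg ‖w‖]
    simpa using And.intro e1 e2
  · have hpos := sq_add_sq_pos hz
    have h3 : hopf₃ z w = hopf₃ z' w' := by
      have := cross_hopf₁_hopf₂ z w
      rw [h1, h2, cross_hopf₁_hopf₂, hn] at this
      exact (smul_right_injective E3 hpos.ne' this).symm
    have h4 := hopfProducts_hopf z w
    rw [h2, h3, hopfProducts_hopf] at h4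
    simp only [Prod.mk.injEq] at h4
    exact eq_or_neg_of_products h4.1.symm h4.2.1.symm h4.2.2.symm

/-- The matrix whose columns are the values of the frame-Hopf map. -/
noncomputable def hopfMatrix (p q : ℂ) : Matrix (Fin 3) (Fin 3) ℝ :=
  Matrix.of fun i j => (![hopf₁ p q, hopf₂ p q, hopf₃ p q] j) i

theorem matAct_hopfMatrix (p q : ℂ) (v : E3) :
    matAct (hopfMatrix p q) v = v 0 • hopf₁ p q + v 1 • hopf₂ p q + v 2 • hopf₃ p q := by
  ext i
  simp [hopfMatrix, Matrix.mulVec, dotProduct, Fin.sum_univ_three]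
  ring

theorem hopf₁_specialUnitary (p q z w : ℂ) :
    hopf₁ (z * p - w * star q) (z * q + w * star p) = matAct (hopfMatrix p q) (hopf₁ z w) := by
  rw [matAct_hopfMatrix]
  ext i
  fin_cases i <;>
    simp [hopf₁, hopf₂, hopf₃, Complex.sq_norm, Complex.normSq_apply, sq_re, sq_im] <;> ring

theorem hopf₂_specialUnitary (p q z w : ℂ) :
    hopf₂ (z * p - w * star q) (z * q + w * star p) = matAct (hopfMatrix p q) (hopf₂ z w) := by
  rw [matAct_hopfMatrix]
  ext i
  fin_cases i <;>
    simp [hopf₁, hopf₂, hopf₃, Complex.sq_norm, Complex.normSq_apply, sq_re, sq_im] <;> ring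

theorem hopf₃_specialUnitary (p q z w : ℂ) :
    hopf₃ (z * p - w * star q) (z * q + w * star p) = matAct (hopfMatrix p q) (hopf₃ z w) := by
  rw [matAct_hopfMatrix]
  ext i
  fin_cases i <;>
    simp [hopf₁, hopf₂, hopf₃, Complex.sq_norm, Complex.normSq_apply, sq_re, sq_im] <;> ring

theorem hopf₁_phase {μ : ℂ} (hμ : ‖μ‖ = 1) (z w : ℂ) : hopf₁ (μ * z) (μ * w) = hopf₁ z w := by
  have h : μ.re * μ.re + μ.im * μ.im = 1 := by
    rw [← Complex.normSq_apply, ← Complex.sq_norm, hμ, one_pow]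
  ext i
  fin_cases i
  · simp only [hopf₁, Complex.sq_norm, Complex.normSq_apply]
    simp
    linear_combination (z.re * z.re + z.im * z.im - (w.re * w.re + w.im * w.im)) * h
  · simp [hopf₁]
    linear_combination (z.im * w.re - z.re * w.im) * h
  · simp [hopf₁]
    linear_combination (z.re * w.re + z.im * w.im) * h

theorem hopf₂_phase (μ z w : ℂ) :
    hopf₂ (μ * z) (μ * w) = (μ ^ 2).re • hopf₂ z w - (μ ^ 2).im • hopf₃ z w := by
  ext i
  fin_cases i <;> simp [hopf₂, hopf₃, sq_re, sq_im] <;> ring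

theorem hopfMatrix_mem {p q : ℂ} (h : ‖p‖ ^ 2 + ‖q‖ ^ 2 = 1) :
    hopfMatrix p q ∈ Matrix.specialOrthogonalGroup (Fin 3) ℝ := by
  rw [Complex.sq_norm, Complex.sq_norm, Complex.normSq_apply, Complex.normSq_apply] at h
  rw [Matrix.mem_specialOrthogonalGroup_iff]
  obtain ⟨a, b⟩ := p
  obtain ⟨c, d⟩ := q
  simp only at h
  have hn : (a * a + b * b + (c * c + d * d)) ^ 2 = 1 := by rw [h, one_pow]
  have hn3 : (a * a + b * b + (c * c + d * d)) ^ 3 = 1 := by rw [h, one_pow]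
  constructor
  · rw [Matrix.mem_orthogonalGroup_iff']
    ext i j
    fin_cases i <;> fin_cases j <;>
      simp [hopfMatrix, hopf₁, hopf₂, hopf₃, Matrix.mul_apply, Fin.sum_univ_three, Complex.sq_norm,
        Complex.normSq_apply, sq_re, sq_im] <;> first | linear_combination hn | ring
  · rw [Matrix.det_fin_three]
    simp [hopfMatrix, hopf₁, hopf₂, hopf₃, Complex.sq_norm,
        Complex.normSq_apply, sq_re, sq_im]
    linear_combination hn3

end Hopf

section HopfUnitary

theorem vecMul_fin_two (v : Fin 2 → ℂ) (U : Matrix (Fin 2) (Fin 2) ℂ) (i : Fin 2) :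
    Matrix.vecMul v U i = v 0 * U 0 i + v 1 * U 1 i := by
  simp [Matrix.vecMul, dotProduct, Fin.sum_univ_two]

/-- A unitary matrix acts on the frame-Hopf map by a rotation of space and a twist of the frame. -/
theorem hopf_unitary {U : Matrix (Fin 2) (Fin 2) ℂ} (hU : U ∈ Matrix.unitaryGroup (Fin 2) ℂ) :
    ∃ A ∈ Matrix.specialOrthogonalGroup (Fin 3) ℝ, ∃ θ : ℝ, ∀ v : Fin 2 → ℂ,
      hopf₁ (Matrix.vecMul v U 0) (Matrix.vecMul v U 1) = matAct A (hopf₁ (v 0) (v 1)) ∧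
      hopf₂ (Matrix.vecMul v U 0) (Matrix.vecMul v U 1) =
        matAct A (Real.cos θ • hopf₂ (v 0) (v 1) + Real.sin θ • hopf₃ (v 0) (v 1)) := by
  have hD : ‖U.det‖ = 1 := by
    have := Matrix.det_of_mem_unitary hU
    exact CStarRing.norm_of_mem_unitary this
  obtain ⟨μ, hμ⟩ := IsAlgClosed.exists_pow_nat_eq U.det two_pos
  have hμ1 : ‖μ‖ = 1 := by
    rw [← hμ, norm_pow] at hD
    exact (pow_eq_one_iff_of_nonneg (norm_nonneg μ) two_ne_zero).1 hD
  have hμ0 : μ ≠ 0 := by rintro rfl; simp at hμ1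
  have hμμ : μ * star μ = 1 := by
    rw [RCLike.star_def, Complex.mul_conj, ← Complex.sq_norm, hμ1]
    simp
  have hrow : U 0 0 * star (U 0 0) + U 0 1 * star (U 0 1) = 1 := by
    have := congrFun (congrFun (Matrix.mem_unitaryGroup_iff.1 hU) 0) 0
    simpa [Matrix.mul_apply, Fin.sum_univ_two] using this
  have hadj : U.det • star U = U.adjugate := by
    calc U.det • star U = (U.adjugate * U) * star U := by
          rw [Matrix.adjugate_mul, Matrix.smul_mul, one_mul]
      _ = U.adjugate := by rw [mul_assoc, Matrix.mem_unitaryGroup_iff.1 hU, mul_one]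
  have h11 : U 1 1 = μ ^ 2 * star (U 0 0) := by
    have := congrFun (congrFun hadj 0) 0
    rw [hμ]
    simpa [Matrix.adjugate_fin_two, Matrix.star_apply] using this.symm
  have h10 : U 1 0 = -(μ ^ 2 * star (U 0 1)) := by
    have := congrFun (congrFun hadj 1) 0
    rw [hμ, eq_neg_iff_add_eq_zero, ← sub_eq_zero.2 this]
    simp [Matrix.adjugate_fin_two, Matrix.star_apply]
    ring
  set p := star μ * U 0 0 with hp
  set q := star μ * U 0 1 with hq
  have hpq : ‖p‖ ^ 2 + ‖q‖ ^ 2 = 1 := by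
    rw [hp, hq, norm_mul, norm_mul, norm_star, hμ1, one_mul, one_mul]
    rw [RCLike.star_def, Complex.mul_conj, Complex.mul_conj] at hrow
    rw [Complex.sq_norm, Complex.sq_norm]
    exact_mod_cast hrow
  have e0 : ∀ v : Fin 2 → ℂ, Matrix.vecMul v U 0 = μ * (v 0 * p - v 1 * star q) := fun v => by
    rw [vecMul_fin_two, h10, hp, hq, star_mul', star_star]
    linear_combination (-(v 0 * U 0 0)) * hμμ
  have e1 : ∀ v : Fin 2 → ℂ, Matrix.vecMul v U 1 = μ * (v 0 * q + v 1 * star p) := fun v => by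
    rw [vecMul_fin_two, h11, hp, hq, star_mul', star_star]
    linear_combination (-(v 0 * U 0 1)) * hμμ
  refine ⟨hopfMatrix p q, hopfMatrix_mem hpq, -Complex.arg (μ ^ 2), fun v => ?_⟩
  have hc : Real.cos (Complex.arg (μ ^ 2)) = (μ ^ 2).re := by
    rw [Complex.cos_arg (pow_ne_zero _ hμ0), norm_pow, hμ1, one_pow, div_one]
  have hs : Real.sin (Complex.arg (μ ^ 2)) = (μ ^ 2).im := by
    rw [Complex.sin_arg, norm_pow, hμ1, one_pow, div_one]
  rw [e0, e1]
  constructor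
  · rw [hopf₁_phase hμ1, hopf₁_specialUnitary]
  · rw [hopf₂_phase, hopf₂_specialUnitary, hopf₃_specialUnitary, Real.cos_neg, Real.sin_neg, hc, hs,
      map_add, map_smul, map_smul, neg_smul, sub_eq_add_neg]

/-- Every rotation of space and every twist of the frame come from a unitary matrix. -/
theorem exists_unitary_of_rotation {A : Matrix (Fin 3) (Fin 3) ℝ}
    (hA : A ∈ Matrix.specialOrthogonalGroup (Fin 3) ℝ) (θ : ℝ) :
    ∃ U ∈ Matrix.unitaryGroup (Fin 2) ℂ, ∀ v : Fin 2 → ℂ,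
      hopf₁ (Matrix.vecMul v U 0) (Matrix.vecMul v U 1) = matAct A (hopf₁ (v 0) (v 1)) ∧
      hopf₂ (Matrix.vecMul v U 0) (Matrix.vecMul v U 1) =
        matAct A (Real.cos θ • hopf₂ (v 0) (v 1) + Real.sin θ • hopf₃ (v 0) (v 1)) := by
  have hO := ((Matrix.mem_specialOrthogonalGroup_iff).1 hA).1
  set e₁ : E3 := !₂[1, 0, 0] with he₁
  set e₂ : E3 := !₂[0, 1, 0] with he₂
  set e₃ : E3 := !₂[0, 0, 1] with he₃
  have hc12 : cross e₁ e₂ = e₃ := by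
    ext i
    fin_cases i <;> simp [cross, cross_apply, he₁, he₂, he₃]
  have n1 : ‖matAct A e₁‖ = 1 := by
    rw [FramedLoop.norm_matAct hO]
    simp [EuclideanSpace.norm_eq, Fin.sum_univ_three, he₁]
  have n2 : ‖matAct A e₂‖ = 1 := by
    rw [FramedLoop.norm_matAct hO]
    simp [EuclideanSpace.norm_eq, Fin.sum_univ_three, he₂]
  have h12 : ⟪matAct A e₁, matAct A e₂⟫_ℝ = 0 := by
    have e := @norm_add_sq_real E3 _ _ (matAct A e₁) (matAct A e₂)
    rw [← map_add, FramedLoop.norm_matAct hO, n1, n2, norm_sq_E3] at e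
    have hs : (e₁ + e₂) 0 ^ 2 + (e₁ + e₂) 1 ^ 2 + (e₁ + e₂) 2 ^ 2 = 2 := by
      simp [he₁, he₂]
      norm_num
    rw [hs] at e
    linarith
  have hc : cross (matAct A e₁) (matAct A e₂) = matAct A e₃ := by
    rw [FramedLoop.cross_matAct hA, hc12]
  have ha : matAct A e₁ ≠ 0 := by
    rw [← norm_ne_zero_iff, n1]
    exact one_ne_zero
  -- `(p, q)` is a preimage of the rotation `A` under the frame-Hopf map.
  obtain ⟨p, q, h1, h2, h3⟩ := exists_roots (hopfProducts_mul (b := ‖matAct A e₁‖ • matAct A e₂)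
    (c := cross (matAct A e₁) (matAct A e₂)) (cross_norm_of_frame n2 h12)
    (inner_cross_of_frame _ _ _))
  have hpr : hopfProducts (‖matAct A e₁‖ • matAct A e₂) (cross (matAct A e₁) (matAct A e₂)) =
    (p ^ 2, p * q, q ^ 2) := by rw [h1, h2, h3]
  obtain ⟨k1, k2, -⟩ := hopf_of_frame ha n2 h12 hpr
  obtain ⟨k3, k4⟩ := hopf_of_products hpr
  rw [n1, one_smul] at k3
  rw [hc] at k4
  rw [n1] at k2
  have hAM : ∀ v, matAct (hopfMatrix p q) v = matAct A v := fun v => by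
    rw [matAct_hopfMatrix, k1, k3, k4, ← map_smul, ← map_smul, ← map_smul, ← map_add, ← map_add]
    congr 1
    ext i
    fin_cases i <;> simp [he₁, he₂, he₃]
  -- Multiplication by the phase `μ` twists the frame by the argument of `μ⁻²`.
  set μ : ℂ := Complex.exp (((-(θ / 2) : ℝ) : ℂ) * Complex.I) with hμ
  have hμ1 : ‖μ‖ = 1 := Complex.norm_exp_ofReal_mul_I _
  have hμμ : μ * star μ = 1 := by
    rw [RCLike.star_def, Complex.mul_conj, ← Complex.sq_norm, hμ1]
    simp
  have hμ2 : μ ^ 2 = Complex.exp (((-θ : ℝ) : ℂ) * Complex.I) := by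
    rw [hμ, ← Complex.exp_nat_mul]
    congr 1
    push_cast
    ring
  have hpq : p * star p + q * star q = 1 := by
    rw [RCLike.star_def, Complex.mul_conj, Complex.mul_conj]
    rw [Complex.sq_norm, Complex.sq_norm] at k2
    exact_mod_cast k2
  refine ⟨!![μ * p, μ * q; -(μ * star q), μ * star p], ?_, fun v => ?_⟩
  · rw [Matrix.mem_unitaryGroup_iff]
    ext i j
    fin_cases i <;> fin_cases j
    · simp [Matrix.mul_apply, Fin.sum_univ_two, Matrix.star_apply]
      simp only [RCLike.star_def] at hμμ hpq
      linear_combination hpq + (p * (starRingEnd ℂ) p + q * (starRingEnd ℂ) q) * hμμ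
    · simp [Matrix.mul_apply, Fin.sum_univ_two, Matrix.star_apply]
      ring
    · simp [Matrix.mul_apply, Fin.sum_univ_two, Matrix.star_apply]
      ring
    · simp [Matrix.mul_apply, Fin.sum_univ_two, Matrix.star_apply]
      simp only [RCLike.star_def] at hμμ hpq
      linear_combination hpq + (p * (starRingEnd ℂ) p + q * (starRingEnd ℂ) q) * hμμ
  · have e0 : Matrix.vecMul v !![μ * p, μ * q; -(μ * star q), μ * star p] 0 =
        μ * (v 0 * p - v 1 * star q) := by
      rw [vecMul_fin_two]
      simp
      ring
    have e1 : Matrix.vecMul v !![μ * p, μ * q; -(μ * star q), μ * star p] 1 =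
        μ * (v 0 * q + v 1 * star p) := by
      rw [vecMul_fin_two]
      simp
      ring
    rw [e0, e1]
    constructor
    · rw [hopf₁_phase hμ1, hopf₁_specialUnitary, hAM]
    · rw [hopf₂_phase, hopf₂_specialUnitary, hopf₃_specialUnitary, hAM, hAM, hμ2,
        Complex.exp_ofReal_mul_I_re, Complex.exp_ofReal_mul_I_im, Real.cos_neg, Real.sin_neg,
        map_add, map_smul, map_smul, neg_smul, sub_neg_eq_add]

theorem hasDerivAt_euclidean {n : ℕ} {f : ℝ → EuclideanSpace ℝ (Fin n)}
    {f' : EuclideanSpace ℝ (Fin n)} {u : ℝ} :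
    HasDerivAt f f' u ↔ ∀ i, HasDerivAt (fun u => f u i) (f' i) u := by
  simp only [hasDerivAt_iff_hasFDerivAt, ← hasFDerivWithinAt_univ, hasFDerivWithinAt_euclidean]
  refine forall_congr' fun i => iff_of_eq ?_
  congr 1

/-- The derivative of the first column of the frame-Hopf map. -/
noncomputable def dhopf₁ (z w ζ η : ℂ) : E3 :=
  !₂[2 * (star z * ζ - star w * η).re, 2 * (ζ * star w + z * star η).im,
    2 * (ζ * star w + z * star η).re]

/-- The derivative of the second column of the frame-Hopf map. -/
noncomputable def dhopf₂ (z w ζ η : ℂ) : E3 :=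
  !₂[2 * (ζ * w + z * η).im, 2 * (z * ζ + w * η).re, 2 * (-(z * ζ) + w * η).im]

theorem norm_dhopf₁ (z w ζ η : ℂ) :
    ‖dhopf₁ z w ζ η‖ ^ 2 = 4 * ((‖z‖ ^ 2 + ‖w‖ ^ 2) * (‖ζ‖ ^ 2 + ‖η‖ ^ 2) -
      (star z * ζ + star w * η).im ^ 2) := by
  rw [norm_sq_E3]
  simp [dhopf₁, Complex.sq_norm, Complex.normSq_apply]
  ring

theorem inner_dhopf₂_hopf₃ (z w ζ η : ℂ) :
    ⟪dhopf₂ z w ζ η, hopf₃ z w⟫_ℝ =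
      -2 * (‖z‖ ^ 2 + ‖w‖ ^ 2) * (star z * ζ + star w * η).im := by
  rw [inner_E3]
  simp [dhopf₂, hopf₃, Complex.sq_norm, Complex.normSq_apply, sq_re, sq_im]
  ring

theorem hasDerivAt_hopf₁ {z w : ℝ → ℂ} {ζ η : ℂ} {u : ℝ} (hz : HasDerivAt z ζ u)
    (hw : HasDerivAt w η u) :
    HasDerivAt (fun u => hopf₁ (z u) (w u)) (dhopf₁ (z u) (w u) ζ η) u := by
  have re : ∀ {f : ℝ → ℂ} {f' : ℂ}, HasDerivAt f f' u → HasDerivAt (fun u => (f u).re) f'.re u :=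
    fun h => (Complex.reCLM.hasFDerivAt.comp_hasDerivAt u h)
  have im : ∀ {f : ℝ → ℂ} {f' : ℂ}, HasDerivAt f f' u → HasDerivAt (fun u => (f u).im) f'.im u :=
    fun h => (Complex.imCLM.hasFDerivAt.comp_hasDerivAt u h)
  have zr := re hz
  have zi := im hz
  have wr := re hw
  have wi := im hw
  rw [hasDerivAt_euclidean]
  intro i
  fin_cases i
  · simp [hopf₁, dhopf₁, Complex.sq_norm, Complex.normSq_apply]
    exact ((zr.fun_mul zr).fun_add (zi.fun_mul zi)).fun_sub
      ((wr.fun_mul wr).fun_add (wi.fun_mul wi)) |>.congr_deriv (by ring)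
  · simp [hopf₁, dhopf₁]
    exact ((((zr.fun_mul wi).fun_neg).fun_add (zi.fun_mul wr)).const_mul 2).congr_deriv (by ring)
  · simp [hopf₁, dhopf₁]
    exact (((zr.fun_mul wr).fun_add (zi.fun_mul wi)).const_mul 2).congr_deriv (by ring)

theorem hasDerivAt_hopf₂ {z w : ℝ → ℂ} {ζ η : ℂ} {u : ℝ} (hz : HasDerivAt z ζ u)
    (hw : HasDerivAt w η u) :
    HasDerivAt (fun u => hopf₂ (z u) (w u)) (dhopf₂ (z u) (w u) ζ η) u := by
  have re : ∀ {f : ℝ → ℂ} {f' : ℂ}, HasDerivAt f f' u → HasDerivAt (fun u => (f u).re) f'.re u :=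
    fun h => (Complex.reCLM.hasFDerivAt.comp_hasDerivAt u h)
  have im : ∀ {f : ℝ → ℂ} {f' : ℂ}, HasDerivAt f f' u → HasDerivAt (fun u => (f u).im) f'.im u :=
    fun h => (Complex.imCLM.hasFDerivAt.comp_hasDerivAt u h)
  rw [hasDerivAt_euclidean]
  intro i
  fin_cases i
  · exact ((im (hz.fun_mul hw)).const_mul 2)
  · exact (re ((hz.fun_pow 2).fun_add (hw.fun_pow 2))).congr_deriv (by
      simp [dhopf₂]; ring)
  · exact (im (((hz.fun_pow 2).fun_neg).fun_add (hw.fun_pow 2))).congr_deriv (by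
      simp [dhopf₂]; ring)

end HopfUnitary

/-! ### Smooth square roots -/

section Roots

variable {X : Type} [NormedAddCommGroup X] [NormedSpace ℝ X]

/-- Local branches of the roots, where the first one does not vanish. -/
theorem exists_local_root_aux {α β δ : X → ℂ} (hα : ContDiff ℝ ∞ α) (hβ : ContDiff ℝ ∞ β)
    (h : ∀ x, α x * δ x = β x ^ 2) {x₀ : X} {z₀ w₀ : ℂ} (hz : z₀ ^ 2 = α x₀) (hzw : z₀ * w₀ = β x₀)
    (h0 : z₀ ≠ 0) :
    ∃ z w : X → ℂ, ContDiffAt ℝ ∞ z x₀ ∧ ContDiffAt ℝ ∞ w x₀ ∧ z x₀ = z₀ ∧ w x₀ = w₀ ∧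
      ∀ᶠ x in 𝓝 x₀, z x ^ 2 = α x ∧ z x * w x = β x ∧ w x ^ 2 = δ x := by
  have hz2 : z₀ ^ 2 ≠ 0 := pow_ne_zero _ h0
  have h1 : α x₀ / z₀ ^ 2 = 1 := by rw [hz]; exact div_self (hz ▸ hz2)
  have hq : ContDiff ℝ ∞ fun x => α x / z₀ ^ 2 := hα.div_const _
  have hlog : ContDiffAt ℝ ∞ (fun x => Complex.log (α x / z₀ ^ 2)) x₀ := by
    have hl : ContDiffAt ℂ ∞ Complex.log (α x₀ / z₀ ^ 2) :=
      Complex.contDiffAt_log (by rw [h1]; exact Complex.one_mem_slitPlane)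
    exact (hl.restrict_scalars ℝ).comp x₀ hq.contDiffAt
  have hzc : ContDiffAt ℝ ∞ (fun x => z₀ * Complex.exp (Complex.log (α x / z₀ ^ 2) / 2)) x₀ :=
    contDiffAt_const.mul (hlog.div_const 2).cexp
  have hne : ∀ x, z₀ * Complex.exp (Complex.log (α x / z₀ ^ 2) / 2) ≠ 0 := fun x =>
    mul_ne_zero h0 (Complex.exp_ne_zero _)
  refine ⟨fun x => z₀ * Complex.exp (Complex.log (α x / z₀ ^ 2) / 2),
    fun x => β x / (z₀ * Complex.exp (Complex.log (α x / z₀ ^ 2) / 2)), hzc,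
    hβ.contDiffAt.mul (hzc.inv (hne x₀)), ?_, ?_, ?_⟩
  · simp [h1]
  · simp only [h1, Complex.log_one, zero_div, Complex.exp_zero, mul_one, ← hzw]
    field_simp
  · have hα0 : α x₀ ≠ 0 := hz ▸ hz2
    filter_upwards [hα.continuous.continuousAt.eventually_ne hα0] with x hx
    have hsq : (z₀ * Complex.exp (Complex.log (α x / z₀ ^ 2) / 2)) ^ 2 = α x := by
      rw [mul_pow, ← Complex.exp_nat_mul]
      have : ((2 : ℕ) : ℂ) * (Complex.log (α x / z₀ ^ 2) / 2) = Complex.log (α x / z₀ ^ 2) := by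
        push_cast
        ring
      rw [this, Complex.exp_log (div_ne_zero hx hz2), mul_div_cancel₀ _ hz2]
    refine ⟨hsq, mul_div_cancel₀ _ (hne x), ?_⟩
    rw [div_pow, hsq, ← h x, mul_div_cancel_left₀ _ hx]

theorem exists_local_root {α β δ : X → ℂ} (hα : ContDiff ℝ ∞ α) (hβ : ContDiff ℝ ∞ β)
    (hδ : ContDiff ℝ ∞ δ) (h : ∀ x, α x * δ x = β x ^ 2) {x₀ : X} {z₀ w₀ : ℂ}
    (hz : z₀ ^ 2 = α x₀) (hzw : z₀ * w₀ = β x₀) (hw : w₀ ^ 2 = δ x₀) (h0 : ¬(z₀ = 0 ∧ w₀ = 0)) :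
    ∃ z w : X → ℂ, ContDiffAt ℝ ∞ z x₀ ∧ ContDiffAt ℝ ∞ w x₀ ∧ z x₀ = z₀ ∧ w x₀ = w₀ ∧
      ∀ᶠ x in 𝓝 x₀, z x ^ 2 = α x ∧ z x * w x = β x ∧ w x ^ 2 = δ x := by
  by_cases hz0 : z₀ = 0
  · have hw0 : w₀ ≠ 0 := fun hw0 => h0 ⟨hz0, hw0⟩
    obtain ⟨w, z, h1, h2, h3, h4, h5⟩ := exists_local_root_aux (δ := α) hδ hβ
      (fun x => by rw [mul_comm, h x]) hw (by rw [mul_comm, hzw]) hw0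
    exact ⟨z, w, h2, h1, h4, h3, h5.mono fun x hx => ⟨hx.2.2, by rw [mul_comm]; exact hx.2.1, hx.1⟩⟩
  · exact exists_local_root_aux hα hβ h hz hzw hz0

/-- Pairs of complex numbers that are not both zero. -/
abbrev NonzeroPair := {p : ℂ × ℂ // p ≠ 0}

/-- The sign group acts on the pairs; the orbits are the unordered pairs `{±(z, w)}`. -/
instance : MulAction ℤˣ NonzeroPair where
  smul u p := ⟨u • p.1, fun h => p.2 ((smul_eq_zero_iff_eq u).1 h)⟩
  one_smul _ := Subtype.ext (one_smul _ _)
  mul_smul u v p := Subtype.ext (mul_smul u v p.1)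

theorem NonzeroPair.smul_val (u : ℤˣ) (p : NonzeroPair) : (u • p).1 = u • p.1 := rfl

theorem isQuotientCoveringMap_nonzeroPair :
    IsQuotientCoveringMap (Quotient.mk (MulAction.orbitRel ℤˣ NonzeroPair)) ℤˣ where
  toIsQuotientMap := isQuotientMap_quotient_mk'
  continuous_const_smul u := by
    have h : Continuous fun p : NonzeroPair => u • p.1 := by
      have hc : Continuous fun p : NonzeroPair => p.1 := continuous_subtype_val
      rcases Int.units_eq_one_or u with rfl | rfl
      · simpa only [one_smul] using hc
      · simp only [Units.smul_def, Units.val_neg, Units.val_one, neg_smul, one_smul]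
        exact hc.neg
    exact h.subtype_mk _
  apply_eq_iff_mem_orbit := Quotient.eq
  disjoint p := by
    have hp : 0 < ‖p.1‖ := norm_pos_iff.2 p.2
    refine ⟨Subtype.val ⁻¹' Metric.ball p.1 ‖p.1‖,
      continuous_subtype_val.continuousAt.preimage_mem_nhds (Metric.ball_mem_nhds _ hp), fun u hu
        => ?_⟩
    rcases Int.units_eq_one_or u with rfl | rfl
    · rfl
    · exfalso
      obtain ⟨-, ⟨x, hx, rfl⟩, hx'⟩ := hu
      simp only [mem_preimage, NonzeroPair.smul_val, Metric.mem_ball, dist_eq_norm] at hx hx'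
      have : (2 : ℝ) • p.1 = -(x.1 - p.1) - ((-1 : ℤˣ) • x.1 - p.1) := by
        simp only [Units.smul_def, Units.val_neg, Units.val_one, neg_smul, one_smul, two_smul]
        abel
      have h2 : ‖(2 : ℝ) • p.1‖ ≤ ‖x.1 - p.1‖ + ‖(-1 : ℤˣ) • x.1 - p.1‖ := by
        rw [this]
        exact (norm_sub_le _ _).trans (by rw [norm_neg])
      rw [norm_smul, Real.norm_of_nonneg zero_le_two] at h2
      linarith

/-- Smooth functions `α`, `β`, `δ` with `α δ = β²` are the products of two smooth functions, as
long as they do not vanish simultaneously. -/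
theorem exists_smooth_roots {α β δ : X → ℂ} (hα : ContDiff ℝ ∞ α) (hβ : ContDiff ℝ ∞ β)
    (hδ : ContDiff ℝ ∞ δ) (h : ∀ x, α x * δ x = β x ^ 2) (h0 : ∀ x, ¬(α x = 0 ∧ δ x = 0)) :
    ∃ z w : X → ℂ, ContDiff ℝ ∞ z ∧ ContDiff ℝ ∞ w ∧
      ∀ x, z x ^ 2 = α x ∧ z x * w x = β x ∧ w x ^ 2 = δ x := by
  have hne : ∀ {x : X} {z w : ℂ}, z ^ 2 = α x → w ^ 2 = δ x → ¬(z = 0 ∧ w = 0) := by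
    rintro x z w h1 h2 ⟨rfl, rfl⟩
    exact h0 x ⟨by simpa using h1.symm, by simpa using h2.symm⟩
  have hne' : ∀ {x : X} {z w : ℂ}, z ^ 2 = α x → w ^ 2 = δ x → (z, w) ≠ 0 := fun h1 h2 h3 =>
    hne h1 h2 (by simpa using h3)
  choose Z W hZ hZW hW using fun x => exists_roots (h x)
  let r : X → NonzeroPair := fun x => ⟨(Z x, W x), hne' (hZ x) (hW x)⟩
  let f : X → Quotient (MulAction.orbitRel ℤˣ NonzeroPair) := fun x => Quotient.mk _ (r x)
  -- two roots at the same point lie in the same orbit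
  have hmk : ∀ (x : X) (p : NonzeroPair), p.1.1 ^ 2 = α x → p.1.1 * p.1.2 = β x →
      p.1.2 ^ 2 = δ x → Quotient.mk (MulAction.orbitRel ℤˣ NonzeroPair) p = f x := by
    intro x p h1 h2 h3
    refine Quotient.sound ?_
    rcases eq_or_neg_of_products (h1.trans (hZ x).symm) (h2.trans (hZW x).symm)
      (h3.trans (hW x).symm) with ⟨e1, e2⟩ | ⟨e1, e2⟩
    · refine ⟨1, Subtype.ext ?_⟩
      rw [NonzeroPair.smul_val, one_smul]
      exact (Prod.ext e1 e2).symm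
    · refine ⟨-1, Subtype.ext ?_⟩
      rw [NonzeroPair.smul_val]
      simp only [Units.smul_def, Units.val_neg, Units.val_one, neg_smul, one_smul]
      exact (Prod.ext e1 e2).symm
  -- The local branches of the roots show that the unordered pair `{±(z, w)}` depends continuously
  -- on `x`; it lifts through the double covering because a normed space is simply connected.
  have hf : Continuous f := by
    rw [continuous_iff_continuousAt]
    intro x₀
    obtain ⟨z, w, hz, hw, hz0, hw0, hev⟩ :=
      exists_local_root hα hβ hδ h (hZ x₀) (hZW x₀) (hW x₀) (hne (hZ x₀) (hW x₀))
    classical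
    let g : X → NonzeroPair := fun x => if hx : (z x, w x) ≠ 0 then ⟨(z x, w x), hx⟩ else r x₀
    have hg : ContinuousAt g x₀ := by
      refine Topology.IsInducing.subtypeVal.continuousAt_iff.2 ?_
      refine (hz.continuousAt.prodMk hw.continuousAt).congr ?_
      filter_upwards [hev] with x hx
      have : g x = ⟨(z x, w x), hne' hx.1 hx.2.2⟩ := dif_pos _
      rw [Function.comp_apply, this]
    have hgf : (fun x => Quotient.mk (MulAction.orbitRel ℤˣ NonzeroPair) (g x)) =ᶠ[𝓝 x₀] f := by
      filter_upwards [hev] with x hx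
      have hx0 := hne' hx.1 hx.2.2
      have : g x = ⟨(z x, w x), hx0⟩ := dif_pos hx0
      rw [this]
      exact hmk x _ hx.1 hx.2.1 hx.2.2
    exact (continuous_quotient_mk'.continuousAt.comp hg).congr hgf
  obtain ⟨F, ⟨-, hF⟩, -⟩ :=
    isQuotientCoveringMap_nonzeroPair.isCoveringMap.existsUnique_continuousMap_lifts
    ⟨f, hf⟩ (0 : X) (r 0) rfl
  have hroot : ∀ x, (F x).1.1 ^ 2 = α x ∧ (F x).1.1 * (F x).1.2 = β x ∧ (F x).1.2 ^ 2 = δ x := by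
    intro x
    obtain ⟨u, hu⟩ := Quotient.exact (congrFun hF x)
    have hu' : u • (Z x, W x) = (F x).1 := congrArg Subtype.val hu
    rw [← hu']
    rcases Int.units_eq_one_or u with rfl | rfl
    · simpa using ⟨hZ x, hZW x, hW x⟩
    · simpa [Units.smul_def] using ⟨hZ x, hZW x, hW x⟩
  -- By continuity the lift agrees with a smooth local branch, not with its negative.
  have hsm : ∀ x₀, ContDiffAt ℝ ∞ (fun x => (F x).1.1) x₀ ∧ ContDiffAt ℝ ∞ (fun x => (F x).1.2) x₀
    := by
    intro x₀
    obtain ⟨h1, h2, h3⟩ := hroot x₀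
    obtain ⟨z, w, hz, hw, hz0, hw0, hev⟩ := exists_local_root hα hβ hδ h h1 h2 h3 (hne h1 h3)
    have hc : ContinuousAt (fun x => (F x).1 + (z x, w x)) x₀ :=
      (continuous_subtype_val.comp F.continuous).continuousAt.add
        (hz.continuousAt.prodMk hw.continuousAt)
    have hc0 : (F x₀).1 + (z x₀, w x₀) ≠ 0 := by
      rw [hz0, hw0]
      have : (F x₀).1 + ((F x₀).1.1, (F x₀).1.2) = (2 : ℂ) • (F x₀).1 := (two_smul ℂ _).symm
      rw [this]
      exact smul_ne_zero two_ne_zero (F x₀).2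
    have hFe : ∀ᶠ x in 𝓝 x₀, (F x).1.1 = z x ∧ (F x).1.2 = w x := by
      filter_upwards [hev, hc.eventually_ne hc0] with x hx hx'
      obtain ⟨k1, k2, k3⟩ := hroot x
      rcases eq_or_neg_of_products (k1.trans hx.1.symm) (k2.trans hx.2.1.symm)
        (k3.trans hx.2.2.symm) with e | ⟨e1, e2⟩
      · exact e
      · exact absurd (Prod.ext (by simp [e1]) (by simp [e2])) hx'
    exact ⟨hz.congr_of_eventuallyEq (hFe.mono fun x hx => hx.1),
      hw.congr_of_eventuallyEq (hFe.mono fun x hx => hx.2)⟩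
  exact ⟨fun x => (F x).1.1, fun x => (F x).1.2, contDiff_iff_contDiffAt.2 fun x => (hsm x).1,
    contDiff_iff_contDiffAt.2 fun x => (hsm x).2, hroot⟩

end Roots

/-! ### From orthonormal pairs to framed loops and back -/

section FramedOf

theorem contDiff_complex_re {X : Type} [NormedAddCommGroup X] [NormedSpace ℝ X] {f : X → ℂ}
    (hf : ContDiff ℝ ∞ f) : ContDiff ℝ ∞ fun x => (f x).re := Complex.reCLM.contDiff.comp hf

theorem contDiff_complex_im {X : Type} [NormedAddCommGroup X] [NormedSpace ℝ X] {f : X → ℂ}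
    (hf : ContDiff ℝ ∞ f) : ContDiff ℝ ∞ fun x => (f x).im := Complex.imCLM.contDiff.comp hf

theorem ContDiff.hopf₁ {X : Type} [NormedAddCommGroup X] [NormedSpace ℝ X] {z w : X → ℂ}
    (hz : ContDiff ℝ ∞ z) (hw : ContDiff ℝ ∞ w) : ContDiff ℝ ∞ fun x => hopf₁ (z x) (w x) := by
  rw [contDiff_euclidean]
  intro i
  fin_cases i
  · exact (hz.norm_sq ℝ).sub (hw.norm_sq ℝ)
  · exact contDiff_const.mul (contDiff_complex_im (hz.mul hw.star_complex))
  · exact contDiff_const.mul (contDiff_complex_re (hz.mul hw.star_complex))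

theorem ContDiff.hopf₂ {X : Type} [NormedAddCommGroup X] [NormedSpace ℝ X] {z w : X → ℂ}
    (hz : ContDiff ℝ ∞ z) (hw : ContDiff ℝ ∞ w) : ContDiff ℝ ∞ fun x => hopf₂ (z x) (w x) := by
  rw [contDiff_euclidean]
  intro i
  fin_cases i
  · exact contDiff_const.mul (contDiff_complex_im (hz.mul hw))
  · exact contDiff_complex_re ((hz.pow 2).add (hw.pow 2))
  · exact contDiff_complex_im ((hz.pow 2).neg.add (hw.pow 2))

/-- The squared length of the values of a pair. -/
noncomputable def rowNormSq (v : Fin 2 → ℂ) : ℝ := ‖v 0‖ ^ 2 + ‖v 1‖ ^ 2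

theorem rowNormSq_pos {v : Fin 2 → ℂ} (hv : v ≠ 0) : 0 < rowNormSq v :=
  sq_add_sq_pos fun h => hv (by ext i; fin_cases i; exacts [h.1, h.2])

theorem ContDiff.rowNormSq {X : Type} [NormedAddCommGroup X] [NormedSpace ℝ X] {v : X → Fin 2 → ℂ}
    (hv : ContDiff ℝ ∞ v) : ContDiff ℝ ∞ fun x => rowNormSq (v x) :=
  (((contDiff_pi.1 hv) 0).norm_sq ℝ).add (((contDiff_pi.1 hv) 1).norm_sq ℝ)

/-- The first column of the frame-Hopf map along a pair of functions: the derivative of the base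
curve with complex coordinates `F`. -/
noncomputable def hopfTangent (F : ℝ → Fin 2 → ℂ) (t : ℝ) : E3 := hopf₁ (F t 0) (F t 1)

/-- The framing of the loop with complex coordinates `F`. -/
noncomputable def hopfFraming (F : ℝ → Fin 2 → ℂ) (t : ℝ) : E3 :=
  (rowNormSq (F t))⁻¹ • hopf₂ (F t 0) (F t 1)

theorem contDiff_hopfTangent {E : Type} [NormedAddCommGroup E] [NormedSpace ℝ E]
    {F : E → ℝ → Fin 2 → ℂ} (hF : ContDiff ℝ ∞ (Function.uncurry F)) :
    ContDiff ℝ ∞ (Function.uncurry fun x => hopfTangent (F x)) :=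
  (contDiff_coord hF 0).hopf₁ (contDiff_coord hF 1)

theorem contDiff_hopfFraming {E : Type} [NormedAddCommGroup E] [NormedSpace ℝ E]
    {F : E → ℝ → Fin 2 → ℂ} (hF : ContDiff ℝ ∞ (Function.uncurry F)) (h0 : ∀ x t, F x t ≠ 0) :
    ContDiff ℝ ∞ (Function.uncurry fun x => hopfFraming (F x)) :=
  (hF.rowNormSq.inv fun q => (rowNormSq_pos (h0 q.1 q.2)).ne').smul
    ((contDiff_coord hF 0).hopf₂ (contDiff_coord hF 1))

variable {σ τ : ℤˣ} {F G : ℝ → Fin 2 → ℂ}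

theorem IsFrame.smul_cases (h : IsFrame σ F) (t : ℝ) :
    F (t + 2) = F t ∨ F (t + 2) = -F t := by
  rw [h.period]
  rcases Int.units_eq_one_or σ with rfl | rfl
  · left; simp
  · right; simp [Units.smul_def]

theorem IsFrame.hopfTangent_periodic (h : IsFrame σ F) :
    Function.Periodic (hopfTangent F) 2 := fun t => by
  rcases h.smul_cases t with e | e
  · rw [hopfTangent, e, hopfTangent]
  · rw [hopfTangent, e, hopfTangent]
    simp [hopf₁]

theorem IsFrame.hopfFraming_periodic (h : IsFrame σ F) (t : ℝ) :
    hopfFraming F (t + 2) = hopfFraming F t := by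
  rcases h.smul_cases t with e | e
  · rw [hopfFraming, e, hopfFraming]
  · rw [hopfFraming, e, hopfFraming]
    simp [hopf₂, rowNormSq]

theorem IsFrame.contDiff_tangent (h : IsFrame σ F) : ContDiff ℝ ∞ (hopfTangent F) :=
  (contDiff_pi.1 h.contDiff 0).hopf₁ (contDiff_pi.1 h.contDiff 1)

theorem integral_apply_E3 {f : ℝ → E3} (hf : Continuous f) (a b : ℝ) (i : Fin 3) :
    (∫ t in a..b, f t) i = ∫ t in a..b, f t i :=
  ((EuclideanSpace.proj i : E3 →L[ℝ] ℝ).intervalIntegral_comp_comm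
    (hf.intervalIntegrable _ _)).symm

theorem IsFrame.integral_norm_sq (h : IsFrame σ F) (i : Fin 2) :
    ∫ t in (0 : ℝ)..2, ‖F t i‖ ^ 2 = 1 := by
  have := gram_self_apply F i
  rw [h.gram_self, Matrix.one_apply_eq] at this
  exact_mod_cast this.symm

theorem IsFrame.integral_tangent (h : IsFrame σ F) : ∫ t in (0 : ℝ)..2, hopfTangent F t = 0 := by
  have hc0 : Continuous fun t => F t 0 := (contDiff_pi.1 h.contDiff 0).continuous
  have hc1 : Continuous fun t => F t 1 := (contDiff_pi.1 h.contDiff 1).continuous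
  have h10 : ∫ t in (0 : ℝ)..2, F t 0 * (starRingEnd ℂ) (F t 1) = 0 := by
    have : gram F F 1 0 = 0 := by rw [h.gram_self]; simp
    rw [← this]
    refine intervalIntegral.integral_congr fun t _ => ?_
    simp [mul_comm]
  have hint : IntervalIntegrable (fun t => F t 0 * (starRingEnd ℂ) (F t 1)) volume 0 2 := by
    apply Continuous.intervalIntegrable
    fun_prop
  ext i
  rw [integral_apply_E3 h.contDiff_tangent.continuous]
  fin_cases i
  · have : (fun t => hopfTangent F t 0) = fun t => ‖F t 0‖ ^ 2 - ‖F t 1‖ ^ 2 := rfl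
    simp only [Fin.zero_eta]
    rw [this, intervalIntegral.integral_sub, h.integral_norm_sq, h.integral_norm_sq]
    · simp
    · apply Continuous.intervalIntegrable
      fun_prop
    · apply Continuous.intervalIntegrable
      fun_prop
  · have : (fun t => hopfTangent F t 1) =
        fun t => 2 * Complex.imCLM (F t 0 * (starRingEnd ℂ) (F t 1)) := rfl
    simp only [Fin.mk_one]
    rw [this, intervalIntegral.integral_const_mul,
      Complex.imCLM.intervalIntegral_comp_comm hint, h10]
    simp
  · have : (fun t => hopfTangent F t 2) =
        fun t => 2 * Complex.reCLM (F t 0 * (starRingEnd ℂ) (F t 1)) := rfl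
    simp only [Fin.reduceFinMk]
    rw [this, intervalIntegral.integral_const_mul,
      Complex.reCLM.intervalIntegral_comp_comm hint, h10]
    simp

theorem hasDerivAt_primitive {W : Type} [NormedAddCommGroup W] [NormedSpace ℝ W] [CompleteSpace W]
    {f : ℝ → W} (hf : Continuous f) (t : ℝ) :
    HasDerivAt (fun t => ∫ s in (0 : ℝ)..t, f s) (f t) t :=
  intervalIntegral.integral_hasDerivAt_right (hf.intervalIntegrable _ _)
    (hf.stronglyMeasurableAtFilter _ _) hf.continuousAt

theorem IsFrame.deriv_primitive (h : IsFrame σ F) (t : ℝ) :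
    deriv (fun t => ∫ s in (0 : ℝ)..t, hopfTangent F s) t = hopfTangent F t :=
  (hasDerivAt_primitive h.contDiff_tangent.continuous t).deriv

theorem IsFrame.contDiff_primitive (h : IsFrame σ F) :
    ContDiff ℝ ∞ fun t => ∫ s in (0 : ℝ)..t, hopfTangent F s := by
  have h1 : ContDiff ℝ ∞ (Function.uncurry fun (_ : ℝ) => hopfTangent F) :=
    h.contDiff_tangent.comp contDiff_snd
  have h2 := contDiff_primitive_family h1
  exact h2.comp (f := fun t : ℝ => ((0 : ℝ), t)) (contDiff_const.prodMk contDiff_id)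

theorem IsFrame.primitive_periodic (h : IsFrame σ F) (t : ℝ) :
    ∫ s in (0 : ℝ)..t + 2, hopfTangent F s = ∫ s in (0 : ℝ)..t, hopfTangent F s := by
  have hi : ∀ a b, IntervalIntegrable (hopfTangent F) volume a b := fun a b =>
    h.contDiff_tangent.continuous.intervalIntegrable a b
  rw [← intervalIntegral.integral_add_adjacent_intervals (hi 0 t) (hi t (t + 2)),
    h.hopfTangent_periodic.intervalIntegral_add_eq t 0, zero_add, h.integral_tangent, add_zero]

theorem IsFrame.contDiff_framing (h : IsFrame σ F) : ContDiff ℝ ∞ (hopfFraming F) := by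
  have h1 : ContDiff ℝ ∞ (Function.uncurry fun (_ : ℝ) => F) := h.contDiff.comp contDiff_snd
  have h2 := contDiff_hopfFraming h1 fun _ => h.ne_zero
  exact h2.comp (f := fun t : ℝ => ((0 : ℝ), t)) (contDiff_const.prodMk contDiff_id)

theorem norm_hopfTangent (F : ℝ → Fin 2 → ℂ) (t : ℝ) : ‖hopfTangent F t‖ = rowNormSq (F t) := by
  rw [hopfTangent, norm_hopf₁, rowNormSq]

theorem IsFrame.tangent_ne_zero (h : IsFrame σ F) (t : ℝ) : hopfTangent F t ≠ 0 := by
  rw [← norm_ne_zero_iff, norm_hopfTangent]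
  exact (rowNormSq_pos (h.ne_zero t)).ne'

theorem IsFrame.norm_framing (h : IsFrame σ F) (t : ℝ) : ‖hopfFraming F t‖ = 1 := by
  have hp := rowNormSq_pos (h.ne_zero t)
  rw [hopfFraming, norm_smul, norm_hopf₂, norm_inv, Real.norm_of_nonneg hp.le]
  exact inv_mul_cancel₀ hp.ne'

theorem inner_hopfTangent_hopfFraming (F : ℝ → Fin 2 → ℂ) (t : ℝ) :
    ⟪hopfTangent F t, hopfFraming F t⟫_ℝ = 0 := by
  rw [hopfFraming, real_inner_smul_right, hopfTangent, inner_hopf₁_hopf₂, mul_zero]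

/-- The base curve with complex coordinates `F`. -/
noncomputable def IsFrame.curve (h : IsFrame σ F) : loops 1 E3 :=
  ⟨fun t => ∫ s in (0 : ℝ)..t, hopfTangent F s, h.contDiff_primitive, fun t => by
    rw [one_smul]; exact h.primitive_periodic t⟩

/-- The framing with complex coordinates `F`. -/
noncomputable def IsFrame.framing (h : IsFrame σ F) : loops 1 E3 :=
  ⟨hopfFraming F, h.contDiff_framing, fun t => by
    rw [one_smul]; exact h.hopfFraming_periodic t⟩

/-- The framed loop with given complex coordinates. -/
noncomputable def Stiefel.toFramed (Φ : Stiefel ℂ σ) : FramedLoop :=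
  ⟨(Φ.isFrame.curve, Φ.isFrame.framing),
    fun t e => Φ.isFrame.tangent_ne_zero t ((Φ.isFrame.deriv_primitive t).symm.trans e),
    Φ.isFrame.norm_framing,
    fun t => (congrArg (fun v => ⟪v, hopfFraming Φ.row t⟫_ℝ) (Φ.isFrame.deriv_primitive t)).trans
      (inner_hopfTangent_hopfFraming Φ.row t)⟩

theorem Stiefel.toFramed_γ (Φ : Stiefel ℂ σ) (t : ℝ) :
    Φ.toFramed.γ t = ∫ s in (0 : ℝ)..t, hopfTangent Φ.row s := rfl

theorem Stiefel.toFramed_V (Φ : Stiefel ℂ σ) (t : ℝ) : Φ.toFramed.V t = hopfFraming Φ.row t := rfl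

theorem Stiefel.deriv_toFramed (Φ : Stiefel ℂ σ) (t : ℝ) :
    deriv Φ.toFramed.γ t = hopfTangent Φ.row t :=
  (hasDerivAt_primitive Φ.isFrame.contDiff_tangent.continuous t).deriv

theorem Stiefel.norm_deriv_toFramed (Φ : Stiefel ℂ σ) (t : ℝ) :
    ‖deriv Φ.toFramed.γ t‖ = rowNormSq (Φ.row t) := by
  rw [Φ.deriv_toFramed, hopfTangent, norm_hopf₁, rowNormSq]

theorem Stiefel.toFramed_length (Φ : Stiefel ℂ σ) : Φ.toFramed.length = 2 := by
  have hc0 : Continuous fun t => Φ.row t 0 := (contDiff_pi.1 Φ.isFrame.contDiff 0).continuous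
  have hc1 : Continuous fun t => Φ.row t 1 := (contDiff_pi.1 Φ.isFrame.contDiff 1).continuous
  simp only [FramedLoop.length, Φ.norm_deriv_toFramed, rowNormSq]
  rw [intervalIntegral.integral_add, Φ.isFrame.integral_norm_sq, Φ.isFrame.integral_norm_sq]
  · norm_num
  · apply Continuous.intervalIntegrable
    fun_prop
  · apply Continuous.intervalIntegrable
    fun_prop

theorem hopf_W {v : Fin 2 → ℂ} (hv : v ≠ 0) {a V : E3} (h1 : hopf₁ (v 0) (v 1) = a)
    (h2 : (rowNormSq v)⁻¹ • hopf₂ (v 0) (v 1) = V) :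
    cross (‖a‖⁻¹ • a) V = (rowNormSq v)⁻¹ • hopf₃ (v 0) (v 1) := by
  have hp := (rowNormSq_pos hv).ne'
  have e : ‖v 0‖ ^ 2 + ‖v 1‖ ^ 2 = rowNormSq v := rfl
  rw [← h1, ← h2, norm_hopf₁, cross_smul_left, cross_smul_right, cross_hopf₁_hopf₂, smul_smul,
    smul_smul, e, mul_assoc, inv_mul_cancel₀ hp, mul_one]

theorem Stiefel.toFramed_W (Φ : Stiefel ℂ σ) (t : ℝ) :
    Φ.toFramed.W t = (rowNormSq (Φ.row t))⁻¹ • hopf₃ (Φ.row t 0) (Φ.row t 1) := by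
  rw [FramedLoop.W, FramedLoop.T]
  exact hopf_W (Φ.isFrame.ne_zero t) (Φ.deriv_toFramed t).symm rfl

/-- A family of framed loops that is jointly smooth. -/
def SmoothFramedFamily {E : Type} [NormedAddCommGroup E] [NormedSpace ℝ E] (x : E → FramedLoop) :
    Prop :=
  ContDiff ℝ ∞ (Function.uncurry fun w => (x w).γ) ∧ ContDiff ℝ ∞ (Function.uncurry fun w => (x
    w).V)

theorem isPlot_framedLoop_iff {n : ℕ} {p : EuclideanSpace ℝ (Fin n) → FramedLoop} :
    IsPlot p ↔ SmoothFramedFamily p := Iff.rfl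

theorem SmoothFamily.toFramed {E : Type} [NormedAddCommGroup E] [NormedSpace ℝ E] [ProperSpace E]
    {Φ : E → Stiefel ℂ σ} (h : SmoothFamily Φ) : SmoothFramedFamily fun x => (Φ x).toFramed :=
  ⟨contDiff_primitive_family (contDiff_hopfTangent h),
    contDiff_hopfFraming h fun x => (Φ x).isFrame.ne_zero⟩

/-- Continuous functions on a connected space that agree up to sign and do not vanish agree up to
a constant sign. -/
theorem eq_or_neg_of_connected {X V : Type*} [TopologicalSpace X] [PreconnectedSpace X]
    [NormedAddCommGroup V] [NormedSpace ℝ V] {F G : X → V}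
    (hF : Continuous F) (hG : Continuous G) (h : ∀ x, G x = F x ∨ G x = -F x) (h0 : ∀ x, F x ≠ 0) :
    (∀ x, G x = F x) ∨ ∀ x, G x = -F x := by
  have hc : IsClopen {x | G x = F x} := by
    refine ⟨isClosed_eq hG hF, ?_⟩
    have : {x | G x = F x} = {x | G x = -F x}ᶜ := by
      ext x
      constructor
      · intro (e : G x = F x) (e' : G x = -F x)
        have h2 : (2 : ℝ) • F x = 0 := by
          rw [two_smul]
          nth_rewrite 2 [e.symm.trans e']
          exact add_neg_cancel _
        exact h0 x ((smul_eq_zero.1 h2).resolve_left two_ne_zero)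
      · exact fun e => (h x).resolve_right e
    rw [this]
    exact (isClosed_eq hG hF.neg).isOpen_compl
  rcases isClopen_iff.1 hc with e | e
  · right
    intro x
    refine (h x).resolve_left fun e' => ?_
    have : x ∈ ({x | G x = F x} : Set X) := e'
    rw [e] at this
    exact this
  · left
    intro x
    have : x ∈ ({x | G x = F x} : Set X) := by rw [e]; trivial
    exact this

theorem hopf_row_unique {v w : Fin 2 → ℂ} (h1 : hopf₁ (v 0) (v 1) = hopf₁ (w 0) (w 1))
    (h2 : hopf₂ (v 0) (v 1) = hopf₂ (w 0) (w 1)) : v = w ∨ v = -w := by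
  rcases hopf_frame_unique h1 h2 with ⟨e1, e2⟩ | ⟨e1, e2⟩
  · left; ext i; fin_cases i; exacts [e1, e2]
  · right; ext i; fin_cases i; exacts [e1, e2]

theorem exists_sign_of_hopf_eq {X : Type*} [TopologicalSpace X] [PreconnectedSpace X]
    {F G : X → Fin 2 → ℂ} (hF : Continuous F) (hG : Continuous G) (h0 : ∀ x, F x ≠ 0)
    (h1 : ∀ x, hopf₁ (G x 0) (G x 1) = hopf₁ (F x 0) (F x 1))
    (h2 : ∀ x, hopf₂ (G x 0) (G x 1) = hopf₂ (F x 0) (F x 1)) :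
    ∃ ε : ℤˣ, ∀ x, G x = ε • F x := by
  rcases eq_or_neg_of_connected hF hG (fun x => hopf_row_unique (h1 x) (h2 x)) h0 with h | h
  · exact ⟨1, fun x => by rw [h, one_smul]⟩
  · exact ⟨-1, fun x => by rw [h]; simp [Units.smul_def]⟩

end FramedOf

section Lifting

theorem FramedLoop.contDiff_γ (x : FramedLoop) : ContDiff ℝ ∞ x.γ := x.1.1.2.1

theorem FramedLoop.contDiff_V (x : FramedLoop) : ContDiff ℝ ∞ x.V := x.1.2.2.1

theorem FramedLoop.hasDerivAt_γ (x : FramedLoop) (t : ℝ) : HasDerivAt x.γ (deriv x.γ t) t :=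
  (x.contDiff_γ.differentiable (by simp)).differentiableAt.hasDerivAt

theorem FramedLoop.continuous_deriv_γ (x : FramedLoop) : Continuous (deriv x.γ) :=
  x.contDiff_γ.continuous_deriv (by simp)

theorem FramedLoop.length_pos (x : FramedLoop) : 0 < x.length :=
  intervalIntegral.intervalIntegral_pos_of_pos
    (x.continuous_deriv_γ.norm.intervalIntegrable _ _) (fun t => norm_pos_iff.2 (x.2.1 t)) two_pos

theorem FramedLoop.integral_deriv_γ (x : FramedLoop) : ∫ t in (0 : ℝ)..2, deriv x.γ t = 0 := by
  rw [intervalIntegral.integral_deriv_eq_sub (fun t _ => (x.hasDerivAt_γ t).differentiableAt)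
    (x.continuous_deriv_γ.intervalIntegrable _ _)]
  have := x.1.1.2.2 0
  rw [zero_add, one_smul] at this
  exact sub_eq_zero.2 this

/-- A similarity can be read off from the derivatives of the base curves. -/
theorem FramedLoop.similar_of_deriv {x y : FramedLoop} {A : Matrix (Fin 3) (Fin 3) ℝ}
    (hA : A ∈ Matrix.specialOrthogonalGroup (Fin 3) ℝ) {r : ℝ} (hr : 0 < r) {θ : ℝ}
    (h : ∀ t, deriv y.γ t = r • matAct A (deriv x.γ t))
    (hV : ∀ t, y.V t = matAct A (Real.cos θ • x.V t + Real.sin θ • x.W t)) :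
    FramedLoop.Similar x y := by
  refine ⟨A, hA, r, hr, y.γ 0 - r • matAct A (x.γ 0), θ, fun t => ?_, hV⟩
  have hd : ∀ t, HasDerivAt (fun t => y.γ t - r • matAct A (x.γ t)) 0 t := fun t => by
    have := (y.hasDerivAt_γ t).sub
      (((matAct A).hasFDerivAt.comp_hasDerivAt t (x.hasDerivAt_γ t)).const_smul r)
    rw [h t, sub_self] at this
    exact this
  have := is_const_of_deriv_eq_zero (fun t => (hd t).differentiableAt) (fun t => (hd t).deriv) t 0
  exact eq_add_of_sub_eq' this

theorem FramedLoop.mk_eq_of_deriv {x y : FramedLoop} {r : ℝ} (hr : 0 < r)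
    (h : ∀ t, deriv y.γ t = r • deriv x.γ t) (hV : ∀ t, y.V t = x.V t) :
    Quotient.mk FramedLoop.setoid x = Quotient.mk FramedLoop.setoid y :=
  Quotient.sound (FramedLoop.similar_of_deriv (one_mem _) hr (θ := 0) (fun t => by simp [h])
    fun t => by simp [hV])

theorem FramedLoop.length_similar {x y : FramedLoop} {A : Matrix (Fin 3) (Fin 3) ℝ}
    (hA : A ∈ Matrix.specialOrthogonalGroup (Fin 3) ℝ) {r : ℝ} (hr : 0 < r) {b : E3}
    (h : ∀ t, y.γ t = r • matAct A (x.γ t) + b) : y.length = r * x.length := by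
  rw [FramedLoop.length, FramedLoop.length, ← intervalIntegral.integral_const_mul]
  refine intervalIntegral.integral_congr fun t _ => ?_
  rw [FramedLoop.deriv_similar h, norm_smul,
    FramedLoop.norm_matAct ((Matrix.mem_specialOrthogonalGroup_iff).1 hA).1,
    Real.norm_of_nonneg hr.le]

/-- Orthonormality of a pair expresses that the curve it defines closes up and has length 2. -/
theorem gram_eq_one_of_integral {F : ℝ → Fin 2 → ℂ} (hF : Continuous F)
    (hT : Continuous (hopfTangent F))
    (h1 : ∫ t in (0 : ℝ)..2, hopfTangent F t = 0) (h2 : ∫ t in (0 : ℝ)..2, rowNormSq (F t) = 2) :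
    gram F F = 1 := by
  have hc : ∀ i, Continuous fun t => F t i := fun i => (continuous_apply i).comp hF
  have hc0 := hc 0
  have hc1 := hc 1
  have hi : ∀ i, IntervalIntegrable (fun t => ‖F t i‖ ^ 2) volume 0 2 := fun i =>
    ((hc i).norm.pow 2).intervalIntegrable _ _
  have hint : IntervalIntegrable (fun t => F t 0 * (starRingEnd ℂ) (F t 1)) volume 0 2 := by
    apply Continuous.intervalIntegrable
    fun_prop
  have hs : (∫ t in (0 : ℝ)..2, ‖F t 0‖ ^ 2) + ∫ t in (0 : ℝ)..2, ‖F t 1‖ ^ 2 = 2 := by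
    rw [← intervalIntegral.integral_add (hi 0) (hi 1)]; exact h2
  have e : ∀ i, ∫ t in (0 : ℝ)..2, hopfTangent F t i = 0 := fun i => by
    rw [← integral_apply_E3 hT, h1]; rfl
  have hd : (∫ t in (0 : ℝ)..2, ‖F t 0‖ ^ 2) - ∫ t in (0 : ℝ)..2, ‖F t 1‖ ^ 2 = 0 := by
    rw [← intervalIntegral.integral_sub (hi 0) (hi 1)]; exact e 0
  have him : (∫ t in (0 : ℝ)..2, F t 0 * (starRingEnd ℂ) (F t 1)).im = 0 := by
    have h : (∫ t in (0 : ℝ)..2, 2 * Complex.imCLM (F t 0 * (starRingEnd ℂ) (F t 1))) = 0 := e 1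
    rw [intervalIntegral.integral_const_mul, Complex.imCLM.intervalIntegral_comp_comm hint] at h
    exact (mul_eq_zero.1 h).resolve_left two_ne_zero
  have hre : (∫ t in (0 : ℝ)..2, F t 0 * (starRingEnd ℂ) (F t 1)).re = 0 := by
    have h : (∫ t in (0 : ℝ)..2, 2 * Complex.reCLM (F t 0 * (starRingEnd ℂ) (F t 1))) = 0 := e 2
    rw [intervalIntegral.integral_const_mul, Complex.reCLM.intervalIntegral_comp_comm hint] at h
    exact (mul_eq_zero.1 h).resolve_left two_ne_zero
  have h10 : gram F F 1 0 = 0 := by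
    have h : gram F F 1 0 = ∫ t in (0 : ℝ)..2, F t 0 * (starRingEnd ℂ) (F t 1) :=
      intervalIntegral.integral_congr fun t _ => by simp [mul_comm]
    rw [h]
    exact Complex.ext hre him
  have h01 : gram F F 0 1 = 0 := by
    have := congrFun (congrFun (gram_conjTranspose F F) 0) 1
    rw [Matrix.conjTranspose_apply, h10, star_zero] at this
    exact this.symm
  ext i j
  fin_cases i <;> fin_cases j
  · simp only [Fin.zero_eta, Matrix.one_apply_eq]
    rw [gram_self_apply, show (∫ t in (0 : ℝ)..2, ‖F t 0‖ ^ 2) = 1 by linarith, Complex.ofReal_one]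
  · simpa using h01
  · simpa using h10
  · simp only [Fin.mk_one, Matrix.one_apply_eq]
    rw [gram_self_apply, show (∫ t in (0 : ℝ)..2, ‖F t 1‖ ^ 2) = 1 by linarith, Complex.ofReal_one]

theorem Stiefel.toFramed_similar {σ : ℤˣ} {Φ Ψ : Stiefel ℂ σ} (h : (stiefelSetoid ℂ σ).r Φ Ψ) :
    FramedLoop.Similar Φ.toFramed Ψ.toFramed := by
  obtain ⟨U, hU, h⟩ := h
  obtain ⟨A, hA, θ, hAθ⟩ := hopf_unitary hU
  have hn : ∀ t, rowNormSq (Ψ.row t) = rowNormSq (Φ.row t) := fun t => by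
    rw [← norm_hopfTangent, ← norm_hopfTangent, hopfTangent, h, (hAθ _).1,
      FramedLoop.norm_matAct ((Matrix.mem_specialOrthogonalGroup_iff).1 hA).1]
    rfl
  refine FramedLoop.similar_of_deriv hA one_pos (θ := θ) (fun t => ?_) fun t => ?_
  · rw [Ψ.deriv_toFramed, Φ.deriv_toFramed, hopfTangent, h, (hAθ _).1, one_smul]
    rfl
  · rw [Ψ.toFramed_V, hopfFraming, hn, h, (hAθ _).2, Φ.toFramed_V, Φ.toFramed_W, hopfFraming,
      ← map_smul]
    congr 1
    module

/-- Complex coordinates of a framed loop are unique up to the unitary group. -/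
theorem Stiefel.of_toFramed_similar {σ τ : ℤˣ} {Φ : Stiefel ℂ σ} {Ψ : Stiefel ℂ τ}
    (h : FramedLoop.Similar Φ.toFramed Ψ.toFramed) :
    σ = τ ∧ ∃ U ∈ Matrix.unitaryGroup (Fin 2) ℂ, Ψ.row = _root_.rmul Φ.row U := by
  obtain ⟨A, hA, r, hr, b, θ, h, hV⟩ := h
  have hr1 : r = 1 := by
    have := FramedLoop.length_similar hA hr h
    rw [Φ.toFramed_length, Ψ.toFramed_length] at this
    linarith
  subst hr1
  obtain ⟨U, hU, hUA⟩ := exists_unitary_of_rotation hA θ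
  have hT : ∀ t, hopfTangent Ψ.row t = matAct A (hopfTangent Φ.row t) := fun t => by
    have := FramedLoop.deriv_similar h t
    rwa [one_smul, Φ.deriv_toFramed, Ψ.deriv_toFramed] at this
  have hn : ∀ t, rowNormSq (Ψ.row t) = rowNormSq (Φ.row t) := fun t => by
    rw [← norm_hopfTangent, ← norm_hopfTangent, hT,
      FramedLoop.norm_matAct ((Matrix.mem_specialOrthogonalGroup_iff).1 hA).1]
  -- `Φ U` and `Ψ` have the same image under the frame-Hopf map, so that they agree up to a sign,
  -- which does not depend on `t` by connectedness.
  obtain ⟨ε, hε⟩ := exists_sign_of_hopf_eq (F := _root_.rmul Φ.row U) (G := Ψ.row)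
    (continuous_rmul Φ.isFrame.contDiff.continuous U) Ψ.isFrame.contDiff.continuous
    ((Φ.isFrame.rmul hU).ne_zero) (fun t => (hT t).trans (hUA _).1.symm) fun t => by
      have hp := (rowNormSq_pos (Φ.isFrame.ne_zero t)).ne'
      have := hV t
      rw [Ψ.toFramed_V, hopfFraming, hn, Φ.toFramed_V, Φ.toFramed_W, hopfFraming] at this
      have e := congrArg (fun v => rowNormSq (Φ.row t) • v) this
      simp only [smul_smul] at e
      rw [mul_inv_cancel₀ hp, one_smul, ← map_smul] at e
      rw [e]
      refine Eq.trans ?_ (hUA _).2.symm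
      congr 1
      rw [smul_add, smul_smul, smul_smul, mul_comm, mul_assoc, inv_mul_cancel₀ hp, mul_one,
        mul_comm, mul_assoc, inv_mul_cancel₀ hp, mul_one]
  have hεU : Ψ.row = _root_.rmul Φ.row (((ε : ℤ) : ℂ) • U) := by
    ext1 t
    rw [hε, _root_.rmul, _root_.rmul, Matrix.vecMul_smul, Units.smul_def, Int.cast_smul_eq_zsmul]
  refine ⟨?_, _, (gram_unitary_of_rmul Φ.isFrame.contDiff.continuous Φ.isFrame.gram_self
    Ψ.isFrame.gram_self hεU).2, hεU⟩
  have h1 := Ψ.isFrame.period 0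
  rw [hεU, _root_.rmul, _root_.rmul, Φ.isFrame.period, Matrix.smul_vecMul] at h1
  have h2 : Matrix.vecMul (Φ.row 0) (((ε : ℤ) : ℂ) • U) ≠ 0 := by
    have := Ψ.isFrame.ne_zero 0
    rwa [hεU] at this
  -- If `σ ≠ τ`, the value of `Φ U` at `2` would be both its value at `0` and the negative of it.
  by_contra hne
  refine h2 ?_
  have key : ∀ v : Fin 2 → ℂ, v = -v → v = 0 := fun v hv => by
    have h2 : (2 : ℝ) • v = 0 := by
      rw [two_smul]
      nth_rewrite 2 [hv]
      exact add_neg_cancel _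
    exact (smul_eq_zero.1 h2).resolve_left two_ne_zero
  rcases Int.units_eq_one_or σ with rfl | rfl <;> rcases Int.units_eq_one_or τ with rfl | rfl
  · exact absurd rfl hne
  · exact key _ (by simpa [Units.smul_def] using h1)
  · exact key _ (by simpa [Units.smul_def] using h1.symm)
  · exact absurd rfl hne

theorem ContDiff.cross {X : Type} [NormedAddCommGroup X] [NormedSpace ℝ X] {f g : X → E3}
    (hf : ContDiff ℝ ∞ f) (hg : ContDiff ℝ ∞ g) : ContDiff ℝ ∞ fun x => cross (f x) (g x) := by
  have hf' := contDiff_euclidean.1 hf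
  have hg' := contDiff_euclidean.1 hg
  rw [contDiff_euclidean]
  intro i
  have e : ∀ x, _root_.cross (f x) (g x) i = ![f x 1 * g x 2 - f x 2 * g x 1,
      f x 2 * g x 0 - f x 0 * g x 2, f x 0 * g x 1 - f x 1 * g x 0] i := fun x => by
    fin_cases i <;> simp [_root_.cross, cross_apply]
  simp only [e]
  fin_cases i
  · exact ((hf' 1).mul (hg' 2)).sub ((hf' 2).mul (hg' 1))
  · exact ((hf' 2).mul (hg' 0)).sub ((hf' 0).mul (hg' 2))
  · exact ((hf' 0).mul (hg' 1)).sub ((hf' 1).mul (hg' 0))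

theorem contDiff_hopfProducts {X : Type} [NormedAddCommGroup X] [NormedSpace ℝ X] {f g : X → E3}
    (hf : ContDiff ℝ ∞ f) (hg : ContDiff ℝ ∞ g) :
    ContDiff ℝ ∞ fun x => hopfProducts (f x) (g x) := by
  have hf' := contDiff_euclidean.1 hf
  have hg' := contDiff_euclidean.1 hg
  have key : ∀ {a b : X → ℝ}, ContDiff ℝ ∞ a → ContDiff ℝ ∞ b →
      ContDiff ℝ ∞ fun x => ((a x : ℝ) : ℂ) + ((b x : ℝ) : ℂ) * Complex.I := fun ha hb =>
    (Complex.ofRealCLM.contDiff.comp ha).add ((Complex.ofRealCLM.contDiff.comp hb).mul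
      contDiff_const)
  exact (key (((hf' 1).add (hg' 2)).div_const 2) (((hg' 1).sub (hf' 2)).div_const 2)).prodMk
    ((key ((hg' 0).neg.div_const 2) ((hf' 0).div_const 2)).prodMk
    (key (((hf' 1).sub (hg' 2)).div_const 2) (((hg' 1).add (hf' 2)).div_const 2)))

variable {E : Type} [NormedAddCommGroup E] [NormedSpace ℝ E]

theorem SmoothFramedFamily.contDiff_deriv {x : E → FramedLoop} (hx : SmoothFramedFamily x) :
    ContDiff ℝ ∞ (Function.uncurry fun e => deriv (x e).γ) :=
  contDiff_derivSlice hx.1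

theorem SmoothFramedFamily.contDiff_length [ProperSpace E] {x : E → FramedLoop}
    (hx : SmoothFramedFamily x) : ContDiff ℝ ∞ fun e => (x e).length :=
  contDiff_integral_family (F := fun e t => ‖deriv (x e).γ t‖)
    (hx.contDiff_deriv.norm ℝ fun q => (x q.1).2.1 q.2) 0 2

/-- The squares and the product of the complex coordinates of the loops of a family, which the
framed curves determine. -/
theorem exists_coordinates [ProperSpace E] {x : E → FramedLoop} (hx : SmoothFramedFamily x) :
    ∃ F : E → ℝ → Fin 2 → ℂ, ContDiff ℝ ∞ (Function.uncurry F) ∧ ∀ e t,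
      hopfProducts (‖(2 / (x e).length) • deriv (x e).γ t‖ • (x e).V t)
        (cross ((2 / (x e).length) • deriv (x e).γ t) ((x e).V t)) =
        (F e t 0 ^ 2, F e t 0 * F e t 1, F e t 1 ^ 2) := by
  have hL : ∀ e, 0 < 2 / (x e).length := fun e => div_pos two_pos (x e).length_pos
  have ha : ContDiff ℝ ∞ (fun q : E × ℝ => (2 / (x q.1).length) • deriv (x q.1).γ q.2) :=
    ((contDiff_const.div hx.contDiff_length fun e => (x e).length_pos.ne').comp contDiff_fst).smul
      hx.contDiff_deriv
  have ha0 : ∀ q : E × ℝ, (2 / (x q.1).length) • deriv (x q.1).γ q.2 ≠ 0 := fun q =>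
    smul_ne_zero (hL q.1).ne' ((x q.1).2.1 q.2)
  have hV : ContDiff ℝ ∞ (fun q : E × ℝ => (x q.1).V q.2) := hx.2
  have hav : ∀ q : E × ℝ, ⟪(2 / (x q.1).length) • deriv (x q.1).γ q.2, (x q.1).V q.2⟫_ℝ = 0 :=
    fun q => by
      rw [real_inner_smul_left,
        show ⟪deriv (x q.1).γ q.2, (x q.1).V q.2⟫_ℝ = 0 from (x q.1).2.2.2 q.2, mul_zero]
  have hP := contDiff_hopfProducts ((ha.norm ℝ ha0).smul hV) (ha.cross hV)
  have hn := fun q : E × ℝ => cross_norm_of_frame ((x q.1).2.2.1 q.2) (hav q)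
  have ho := fun q : E × ℝ => inner_cross_of_frame
    ((2 / (x q.1).length) • deriv (x q.1).γ q.2) ((x q.1).V q.2)
    ‖(2 / (x q.1).length) • deriv (x q.1).γ q.2‖
  obtain ⟨z, w, hz, hw, h⟩ := exists_smooth_roots hP.fst hP.snd.fst hP.snd.snd
    (fun q => hopfProducts_mul (hn q) (ho q))
    (fun q => hopfProducts_ne_zero (hn q) (ho q) (smul_ne_zero (norm_ne_zero_iff.2 (ha0 q))
      (norm_ne_zero_iff.1 (by rw [show ‖(x q.1).V q.2‖ = 1 from (x q.1).2.2.1 q.2]; norm_num))))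
  refine ⟨fun e t => ![z (e, t), w (e, t)], contDiff_pi.2 fun i => ?_, fun e t => ?_⟩
  · fin_cases i
    · exact hz
    · exact hw
  · obtain ⟨h1, h2, h3⟩ := h (e, t)
    exact Prod.ext h1.symm (Prod.ext h2.symm h3.symm)

/-- Smooth families of framed loops have smooth families of complex coordinates. -/
theorem exists_stiefel_lift [ProperSpace E] {x : E → FramedLoop} (hx : SmoothFramedFamily x) :
    ∃ (σ : ℤˣ) (Φ : E → Stiefel ℂ σ), SmoothFamily Φ ∧
      (∀ e t, hopfTangent (Φ e).row t = (2 / (x e).length) • deriv (x e).γ t) ∧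
      (∀ e t, hopfFraming (Φ e).row t = (x e).V t) ∧
      ∀ e t, hopfProducts (‖(2 / (x e).length) • deriv (x e).γ t‖ • (x e).V t)
        (cross ((2 / (x e).length) • deriv (x e).γ t) ((x e).V t)) =
        ((Φ e).row t 0 ^ 2, (Φ e).row t 0 * (Φ e).row t 1, (Φ e).row t 1 ^ 2) := by
  obtain ⟨F, hF, h⟩ := exists_coordinates hx
  have hL : ∀ e, 0 < 2 / (x e).length := fun e => div_pos two_pos (x e).length_pos
  have hfr := fun e t => hopf_of_frame (smul_ne_zero (hL e).ne' ((x e).2.1 t)) ((x e).2.2.1 t)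
    (by rw [real_inner_smul_left, (x e).2.2.2 t, mul_zero]) (h e t)
  have hT : ∀ e t, hopfTangent (F e) t = (2 / (x e).length) • deriv (x e).γ t :=
    fun e t => (hfr e t).1
  have hV : ∀ e t, hopfFraming (F e) t = (x e).V t := fun e t => (hfr e t).2.2
  have h0 : ∀ e t, F e t ≠ 0 := fun e t e0 => by
    have h1 := hT e t
    rw [hopfTangent, e0] at h1
    refine smul_ne_zero (hL e).ne' ((x e).2.1 t) (h1.symm.trans ?_)
    rw [← norm_eq_zero, norm_hopf₁]
    simp
  have hn : ∀ e t, rowNormSq (F e t) = (2 / (x e).length) * ‖deriv (x e).γ t‖ := fun e t => by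
    rw [← norm_hopfTangent, hT, norm_smul, Real.norm_of_nonneg (hL e).le]
  have hshift : ∀ e t, deriv (x e).γ (t + 2) = deriv (x e).γ t := fun e t => by
    rw [← deriv_comp_add_const]
    congr 1
    ext1 s
    have := (x e).1.1.2.2 s
    rwa [one_smul] at this
  have hVshift : ∀ e t, (x e).V (t + 2) = (x e).V t := fun e t => by
    have := (x e).1.2.2.2 t
    rwa [one_smul] at this
  -- The monodromy of the coordinates along the loop is a sign `σ`: periodic or antiperiodic.
  obtain ⟨σ, hσ⟩ := exists_sign_of_hopf_eq (X := E × ℝ) (F := Function.uncurry F)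
    (G := fun q => F q.1 (q.2 + 2)) hF.continuous
    (hF.continuous.comp (continuous_fst.prodMk (continuous_snd.add continuous_const)))
    (fun q => h0 q.1 q.2)
    (fun q => by
      change hopfTangent (F q.1) (q.2 + 2) = hopfTangent (F q.1) q.2
      rw [hT, hT, hshift])
    (fun q => by
      have h1 := hV q.1 (q.2 + 2)
      rw [hVshift, ← hV q.1 q.2, hopfFraming, hopfFraming, hn, hshift, ← hn] at h1
      exact smul_right_injective E3 (inv_ne_zero (rowNormSq_pos (h0 q.1 q.2)).ne') h1)
  have hfrm : ∀ e, IsFrame σ (F e) := fun e => by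
    have hFe : ContDiff ℝ ∞ (F e) := contDiff_slice hF e
    refine ⟨hFe, fun t => hσ (e, t), gram_eq_one_of_integral hFe.continuous
      ((contDiff_pi.1 hFe 0).hopf₁ (contDiff_pi.1 hFe 1)).continuous ?_ ?_, h0 e⟩
    · simp only [hT]
      rw [intervalIntegral.integral_smul, (x e).integral_deriv_γ, smul_zero]
    · simp only [hn]
      rw [intervalIntegral.integral_const_mul]
      exact div_mul_cancel₀ _ (x e).length_pos.ne'
  refine ⟨σ, fun e => (hfrm e).toStiefel, ?_, fun e t => ?_, fun e t => ?_, fun e t => ?_⟩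
  · rw [SmoothFamily]
    simp only [IsFrame.row_toStiefel]
    exact hF
  · rw [IsFrame.row_toStiefel, hT]
  · rw [IsFrame.row_toStiefel, hV]
  · rw [IsFrame.row_toStiefel, h]

theorem mk_toFramed_eq {σ : ℤˣ} {Φ : Stiefel ℂ σ} {x : FramedLoop}
    (hT : ∀ t, hopfTangent Φ.row t = (2 / x.length) • deriv x.γ t)
    (hV : ∀ t, hopfFraming Φ.row t = x.V t) :
    Quotient.mk FramedLoop.setoid Φ.toFramed = Quotient.mk FramedLoop.setoid x :=
  (FramedLoop.mk_eq_of_deriv (div_pos two_pos x.length_pos)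
    (fun t => (Φ.deriv_toFramed t).trans (hT t)) hV).symm

/-- The coordinate map from the complex Grassmannian to framed loops. -/
noncomputable def complexCoordinates (σ : ℤˣ) : Grassmannian ℂ σ → FramedModuli :=
  Quotient.map Stiefel.toFramed fun _ _ => Stiefel.toFramed_similar

theorem hasComplexCoordinates_toFramed {σ : ℤˣ} (Φ : Stiefel ℂ σ) :
    HasComplexCoordinates Φ Φ.toFramed := ⟨fun _ => rfl, fun _ => rfl⟩

theorem complexCoordinates_bijective :
    Function.Bijective (fun y : Σ σ, Grassmannian ℂ σ => complexCoordinates y.1 y.2) := by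
  constructor
  · rintro ⟨σ, y⟩ ⟨τ, z⟩ h
    induction y using Quotient.inductionOn with | _ Φ
    induction z using Quotient.inductionOn with | _ Ψ
    obtain ⟨rfl, U, hU, h⟩ := Stiefel.of_toFramed_similar (Quotient.exact h)
    exact congrArg (Sigma.mk σ) (Stiefel.mk_eq_iff.2 ⟨U, hU, h⟩)
  · intro c
    induction c using Quotient.inductionOn with | _ x
    have hx : SmoothFramedFamily (fun _ : ℝ => x) :=
      ⟨x.contDiff_γ.comp contDiff_snd, x.contDiff_V.comp contDiff_snd⟩
    obtain ⟨σ, Φ, -, hT, hV, -⟩ := exists_stiefel_lift hx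
    exact ⟨⟨σ, Quotient.mk _ (Φ 0)⟩, mk_toFramed_eq (hT 0) (hV 0)⟩

end Lifting

/-! ### Inductions of diffeological spaces -/

section DiffeologyLemmas

variable {X Y : Type*} [DiffeologicalSpace X] [DiffeologicalSpace Y] {n : ℕ}

theorem isPlot_of_eventuallyEq {p : EuclideanSpace ℝ (Fin n) → X}
    (h : ∀ x, ∃ q : EuclideanSpace ℝ (Fin n) → X, IsPlot q ∧ ∀ᶠ y in 𝓝 x, p y = q y) :
    IsPlot p := by
  refine DiffeologicalSpace.locality fun x => ?_
  obtain ⟨q, hq, hpq⟩ := h x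
  obtain ⟨u, hu, huo, hxu⟩ := eventually_nhds_iff.1 hpq
  refine ⟨u, huo, hxu, fun {m f} hf hfs => ?_⟩
  have : p ∘ f = q ∘ f := funext fun y => hu _ (hf y)
  rw [this]
  exact isPlot_reparam hq hfs

theorem isOpen_dTopology_of_eventually {U : Set X}
    (h : ∀ (n : ℕ) (p : EuclideanSpace ℝ (Fin n) → X), IsPlot p → ∀ x, p x ∈ U →
      ∀ᶠ y in 𝓝 x, p y ∈ U) : IsOpen[dTopology] U :=
  isOpen_iff_preimages_plots.2 fun n p hp => isOpen_iff_mem_nhds.2 fun x hx => h n p hp x hx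

theorem eventually_mem_of_isOpen {U : Set X} (hU : IsOpen[dTopology] U)
    {p : EuclideanSpace ℝ (Fin n) → X} (hp : IsPlot p) {x : EuclideanSpace ℝ (Fin n)}
    (hx : p x ∈ U) : ∀ᶠ y in 𝓝 x, p y ∈ U :=
  (isOpen_iff_preimages_plots.1 hU n p hp).mem_nhds hx

theorem IsInduction.isOpenInduction {f : X → Y} (hf : IsInduction f)
    (hr : IsOpen[dTopology] (range f)) : IsOpenInduction f := by
  refine ⟨hf, fun U hU => isOpen_dTopology_of_eventually fun n p hp x hx => ?_⟩
  obtain ⟨u, hu, huo, hxu⟩ := eventually_nhds_iff.1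
    (eventually_mem_of_isOpen hr hp (image_subset_range f U hx))
  obtain ⟨r, hr, hru, hrx⟩ := exists_smooth_retract huo hxu
  choose g hg using fun y => hu (r y) (hru y)
  have hgp : IsPlot g := (hf.2 n g).2 (by
    rw [show f ∘ g = p ∘ r from funext hg]
    exact isPlot_reparam hp hr)
  have hgx : g x ∈ U := by
    obtain ⟨z, hz, hzx⟩ := hx
    have : f (g x) = f z := by rw [hg, hrx.self_of_nhds, hzx]
    rwa [hf.1 this]
  filter_upwards [eventually_mem_of_isOpen hU hgp hgx, hrx] with y h1 h2
  exact ⟨g y, h1, by rw [hg, h2]⟩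

theorem isInduction_of_local {f : X → Y} (hi : Function.Injective f) (hs : DSmooth f)
    (h : ∀ (n : ℕ) (p : EuclideanSpace ℝ (Fin n) → X), IsPlot (f ∘ p) → ∀ x,
      ∃ q : EuclideanSpace ℝ (Fin n) → X, IsPlot q ∧ ∀ᶠ y in 𝓝 x, f (p y) = f (q y)) :
    IsInduction f := by
  refine ⟨hi, fun n p => ⟨fun hp => hs n p hp, fun hp => isPlot_of_eventuallyEq fun x => ?_⟩⟩
  obtain ⟨q, hq, hpq⟩ := h n p hp x
  exact ⟨q, hq, hpq.mono fun y hy => hi hy⟩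

theorem isPlot_quotient_mk {s : Setoid X} {q : EuclideanSpace ℝ (Fin n) → X} (hq : IsPlot q) :
    IsPlot fun y => Quotient.mk s (q y) :=
  fun _ => ⟨q, hq, Eventually.of_forall fun _ => rfl⟩

theorem dSmooth_quotient {s : Setoid X} {f : Quotient s → Y}
    (h : ∀ (n : ℕ) (q : EuclideanSpace ℝ (Fin n) → X), IsPlot q →
      IsPlot fun y => f (Quotient.mk s (q y))) : DSmooth f := fun n p hp =>
  isPlot_of_eventuallyEq fun x => by
    obtain ⟨q, hq, hpq⟩ := hp x
    exact ⟨_, h n q hq, hpq.mono fun y hy => congrArg f hy⟩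

end DiffeologyLemmas

section ComplexChart

/-- Plots of the moduli space of framed loops have local complex coordinates. -/
theorem exists_local_coordinates {n : ℕ} {p : EuclideanSpace ℝ (Fin n) → FramedModuli}
    (hp : IsPlot p) (x : EuclideanSpace ℝ (Fin n)) :
    ∃ (σ : ℤˣ) (Φ : EuclideanSpace ℝ (Fin n) → Stiefel ℂ σ), SmoothFamily Φ ∧
      ∀ᶠ y in 𝓝 x, p y = complexCoordinates σ (Quotient.mk _ (Φ y)) := by
  obtain ⟨q, hq, hpq⟩ := hp x
  obtain ⟨σ, Φ, hΦ, hT, hV, -⟩ := exists_stiefel_lift (isPlot_framedLoop_iff.1 hq)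
  refine ⟨σ, Φ, hΦ, hpq.mono fun y hy => hy.trans ?_⟩
  exact (mk_toFramed_eq (hT y) (hV y)).symm

theorem dSmooth_complexCoordinates (σ : ℤˣ) : DSmooth (complexCoordinates σ) :=
  dSmooth_quotient fun _ _ hq => isPlot_quotient_mk (SmoothFamily.toFramed (isPlot_stiefel_iff.1
    hq))

theorem complexCoordinates_eq_iff {σ τ : ℤˣ} {Φ : Stiefel ℂ σ} {Ψ : Stiefel ℂ τ} :
    complexCoordinates σ (Quotient.mk _ Φ) = complexCoordinates τ (Quotient.mk _ Ψ) ↔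
      σ = τ ∧ ∃ U ∈ Matrix.unitaryGroup (Fin 2) ℂ, Ψ.row = _root_.rmul Φ.row U := by
  constructor
  · exact fun h => Stiefel.of_toFramed_similar (Quotient.exact h)
  · rintro ⟨rfl, U, hU, h⟩
    exact congrArg _ (Stiefel.mk_eq_iff.2 ⟨U, hU, h⟩)

theorem complexCoordinates_injective (σ : ℤˣ) : Function.Injective (complexCoordinates σ) :=
  fun y z h => by
    have := complexCoordinates_bijective.1 (a₁ := ⟨σ, y⟩) (a₂ := ⟨σ, z⟩) h
    exact eq_of_heq (Sigma.mk.inj this).2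

theorem isOpenInduction_complexCoordinates (σ : ℤˣ) : IsOpenInduction (complexCoordinates σ) := by
  refine IsInduction.isOpenInduction (isInduction_of_local (complexCoordinates_injective σ)
    (dSmooth_complexCoordinates σ) fun n p hp x => ?_) ?_
  · obtain ⟨τ, Φ, hΦ, h⟩ := exists_local_coordinates hp x
    obtain ⟨Ψ, hΨ⟩ := Quotient.exists_rep (p x)
    have hx := h.self_of_nhds
    rw [Function.comp_apply, ← hΨ] at hx
    obtain ⟨rfl, -⟩ := complexCoordinates_eq_iff.1 hx
    exact ⟨_, isPlot_quotient_mk (isPlot_stiefel_iff.2 hΦ), h⟩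
  · refine isOpen_dTopology_of_eventually fun n p hp x hx => ?_
    obtain ⟨τ, Φ, hΦ, h⟩ := exists_local_coordinates hp x
    obtain ⟨y, hy⟩ := hx
    obtain ⟨Ψ, rfl⟩ := Quotient.exists_rep y
    obtain ⟨rfl, -⟩ := complexCoordinates_eq_iff.1 (hy.trans h.self_of_nhds)
    exact h.mono fun y hy => ⟨_, hy.symm⟩

theorem isCoordinateSystem_complexCoordinates : IsCoordinateSystem complexCoordinates :=
  ⟨complexCoordinates_bijective, isOpenInduction_complexCoordinates⟩

end ComplexChart

/-! ### Real pairs -/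

section RealPairs

/-- All values are real. -/
def RealValued (F : ℝ → Fin 2 → ℂ) : Prop := ∀ t i, (F t i).im = 0

/-- All entries are real. -/
def RealMatrix (M : Matrix (Fin 2) (Fin 2) ℂ) : Prop := ∀ i j, (M i j).im = 0

theorem RealMatrix.det {M : Matrix (Fin 2) (Fin 2) ℂ} (hM : RealMatrix M) : M.det.im = 0 := by
  simp [Matrix.det_fin_two, hM _ _]

theorem RealMatrix.inv {M : Matrix (Fin 2) (Fin 2) ℂ} (hM : RealMatrix M) : RealMatrix M⁻¹ :=
  fun i j => by
    simp only [Matrix.inv_def, Ring.inverse_eq_inv', Matrix.smul_apply, smul_eq_mul,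
      Matrix.adjugate_fin_two]
    have h1 : (M.det)⁻¹.im = 0 := by simp [Complex.inv_im, hM.det]
    have h2 : (!![M 1 1, -M 0 1; -M 1 0, M 0 0] i j).im = 0 := by
      fin_cases i <;> fin_cases j <;> simp [hM _ _]
    rw [Complex.mul_im, h1, h2, mul_zero, zero_mul, add_zero]

theorem RealMatrix.gramSchmidt {M : Matrix (Fin 2) (Fin 2) ℂ} (hM : RealMatrix M) :
    RealMatrix (gramSchmidtMatrix M) := fun i j => by
  have h := hM 0 1
  fin_cases i <;> fin_cases j
  · exact Complex.ofReal_im _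
  · change (-(M 0 1 * ((_ : ℝ) : ℂ))).im = 0
    rw [Complex.neg_im, Complex.im_mul_ofReal, h, zero_mul, neg_zero]
  · exact Complex.zero_im
  · exact Complex.ofReal_im _

theorem RealValued.rmul {F : ℝ → Fin 2 → ℂ} (hF : RealValued F) {M : Matrix (Fin 2) (Fin 2) ℂ}
    (hM : RealMatrix M) : RealValued (rmul F M) := fun t i => by
  simp [rmul_apply, hM _ _, hF _ _]

theorem RealValued.gram {F G : ℝ → Fin 2 → ℂ} (hF : RealValued F) (hG : RealValued G) :
    RealMatrix (_root_.gram F G) := fun i j => by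
  have h : _root_.gram F G i j = ((∫ t in (0 : ℝ)..2, (F t i).re * (G t j).re : ℝ) : ℂ) := by
    rw [← intervalIntegral.integral_ofReal]
    refine intervalIntegral.integral_congr fun t _ => ?_
    apply Complex.ext <;> simp [hF _ _, hG _ _]
  rw [h, Complex.ofReal_im]

/-- The values of a pair that spans the complexification of a real plane become real when the pair
is normalized against a real pair. -/
theorem RealValued.normalize {R₀ R : ℝ → Fin 2 → ℂ} (h0 : RealValued R₀) (hR : RealValued R)
    (c0 : Continuous R₀) (cR : Continuous R) {M : Matrix (Fin 2) (Fin 2) ℂ} (hM : M.det ≠ 0) :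
    RealValued (_root_.rmul (_root_.rmul R M) (_root_.gram R₀ (_root_.rmul R M))⁻¹) := by
  rw [gram_rmul_right c0 cR, Matrix.mul_inv_rev, rmul_rmul, ← mul_assoc,
    Matrix.mul_nonsing_inv _ (isUnit_iff_ne_zero.2 hM), one_mul]
  exact hR.rmul (h0.gram hR).inv

variable {σ τ : ℤˣ}

theorem Stiefel.row_toComplex (Φ : Stiefel ℝ σ) (t : ℝ) (i : Fin 2) :
    Φ.toComplex.row t i = ((Φ.row t i : ℝ) : ℂ) := by
  fin_cases i <;> rfl

theorem Stiefel.realValued_toComplex (Φ : Stiefel ℝ σ) : RealValued Φ.toComplex.row :=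
  fun t i => by rw [Φ.row_toComplex, Complex.ofReal_im]

theorem Stiefel.exists_toComplex {Φ : Stiefel ℂ σ} (h : RealValued Φ.row) :
    ∃ R : Stiefel ℝ σ, R.toComplex = Φ := by
  have e : ∀ t i, ((Φ.row t i).re : ℂ) = Φ.row t i := fun t i =>
    Complex.ext (Complex.ofReal_re _) ((Complex.ofReal_im _).trans (h t i).symm)
  have hper : ∀ t i, (Φ.row (t + 2) i).re = σ • (Φ.row t i).re := fun t i => by
    have := congrArg Complex.re (congrFun (Φ.row_period t) i)
    rw [this]
    rcases Int.units_eq_one_or σ with rfl | rfl <;> simp [Units.smul_def]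
  have hn : ∀ t i, ‖(Φ.row t i).re‖ = ‖Φ.row t i‖ := fun t i => by
    conv_rhs => rw [← e]
    rw [Complex.norm_real]
  refine ⟨⟨(⟨fun t => (Φ.row t 0).re, contDiff_complex_re Φ.1.1.2.1, fun t => hper t 0⟩,
    ⟨fun t => (Φ.row t 1).re, contDiff_complex_re Φ.1.2.2.1, fun t => hper t 1⟩), ?_, ?_, ?_, ?_⟩,
      ?_⟩
  · simp only [hn]; exact Φ.2.1
  · simp only [hn]; exact Φ.2.2.1
  · change ∫ t in (0 : ℝ)..2, (Φ.row t 0).re * (Φ.row t 1).re = 0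
    have h1 : ∫ t in (0 : ℝ)..2, Φ.row t 0 * (starRingEnd ℂ) (Φ.row t 1) = 0 := Φ.2.2.2.1
    refine Complex.ofReal_injective ?_
    rw [← intervalIntegral.integral_ofReal]
    refine Eq.trans (intervalIntegral.integral_congr fun t _ => ?_)
      (h1.trans Complex.ofReal_zero.symm)
    rw [← e t 0, ← e t 1, Complex.conj_ofReal]
    simp
  · rintro t ⟨(h0 : (Φ.row t 0).re = 0), (h1 : (Φ.row t 1).re = 0)⟩
    exact Φ.2.2.2.2 t ⟨(e t 0).symm.trans ((congrArg _ h0).trans Complex.ofReal_zero),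
      (e t 1).symm.trans ((congrArg _ h1).trans Complex.ofReal_zero)⟩
  · refine Stiefel.row_injective (funext fun t => funext fun i => ?_)
    rw [Stiefel.row_toComplex]
    refine Eq.trans ?_ (e t i)
    fin_cases i <;> rfl

theorem Grassmannian.inclusion_injective (σ : ℤˣ) :
    Function.Injective (Grassmannian.inclusion σ) := by
  intro y z h
  induction y using Quotient.inductionOn with | _ Φ
  induction z using Quotient.inductionOn with | _ Ψ
  obtain ⟨U, hU, hUr⟩ := Stiefel.mk_eq_iff.1 h
  have hUg := (gram_unitary_of_rmul Φ.toComplex.isFrame.contDiff.continuous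
    Φ.toComplex.isFrame.gram_self Ψ.toComplex.isFrame.gram_self hUr).1
  have hreal : RealMatrix U := by
    rw [hUg]
    exact Φ.realValued_toComplex.gram Ψ.realValued_toComplex
  have e : ∀ i j, ((U i j).re : ℂ) = U i j := fun i j =>
    Complex.ext (Complex.ofReal_re _) ((Complex.ofReal_im _).trans (hreal i j).symm)
  refine Quotient.sound ⟨U.map Complex.re, ?_, fun t => ?_⟩
  · rw [Matrix.mem_unitaryGroup_iff]
    have h1 := Matrix.mem_unitaryGroup_iff.1 hU
    ext i j
    have h2 := congrArg Complex.re (congrFun (congrFun h1 i) j)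
    rw [Matrix.mul_apply, Fin.sum_univ_two] at h2 ⊢
    simp only [Matrix.star_apply, Complex.add_re, Complex.mul_re, RCLike.star_def, Complex.conj_re,
      Complex.conj_im, hreal i 0, hreal i 1, zero_mul, sub_zero, Matrix.map_apply, star_trivial]
      at h2 ⊢
    rw [h2]
    rcases eq_or_ne i j with rfl | hij
    · simp
    · simp [hij]
  · ext j
    apply Complex.ofReal_injective
    have h1 := congrFun (congrFun hUr t) j
    rw [Stiefel.row_toComplex, rmul_apply, Stiefel.row_toComplex, Stiefel.row_toComplex,
      ← e 0 j, ← e 1 j] at h1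
    rw [h1, Matrix.vecMul, dotProduct, Fin.sum_univ_two]
    simp

theorem IsPreframe.mul {F : ℝ → Fin 2 → ℂ} (h : IsPreframe σ F) {M : Matrix (Fin 2) (Fin 2) ℂ}
    (hM : M.det ≠ 0) : IsPreframe σ (_root_.rmul F M) where
  contDiff := contDiff_rmul h.contDiff _
  period t := by rw [_root_.rmul, h.period, Matrix.smul_vecMul]; rfl
  ne_zero t ht := h.ne_zero t (Matrix.eq_zero_of_vecMul_eq_zero hM ht)
  indep := by
    obtain ⟨Ψ, hΨ, hd⟩ := h.indep
    exact ⟨Ψ, hΨ, by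
      rw [gram_rmul_right hΨ h.contDiff.continuous, Matrix.det_mul]
      exact mul_ne_zero hd hM⟩

theorem IsFrame.isPreframe {F : ℝ → Fin 2 → ℂ} (h : IsFrame σ F) : IsPreframe σ F :=
  ⟨h.contDiff, h.period, h.ne_zero, F, h.contDiff.continuous, by
    rw [h.gram_self, Matrix.det_one]; exact one_ne_zero⟩

theorem IsPreframe.realValued_orthonormalize {F : ℝ → Fin 2 → ℂ} (h : IsPreframe σ F)
    (hF : RealValued F) : RealValued h.orthonormalize.row := by
  rw [h.row_orthonormalize]
  exact hF.rmul (hF.gram hF).gramSchmidt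

/-- The complex plane spanned by a pair is the complexification of a real plane. -/
def Stiefel.HasRealSpan (Φ : Stiefel ℂ σ) : Prop :=
  ∃ R : Stiefel ℝ σ, Quotient.mk (stiefelSetoid ℂ σ) Φ = Quotient.mk (stiefelSetoid ℂ σ) R.toComplex

/-- A smooth family of complexified real planes is locally spanned by a smooth family of real
pairs. -/
theorem exists_real_family {E : Type} [NormedAddCommGroup E] [NormedSpace ℝ E]
    [FiniteDimensional ℝ E] {Φ : E → Stiefel ℂ σ} (hΦ : SmoothFamily Φ) {x : E}
    (h : ∀ᶠ y in 𝓝 x, (Φ y).HasRealSpan) :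
    ∃ R : E → Stiefel ℝ σ, SmoothFamily (fun y => (R y).toComplex) ∧
      ∀ᶠ y in 𝓝 x, Quotient.mk (stiefelSetoid ℂ σ) (Φ y) = Quotient.mk _ (R y).toComplex := by
  have : ProperSpace E := FiniteDimensional.proper ℝ E
  obtain ⟨R₀, hR₀⟩ := h.self_of_nhds
  obtain ⟨U, hU, hUr⟩ := Stiefel.mk_eq_iff.1 hR₀.symm
  have c0 := R₀.toComplex.isFrame.contDiff.continuous
  have hs : SmoothMatrix fun y => gram R₀.toComplex.row (Φ y).row :=
    smoothMatrix_gram (F := fun _ => R₀.toComplex.row)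
      (R₀.toComplex.isFrame.contDiff.comp contDiff_snd) hΦ
  have hd : ∀ᶠ y in 𝓝 x, (gram R₀.toComplex.row (Φ y).row).det ≠ 0 := by
    refine hs.det.continuous.continuousAt.eventually_ne ?_
    rw [hUr, gram_rmul_right c0 c0, R₀.toComplex.isFrame.gram_self, one_mul]
    exact (Matrix.det_of_mem_unitary hU) |> fun h => by
      intro h0
      rw [h0] at h
      simpa using CStarRing.norm_of_mem_unitary h
  -- The pair `Φ (R₀* Φ)⁻¹` spans the same plane as `Φ`, and it is real if the plane is.
  obtain ⟨r, hr, hru, hrx⟩ := exists_smooth_retraction (h.and hd)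
  have hpre : ∀ y, IsPreframe σ (_root_.rmul (Φ (r y)).row
      (gram R₀.toComplex.row (Φ (r y)).row)⁻¹) := fun y =>
    (Φ (r y)).isFrame.isPreframe.mul (by
      rw [Matrix.det_nonsing_inv, Ring.inverse_eq_inv']
      exact inv_ne_zero (hru y).2)
  have hsm := smoothFamily_orthonormalize (contDiff_rmul_family (hΦ.comp hr)
    ((hs.comp hr).inv fun y => (hru y).2)) hpre
  have hreal : ∀ y, RealValued (hpre y).orthonormalize.row := fun y =>
    (hpre y).realValued_orthonormalize (by
      obtain ⟨R, hR⟩ := (hru y).1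
      obtain ⟨V, hV, hVr⟩ := Stiefel.mk_eq_iff.1 hR.symm
      rw [hVr]
      refine R₀.realValued_toComplex.normalize R.realValued_toComplex c0
        R.toComplex.isFrame.contDiff.continuous ?_
      intro h0
      have := Matrix.det_of_mem_unitary hV
      rw [h0] at this
      simpa using CStarRing.norm_of_mem_unitary this)
  choose R hR using fun y => Stiefel.exists_toComplex (hreal y)
  refine ⟨R, ?_, ?_⟩
  · simp only [hR]
    exact hsm
  · filter_upwards [hrx] with y hy
    have h1 := Stiefel.mk_eq_of_rmul
      (((hpre y).row_orthonormalize).trans (rmul_rmul _ _ _))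
    rw [hR, ← h1, hy]

end RealPairs

/-! ### Planar loops and real pairs -/

section Planar

variable {σ τ : ℤˣ}

theorem hasDerivAt_planar (γ : PlanarLoop) (t : ℝ) : HasDerivAt γ.1.1 (deriv γ.1.1 t) t :=
  (γ.1.2.1.differentiable (by simp)).differentiableAt.hasDerivAt

theorem PlanarLoop.deriv_framed (γ : PlanarLoop) (t : ℝ) :
    deriv γ.framed.γ t = planeToSpace (deriv γ.1.1 t) := deriv_loopMap _ _ _

theorem PlanarLoop.framed_V (γ : PlanarLoop) (t : ℝ) : γ.framed.V t = !₂[0, 1, 0] := rfl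

/-- The projection `(x, y, z) ↦ (x, z)` of three-space to the plane. -/
noncomputable def spaceToPlane : E3 →L[ℝ] E2 :=
  LinearMap.toContinuousLinearMap
    { toFun := fun v => !₂[v 0, v 2]
      map_add' := fun v w => by ext i; fin_cases i <;> simp
      map_smul' := fun c v => by ext i; fin_cases i <;> simp }

theorem spaceToPlane_apply (v : E3) : spaceToPlane v = !₂[v 0, v 2] := rfl

theorem spaceToPlane_planeToSpace (v : E2) : spaceToPlane (planeToSpace v) = v := by
  ext i; fin_cases i <;> rfl

theorem planeToSpace_spaceToPlane {v : E3} (h : v 1 = 0) : planeToSpace (spaceToPlane v) = v := by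
  ext i; fin_cases i
  · rfl
  · exact h.symm
  · rfl

/-- A framed loop in the `xz`-plane with constant normal framing comes from a planar loop. -/
noncomputable def FramedLoop.toPlanar (x : FramedLoop) (h : ∀ t, x.γ t 1 = 0) : PlanarLoop :=
  ⟨loopMap spaceToPlane x.1.1, fun t h0 => x.2.1 t (by
    rw [deriv_loopMap] at h0
    have h1 : deriv x.γ t 1 = 0 := by
      have := (((EuclideanSpace.proj 1 : E3 →L[ℝ] ℝ).hasFDerivAt.comp_hasDerivAt t
        (x.hasDerivAt_γ t))).deriv
      refine this.symm.trans ?_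
      have : (⇑(EuclideanSpace.proj 1 : E3 →L[ℝ] ℝ) ∘ x.γ) = fun _ => 0 := funext h
      rw [this, deriv_const]
    exact (planeToSpace_spaceToPlane h1).symm.trans ((congrArg _ h0).trans (map_zero _)))⟩

theorem FramedLoop.framed_toPlanar (x : FramedLoop) (h : ∀ t, x.γ t 1 = 0)
    (hV : ∀ t, x.V t = !₂[0, 1, 0]) : (x.toPlanar h).framed = x := by
  refine Subtype.ext (Prod.ext (Subtype.ext (funext fun t => ?_)) (Subtype.ext (funext fun t =>
    ?_)))
  · exact planeToSpace_spaceToPlane (h t)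
  · exact (hV t).symm

theorem hopf₁_ofReal (a b : ℝ) : hopf₁ (a : ℂ) (b : ℂ) = !₂[a ^ 2 - b ^ 2, 0, 2 * a * b] := by
  ext i
  fin_cases i <;> simp [hopf₁, ← Complex.ofReal_mul] ; ring

theorem hopf₂_ofReal (a b : ℝ) : hopf₂ (a : ℂ) (b : ℂ) = !₂[0, a ^ 2 + b ^ 2, 0] := by
  ext i
  fin_cases i <;> simp [hopf₂, ← Complex.ofReal_mul, ← Complex.ofReal_pow]

theorem Stiefel.hopfTangent_toComplex (Φ : Stiefel ℝ σ) (t : ℝ) :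
    hopfTangent Φ.toComplex.row t =
      !₂[Φ.1.1.1 t ^ 2 - Φ.1.2.1 t ^ 2, 0, 2 * Φ.1.1.1 t * Φ.1.2.1 t] :=
  hopf₁_ofReal _ _

theorem Stiefel.hopfFraming_toComplex (Φ : Stiefel ℝ σ) (t : ℝ) :
    hopfFraming Φ.toComplex.row t = !₂[0, 1, 0] := by
  have hp := rowNormSq_pos (Φ.toComplex.isFrame.ne_zero t)
  have h : rowNormSq (Φ.toComplex.row t) = Φ.1.1.1 t ^ 2 + Φ.1.2.1 t ^ 2 := by
    rw [rowNormSq, Φ.row_toComplex, Φ.row_toComplex, Complex.norm_real, Complex.norm_real,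
      Real.norm_eq_abs, Real.norm_eq_abs, sq_abs, sq_abs]
    rfl
  have h2 : hopf₂ (Φ.toComplex.row t 0) (Φ.toComplex.row t 1) =
      !₂[0, Φ.1.1.1 t ^ 2 + Φ.1.2.1 t ^ 2, 0] := hopf₂_ofReal _ _
  rw [hopfFraming, h2, ← h]
  ext i
  fin_cases i
  · simp
  · simp [hp.ne']
  · simp

theorem Stiefel.toFramed_toComplex_γ (Φ : Stiefel ℝ σ) (t : ℝ) :
    Φ.toComplex.toFramed.γ t 1 = 0 := by
  rw [Stiefel.toFramed_γ, integral_apply_E3 Φ.toComplex.isFrame.contDiff_tangent.continuous]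
  simp [Stiefel.hopfTangent_toComplex]

/-- The planar loop with given real coordinates. -/
noncomputable def Stiefel.toPlanar (Φ : Stiefel ℝ σ) : PlanarLoop :=
  Φ.toComplex.toFramed.toPlanar Φ.toFramed_toComplex_γ

theorem Stiefel.framed_toPlanar (Φ : Stiefel ℝ σ) : Φ.toPlanar.framed = Φ.toComplex.toFramed :=
  FramedLoop.framed_toPlanar _ _ Φ.hopfFraming_toComplex

theorem Stiefel.hasRealCoordinates (Φ : Stiefel ℝ σ) : HasRealCoordinates Φ Φ.toPlanar := fun t =>
    by
  change spaceToPlane (∫ s in (0 : ℝ)..t, hopfTangent Φ.toComplex.row s) = _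
  rw [← spaceToPlane.intervalIntegral_comp_comm
    (Φ.toComplex.isFrame.contDiff_tangent.continuous.intervalIntegrable _ _)]
  refine intervalIntegral.integral_congr fun s _ => ?_
  simp only [Stiefel.hopfTangent_toComplex]
  rw [spaceToPlane_apply]
  simp

theorem planarSimilar_of_deriv {G : Submonoid (Matrix (Fin 2) (Fin 2) ℝ)} {γ η : PlanarLoop}
    {A : Matrix (Fin 2) (Fin 2) ℝ} (hA : A ∈ G) {r : ℝ} (hr : 0 < r)
    (h : ∀ t, deriv η.1.1 t = r • matAct A (deriv γ.1.1 t)) : PlanarSimilar G γ η := by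
  refine ⟨A, hA, r, hr, η.1.1 0 - r • matAct A (γ.1.1 0), fun t => ?_⟩
  have hd : ∀ t, HasDerivAt (fun t => η.1.1 t - r • matAct A (γ.1.1 t)) 0 t := fun t => by
    have := (hasDerivAt_planar η t).sub
      (((matAct A).hasFDerivAt.comp_hasDerivAt t (hasDerivAt_planar γ t)).const_smul r)
    rw [h t, sub_self] at this
    exact this
  have := is_const_of_deriv_eq_zero (fun t => (hd t).differentiableAt) (fun t => (hd t).deriv) t 0
  exact eq_add_of_sub_eq' this

theorem PlanarSimilar.deriv_eq {γ η : PlanarLoop} {A : Matrix (Fin 2) (Fin 2) ℝ} {r : ℝ} {b : E2}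
    (h : ∀ t, η.1.1 t = r • matAct A (γ.1.1 t) + b) (t : ℝ) :
    deriv η.1.1 t = r • matAct A (deriv γ.1.1 t) := by
  rw [funext h]
  exact ((((matAct A).hasFDerivAt.comp_hasDerivAt t (hasDerivAt_planar γ t)).const_smul r).add_const
    b).deriv

theorem Stiefel.deriv_toPlanar (Φ : Stiefel ℝ σ) (t : ℝ) :
    deriv Φ.toPlanar.1.1 t =
      !₂[Φ.1.1.1 t ^ 2 - Φ.1.2.1 t ^ 2, 2 * Φ.1.1.1 t * Φ.1.2.1 t] := by
  have h : deriv Φ.toPlanar.1.1 t = spaceToPlane (hopfTangent Φ.toComplex.row t) := by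
    refine (deriv_loopMap spaceToPlane Φ.toComplex.toFramed.1.1 t).trans ?_
    exact congrArg _ (Φ.toComplex.deriv_toFramed t)
  rw [h, Stiefel.hopfTangent_toComplex, spaceToPlane_apply]
  simp

theorem matAct_fin_two (A : Matrix (Fin 2) (Fin 2) ℝ) (v : E2) :
    matAct A v = !₂[A 0 0 * v 0 + A 0 1 * v 1, A 1 0 * v 0 + A 1 1 * v 1] := by
  ext i
  fin_cases i <;> simp [matAct, Matrix.mulVec, dotProduct, Fin.sum_univ_two]

theorem Stiefel.toPlanar_similar {Φ Ψ : Stiefel ℝ σ} (h : (stiefelSetoid ℝ σ).r Φ Ψ) :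
    PlanarSimilar (Matrix.orthogonalGroup (Fin 2) ℝ) Φ.toPlanar Ψ.toPlanar := by
  obtain ⟨U, hU, h⟩ := h
  have h1 := Matrix.mem_unitaryGroup_iff.1 hU
  have h00 := congrFun (congrFun h1 0) 0
  have h01 := congrFun (congrFun h1 0) 1
  have h11 := congrFun (congrFun h1 1) 1
  simp [Matrix.mul_apply, Fin.sum_univ_two, Matrix.star_apply] at h00 h01 h11
  have h1' := Matrix.mem_unitaryGroup_iff'.1 hU
  have k00 := congrFun (congrFun h1' 0) 0
  have k01 := congrFun (congrFun h1' 0) 1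
  have k11 := congrFun (congrFun h1' 1) 1
  simp [Matrix.mul_apply, Fin.sum_univ_two, Matrix.star_apply] at k00 k01 k11
  -- the action of `U` on the squares of complex numbers `φ + i ψ`
  refine planarSimilar_of_deriv (A := !![U 0 0 ^ 2 - U 0 1 ^ 2, U 0 0 * U 1 0 - U 0 1 * U 1 1;
    2 * U 0 0 * U 0 1, U 0 0 * U 1 1 + U 0 1 * U 1 0]) (r := 1) ?_ one_pos fun t => ?_
  · rw [Matrix.mem_orthogonalGroup_iff']
    ext i j
    fin_cases i <;> fin_cases j <;>
      simp [Matrix.mul_apply, Fin.sum_univ_two]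
    · linear_combination (U 0 0 ^ 2 + U 0 1 ^ 2 + 1) * h00
    · linear_combination (U 0 0 ^ 2 + U 0 1 ^ 2) * h01
    · linear_combination (U 0 0 ^ 2 + U 0 1 ^ 2) * h01
    · linear_combination (U 1 0 ^ 2 + U 1 1 ^ 2) * h00 + h11
  · have e0 : Ψ.1.1.1 t = Φ.1.1.1 t * U 0 0 + Φ.1.2.1 t * U 1 0 := by
      have := congrFun (h t) 0
      rw [Matrix.vecMul, dotProduct, Fin.sum_univ_two] at this
      exact this
    have e1 : Ψ.1.2.1 t = Φ.1.1.1 t * U 0 1 + Φ.1.2.1 t * U 1 1 := by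
      have := congrFun (h t) 1
      rw [Matrix.vecMul, dotProduct, Fin.sum_univ_two] at this
      exact this
    rw [Ψ.deriv_toPlanar, Φ.deriv_toPlanar, matAct_fin_two, one_smul, e0, e1]
    ext i
    fin_cases i
    · simp
      linear_combination (Φ.1.2.1 t) ^ 2 * (k00 - k11)
    · simp
      linear_combination 2 * (Φ.1.2.1 t) ^ 2 * k01

/-- Planar loops that are similar, possibly by a reflection, give similar framed loops: the
reflection extends to a rotation of space followed by a half turn of the frame. -/
theorem planeToSpace_similar {γ η : PlanarLoop}
    (h : PlanarSimilar (Matrix.orthogonalGroup (Fin 2) ℝ) γ η) :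
    FramedLoop.Similar γ.framed η.framed := by
  obtain ⟨A, hA, r, hr, b, h⟩ := h
  have h1 := (Matrix.mem_orthogonalGroup_iff _ _).1 hA
  have h00 := congrFun (congrFun h1 0) 0
  have h01 := congrFun (congrFun h1 0) 1
  have h11 := congrFun (congrFun h1 1) 1
  simp [Matrix.mul_apply, Fin.sum_univ_two] at h00 h01 h11
  have hdet : A.det = 1 ∨ A.det = -1 := by
    have := congrArg Matrix.det h1
    rw [Matrix.det_mul, Matrix.det_transpose, Matrix.det_one] at this
    exact mul_self_eq_one_iff.1 this
  have hdet2 : A.det * A.det = 1 := by rcases hdet with e | e <;> rw [e] <;> norm_num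
  obtain ⟨θ, hθ, hθ'⟩ : ∃ θ : ℝ, Real.cos θ = A.det ∧ Real.sin θ = 0 := by
    rcases hdet with e | e
    · exact ⟨0, by simp [e]⟩
    · exact ⟨Real.pi, by simp [e]⟩
  refine FramedLoop.similar_of_deriv (A := !![A 0 0, 0, A 0 1; 0, A.det, 0; A 1 0, 0, A 1 1])
    (r := r) (θ := θ) ?_ hr (fun t => ?_) fun t => ?_
  · rw [Matrix.mem_specialOrthogonalGroup_iff, Matrix.mem_orthogonalGroup_iff]
    refine ⟨?_, ?_⟩
    · ext i j
      fin_cases i <;> fin_cases j <;>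
        simp [Matrix.mul_apply, Fin.sum_univ_three] <;> linarith
    · rw [Matrix.det_fin_three]
      simp
      rw [Matrix.det_fin_two] at hdet2 ⊢
      linarith
  · rw [PlanarLoop.deriv_framed, PlanarLoop.deriv_framed, PlanarSimilar.deriv_eq h, map_smul,
      matAct_fin_two]
    congr 1
    ext i
    fin_cases i <;> simp [planeToSpace_apply, mul_comm]
  · rw [hθ, hθ', zero_smul, add_zero, PlanarLoop.framed_V, PlanarLoop.framed_V]
    ext i
    fin_cases i <;> simp [hdet2]

/-- The map from the moduli space of planar loops to the moduli space of framed loops. -/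
noncomputable def planarInclusion : PlanarModuli → FramedModuli :=
  Quotient.map PlanarLoop.framed fun _ _ => planeToSpace_similar

/-- The coordinate map from the real Grassmannian to planar loops. -/
noncomputable def realCoordinates (σ : ℤˣ) : Grassmannian ℝ σ → PlanarModuli :=
  Quotient.map Stiefel.toPlanar fun _ _ => Stiefel.toPlanar_similar

theorem planarInclusion_realCoordinates (σ : ℤˣ) :
    planarInclusion ∘ realCoordinates σ = complexCoordinates σ ∘ Grassmannian.inclusion σ := by
  funext y
  induction y using Quotient.inductionOn with | _ Φ
  exact congrArg _ Φ.framed_toPlanar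

/-- A family of planar loops that is jointly smooth. -/
def SmoothPlanarFamily {E : Type} [NormedAddCommGroup E] [NormedSpace ℝ E] (γ : E → PlanarLoop) :
    Prop := ContDiff ℝ ∞ (Function.uncurry fun w => (γ w).1.1)

theorem isPlot_planarLoop_iff {n : ℕ} {p : EuclideanSpace ℝ (Fin n) → PlanarLoop} :
    IsPlot p ↔ SmoothPlanarFamily p := Iff.rfl

variable {E : Type} [NormedAddCommGroup E] [NormedSpace ℝ E]

theorem SmoothPlanarFamily.framed {γ : E → PlanarLoop} (h : SmoothPlanarFamily γ) :
    SmoothFramedFamily fun e => (γ e).framed :=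
  ⟨planeToSpace.contDiff.comp h, contDiff_const⟩

theorem SmoothFamily.toPlanar [ProperSpace E] {R : E → Stiefel ℝ σ}
    (h : SmoothFamily fun e => (R e).toComplex) : SmoothPlanarFamily fun e => (R e).toPlanar :=
  spaceToPlane.contDiff.comp h.toFramed.1

/-- Smooth families of planar loops have smooth families of real coordinates. The complex
coordinates `z, w` of a planar loop are automatically real, since `z²` and `w²` are real and
nonnegative. -/
theorem exists_real_stiefel_lift [ProperSpace E] {γ : E → PlanarLoop} (h : SmoothPlanarFamily γ) :
    ∃ (σ : ℤˣ) (R : E → Stiefel ℝ σ), SmoothFamily (fun e => (R e).toComplex) ∧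
      ∀ e t, hopfTangent (R e).toComplex.row t =
        (2 / (γ e).framed.length) • deriv (γ e).framed.γ t := by
  obtain ⟨σ, Φ, hΦ, hT, -, hP⟩ := exists_stiefel_lift h.framed
  have him : ∀ {z : ℂ} {r : ℝ}, 0 ≤ r → z ^ 2 = r → z.im = 0 := fun {z r} hr hz => by
    have h1 := congrArg Complex.re hz
    have h2 := congrArg Complex.im hz
    simp only [pow_two, Complex.mul_re, Complex.mul_im, Complex.ofReal_re,
      Complex.ofReal_im] at h1 h2
    have h3 : z.re * z.im = 0 := by linarith
    rcases mul_eq_zero.1 h3 with h4 | h4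
    · rw [h4] at h1
      nlinarith [mul_self_nonneg z.im]
    · exact h4
  -- For a loop in the `xz`-plane with framing `(0, 1, 0)` the squares of the coordinates are
  -- `(‖a‖ ± a 0) / 2 ≥ 0`.
  have hreal : ∀ e, RealValued (Φ e).row := fun e t i => by
    have hp := hP e t
    set a := (2 / (γ e).framed.length) • deriv (γ e).framed.γ t with ha
    have hab : ‖a‖ ^ 2 = a 0 ^ 2 + a 1 ^ 2 + a 2 ^ 2 := norm_sq_E3 a
    have hle := abs_le_of_sq_le_sq' (a := a 0) (b := ‖a‖)
      (by nlinarith [sq_nonneg (a 1), sq_nonneg (a 2)]) (norm_nonneg _)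
    rw [PlanarLoop.framed_V] at hp
    have h1 := (congrArg (fun p => p.1) hp).symm
    have h2 := (congrArg (fun p => p.2.2) hp).symm
    simp [hopfProducts, cross, cross_apply] at h1 h2
    fin_cases i
    · exact him (r := (‖a‖ + a 0) / 2) (by linarith [hle.1]) (by
        refine h1.trans ?_; push_cast; ring)
    · exact him (r := (‖a‖ - a 0) / 2) (by linarith [hle.2]) (by
        refine h2.trans ?_; push_cast; ring)
  choose R hR using fun e => Stiefel.exists_toComplex (hreal e)
  refine ⟨σ, R, ?_, fun e t => ?_⟩
  · simp only [hR]
    exact hΦ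
  · rw [hR, hT]

theorem mk_toPlanar_eq {R : Stiefel ℝ σ} {γ : PlanarLoop}
    (h : ∀ t, hopfTangent R.toComplex.row t = (2 / γ.framed.length) • deriv γ.framed.γ t) :
    Quotient.mk planarSetoid R.toPlanar = Quotient.mk planarSetoid γ := by
  refine (Quotient.sound (planarSimilar_of_deriv (one_mem _)
    (div_pos two_pos γ.framed.length_pos) fun t => ?_)).symm
  have h1 : planeToSpace (deriv R.toPlanar.1.1 t) =
      planeToSpace ((2 / γ.framed.length) • deriv γ.1.1 t) := by
    rw [map_smul, ← PlanarLoop.deriv_framed, ← PlanarLoop.deriv_framed, ← h, R.framed_toPlanar,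
      R.toComplex.deriv_toFramed]
  have h2 := congrArg spaceToPlane h1
  rw [spaceToPlane_planeToSpace, spaceToPlane_planeToSpace] at h2
  simpa using h2

theorem realCoordinates_surjective (c : PlanarModuli) :
    ∃ (σ : ℤˣ) (R : Stiefel ℝ σ), realCoordinates σ (Quotient.mk _ R) = c := by
  induction c using Quotient.inductionOn with | _ γ
  obtain ⟨σ, R, -, h⟩ := exists_real_stiefel_lift (E := ℝ) (γ := fun _ => γ)
    (γ.1.2.1.comp contDiff_snd)
  exact ⟨σ, R 0, mk_toPlanar_eq (h 0)⟩

theorem planarInclusion_mk {R : Stiefel ℝ σ} :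
    planarInclusion (realCoordinates σ (Quotient.mk _ R)) =
      complexCoordinates σ (Quotient.mk _ R.toComplex) :=
  congrFun (planarInclusion_realCoordinates σ) _

theorem realCoordinates_eq_of_planarInclusion_eq {R : Stiefel ℝ σ} {S : Stiefel ℝ τ}
    (h : planarInclusion (realCoordinates σ (Quotient.mk _ R)) =
      planarInclusion (realCoordinates τ (Quotient.mk _ S))) :
    (⟨σ, Quotient.mk _ R⟩ : Σ σ, Grassmannian ℝ σ) = ⟨τ, Quotient.mk _ S⟩ := by
  rw [planarInclusion_mk, planarInclusion_mk] at h
  obtain ⟨rfl, -⟩ := complexCoordinates_eq_iff.1 h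
  have h1 := complexCoordinates_injective σ h
  rw [Grassmannian.inclusion_injective σ (a₁ := Quotient.mk _ R) (a₂ := Quotient.mk _ S) h1]

theorem planarInclusion_injective : Function.Injective planarInclusion := fun c d h => by
  obtain ⟨σ, R, rfl⟩ := realCoordinates_surjective c
  obtain ⟨τ, S, rfl⟩ := realCoordinates_surjective d
  exact congrArg (fun y : Σ σ, Grassmannian ℝ σ => realCoordinates y.1 y.2)
    (realCoordinates_eq_of_planarInclusion_eq h)

theorem realCoordinates_bijective :
    Function.Bijective (fun y : Σ σ, Grassmannian ℝ σ => realCoordinates y.1 y.2) := by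
  constructor
  · rintro ⟨σ, y⟩ ⟨τ, z⟩ h
    induction y using Quotient.inductionOn with | _ R
    induction z using Quotient.inductionOn with | _ S
    exact realCoordinates_eq_of_planarInclusion_eq (congrArg planarInclusion h)
  · intro c
    obtain ⟨σ, R, h⟩ := realCoordinates_surjective c
    exact ⟨⟨σ, _⟩, h⟩

theorem isPlot_real_stiefel_iff {n : ℕ} {p : EuclideanSpace ℝ (Fin n) → Stiefel ℝ σ} :
    IsPlot p ↔ SmoothFamily fun y => (p y).toComplex := by
  constructor
  · rintro ⟨h1, h2⟩
    refine contDiff_pi.2 fun i => ?_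
    fin_cases i
    · exact Complex.ofRealCLM.contDiff.comp h1
    · exact Complex.ofRealCLM.contDiff.comp h2
  · intro h
    exact ⟨contDiff_complex_re (contDiff_pi.1 h 0), contDiff_complex_re (contDiff_pi.1 h 1)⟩

theorem exists_local_real_coordinates {n : ℕ} {p : EuclideanSpace ℝ (Fin n) → PlanarModuli}
    (hp : IsPlot p) (x : EuclideanSpace ℝ (Fin n)) :
    ∃ (σ : ℤˣ) (R : EuclideanSpace ℝ (Fin n) → Stiefel ℝ σ), IsPlot R ∧
      ∀ᶠ y in 𝓝 x, p y = realCoordinates σ (Quotient.mk _ (R y)) := by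
  obtain ⟨q, hq, hpq⟩ := hp x
  obtain ⟨σ, R, hR, h⟩ := exists_real_stiefel_lift (isPlot_planarLoop_iff.1 hq)
  exact ⟨σ, R, isPlot_real_stiefel_iff.2 hR, hpq.mono fun y hy =>
    hy.trans (mk_toPlanar_eq (h y)).symm⟩

theorem realCoordinates_eq_imp {R : Stiefel ℝ σ} {S : Stiefel ℝ τ}
    (h : realCoordinates σ (Quotient.mk _ R) = realCoordinates τ (Quotient.mk _ S)) : σ = τ :=
  congrArg Sigma.fst (realCoordinates_bijective.1 (a₁ := ⟨σ, Quotient.mk _ R⟩)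
    (a₂ := ⟨τ, Quotient.mk _ S⟩) h)

theorem isCoordinateSystem_realCoordinates : IsCoordinateSystem realCoordinates := by
  refine ⟨realCoordinates_bijective, fun σ => IsInduction.isOpenInduction
    (isInduction_of_local (fun y z h => ?_) (dSmooth_quotient fun _ _ hq => ?_)
      fun n p hp x => ?_) ?_⟩
  · have := realCoordinates_bijective.1 (a₁ := ⟨σ, y⟩) (a₂ := ⟨σ, z⟩) h
    exact eq_of_heq (Sigma.mk.inj this).2
  · exact isPlot_quotient_mk (SmoothFamily.toPlanar (isPlot_real_stiefel_iff.1 hq))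
  · obtain ⟨τ, R, hR, h⟩ := exists_local_real_coordinates hp x
    obtain ⟨S, hS⟩ := Quotient.exists_rep (p x)
    have hx := h.self_of_nhds
    rw [Function.comp_apply, ← hS] at hx
    obtain rfl := realCoordinates_eq_imp hx
    exact ⟨_, isPlot_quotient_mk hR, h⟩
  · refine isOpen_dTopology_of_eventually fun n p hp x hx => ?_
    obtain ⟨τ, R, hR, h⟩ := exists_local_real_coordinates hp x
    obtain ⟨y, hy⟩ := hx
    obtain ⟨S, rfl⟩ := Quotient.exists_rep y
    obtain rfl := realCoordinates_eq_imp (hy.trans h.self_of_nhds)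
    exact h.mono fun y hy => ⟨_, hy.symm⟩

theorem dSmooth_planarInclusion : DSmooth planarInclusion :=
  dSmooth_quotient fun _ _ hq => isPlot_quotient_mk (SmoothPlanarFamily.framed hq)

theorem hasRealSpan_of_mem_range {Φ : Stiefel ℂ σ}
    (h : complexCoordinates σ (Quotient.mk _ Φ) ∈ range planarInclusion) : Φ.HasRealSpan := by
  obtain ⟨c, hc⟩ := h
  obtain ⟨τ, R, rfl⟩ := realCoordinates_surjective c
  rw [planarInclusion_mk] at hc
  obtain ⟨rfl, -⟩ := complexCoordinates_eq_iff.1 hc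
  exact ⟨R, (complexCoordinates_injective _ hc).symm⟩

theorem Stiefel.HasRealSpan.mem_range {Φ : Stiefel ℂ σ} (h : Φ.HasRealSpan) :
    complexCoordinates σ (Quotient.mk _ Φ) ∈ range planarInclusion := by
  obtain ⟨R, hR⟩ := h
  exact ⟨realCoordinates σ (Quotient.mk _ R), by rw [planarInclusion_mk, hR]⟩

theorem isInduction_planarInclusion : IsInduction planarInclusion := by
  refine isInduction_of_local planarInclusion_injective dSmooth_planarInclusion fun n p hp x => ?_
  obtain ⟨σ, Φ, hΦ, h⟩ := exists_local_coordinates hp x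
  obtain ⟨R, hR, hΦR⟩ := exists_real_family hΦ (h.mono fun y hy =>
    hasRealSpan_of_mem_range ⟨p y, hy⟩)
  refine ⟨fun y => realCoordinates σ (Quotient.mk _ (R y)),
    isPlot_quotient_mk (SmoothFamily.toPlanar hR), ?_⟩
  filter_upwards [h, hΦR] with y h1 h2
  rw [planarInclusion_mk, ← h2]
  exact h1

end Planar

/-! ### The embedding of the planar loops -/

section Embedding

/-- An induction with split submanifold charts is a topological embedding. -/
theorem isEmbedding_of_charts {X Y : Type*} [DiffeologicalSpace X] [DiffeologicalSpace Y]
    {f : X → Y} (hf : IsInduction f) (h : ∀ x, HasSubmanifoldChart (range f) (f x)) :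
    @Topology.IsEmbedding X Y dTopology dTopology f := by
  let _ : TopologicalSpace X := dTopology
  let _ : TopologicalSpace Y := dTopology
  have hs : DSmooth f := fun n p hp => (hf.2 n p).1 hp
  refine ⟨⟨le_antisymm (continuous_iff_le_induced.1 hs.continuous) fun U hU => ?_⟩, hf.1⟩
  have key : ∀ x ∈ U, ∃ V : Set Y, IsOpen V ∧ f x ∈ V ∧ f ⁻¹' V ⊆ U := fun x hx => by
    obtain ⟨σ, d, F, F', -, -, O, h0, χ, hO, hχ, hχ0, hS⟩ := h x
    -- `Z` is the cylinder over the set that corresponds to `U` in the chart.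
    let Z : Set O := {z | ∃ h : ((z : F × F').1, 0) ∈ O, ∃ c ∈ U, f c = χ ⟨_, h⟩}
    have hZ : IsOpen[dTopology] Z := by
      refine isOpen_dTopology_of_eventually fun n p hp y hy => ?_
      obtain ⟨hy0, c, hc, hcy⟩ := hy
      have hp0 : IsPlot (fun y => (((p y : F × F').1, 0) : F × F')) := ⟨hp.1, isPlot_const⟩
      obtain ⟨u, hu, huo, hyu⟩ := eventually_nhds_iff.1 (eventually_mem_of_isOpen hO hp0 hy0)
      obtain ⟨r, hr, hru, hry⟩ := exists_smooth_retract huo hyu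
      let q : EuclideanSpace ℝ (Fin n) → O := fun y => ⟨_, hu (r y) (hru y)⟩
      have hq : IsPlot q := isPlot_reparam hp0 hr
      have hqf : ∀ y, χ (q y) ∈ range f := fun y => (hS _).2 rfl
      choose g hg using hqf
      have hgp : IsPlot g := (hf.2 n g).2 (by
        rw [show f ∘ g = χ ∘ q from funext hg]
        exact (hχ.1.2 n q).1 hq)
      have hgy : g y ∈ U := by
        have : f (g y) = f c := by
          rw [hg, hcy]
          exact congrArg χ (Subtype.ext (by simp [q, hry.self_of_nhds]))
        rwa [hf.1 this]
      filter_upwards [eventually_mem_of_isOpen hU hgp hgy, hry] with w h1 h2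
      have e : ((p (r w) : F × F').1, (0 : F')) = ((p w : F × F').1, 0) := by rw [h2]
      have hw : ((p w : F × F').1, (0 : F')) ∈ O := e ▸ (q w).2
      exact ⟨hw, g w, h1, (hg w).trans (congrArg χ (Subtype.ext e))⟩
    refine ⟨χ '' Z, hχ.2 Z hZ, ⟨⟨0, h0⟩, ⟨h0, x, hx, hχ0.symm⟩, hχ0⟩, ?_⟩
    rintro c ⟨z, ⟨hz, c', hc', hcz⟩, hzc⟩
    have hz0 : (z : F × F').2 = 0 := (hS z).1 ⟨c, hzc.symm⟩
    have e : z = ⟨((z : F × F').1, 0), hz⟩ := Subtype.ext (Prod.ext rfl hz0)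
    have : f c = f c' := by rw [hcz, ← e, hzc]
    rwa [hf.1 this]
  refine ⟨⋃₀ {V | IsOpen V ∧ f ⁻¹' V ⊆ U}, isOpen_sUnion fun V hV => hV.1, ?_⟩
  ext x
  constructor
  · rintro ⟨V, ⟨hV, hVU⟩, hx⟩
    exact hVU hx
  · intro hx
    obtain ⟨V, hV, hxV, hVU⟩ := key x hx
    exact ⟨V, ⟨hV, hVU⟩, hxV⟩

variable {σ : ℤˣ}

/-- A plane-valued loop or path as a pair of real-valued functions. -/
noncomputable def realRow (f : loops σ E2) (t : ℝ) (i : Fin 2) : ℂ := ((f.1 t i : ℝ) : ℂ)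

theorem contDiff_realRow {E : Type} [NormedAddCommGroup E] [NormedSpace ℝ E] {f : E → loops σ E2}
    (hf : ContDiff ℝ ∞ fun q : E × ℝ => (f q.1).1 q.2) :
    ContDiff ℝ ∞ (Function.uncurry fun x => realRow (f x)) :=
  contDiff_pi.2 fun i => Complex.ofRealCLM.contDiff.comp (contDiff_euclidean.1 hf i)

theorem continuous_realRow (f : loops σ E2) : Continuous (realRow f) :=
  continuous_pi fun i => Complex.continuous_ofReal.comp
    ((contDiff_euclidean.1 f.2.1 i).continuous)

theorem realValued_realRow (f : loops σ E2) : RealValued (realRow f) :=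
  fun _ _ => Complex.ofReal_im _

theorem realRow_period (f : loops σ E2) (t : ℝ) : realRow f (t + 2) = σ • realRow f t := by
  ext i
  have := f.2.2 t
  rw [realRow, this]
  rcases Int.units_eq_one_or σ with rfl | rfl <;> simp [Units.smul_def, realRow]

/-- The pair of real-valued functions with values `re (G t i)`. -/
noncomputable def reLoop (G : ℝ → Fin 2 → ℂ) (hG : ContDiff ℝ ∞ G)
    (hp : ∀ t, G (t + 2) = σ • G t) : loops σ E2 :=
  ⟨fun t => !₂[(G t 0).re, (G t 1).re], by
    rw [contDiff_euclidean]
    intro i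
    fin_cases i
    · exact contDiff_complex_re (contDiff_pi.1 hG 0)
    · exact contDiff_complex_re (contDiff_pi.1 hG 1), fun t => by
    ext i
    simp only [hp]
    fin_cases i <;> rcases Int.units_eq_one_or σ with rfl | rfl <;> simp [Units.smul_def]⟩

theorem realRow_reLoop {G : ℝ → Fin 2 → ℂ} (hG : ContDiff ℝ ∞ G)
    (hp : ∀ t, G (t + 2) = σ • G t) (t : ℝ) (i : Fin 2) :
    realRow (reLoop G hG hp) t i = ((G t i).re : ℂ) := by
  fin_cases i <;> rfl

variable (Φ₀ : Stiefel ℝ σ)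

/-- The pairs of real functions that are orthogonal to the plane spanned by `Φ₀`. -/
noncomputable def normalSpace : Submodule ℝ (loops σ E2) where
  carrier := {f | gram Φ₀.toComplex.row (realRow f) = 0}
  zero_mem' := by
    change gram _ _ = 0
    ext i j
    simp [gram, realRow]
  add_mem' := fun {f g} (hf : gram _ _ = 0) (hg : gram _ _ = 0) => by
    change gram _ _ = 0
    have e : realRow (f + g) = realRow f + realRow g := by
      ext t i
      simp [realRow]
    rw [e, gram_add_right Φ₀.toComplex.isFrame.contDiff.continuous (continuous_realRow f)
      (continuous_realRow g), hf, hg, add_zero]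
  smul_mem' := fun c f (hf : gram _ _ = 0) => by
    change gram _ _ = 0
    have e : realRow (c • f) = rmul (realRow f) ((c : ℂ) • (1 : Matrix (Fin 2) (Fin 2) ℂ)) := by
      ext t i
      fin_cases i <;> simp [realRow, rmul_apply, mul_comm]
    rw [e, gram_rmul_right Φ₀.toComplex.isFrame.contDiff.continuous (continuous_realRow f), hf,
      zero_mul]

theorem isClosed_normalSpace : IsClosed[dTopology] (normalSpace Φ₀ : Set (loops σ E2)) := by
  let _ : TopologicalSpace (loops σ E2) := dTopology
  refine ⟨isOpen_iff_preimages_plots.2 fun n p hp => ?_⟩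
  have hs : SmoothMatrix fun y => gram Φ₀.toComplex.row (realRow (p y)) :=
    smoothMatrix_gram (F := fun _ => Φ₀.toComplex.row)
      (Φ₀.toComplex.isFrame.contDiff.comp contDiff_snd) (contDiff_realRow hp)
  have hc : Continuous fun y => gram Φ₀.toComplex.row (realRow (p y)) :=
    continuous_matrix fun i j => (hs i j).continuous
  exact (isClosed_singleton.preimage hc).isOpen_compl

/-- The pair `Φ₀ + x + i y`, for real `x` and `y` that are orthogonal to `Φ₀`. These are the pairs
whose matrix of inner products with `Φ₀` is the identity. -/
noncomputable def chartRow (z : normalSpace Φ₀ × normalSpace Φ₀) (t : ℝ) (i : Fin 2) : ℂ :=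
  Φ₀.toComplex.row t i + realRow z.1.1 t i + Complex.I * realRow z.2.1 t i

theorem chartRow_eq (z : normalSpace Φ₀ × normalSpace Φ₀) :
    chartRow Φ₀ z = Φ₀.toComplex.row + realRow z.1.1 +
      rmul (realRow z.2.1) (Complex.I • (1 : Matrix (Fin 2) (Fin 2) ℂ)) := by
  ext t i
  fin_cases i <;> simp [chartRow, rmul_apply, mul_comm]

theorem gram_chartRow (z : normalSpace Φ₀ × normalSpace Φ₀) :
    gram Φ₀.toComplex.row (chartRow Φ₀ z) = 1 := by
  have c0 := Φ₀.toComplex.isFrame.contDiff.continuous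
  have c1 := continuous_realRow z.1.1
  have c2 := continuous_realRow z.2.1
  have h1 : gram Φ₀.toComplex.row (realRow z.1.1) = 0 := z.1.2
  have h2 : gram Φ₀.toComplex.row (realRow z.2.1) = 0 := z.2.2
  rw [chartRow_eq, gram_add_right c0 (c0.add c1) (continuous_rmul c2 _), gram_add_right c0 c0 c1,
    gram_rmul_right c0 c2, h1, h2, Φ₀.toComplex.isFrame.gram_self, zero_mul, add_zero, add_zero]

theorem contDiff_chartRow {E : Type} [NormedAddCommGroup E] [NormedSpace ℝ E]
    {z : E → normalSpace Φ₀ × normalSpace Φ₀}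
    (h1 : ContDiff ℝ ∞ fun q : E × ℝ => (z q.1).1.1.1 q.2)
    (h2 : ContDiff ℝ ∞ fun q : E × ℝ => (z q.1).2.1.1 q.2) :
    ContDiff ℝ ∞ (Function.uncurry fun x => chartRow Φ₀ (z x)) := by
  refine contDiff_pi.2 fun i => ?_
  exact (((contDiff_pi.1 Φ₀.toComplex.isFrame.contDiff i).comp contDiff_snd).add
    (contDiff_pi.1 (contDiff_realRow (f := fun x => (z x).1.1) h1) i)).add
    (contDiff_const.mul (contDiff_pi.1 (contDiff_realRow (f := fun x => (z x).2.1) h2) i))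

theorem chartRow_period (z : normalSpace Φ₀ × normalSpace Φ₀) (t : ℝ) :
    chartRow Φ₀ z (t + 2) = σ • chartRow Φ₀ z t := by
  ext i
  rw [chartRow, Φ₀.toComplex.row_period, realRow_period, realRow_period]
  rcases Int.units_eq_one_or σ with rfl | rfl
  · simp [chartRow]
  · simp [Units.smul_def, chartRow]
    try ring

theorem chartRow_injective {z z' : normalSpace Φ₀ × normalSpace Φ₀}
    (h : chartRow Φ₀ z = chartRow Φ₀ z') : z = z' := by
  have key : ∀ t i, (z.1.1.1 t i = z'.1.1.1 t i) ∧ z.2.1.1 t i = z'.2.1.1 t i := fun t i => by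
    have h1 := congrFun (congrFun h t) i
    have hr := congrArg Complex.re h1
    have hi := congrArg Complex.im h1
    simp [chartRow, realRow] at hr hi
    exact ⟨hr, hi⟩
  refine Prod.ext (Subtype.ext (Subtype.ext (funext fun t => PiLp.ext fun i => (key t i).1)))
    (Subtype.ext (Subtype.ext (funext fun t => PiLp.ext fun i => (key t i).2)))

/-- The domain of the chart: no common zeros. -/
def chartDomain : Set (normalSpace Φ₀ × normalSpace Φ₀) := {z | ∀ t, chartRow Φ₀ z t ≠ 0}

theorem ne_zero_of_period {F : ℝ → Fin 2 → ℂ} (hp : ∀ t, F (t + 2) = σ • F t)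
    (h : ∀ t ∈ Icc (0 : ℝ) 2, F t ≠ 0) (t : ℝ) : F t ≠ 0 := by
  have hper : Function.Periodic (fun t => ‖F t‖) 2 := fun t => by
    simp only [hp]
    rcases Int.units_eq_one_or σ with rfl | rfl <;> simp [Units.smul_def]
  obtain ⟨s, hs, hst⟩ := hper.exists_mem_Ico₀ two_pos t
  rw [← norm_ne_zero_iff, hst, norm_ne_zero_iff]
  exact h s ⟨hs.1, hs.2.le⟩

theorem eventually_ne_zero {E : Type} [TopologicalSpace E] {F : E → ℝ → Fin 2 → ℂ}
    (hF : Continuous (Function.uncurry F)) (hp : ∀ x t, F x (t + 2) = σ • F x t) {x : E}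
    (h : ∀ t, F x t ≠ 0) : ∀ᶠ y in 𝓝 x, ∀ t, F y t ≠ 0 := by
  have : ∀ᶠ y in 𝓝 x, ∀ t ∈ Icc (0 : ℝ) 2, F y t ≠ 0 := by
    refine isCompact_Icc.eventually_forall_of_forall_eventually fun t _ => ?_
    exact hF.continuousAt.eventually_ne (h t)
  exact this.mono fun y hy => ne_zero_of_period (hp y) hy

theorem isOpen_chartDomain : IsOpen[dTopology] (chartDomain Φ₀) :=
  isOpen_dTopology_of_eventually fun _ p hp _ hx =>
    eventually_ne_zero (F := fun y => chartRow Φ₀ (p y)) (contDiff_chartRow Φ₀ hp.1 hp.2).continuous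
      (fun y => chartRow_period Φ₀ (p y)) hx

theorem isPreframe_chartRow (z : chartDomain Φ₀) : IsPreframe σ (chartRow Φ₀ z.1) where
  contDiff := by
    have := contDiff_chartRow (E := ℝ) Φ₀ (z := fun _ => z.1) (z.1.1.1.2.1.comp contDiff_snd)
      (z.1.2.1.2.1.comp contDiff_snd)
    exact contDiff_slice this 0
  period := chartRow_period Φ₀ z.1
  ne_zero := z.2
  indep := ⟨_, Φ₀.toComplex.isFrame.contDiff.continuous, by
    rw [gram_chartRow, Matrix.det_one]; exact one_ne_zero⟩

/-- The chart of the moduli space of framed loops around a planar loop: a plane near `Φ₀` is the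
graph of a linear map from `Φ₀` to its orthogonal complement. -/
noncomputable def chart (z : chartDomain Φ₀) : FramedModuli :=
  complexCoordinates σ (Quotient.mk _ (isPreframe_chartRow Φ₀ z).orthonormalize)

/-- Equality of spans in terms of pairs that need not be orthonormal. -/
theorem mk_orthonormalize_eq_iff {F : ℝ → Fin 2 → ℂ} (hF : IsPreframe σ F) {Ψ : Stiefel ℂ σ} :
    Quotient.mk (stiefelSetoid ℂ σ) hF.orthonormalize = Quotient.mk _ Ψ ↔
      ∃ M : Matrix (Fin 2) (Fin 2) ℂ, M.det ≠ 0 ∧ F = rmul Ψ.row M := by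
  have hd := gramSchmidtMatrix_det hF.re_pos hF.det_pos
  constructor
  · intro h
    obtain ⟨U, hU, hUr⟩ := Stiefel.mk_eq_iff.1 h.symm
    refine ⟨U * (gramSchmidtMatrix (gram F F))⁻¹, ?_, ?_⟩
    · rw [Matrix.det_mul, Matrix.det_nonsing_inv, Ring.inverse_eq_inv']
      refine mul_ne_zero (fun h0 => ?_) (inv_ne_zero hd)
      have := Matrix.det_of_mem_unitary hU
      rw [h0] at this
      simpa using CStarRing.norm_of_mem_unitary this
    · rw [← rmul_rmul, ← hUr, hF.row_orthonormalize, rmul_rmul,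
        Matrix.mul_nonsing_inv _ (isUnit_iff_ne_zero.2 hd), rmul_one]
  · rintro ⟨M, -, hM⟩
    refine (Stiefel.mk_eq_of_rmul (M := M * gramSchmidtMatrix (gram F F)) ?_).symm
    rw [hF.row_orthonormalize, ← rmul_rmul, ← hM]

theorem chart_eq_iff {z : chartDomain Φ₀} {τ : ℤˣ} {Ψ : Stiefel ℂ τ} :
    chart Φ₀ z = complexCoordinates τ (Quotient.mk _ Ψ) ↔
      σ = τ ∧ ∃ M : Matrix (Fin 2) (Fin 2) ℂ, M.det ≠ 0 ∧ chartRow Φ₀ z.1 = rmul Ψ.row M := by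
  constructor
  · intro h
    obtain ⟨rfl, -⟩ := complexCoordinates_eq_iff.1 h
    exact ⟨rfl, (mk_orthonormalize_eq_iff _).1 (complexCoordinates_injective _ h)⟩
  · rintro ⟨rfl, h⟩
    rw [chart, (mk_orthonormalize_eq_iff (isPreframe_chartRow Φ₀ z)).2 h]

theorem chart_injective : Function.Injective (chart Φ₀) := fun z z' h => by
  have c0 := Φ₀.toComplex.isFrame.contDiff.continuous
  obtain ⟨Ψ, hz'⟩ : ∃ Ψ : Stiefel ℂ σ, chart Φ₀ z' = complexCoordinates σ (Quotient.mk _ Ψ) :=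
    ⟨_, rfl⟩
  obtain ⟨-, M, -, hM⟩ := (chart_eq_iff Φ₀).1 (h.trans hz')
  obtain ⟨-, M', hd', hM'⟩ := (chart_eq_iff Φ₀).1 hz'
  have c' := (isPreframe_chartRow Φ₀ z').contDiff.continuous
  have e : chartRow Φ₀ z.1 = rmul (chartRow Φ₀ z'.1) (M'⁻¹ * M) := by
    rw [hM', rmul_rmul, ← mul_assoc, Matrix.mul_nonsing_inv _ (isUnit_iff_ne_zero.2 hd'), one_mul]
    exact hM
  have h1 := gram_chartRow Φ₀ z.1
  rw [e, gram_rmul_right c0 c', gram_chartRow, one_mul] at h1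
  rw [h1, rmul_one] at e
  exact Subtype.ext (chartRow_injective Φ₀ e)

/-- Every pair in general position to `Φ₀` can be normalized against `Φ₀`. -/
theorem exists_chartRow_eq {G : ℝ → Fin 2 → ℂ} (hG : ContDiff ℝ ∞ G)
    (hp : ∀ t, G (t + 2) = σ • G t) (h : gram Φ₀.toComplex.row G = 1) :
    ∃ z : normalSpace Φ₀ × normalSpace Φ₀, chartRow Φ₀ z = G ∧
      (∀ t i, (z.1.1.1 t i : ℝ) = (G t i - Φ₀.toComplex.row t i).re) ∧
      ∀ t i, (z.2.1.1 t i : ℝ) = (G t i - Φ₀.toComplex.row t i).im := by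
  have c0 := Φ₀.toComplex.isFrame.contDiff.continuous
  -- `D` is orthogonal to the real plane `Φ₀`, hence so are its real and imaginary parts.
  set D : ℝ → Fin 2 → ℂ := G - Φ₀.toComplex.row with hD
  have hDs : ContDiff ℝ ∞ D := hG.sub Φ₀.toComplex.isFrame.contDiff
  have hDp : ∀ t, D (t + 2) = σ • D t := fun t => by
    rw [hD, Pi.sub_apply, hp, Φ₀.toComplex.row_period, Pi.sub_apply, smul_sub]
  set D' : ℝ → Fin 2 → ℂ := rmul D ((-Complex.I) • (1 : Matrix (Fin 2) (Fin 2) ℂ)) with hD'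
  have hDs' : ContDiff ℝ ∞ D' := contDiff_rmul hDs _
  have hDp' : ∀ t, D' (t + 2) = σ • D' t := fun t => by
    rw [hD', rmul, rmul, hDp, Matrix.smul_vecMul]
  have hre : ∀ t i, (D' t i).re = (D t i).im := fun t i => by
    rw [hD', rmul_apply]
    fin_cases i <;> simp
  have hdec : D = realRow (reLoop D hDs hDp) +
      rmul (realRow (reLoop D' hDs' hDp')) (Complex.I • (1 : Matrix (Fin 2) (Fin 2) ℂ)) := by
    ext t i
    rw [Pi.add_apply, Pi.add_apply, rmul_apply, realRow_reLoop, realRow_reLoop, realRow_reLoop, hre,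
      hre]
    apply Complex.ext <;> fin_cases i <;> simp
  have hg : gram Φ₀.toComplex.row D = 0 := by
    have e : G = D + Φ₀.toComplex.row := by rw [hD, sub_add_cancel]
    have h' := h
    rw [e, gram_add_right c0 hDs.continuous c0, Φ₀.toComplex.isFrame.gram_self] at h'
    exact add_eq_right.1 h'
  rw [hdec, gram_add_right c0 (continuous_realRow _) (continuous_rmul (continuous_realRow _) _),
    gram_rmul_right c0 (continuous_realRow _)] at hg
  have hX := Φ₀.realValued_toComplex.gram (realValued_realRow (reLoop D hDs hDp))
  have hY := Φ₀.realValued_toComplex.gram (realValued_realRow (reLoop D' hDs' hDp'))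
  have hXY : gram Φ₀.toComplex.row (realRow (reLoop D hDs hDp)) = 0 ∧
      gram Φ₀.toComplex.row (realRow (reLoop D' hDs' hDp')) = 0 := by
    set X := gram Φ₀.toComplex.row (realRow (reLoop D hDs hDp))
    set Y := gram Φ₀.toComplex.row (realRow (reLoop D' hDs' hDp'))
    constructor
    · ext i j
      have := congrArg Complex.re (congrFun (congrFun hg i) j)
      simp at this
      exact Complex.ext (by simpa [hY i j] using this) (hX i j)
    · ext i j
      have := congrArg Complex.im (congrFun (congrFun hg i) j)
      simp at this
      exact Complex.ext (by simpa [hX i j] using this) (hY i j)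
  refine ⟨(⟨_, hXY.1⟩, ⟨_, hXY.2⟩), ?_, fun t i => ?_, fun t i => ?_⟩
  · rw [chartRow_eq, add_assoc, ← hdec, hD, add_sub_cancel]
  · fin_cases i <;> rfl
  · refine Eq.trans ?_ (hre t i)
    fin_cases i <;> rfl

theorem exists_chart_eq {Ψ : Stiefel ℂ σ} (h : (gram Φ₀.toComplex.row Ψ.row).det ≠ 0) :
    ∃ z : chartDomain Φ₀, chart Φ₀ z = complexCoordinates σ (Quotient.mk _ Ψ) ∧
      chartRow Φ₀ z.1 = rmul Ψ.row (gram Φ₀.toComplex.row Ψ.row)⁻¹ ∧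
      (∀ t i, (z.1.1.1.1 t i : ℝ) = (rmul Ψ.row (gram Φ₀.toComplex.row Ψ.row)⁻¹ t i -
        Φ₀.toComplex.row t i).re) ∧
      ∀ t i, (z.1.2.1.1 t i : ℝ) = (rmul Ψ.row (gram Φ₀.toComplex.row Ψ.row)⁻¹ t i -
        Φ₀.toComplex.row t i).im := by
  have hd : ((gram Φ₀.toComplex.row Ψ.row)⁻¹).det ≠ 0 := by
    rw [Matrix.det_nonsing_inv, Ring.inverse_eq_inv']
    exact inv_ne_zero h
  have hpre := Ψ.isFrame.isPreframe.mul hd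
  obtain ⟨z, hz, h1, h2⟩ := exists_chartRow_eq Φ₀ hpre.contDiff hpre.period (by
    rw [gram_rmul_right Φ₀.toComplex.isFrame.contDiff.continuous Ψ.isFrame.contDiff.continuous,
      Matrix.mul_nonsing_inv _ (isUnit_iff_ne_zero.2 h)])
  refine ⟨⟨z, ?_⟩, (chart_eq_iff Φ₀).2 ⟨rfl, _, hd, hz⟩, hz, h1, h2⟩
  intro t
  rw [hz]
  exact hpre.ne_zero t

theorem det_gram_ne_zero_of_mem_range {Ψ : Stiefel ℂ σ}
    (h : complexCoordinates σ (Quotient.mk _ Ψ) ∈ range (chart Φ₀)) :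
    (gram Φ₀.toComplex.row Ψ.row).det ≠ 0 := by
  obtain ⟨z, hz⟩ := h
  obtain ⟨-, M, hM, hzM⟩ := (chart_eq_iff Φ₀).1 hz
  have h1 := gram_chartRow Φ₀ z.1
  rw [hzM, gram_rmul_right Φ₀.toComplex.isFrame.contDiff.continuous
    Ψ.isFrame.contDiff.continuous] at h1
  have h2 := congrArg Matrix.det h1
  rw [Matrix.det_mul, Matrix.det_one] at h2
  exact left_ne_zero_of_mul_eq_one h2

theorem smoothMatrix_gram_const {E : Type} [NormedAddCommGroup E] [NormedSpace ℝ E] [ProperSpace E]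
    {Φ : E → Stiefel ℂ σ} (hΦ : SmoothFamily Φ) :
    SmoothMatrix fun y => gram Φ₀.toComplex.row (Φ y).row :=
  smoothMatrix_gram (F := fun _ => Φ₀.toComplex.row)
    (Φ₀.toComplex.isFrame.contDiff.comp contDiff_snd) hΦ

theorem isOpenInduction_chart : IsOpenInduction (chart Φ₀) := by
  refine IsInduction.isOpenInduction (isInduction_of_local (chart_injective Φ₀) (fun n p hp => ?_)
    fun n p hp x => ?_) ?_
  · have h1 := smoothFamily_orthonormalize (F := fun y => chartRow Φ₀ (p y).1)
      (contDiff_chartRow Φ₀ hp.1 hp.2) fun y => isPreframe_chartRow Φ₀ (p y)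
    exact dSmooth_complexCoordinates σ n _ (isPlot_quotient_mk (isPlot_stiefel_iff.2 h1))
  · obtain ⟨τ, Φ, hΦ, h⟩ := exists_local_coordinates hp x
    obtain ⟨rfl, -⟩ := (chart_eq_iff Φ₀).1 h.self_of_nhds
    have hs := smoothMatrix_gram_const Φ₀ hΦ
    have hd : ∀ᶠ y in 𝓝 x, (gram Φ₀.toComplex.row (Φ y).row).det ≠ 0 :=
      hs.det.continuous.continuousAt.eventually_ne
        (det_gram_ne_zero_of_mem_range Φ₀ ⟨p x, h.self_of_nhds⟩)
    obtain ⟨r, hr, hru, hrx⟩ := exists_smooth_retraction hd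
    choose q hq1 hq2 hq3 hq4 using fun y => exists_chart_eq Φ₀ (hru y)
    have hsm : ContDiff ℝ ∞ (Function.uncurry fun y =>
        rmul (Φ (r y)).row (gram Φ₀.toComplex.row (Φ (r y)).row)⁻¹) :=
      contDiff_rmul_family (hΦ.comp hr) ((hs.comp hr).inv hru)
    have hc : ∀ i, ContDiff ℝ ∞ fun w : EuclideanSpace ℝ (Fin n) × ℝ =>
        rmul (Φ (r w.1)).row (gram Φ₀.toComplex.row (Φ (r w.1)).row)⁻¹ w.2 i -
          Φ₀.toComplex.row w.2 i := fun i =>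
      (contDiff_pi.1 hsm i).sub ((contDiff_pi.1 Φ₀.toComplex.isFrame.contDiff i).comp contDiff_snd)
    have hre : ContDiff ℝ ∞ fun w : EuclideanSpace ℝ (Fin n) × ℝ => (q w.1).1.1.1.1 w.2 :=
      contDiff_euclidean.2 fun i => by
        simp only [hq3]
        exact contDiff_complex_re (hc i)
    have him : ContDiff ℝ ∞ fun w : EuclideanSpace ℝ (Fin n) × ℝ => (q w.1).1.2.1.1 w.2 :=
      contDiff_euclidean.2 fun i => by
        simp only [hq4]
        exact contDiff_complex_im (hc i)
    refine ⟨q, ⟨hre, him⟩, ?_⟩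
    · filter_upwards [h, hrx] with y h1 h2
      rw [hq1, h2]
      exact h1
  · refine isOpen_dTopology_of_eventually fun n p hp x hx => ?_
    obtain ⟨τ, Φ, hΦ, h⟩ := exists_local_coordinates hp x
    have hx' := hx
    obtain ⟨z, hz⟩ := hx
    obtain ⟨rfl, -⟩ := (chart_eq_iff Φ₀).1 (hz.trans h.self_of_nhds)
    rw [h.self_of_nhds] at hx'
    have hd := (smoothMatrix_gram_const Φ₀ hΦ).det.continuous.continuousAt.eventually_ne
      (det_gram_ne_zero_of_mem_range Φ₀ hx')
    filter_upwards [h, hd] with y h1 h2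
    obtain ⟨z, hz, -⟩ := exists_chart_eq Φ₀ h2
    exact ⟨z, hz.trans h1.symm⟩

theorem zero_mem_chartDomain : (0 : normalSpace Φ₀ × normalSpace Φ₀) ∈ chartDomain Φ₀ := fun t => by
  have : chartRow Φ₀ 0 t = Φ₀.toComplex.row t := by
    ext i
    simp [chartRow, realRow]
  rw [this]
  exact Φ₀.toComplex.isFrame.ne_zero t

theorem chart_mem_range_iff (z : chartDomain Φ₀) : chart Φ₀ z ∈ range planarInclusion ↔ z.1.2 = 0
    := by
  constructor
  · intro h
    obtain ⟨R, hR⟩ := hasRealSpan_of_mem_range h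
    obtain ⟨M, hM, hzM⟩ := (mk_orthonormalize_eq_iff _).1 hR
    -- The normalized pair of a real plane is real, and `chartRow` is normalized already.
    have h1 := Φ₀.realValued_toComplex.normalize R.realValued_toComplex
      Φ₀.toComplex.isFrame.contDiff.continuous R.toComplex.isFrame.contDiff.continuous hM
    rw [← hzM, gram_chartRow, inv_one, rmul_one] at h1
    refine Subtype.ext (Subtype.ext (funext fun t => PiLp.ext fun i => ?_))
    have h2 := h1 t i
    have h3 := Φ₀.realValued_toComplex t i
    simpa [chartRow, realRow, h3] using h2
  · intro h
    have hreal : RealValued (chartRow Φ₀ z.1) := fun t i => by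
      have h3 := Φ₀.realValued_toComplex t i
      simp [chartRow, realRow, h, h3]
    obtain ⟨R, hR⟩ := Stiefel.exists_toComplex
      ((isPreframe_chartRow Φ₀ z).realValued_orthonormalize hreal)
    exact Stiefel.HasRealSpan.mem_range ⟨R, by rw [hR]⟩

theorem isSubmanifoldEmbedding_planarInclusion : IsSubmanifoldEmbedding planarInclusion := by
  have hchart : ∀ c, HasSubmanifoldChart (range planarInclusion) (planarInclusion c) := fun c => by
    obtain ⟨σ, Φ₀, rfl⟩ := realCoordinates_surjective c
    refine ⟨σ, 2, normalSpace Φ₀, normalSpace Φ₀, isClosed_normalSpace Φ₀, isClosed_normalSpace Φ₀,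
      chartDomain Φ₀, zero_mem_chartDomain Φ₀, chart Φ₀, isOpen_chartDomain Φ₀,
      isOpenInduction_chart Φ₀, ?_, chart_mem_range_iff Φ₀⟩
    rw [planarInclusion_mk]
    refine (chart_eq_iff Φ₀).2 ⟨rfl, 1, by rw [Matrix.det_one]; exact one_ne_zero, ?_⟩
    rw [rmul_one]
    ext t i
    simp [chartRow, realRow]
  exact ⟨isInduction_planarInclusion, isEmbedding_of_charts isInduction_planarInclusion hchart,
    hchart⟩

end Embedding

/-! ### The orientation double cover -/

section Orientation

/-- The velocity of a planar loop as a complex number. -/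
noncomputable def planarVelocity (γ : PlanarLoop) (t : ℝ) : ℂ :=
  ⟨deriv γ.1.1 t 0, deriv γ.1.1 t 1⟩

theorem SmoothPlanarFamily.contDiff_velocity {E : Type} [NormedAddCommGroup E] [NormedSpace ℝ E]
    {γ : E → PlanarLoop} (h : SmoothPlanarFamily γ) :
    ContDiff ℝ ∞ (Function.uncurry fun e => planarVelocity (γ e)) := by
  have hd : ContDiff ℝ ∞ (Function.uncurry fun e => deriv (γ e).1.1) := contDiff_derivSlice h
  have hc := contDiff_euclidean.1 hd
  exact Complex.equivRealProdCLM.symm.contDiff.comp ((hc 0).prodMk (hc 1))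

theorem continuous_planarVelocity (γ : PlanarLoop) : Continuous (planarVelocity γ) := by
  have h : SmoothPlanarFamily (fun _ : ℝ => γ) := γ.1.2.1.comp contDiff_snd
  exact (contDiff_slice h.contDiff_velocity 0).continuous

theorem PlanarLoop.deriv_reflect (γ : PlanarLoop) (t : ℝ) :
    deriv γ.reflect.1.1 t = reflPlane (deriv γ.1.1 t) := deriv_loopMap _ _ _

theorem planarVelocity_reflect (γ : PlanarLoop) (t : ℝ) :
    planarVelocity γ.reflect t = (starRingEnd ℂ) (planarVelocity γ t) := by
  rw [planarVelocity, γ.deriv_reflect, reflPlane_apply]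
  rfl

theorem reflPlane_eq_matAct (v : E2) : reflPlane v = matAct !![1, 0; 0, -1] v := by
  rw [matAct_fin_two, reflPlane_apply]
  simp

theorem planarVelocity_similar {γ η : PlanarLoop}
    (h : PlanarSimilar (Matrix.specialOrthogonalGroup (Fin 2) ℝ) γ η) :
    ∃ c : ℂ, c ≠ 0 ∧ ∀ t, planarVelocity η t = c * planarVelocity γ t := by
  obtain ⟨A, hA, r, hr, b, h⟩ := h
  obtain ⟨hO, hdet⟩ := Matrix.mem_specialOrthogonalGroup_iff.1 hA
  have h1 := (Matrix.mem_orthogonalGroup_iff _ _).1 hO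
  have h00 := congrFun (congrFun h1 0) 0
  have h01 := congrFun (congrFun h1 0) 1
  have h11 := congrFun (congrFun h1 1) 1
  simp [Matrix.mul_apply, Fin.sum_univ_two] at h00 h01 h11
  rw [Matrix.det_fin_two] at hdet
  have e1 : A 1 1 = A 0 0 := by linear_combination A 0 0 * hdet - A 1 1 * h00 + A 0 1 * h01
  have e2 : A 0 1 = -A 1 0 := by linear_combination (-A 1 0) * h00 + A 0 0 * h01 - A 0 1 * hdet
  refine ⟨⟨r * A 0 0, r * A 1 0⟩, fun h0 => ?_, fun t => ?_⟩
  · have k0 : A 0 0 = 0 := (mul_eq_zero.1 (congrArg Complex.re h0)).resolve_left hr.ne'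
    have k1 : A 1 0 = 0 := (mul_eq_zero.1 (congrArg Complex.im h0)).resolve_left hr.ne'
    rw [e2, k0, k1] at h00
    norm_num at h00
  · rw [planarVelocity, PlanarSimilar.deriv_eq h, matAct_fin_two, planarVelocity]
    apply Complex.ext
    · simp [e2]
      ring
    · simp [e1]
      ring

/-- The planar loop `η` is more strongly correlated to `γ` than to the mirror image of `γ`. This
separates the two sheets of the orientation cover. -/
def Favours (γ η : PlanarLoop) : Prop :=
  ‖∫ t in (0 : ℝ)..2, planarVelocity η t * planarVelocity γ t‖ <
    ‖∫ t in (0 : ℝ)..2, planarVelocity η t * (starRingEnd ℂ) (planarVelocity γ t)‖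

theorem Favours.congr {γ η ζ : PlanarLoop}
    (h : PlanarSimilar (Matrix.specialOrthogonalGroup (Fin 2) ℝ) η ζ) (hη : Favours γ η) :
    Favours γ ζ := by
  obtain ⟨c, hc, h⟩ := planarVelocity_similar h
  rw [Favours]
  simp only [h, mul_assoc]
  rw [intervalIntegral.integral_const_mul, intervalIntegral.integral_const_mul, norm_mul, norm_mul]
  exact mul_lt_mul_of_pos_left hη (norm_pos_iff.2 hc)

theorem Favours.not_reflect {γ η : PlanarLoop} (h : Favours γ η) : ¬Favours γ η.reflect := by
  have hc : ∀ f : ℝ → ℂ, ‖∫ t in (0 : ℝ)..2, (starRingEnd ℂ) (f t)‖ = ‖∫ t in (0 : ℝ)..2, f t‖ :=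
    fun f => by
      have : ∫ t in (0 : ℝ)..2, (starRingEnd ℂ) (f t) = (starRingEnd ℂ) (∫ t in (0 : ℝ)..2, f t) :=
        by
        simp only [intervalIntegral.integral_of_le zero_le_two]
        exact integral_conj
      rw [this, RCLike.norm_conj]
  rw [Favours, not_lt]
  have e1 : ∀ t, planarVelocity η.reflect t * planarVelocity γ t =
      (starRingEnd ℂ) (planarVelocity η t * (starRingEnd ℂ) (planarVelocity γ t)) := fun t => by
    rw [planarVelocity_reflect, map_mul, Complex.conj_conj]
  have e2 : ∀ t, planarVelocity η.reflect t * (starRingEnd ℂ) (planarVelocity γ t) =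
      (starRingEnd ℂ) (planarVelocity η t * planarVelocity γ t) := fun t => by
    rw [planarVelocity_reflect, map_mul]
  simp only [e1, e2]
  rw [hc, hc]
  exact h.le

/-- A closed curve is not contained in a line, which makes the Cauchy–Schwarz inequality strict. -/
theorem favours_self (γ : PlanarLoop) : Favours γ γ := by
  have hg := continuous_planarVelocity γ
  set g := planarVelocity γ with hgdef
  rw [Favours, ← hgdef]
  by_contra hcon
  rw [not_lt] at hcon
  -- After a rotation by `v` the two integrals are those of `re² - im²` and of `re² + im²`.
  obtain ⟨v, hv1, hv⟩ : ∃ v : ℂ, ‖v‖ = 1 ∧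
      v ^ 2 * (∫ t in (0 : ℝ)..2, g t * g t) = (‖∫ t in (0 : ℝ)..2, g t * g t‖ : ℂ) := by
    set I := ∫ t in (0 : ℝ)..2, g t * g t
    by_cases hI : I = 0
    · exact ⟨1, norm_one, by simp [hI]⟩
    · have hIn : (‖I‖ : ℂ) ≠ 0 := by exact_mod_cast norm_ne_zero_iff.2 hI
      obtain ⟨v, hv⟩ := IsAlgClosed.exists_pow_nat_eq ((‖I‖ : ℂ) / I) two_pos
      refine ⟨v, ?_, by rw [hv, div_mul_cancel₀ _ hI]⟩
      have := congrArg norm hv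
      rw [norm_pow, norm_div, Complex.norm_real, norm_norm,
        div_self (norm_ne_zero_iff.2 hI)] at this
      exact (pow_eq_one_iff_of_nonneg (norm_nonneg v) two_ne_zero).1 this
  have hh : Continuous fun t => v * g t := continuous_const.mul hg
  have hre : Continuous fun t => (v * g t).re := Complex.continuous_re.comp hh
  have him : Continuous fun t => (v * g t).im := Complex.continuous_im.comp hh
  have h1 : ‖∫ t in (0 : ℝ)..2, g t * g t‖ =
      ∫ t in (0 : ℝ)..2, ((v * g t).re ^ 2 - (v * g t).im ^ 2) := by
    have h2 := congrArg Complex.re hv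
    rw [Complex.ofReal_re, ← intervalIntegral.integral_const_mul] at h2
    rw [← h2]
    refine (Complex.reCLM.intervalIntegral_comp_comm
      (Continuous.intervalIntegrable (by fun_prop) _ _)).symm.trans ?_
    refine intervalIntegral.integral_congr fun t _ => ?_
    have : v ^ 2 * (g t * g t) = (v * g t) * (v * g t) := by ring
    simp only [Complex.reCLM_apply]
    rw [this, Complex.mul_re]
    ring
  have h2 : ‖∫ t in (0 : ℝ)..2, g t * (starRingEnd ℂ) (g t)‖ =
      ∫ t in (0 : ℝ)..2, ((v * g t).re ^ 2 + (v * g t).im ^ 2) := by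
    have e : ∀ t, g t * (starRingEnd ℂ) (g t) =
        (((v * g t).re ^ 2 + (v * g t).im ^ 2 : ℝ) : ℂ) := fun t => by
      have : (v * g t).re ^ 2 + (v * g t).im ^ 2 = Complex.normSq (v * g t) := by
        rw [Complex.normSq_apply]; ring
      rw [this, map_mul, Complex.normSq_eq_norm_sq v, hv1, one_pow, one_mul, Complex.mul_conj]
    simp only [e]
    rw [intervalIntegral.integral_ofReal, Complex.norm_real, Real.norm_of_nonneg]
    exact intervalIntegral.integral_nonneg zero_le_two fun t _ => by positivity
  rw [h1, h2, intervalIntegral.integral_add, intervalIntegral.integral_sub] at hcon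
  rotate_left
  · exact (hre.pow 2).intervalIntegrable _ _
  · exact (him.pow 2).intervalIntegrable _ _
  · exact (hre.pow 2).intervalIntegrable _ _
  · exact (him.pow 2).intervalIntegrable _ _
  have hi0 : ∀ t ∈ Icc (0 : ℝ) 2, (v * g t).im = 0 := fun t ht => by
    by_contra hne
    have : 0 < ∫ t in (0 : ℝ)..2, (v * g t).im ^ 2 :=
      intervalIntegral.integral_pos (by norm_num) (him.pow 2).continuousOn
        (fun _ _ => by positivity) ⟨t, ht, by positivity⟩
    linarith
  -- by Rolle's theorem the component of the velocity along the line vanishes somewhere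
  have hder : ∀ t, HasDerivAt (fun t => v.re * γ.1.1 t 0 - v.im * γ.1.1 t 1) (v * g t).re t :=
    fun t => by
      have h0 := hasDerivAt_euclidean.1 (hasDerivAt_planar γ t)
      exact ((h0 0).const_mul _).sub ((h0 1).const_mul _)
  obtain ⟨t, ht, ht0⟩ := exists_hasDerivAt_eq_zero (a := 0) (b := 2) two_pos
    (fun t _ => (hder t).continuousAt.continuousWithinAt) (by
      have := γ.1.2.2 0
      rw [zero_add, one_smul] at this
      simp only [this]) fun t _ => hder t
  have hz : v * g t = 0 := Complex.ext ht0 (hi0 t (Ioo_subset_Icc_self ht))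
  have hv0 : v ≠ 0 := norm_ne_zero_iff.1 (by rw [hv1]; exact one_ne_zero)
  have hg0 : g t = 0 := (mul_eq_zero.1 hz).resolve_left hv0
  refine γ.2 t (PiLp.ext fun i => ?_)
  fin_cases i
  · exact congrArg Complex.re hg0
  · exact congrArg Complex.im hg0

theorem forgetOrientation_mk (γ : PlanarLoop) :
    forgetOrientation (Quotient.mk orientedPlanarSetoid γ) = Quotient.mk planarSetoid γ := rfl

theorem reflection_mem : (!![1, 0; 0, -1] : Matrix (Fin 2) (Fin 2) ℝ) ∈
    Matrix.orthogonalGroup (Fin 2) ℝ := by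
  rw [Matrix.mem_orthogonalGroup_iff]
  ext i j
  fin_cases i <;> fin_cases j <;> simp [Matrix.mul_apply, Fin.sum_univ_two]

theorem forgetOrientation_eq_iff (γ η : PlanarLoop) :
    forgetOrientation (Quotient.mk orientedPlanarSetoid γ) =
        forgetOrientation (Quotient.mk orientedPlanarSetoid η) ↔
      Quotient.mk orientedPlanarSetoid η = Quotient.mk orientedPlanarSetoid γ ∨
      Quotient.mk orientedPlanarSetoid η = Quotient.mk orientedPlanarSetoid γ.reflect := by
  rw [forgetOrientation_mk, forgetOrientation_mk]
  have hrefl : Quotient.mk planarSetoid γ = Quotient.mk planarSetoid γ.reflect :=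
    Quotient.sound (planarSimilar_of_deriv reflection_mem one_pos fun t => by
      rw [γ.deriv_reflect, reflPlane_eq_matAct, one_smul])
  constructor
  · intro h
    obtain ⟨A, hA, r, hr, b, h⟩ := Quotient.exact h
    have h1 := (Matrix.mem_orthogonalGroup_iff _ _).1 hA
    have hdet : A.det = 1 ∨ A.det = -1 := by
      have := congrArg Matrix.det h1
      rw [Matrix.det_mul, Matrix.det_transpose, Matrix.det_one] at this
      exact mul_self_eq_one_iff.1 this
    rcases hdet with e | e
    · left
      exact (Quotient.sound (s := orientedPlanarSetoid)
        ⟨A, Matrix.mem_specialOrthogonalGroup_iff.2 ⟨hA, e⟩, r, hr, b, h⟩).symm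
    · right
      refine (Quotient.sound (s := orientedPlanarSetoid) ⟨A * !![1, 0; 0, -1],
        Matrix.mem_specialOrthogonalGroup_iff.2 ⟨mul_mem hA reflection_mem, ?_⟩, r, hr, b,
        fun t => ?_⟩).symm
      · rw [Matrix.det_mul, e, Matrix.det_fin_two_of]
        norm_num
      · rw [h, matAct_mul]
        congr 3
        change γ.1.1 t = matAct _ (reflPlane (γ.1.1 t))
        rw [← reflPlane_eq_matAct]
        ext i
        fin_cases i <;> simp [reflPlane_apply]
  · rintro (h | h)
    · exact (congrArg forgetOrientation h).symm
    · exact hrefl.trans (congrArg forgetOrientation h).symm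

theorem mk_reflect_ne (γ : PlanarLoop) :
    Quotient.mk orientedPlanarSetoid γ.reflect ≠ Quotient.mk orientedPlanarSetoid γ := fun h =>
  (favours_self γ).not_reflect ((favours_self γ).congr (Quotient.exact h.symm))

theorem SmoothPlanarFamily.reflect {E : Type} [NormedAddCommGroup E] [NormedSpace ℝ E]
    {γ : E → PlanarLoop} (h : SmoothPlanarFamily γ) : SmoothPlanarFamily fun e => (γ e).reflect :=
  reflPlane.contDiff.comp h

/-- The oriented similarity classes of the loops that favour `γ` over its mirror image. -/
def favourableSet (γ : PlanarLoop) : Set OrientedPlanarModuli :=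
  {b | ∃ η, Quotient.mk orientedPlanarSetoid η = b ∧ Favours γ η}

theorem mk_mem_favourableSet {γ η : PlanarLoop} :
    Quotient.mk orientedPlanarSetoid η ∈ favourableSet γ ↔ Favours γ η := by
  constructor
  · rintro ⟨ζ, h, hζ⟩
    exact hζ.congr (Quotient.exact h)
  · exact fun h => ⟨η, rfl, h⟩

theorem SmoothPlanarFamily.eventually_favours {n : ℕ} {q : EuclideanSpace ℝ (Fin n) → PlanarLoop}
    (hq : SmoothPlanarFamily q) {γ : PlanarLoop} {x : EuclideanSpace ℝ (Fin n)}
    (hx : Favours γ (q x)) : ∀ᶠ y in 𝓝 x, Favours γ (q y) := by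
  have hγ : ContDiff ℝ ∞ fun w : EuclideanSpace ℝ (Fin n) × ℝ => planarVelocity γ w.2 := by
    have h : SmoothPlanarFamily (fun _ : EuclideanSpace ℝ (Fin n) => γ) := γ.1.2.1.comp contDiff_snd
    exact h.contDiff_velocity
  have h1 := contDiff_integral_family (F := fun y t => planarVelocity (q y) t * planarVelocity γ t)
    (hq.contDiff_velocity.mul hγ) 0 2
  have h2 := contDiff_integral_family
    (F := fun y t => planarVelocity (q y) t * (starRingEnd ℂ) (planarVelocity γ t))
    (hq.contDiff_velocity.mul hγ.star_complex) 0 2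
  exact h1.continuous.norm.continuousAt.eventually_lt h2.continuous.norm.continuousAt hx

theorem isOpen_favourableSet (γ : PlanarLoop) : IsOpen[dTopology] (favourableSet γ) := by
  refine isOpen_dTopology_of_eventually fun n p hp x hx => ?_
  obtain ⟨q, hq, hpq⟩ := hp x
  rw [hpq.self_of_nhds, mk_mem_favourableSet] at hx
  filter_upwards [hpq, (isPlot_planarLoop_iff.1 hq).eventually_favours hx] with y h1 h2
  rw [h1, mk_mem_favourableSet]
  exact h2

theorem forgetOrientation_injOn (γ : PlanarLoop) :
    Function.Injective (fun b : favourableSet γ => forgetOrientation b) := by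
  rintro ⟨_, η, rfl, hη⟩ ⟨_, ζ, rfl, hζ⟩ h
  rcases (forgetOrientation_eq_iff η ζ).1 h with e | e
  · exact Subtype.ext e.symm
  · exact absurd (hζ.congr (Quotient.exact e)) hη.not_reflect

/-- Lifts of plots to oriented loops that start in the favourable set. -/
theorem exists_favourable_lift {γ : PlanarLoop} {n : ℕ} {p : EuclideanSpace ℝ (Fin n) →
    PlanarModuli}
    (hp : IsPlot p) {x : EuclideanSpace ℝ (Fin n)} {b : favourableSet γ}
    (hx : p x = forgetOrientation b) :
    ∃ q : EuclideanSpace ℝ (Fin n) → favourableSet γ, IsPlot q ∧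
      ∀ᶠ y in 𝓝 x, p y = forgetOrientation (q y) := by
  obtain ⟨q₀, hq₀, hpq₀⟩ := hp x
  obtain ⟨q, hq, hpq, hqx⟩ : ∃ q : EuclideanSpace ℝ (Fin n) → PlanarLoop, SmoothPlanarFamily q ∧
      (∀ᶠ y in 𝓝 x, p y = Quotient.mk planarSetoid (q y)) ∧ Favours γ (q x) := by
    obtain ⟨_, η, rfl, hη⟩ := b
    rcases (forgetOrientation_eq_iff (q₀ x) η).1 (hpq₀.self_of_nhds.symm.trans hx) with e | e
    · exact ⟨q₀, hq₀, hpq₀, hη.congr (Quotient.exact e)⟩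
    · refine ⟨fun y => (q₀ y).reflect, (isPlot_planarLoop_iff.1 hq₀).reflect,
        hpq₀.mono fun y hy => hy.trans ?_, hη.congr (Quotient.exact e)⟩
      exact (forgetOrientation_eq_iff (q₀ y) (q₀ y).reflect).2 (Or.inr rfl)
  obtain ⟨u, hu, huo, hxu⟩ := eventually_nhds_iff.1 (hq.eventually_favours hqx)
  obtain ⟨r, hr, hru, hrx⟩ := exists_smooth_retract huo hxu
  refine ⟨fun y => ⟨Quotient.mk orientedPlanarSetoid (q (r y)),
    mk_mem_favourableSet.2 (hu _ (hru y))⟩, ?_, ?_⟩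
  · exact isPlot_quotient_mk (s := orientedPlanarSetoid)
      (isPlot_reparam (isPlot_planarLoop_iff.2 hq) hr)
  · filter_upwards [hpq, hrx] with y h1 h2
    rw [h1]
    simp only [h2]
    rfl

theorem isOpenInduction_forgetOrientation (γ : PlanarLoop) :
    IsOpenInduction (fun b : favourableSet γ => forgetOrientation b) := by
  refine IsInduction.isOpenInduction (isInduction_of_local (forgetOrientation_injOn γ)
    (fun n p hp => ?_) fun n p hp x => exists_favourable_lift hp rfl) ?_
  · refine isPlot_of_eventuallyEq fun x => ?_
    obtain ⟨q, hq, hpq⟩ := hp x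
    exact ⟨_, isPlot_quotient_mk (s := planarSetoid) hq, hpq.mono fun y hy =>
      congrArg forgetOrientation hy⟩
  · refine isOpen_dTopology_of_eventually fun n p hp x ⟨b, hb⟩ => ?_
    obtain ⟨q, hq, hpq⟩ := exists_favourable_lift hp hb.symm
    exact hpq.mono fun y hy => ⟨q y, hy.symm⟩

theorem exists_orientation_chart (a : OrientedPlanarModuli) :
    ∃ U : Set OrientedPlanarModuli, a ∈ U ∧ IsOpen[dTopology] U ∧
      IsOpenInduction (fun b : U => forgetOrientation b) := by
  obtain ⟨γ, rfl⟩ := Quotient.exists_rep a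
  exact ⟨favourableSet γ, mk_mem_favourableSet.2 (favours_self γ), isOpen_favourableSet γ,
    isOpenInduction_forgetOrientation γ⟩

end Orientation

/-! ### The Lagrangian property -/

section Lagrangian

theorem hasDerivAt_loop (f : loops 1 E3) (t : ℝ) : HasDerivAt f.1 (deriv f.1 t) t :=
  (f.2.1.differentiable (by simp)).differentiableAt.hasDerivAt

theorem hasDerivAt_loop_coord (f : loops 1 E3) (t : ℝ) (i : Fin 3) :
    HasDerivAt (fun t => f.1 t i) (deriv f.1 t i) t :=
  hasDerivAt_euclidean.1 (hasDerivAt_loop f t) i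

theorem continuous_deriv_loop (f : loops 1 E3) : Continuous (deriv f.1) :=
  f.2.1.continuous_deriv (by simp)

theorem continuous_deriv_coord (f : loops 1 E3) (i : Fin 3) : Continuous fun t => deriv f.1 t i :=
  (EuclideanSpace.proj i : E3 →L[ℝ] ℝ).continuous.comp (continuous_deriv_loop f)

theorem continuous_coord (f : loops 1 E3) (i : Fin 3) : Continuous fun t => f.1 t i :=
  (EuclideanSpace.proj i : E3 →L[ℝ] ℝ).continuous.comp f.2.1.continuous

theorem integral_deriv_coord (f : loops 1 E3) (i : Fin 3) :
    ∫ t in (0 : ℝ)..2, deriv f.1 t i = 0 := by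
  rw [intervalIntegral.integral_eq_sub_of_hasDerivAt (fun t _ => hasDerivAt_loop_coord f t i)
    ((continuous_deriv_coord f i).intervalIntegrable _ _)]
  have := f.2.2 0
  rw [zero_add, one_smul] at this
  rw [this, sub_self]

theorem deriv_loop_add (f g : loops 1 E3) (t : ℝ) :
    deriv (f + g).1 t = deriv f.1 t + deriv g.1 t :=
  deriv_add (hasDerivAt_loop f t).differentiableAt (hasDerivAt_loop g t).differentiableAt

/-- The symplectic form on the variations of a framed planar loop, as an explicit bilinear form. -/
noncomputable def planarForm (v w : Variation) : ℝ :=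
  1 / 4 * ∫ t in (0 : ℝ)..2,
    ((deriv w.1.1 t 0 * v.2.1 t 2 - deriv w.1.1 t 2 * v.2.1 t 0) -
      (deriv v.1.1 t 0 * w.2.1 t 2 - deriv v.1.1 t 2 * w.2.1 t 0))

theorem intervalIntegrable_planarForm (v w : Variation) :
    IntervalIntegrable (fun t => ((deriv w.1.1 t 0 * v.2.1 t 2 - deriv w.1.1 t 2 * v.2.1 t 0) -
      (deriv v.1.1 t 0 * w.2.1 t 2 - deriv v.1.1 t 2 * w.2.1 t 0))) volume 0 2 := by
  have h1 := continuous_deriv_coord v.1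
  have h2 := continuous_deriv_coord w.1
  have h3 := continuous_coord v.2
  have h4 := continuous_coord w.2
  exact Continuous.intervalIntegrable ((((h2 0).mul (h3 2)).sub ((h2 2).mul (h3 0))).sub
    (((h1 0).mul (h4 2)).sub ((h1 2).mul (h4 0)))) _ _

theorem planarForm_add_left (v v' w : Variation) :
    planarForm (v + v') w = planarForm v w + planarForm v' w := by
  rw [planarForm, planarForm, planarForm, ← mul_add,
    ← intervalIntegral.integral_add (intervalIntegrable_planarForm v w)
      (intervalIntegrable_planarForm v' w)]
  congr 1
  refine intervalIntegral.integral_congr fun t _ => ?_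
  have e1 : deriv (v + v').1.1 t = deriv v.1.1 t + deriv v'.1.1 t := deriv_loop_add _ _ _
  have e2 : (v + v').2.1 t = v.2.1 t + v'.2.1 t := rfl
  simp only [e1, e2, PiLp.add_apply]
  ring

theorem planarForm_swap (v w : Variation) : planarForm v w = -planarForm w v := by
  have h : ∫ t in (0 : ℝ)..2,
      ((deriv w.1.1 t 0 * v.2.1 t 2 - deriv w.1.1 t 2 * v.2.1 t 0) -
        (deriv v.1.1 t 0 * w.2.1 t 2 - deriv v.1.1 t 2 * w.2.1 t 0)) = ∫ t in (0 : ℝ)..2,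
      -((deriv v.1.1 t 0 * w.2.1 t 2 - deriv v.1.1 t 2 * w.2.1 t 0) -
        (deriv w.1.1 t 0 * v.2.1 t 2 - deriv w.1.1 t 2 * v.2.1 t 0)) :=
    intervalIntegral.integral_congr fun t _ => by ring
  rw [planarForm, planarForm, h, intervalIntegral.integral_neg, mul_neg]

theorem planarForm_add_right (v w w' : Variation) :
    planarForm v (w + w') = planarForm v w + planarForm v w' := by
  rw [planarForm_swap, planarForm_add_left, planarForm_swap w, planarForm_swap w']
  ring

variable (γ : PlanarLoop)

theorem PlanarLoop.deriv_framed_apply_one (t : ℝ) : deriv γ.framed.γ t 1 = 0 := by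
  rw [γ.deriv_framed]; rfl

theorem PlanarLoop.T_apply (t : ℝ) (i : Fin 3) :
    γ.framed.T t i = ‖deriv γ.framed.γ t‖⁻¹ * deriv γ.framed.γ t i := rfl

theorem PlanarLoop.T_apply_one (t : ℝ) : γ.framed.T t 1 = 0 := by
  rw [γ.T_apply, γ.deriv_framed_apply_one, mul_zero]

theorem PlanarLoop.T_sq (t : ℝ) : γ.framed.T t 0 ^ 2 + γ.framed.T t 2 ^ 2 = 1 := by
  have h := norm_sq_E3 (γ.framed.T t)
  rw [FramedLoop.norm_T, γ.T_apply_one] at h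
  linarith

theorem PlanarLoop.W_eq (t : ℝ) : γ.framed.W t = !₂[-γ.framed.T t 2, 0, γ.framed.T t 0] := by
  rw [FramedLoop.W, γ.framed_V]
  ext i
  fin_cases i <;> simp [cross, cross_apply]

theorem mem_tangentSpace_framed {v : Variation} : v ∈ tangentSpace γ.framed ↔
    (∀ t, deriv v.1.1 t 1 +
      (deriv γ.framed.γ t 0 * v.2.1 t 0 + deriv γ.framed.γ t 2 * v.2.1 t 2) = 0) ∧
    (∀ t, v.2.1 t 1 = 0) ∧
    ∫ t in (0 : ℝ)..2, (deriv v.1.1 t 0 * γ.framed.T t 0 + deriv v.1.1 t 2 * γ.framed.T t 2) = 0 :=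
      by
  have h2 : (∀ t, ⟪v.2.1 t, γ.framed.V t⟫_ℝ = 0) ↔ ∀ t, v.2.1 t 1 = 0 := by
    simp [inner_E3, γ.framed_V]
  have h1 : (∀ t, ⟪deriv v.1.1 t, γ.framed.V t⟫_ℝ + ⟪deriv γ.framed.γ t, v.2.1 t⟫_ℝ = 0) ↔
      ∀ t, deriv v.1.1 t 1 +
        (deriv γ.framed.γ t 0 * v.2.1 t 0 + deriv γ.framed.γ t 2 * v.2.1 t 2) = 0 := by
    simp [inner_E3, γ.framed_V, γ.deriv_framed_apply_one]
  have h3 : ∀ t, ⟪deriv v.1.1 t, γ.framed.T t⟫_ℝ =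
      deriv v.1.1 t 0 * γ.framed.T t 0 + deriv v.1.1 t 2 * γ.framed.T t 2 := fun t => by
    rw [inner_E3, γ.T_apply_one]; ring
  have : v ∈ tangentSpace γ.framed ↔
    (∀ t, ⟪deriv v.1.1 t, γ.framed.V t⟫_ℝ + ⟪deriv γ.framed.γ t, v.2.1 t⟫_ℝ = 0) ∧
    (∀ t, ⟪v.2.1 t, γ.framed.V t⟫_ℝ = 0) ∧
    ∫ t in (0 : ℝ)..2, ⟪deriv v.1.1 t, γ.framed.T t⟫_ℝ = 0 := Iff.rfl
  rw [this, h1, h2]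
  simp only [h3]

theorem symplecticForm_eq_planarForm {v w : Variation} (hv : v ∈ tangentSpace γ.framed)
    (hw : w ∈ tangentSpace γ.framed) :
    symplecticForm γ.framed v.fields w.fields = planarForm v w := by
  obtain ⟨hv1, hv2, -⟩ := (mem_tangentSpace_framed γ).1 hv
  obtain ⟨hw1, hw2, -⟩ := (mem_tangentSpace_framed γ).1 hw
  rw [symplecticForm, jetMetric, planarForm]
  congr 1
  refine intervalIntegral.integral_congr fun t _ => ?_
  have hn : ‖deriv γ.framed.γ t‖ ≠ 0 := norm_ne_zero_iff.2 (γ.framed.2.1 t)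
  have hT := γ.T_sq t
  have hg : ∀ i, deriv γ.framed.γ t i = ‖deriv γ.framed.γ t‖ * γ.framed.T t i := fun i => by
    rw [γ.T_apply, ← mul_assoc, mul_inv_cancel₀ hn, one_mul]
  have hv1' := hv1 t
  have hw1' := hw1 t
  rw [hg, hg] at hv1' hw1'
  have hT1 := γ.T_apply_one t
  simp only [complexStructure, jet, Variation.fields, inner_E3, γ.W_eq, γ.framed_V, hv2 t, hw2 t,
    hT1, PiLp.add_apply, PiLp.sub_apply, PiLp.smul_apply, smul_eq_mul]
  simp
  set n := ‖deriv γ.framed.γ t‖ with hndef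
  obtain ⟨a, ha⟩ : ∃ a : Fin 3 → ℝ, ∀ i, deriv v.1.1 t i = n * a i :=
    ⟨fun i => n⁻¹ * deriv v.1.1 t i, fun i => by rw [← mul_assoc, mul_inv_cancel₀ hn, one_mul]⟩
  obtain ⟨c, hc⟩ : ∃ c : Fin 3 → ℝ, ∀ i, deriv w.1.1 t i = n * c i :=
    ⟨fun i => n⁻¹ * deriv w.1.1 t i, fun i => by rw [← mul_assoc, mul_inv_cancel₀ hn, one_mul]⟩
  have hinv : ∀ x : ℝ, n⁻¹ * (n * x) = x := fun x => by
    rw [← mul_assoc, inv_mul_cancel₀ hn, one_mul]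
  rw [ha] at hv1'
  rw [hc] at hw1'
  simp only [ha, hc, hinv]
  set T0 := γ.framed.T t 0
  set T2 := γ.framed.T t 2
  have ha1 : a 1 = -(T0 * v.2.1 t 0 + T2 * v.2.1 t 2) := mul_left_cancel₀ hn (by linarith)
  have hc1 : c 1 = -(T0 * w.2.1 t 0 + T2 * w.2.1 t 2) := mul_left_cancel₀ hn (by linarith)
  rw [ha1, hc1]
  linear_combination n * (v.2.1 t 2 * c 0 - v.2.1 t 0 * c 2 - a 0 * w.2.1 t 2 + a 2 * w.2.1 t 0 -
    (a 0 * T0 + a 2 * T2) * (-T2 * w.2.1 t 0 + T0 * w.2.1 t 2)) * hT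

/-- The explicit form of the vectors tangent to the orbit. -/
def IsVertical (v : Variation) : Prop :=
  ∃ (a b : E3) (c : ℝ), (∀ t, v.1.1 t = cross a (γ.framed.γ t) + b) ∧
    ∀ t, v.2.1 t = cross a (γ.framed.V t) + c • γ.framed.W t

theorem cross_add_left (a b v : E3) : cross (a + b) v = cross a v + cross b v := by
  simp [cross]

theorem cross_zero_left (v : E3) : cross 0 v = 0 := by
  simp [cross]

theorem mem_verticalSpace_iff {v : Variation} : v ∈ verticalSpace γ.framed ↔ IsVertical γ v := by
  constructor
  · intro h
    induction h using Submodule.span_induction with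
    | mem v h => exact h
    | zero =>
      exact ⟨0, 0, 0, fun t => by rw [cross_zero_left, add_zero]; rfl,
        fun t => by rw [cross_zero_left, zero_smul, add_zero]; rfl⟩
    | add v w _ _ hv hw =>
      obtain ⟨a, b, c, h1, h2⟩ := hv
      obtain ⟨a', b', c', h1', h2'⟩ := hw
      refine ⟨a + a', b + b', c + c', fun t => ?_, fun t => ?_⟩
      · have : (v + w).1.1 t = v.1.1 t + w.1.1 t := rfl
        rw [this, h1, h1', cross_add_left]
        abel
      · have : (v + w).2.1 t = v.2.1 t + w.2.1 t := rfl
        rw [this, h2, h2', cross_add_left, add_smul]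
        abel
    | smul r v _ hv =>
      obtain ⟨a, b, c, h1, h2⟩ := hv
      refine ⟨r • a, r • b, r * c, fun t => ?_, fun t => ?_⟩
      · have : (r • v).1.1 t = r • v.1.1 t := rfl
        rw [this, h1, cross_smul_left, smul_add]
      · have : (r • v).2.1 t = r • v.2.1 t := rfl
        rw [this, h2, cross_smul_left, smul_add, smul_smul]
  · exact fun h => Submodule.subset_span h

theorem IsVertical.deriv_eq {v : Variation} {a b : E3}
    (h : ∀ t, v.1.1 t = cross a (γ.framed.γ t) + b) (t : ℝ) :
    deriv v.1.1 t = cross a (deriv γ.framed.γ t) := by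
  rw [funext h]
  refine (HasDerivAt.add_const b (f := fun t => cross a (γ.framed.γ t)) ?_).deriv
  have hg := hasDerivAt_euclidean.1 (γ.framed.hasDerivAt_γ t)
  rw [hasDerivAt_euclidean]
  intro i
  fin_cases i
  · simpa [cross, cross_apply] using ((hg 2).const_mul (a 1)).fun_sub ((hg 1).const_mul (a 2))
  · simpa [cross, cross_apply] using ((hg 0).const_mul (a 2)).fun_sub ((hg 2).const_mul (a 0))
  · simpa [cross, cross_apply] using ((hg 1).const_mul (a 0)).fun_sub ((hg 0).const_mul (a 1))

/-- The components of a vector tangent to the orbit. -/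
theorem IsVertical.components {v : Variation} {a b : E3} {c : ℝ}
    (h1 : ∀ t, v.1.1 t = cross a (γ.framed.γ t) + b)
    (h2 : ∀ t, v.2.1 t = cross a (γ.framed.V t) + c • γ.framed.W t) (t : ℝ) :
    (deriv v.1.1 t 0 = a 1 * deriv γ.framed.γ t 2 ∧
      deriv v.1.1 t 1 = a 2 * deriv γ.framed.γ t 0 - a 0 * deriv γ.framed.γ t 2 ∧
      deriv v.1.1 t 2 = -(a 1 * deriv γ.framed.γ t 0)) ∧
    v.2.1 t 0 = -a 2 - c * γ.framed.T t 2 ∧ v.2.1 t 1 = 0 ∧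
      v.2.1 t 2 = a 0 + c * γ.framed.T t 0 := by
  have hd1 := γ.deriv_framed_apply_one t
  refine ⟨?_, ?_⟩
  · rw [IsVertical.deriv_eq γ h1]
    refine ⟨?_, ?_, ?_⟩ <;> simp [cross, cross_apply, hd1]
  · rw [h2, γ.W_eq, γ.framed_V]
    refine ⟨?_, ?_, ?_⟩ <;> simp [cross, cross_apply] ; ring

theorem verticalSpace_le_tangentSpace : verticalSpace γ.framed ≤ tangentSpace γ.framed := by
  intro v hv
  obtain ⟨a, b, c, h1, h2⟩ := (mem_verticalSpace_iff γ).1 hv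
  have hT : ∀ t i, deriv γ.framed.γ t i = ‖deriv γ.framed.γ t‖ * γ.framed.T t i := fun t i => by
    have hn : ‖deriv γ.framed.γ t‖ ≠ 0 := norm_ne_zero_iff.2 (γ.framed.2.1 t)
    rw [γ.T_apply, ← mul_assoc, mul_inv_cancel₀ hn, one_mul]
  refine (mem_tangentSpace_framed γ).2 ⟨fun t => ?_, fun t => ?_, ?_⟩
  · obtain ⟨⟨-, e1, -⟩, e2, -, e3⟩ := IsVertical.components γ h1 h2 t
    rw [e1, e2, e3, hT, hT]
    ring
  · exact (IsVertical.components γ h1 h2 t).2.2.1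
  · rw [intervalIntegral.integral_congr (g := fun _ => (0 : ℝ)) fun t _ => ?_,
      intervalIntegral.integral_zero]
    obtain ⟨⟨e0, -, e2⟩, -⟩ := IsVertical.components γ h1 h2 t
    simp only [e0, e2]
    rw [hT t 0, hT t 2]
    ring

/-- The orbit directions lie in the radical of the symplectic form. -/
theorem planarForm_vertical {v w : Variation} (hv : v ∈ verticalSpace γ.framed)
    (hw : w ∈ tangentSpace γ.framed) : planarForm v w = 0 := by
  obtain ⟨a, b, c, h1, h2⟩ := (mem_verticalSpace_iff γ).1 hv
  obtain ⟨hw1, -, hw3⟩ := (mem_tangentSpace_framed γ).1 hw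
  have e : ∀ t, ((deriv w.1.1 t 0 * v.2.1 t 2 - deriv w.1.1 t 2 * v.2.1 t 0) -
      (deriv v.1.1 t 0 * w.2.1 t 2 - deriv v.1.1 t 2 * w.2.1 t 0)) =
      (a 0 * deriv w.1.1 t 0 + a 1 * deriv w.1.1 t 1 + a 2 * deriv w.1.1 t 2) +
        c * (deriv w.1.1 t 0 * γ.framed.T t 0 + deriv w.1.1 t 2 * γ.framed.T t 2) := fun t => by
    obtain ⟨⟨e0, -, e2⟩, k0, -, k2⟩ := IsVertical.components γ h1 h2 t
    rw [e0, e2, k0, k2]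
    linear_combination (-a 1) * hw1 t
  have hd := continuous_deriv_coord w.1
  have hT : ∀ i, Continuous fun t => γ.framed.T t i := fun i =>
    (EuclideanSpace.proj i : E3 →L[ℝ] ℝ).continuous.comp γ.framed.continuous_T
  have hi : ∀ i, IntervalIntegrable (fun t => a i * deriv w.1.1 t i) volume 0 2 := fun i =>
    (continuous_const.mul (hd i)).intervalIntegrable _ _
  have hc : IntervalIntegrable (fun t =>
      c * (deriv w.1.1 t 0 * γ.framed.T t 0 + deriv w.1.1 t 2 * γ.framed.T t 2)) volume 0 2 :=
    (continuous_const.mul (((hd 0).mul (hT 0)).add ((hd 2).mul (hT 2)))).intervalIntegrable _ _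
  rw [planarForm]
  simp only [e]
  rw [intervalIntegral.integral_add (((hi 0).add (hi 1)).add (hi 2)) hc,
    intervalIntegral.integral_add ((hi 0).add (hi 1)) (hi 2),
    intervalIntegral.integral_add (hi 0) (hi 1)]
  simp only [intervalIntegral.integral_const_mul]
  rw [integral_deriv_coord, integral_deriv_coord, integral_deriv_coord, hw3]
  ring

theorem loops_periodic (f : loops 1 E2) : Function.Periodic f.1 2 := fun t => by
  have := f.2.2 t
  rwa [one_smul] at this

theorem loops_eq_of_eqOn {f g : loops 1 E2} (h : ∀ t ∈ Icc (0 : ℝ) 2, f.1 t = g.1 t) : f = g := by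
  refine Subtype.ext (funext fun t => ?_)
  have hp : Function.Periodic (fun t => (f.1 t, g.1 t)) 2 := fun t => by
    simp only [loops_periodic f t, loops_periodic g t]
  obtain ⟨s, hs, hst⟩ := hp.exists_mem_Ico₀ two_pos t
  rw [(Prod.mk.inj hst).1, (Prod.mk.inj hst).2]
  exact h s ⟨hs.1, hs.2.le⟩

theorem integral_inner_const {u : ℝ → E2} (hu : Continuous u) (c : E2) :
    ∫ t in (0 : ℝ)..2, ⟪u t, c⟫_ℝ = ⟪∫ t in (0 : ℝ)..2, u t, c⟫_ℝ := by
  have := (innerSL ℝ c).intervalIntegral_comp_comm (hu.intervalIntegrable (μ := volume) 0 2)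
  simp only [innerSL_apply_apply] at this
  rw [real_inner_comm, ← this]
  exact intervalIntegral.integral_congr fun t _ => real_inner_comm _ _

/-- The constant loops. -/
def constLoop (c : E2) : loops 1 E2 := ⟨fun _ => c, contDiff_const, fun _ => (one_smul _ _).symm⟩

theorem eq_zero_of_integral_inner_self {u : loops 1 E2}
    (h : ∫ t in (0 : ℝ)..2, ⟪u.1 t, u.1 t⟫_ℝ = 0) : u = 0 := by
  refine loops_eq_of_eqOn fun t ht => ?_
  by_contra hne
  have : 0 < ∫ t in (0 : ℝ)..2, ⟪u.1 t, u.1 t⟫_ℝ :=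
    intervalIntegral.integral_pos (by norm_num) (u.2.1.continuous.inner
      u.2.1.continuous).continuousOn
      (fun _ _ => real_inner_self_nonneg) ⟨t, ht, by
        rw [real_inner_self_eq_norm_sq]
        have := norm_pos_iff.2 hne
        positivity⟩
  exact this.ne' h

/-- The double orthogonal complement of the span of the constants and of `T`. -/
theorem exists_eq_const_add_smul {y T : loops 1 E2}
    (h : ∀ u : loops 1 E2, ∫ t in (0 : ℝ)..2, u.1 t = 0 → ∫ t in (0 : ℝ)..2, ⟪u.1 t, T.1 t⟫_ℝ = 0 →
      ∫ t in (0 : ℝ)..2, ⟪u.1 t, y.1 t⟫_ℝ = 0) :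
    ∃ (c : E2) (l : ℝ), ∀ t, y.1 t = c + l • T.1 t := by
  have hint : ∀ f g : loops 1 E2, IntervalIntegrable (fun t => ⟪f.1 t, g.1 t⟫_ℝ) volume 0 2 :=
    fun f g => (f.2.1.continuous.inner g.2.1.continuous).intervalIntegrable _ _
  have hmean : ∀ f : loops 1 E2, ∃ m : E2, ∫ t in (0 : ℝ)..2, (f - constLoop m).1 t = 0 := fun f =>
    by
    refine ⟨(2 : ℝ)⁻¹ • ∫ t in (0 : ℝ)..2, f.1 t, ?_⟩
    change ∫ t in (0 : ℝ)..2, (f.1 t - (2 : ℝ)⁻¹ • ∫ t in (0 : ℝ)..2, f.1 t) = 0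
    rw [intervalIntegral.integral_sub (f.2.1.continuous.intervalIntegrable _ _)
      (continuous_const.intervalIntegrable _ _), intervalIntegral.integral_const, smul_smul]
    norm_num
  have hintc : ∀ (f : loops 1 E2) (c : E2), IntervalIntegrable (fun t => ⟪f.1 t, c⟫_ℝ) volume 0 2 :=
    fun f c => (f.2.1.continuous.inner continuous_const).intervalIntegrable _ _
  obtain ⟨m, hm⟩ := hmean y
  obtain ⟨k, hk⟩ := hmean T
  set y' := y - constLoop m with hy'
  set T' := T - constLoop k with hT'
  have hsub : ∀ f : loops 1 E2, ∫ t in (0 : ℝ)..2, f.1 t = 0 →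
      ∫ t in (0 : ℝ)..2, ⟪f.1 t, T.1 t⟫_ℝ = ∫ t in (0 : ℝ)..2, ⟪f.1 t, T'.1 t⟫_ℝ := fun f hf => by
    have e : ∀ t, ⟪f.1 t, T.1 t⟫_ℝ = ⟪f.1 t, T'.1 t⟫_ℝ + ⟪f.1 t, k⟫_ℝ := fun t => by
      rw [← inner_add_right]
      congr 1
      exact (sub_add_cancel _ _).symm
    simp only [e]
    rw [intervalIntegral.integral_add (hint f T') (hintc f k),
      integral_inner_const f.2.1.continuous, hf, inner_zero_left, add_zero]
  obtain ⟨l, hl⟩ : ∃ l : ℝ, ∫ t in (0 : ℝ)..2, ⟪y'.1 t, T'.1 t⟫_ℝ =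
      l * ∫ t in (0 : ℝ)..2, ⟪T'.1 t, T'.1 t⟫_ℝ := by
    by_cases hB : ∫ t in (0 : ℝ)..2, ⟪T'.1 t, T'.1 t⟫_ℝ = 0
    · refine ⟨0, ?_⟩
      rw [eq_zero_of_integral_inner_self hB]
      simp
    · exact ⟨_, (div_mul_cancel₀ _ hB).symm⟩
  -- `u` is the component of `y` orthogonal to the constants and to `T`; it is admissible in `h`.
  set u := y' - l • T' with hu
  have hu0 : ∫ t in (0 : ℝ)..2, u.1 t = 0 := by
    change ∫ t in (0 : ℝ)..2, (y'.1 t - l • T'.1 t) = 0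
    have hlT : IntervalIntegrable (fun t => l • T'.1 t) volume 0 2 :=
      (T'.2.1.continuous.const_smul l).intervalIntegrable _ _
    rw [intervalIntegral.integral_sub (y'.2.1.continuous.intervalIntegrable _ _) hlT,
      intervalIntegral.integral_smul, hm, hk,
      smul_zero, sub_zero]
  have huT : ∫ t in (0 : ℝ)..2, ⟪u.1 t, T.1 t⟫_ℝ = 0 := by
    rw [hsub u hu0]
    have e : ∀ t, ⟪u.1 t, T'.1 t⟫_ℝ = ⟪y'.1 t, T'.1 t⟫_ℝ - l * ⟪T'.1 t, T'.1 t⟫_ℝ := fun t => by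
      rw [← real_inner_smul_left, ← inner_sub_left]
      rfl
    simp only [e]
    rw [intervalIntegral.integral_sub (hint y' T') ((hint T' T').const_mul l),
      intervalIntegral.integral_const_mul, hl, sub_self]
  have huu : ∫ t in (0 : ℝ)..2, ⟪u.1 t, u.1 t⟫_ℝ = 0 := by
    have e : ∀ t, ⟪u.1 t, u.1 t⟫_ℝ =
        ⟪u.1 t, y.1 t⟫_ℝ - ⟪u.1 t, m - l • k⟫_ℝ - l * ⟪u.1 t, T.1 t⟫_ℝ := fun t => by
      rw [← real_inner_smul_right, ← inner_sub_right, ← inner_sub_right]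
      congr 1
      change (y.1 t - m) - l • (T.1 t - k) = _
      module
    simp only [e]
    rw [intervalIntegral.integral_sub ((hint u y).sub (hintc u _)) ((hint u T).const_mul l),
      intervalIntegral.integral_sub (hint u y) (hintc u _),
      integral_inner_const u.2.1.continuous, intervalIntegral.integral_const_mul, huT, hu0,
      h u hu0 huT]
    simp
  refine ⟨m - l • k, l, fun t => ?_⟩
  have h0 : (y.1 t - m) - l • (T.1 t - k) = 0 :=
    congrFun (congrArg Subtype.val (eq_zero_of_integral_inner_self huu)) t
  have : y.1 t = ((y.1 t - m) - l • (T.1 t - k)) + (m - l • k + l • T.1 t) := by module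
  rw [this, h0, zero_add]

/-- The primitive of a planar loop with mean zero. -/
theorem exists_primitive_loop {u : loops 1 E2} (hu : ∫ t in (0 : ℝ)..2, u.1 t = 0) :
    ∃ U : loops 1 E2, ∀ t, deriv U.1 t = u.1 t := by
  have h1 : ContDiff ℝ ∞ (Function.uncurry fun (_ : ℝ) => u.1) := u.2.1.comp contDiff_snd
  have h2 := contDiff_primitive_family h1
  refine ⟨⟨fun t => ∫ s in (0 : ℝ)..t, u.1 s,
    h2.comp (f := fun t : ℝ => ((0 : ℝ), t)) (contDiff_const.prodMk contDiff_id), fun t => ?_⟩,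
    fun t => (hasDerivAt_primitive u.2.1.continuous t).deriv⟩
  have hi : ∀ a b, IntervalIntegrable u.1 volume a b := fun a b =>
    u.2.1.continuous.intervalIntegrable a b
  simp only
  rw [one_smul, ← intervalIntegral.integral_add_adjacent_intervals (hi 0 t) (hi t (t + 2)),
    (loops_periodic u).intervalIntegral_add_eq t 0, zero_add, hu, add_zero]

/-- The unit tangent of a planar loop. -/
theorem PlanarLoop.exists_tangentLoop : ∃ T : loops 1 E2,
    ∀ t, T.1 t = !₂[γ.framed.T t 0, γ.framed.T t 2] := by
  have hd : ContDiff ℝ ∞ (deriv γ.framed.γ) := ContDiff.deriv' (γ.framed.contDiff_γ.of_le (by simp))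
  have hT : ContDiff ℝ ∞ γ.framed.T :=
    ((hd.norm ℝ γ.framed.2.1).inv fun t => norm_ne_zero_iff.2 (γ.framed.2.1 t)).smul hd
  refine ⟨⟨fun t => spaceToPlane (γ.framed.T t), spaceToPlane.contDiff.comp hT, fun t => ?_⟩,
    fun t => rfl⟩
  have : deriv γ.framed.γ (t + 2) = deriv γ.framed.γ t := by
    rw [← deriv_comp_add_const]
    congr 1
    ext1 s
    have := γ.framed.1.1.2.2 s
    rwa [one_smul] at this
  have hT2 : γ.framed.T (t + 2) = γ.framed.T t := by
    rw [FramedLoop.T, this]; rfl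
  simp only [hT2, one_smul]

theorem mem_planarTangentSpace {v : Variation} (hv : v ∈ tangentSpace γ.framed)
    (h1 : ∀ t, v.1.1 t 1 = 0) (h2 : ∀ t, v.2.1 t = 0) : v ∈ planarTangentSpace γ := by
  have e : planarVariation (loopMap spaceToPlane v.1) = v :=
    Prod.ext (Subtype.ext (funext fun t => planeToSpace_spaceToPlane (h1 t)))
      (Subtype.ext (funext fun t => (h2 t).symm))
  refine Submodule.mem_sup_left ⟨loopMap spaceToPlane v.1, ?_, e⟩
  change planarVariation _ ∈ tangentSpace γ.framed
  rwa [e]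

theorem planarTangentSpace_le : planarTangentSpace γ ≤ tangentSpace γ.framed :=
  sup_le (Submodule.map_comap_le _ _) (verticalSpace_le_tangentSpace γ)

theorem planarForm_planar (u w : loops 1 E2) :
    planarForm (planarVariation u) (planarVariation w) = 0 := by
  rw [planarForm, intervalIntegral.integral_congr (g := fun _ => (0 : ℝ)) fun t _ => ?_,
    intervalIntegral.integral_zero, mul_zero]
  have h : ∀ u : loops 1 E2, (planarVariation u).2.1 t = 0 := fun _ => rfl
  simp [h]

theorem planarForm_planarTangentSpace {v w : Variation} (hv : v ∈ planarTangentSpace γ)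
    (hw : w ∈ planarTangentSpace γ) : planarForm v w = 0 := by
  obtain ⟨_, ⟨p, hp, rfl⟩, r, hr, rfl⟩ := Submodule.mem_sup.1 hv
  rw [planarForm_add_left, planarForm_vertical γ hr (planarTangentSpace_le γ hw), add_zero]
  obtain ⟨_, ⟨q, hq, rfl⟩, r', hr', rfl⟩ := Submodule.mem_sup.1 hw
  rw [planarForm_add_right, planarForm_planar, planarForm_swap, planarForm_vertical γ hr' hp,
    zero_add, neg_zero]

/-- A variation that is orthogonal to all planar variations is planar, up to the orbit. -/
theorem mem_planarTangentSpace_of_orthogonal {v : Variation} (hv : v ∈ tangentSpace γ.framed)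
    (h : ∀ w ∈ planarTangentSpace γ, planarForm v w = 0) : v ∈ planarTangentSpace γ := by
  obtain ⟨hv1, hv2, -⟩ := (mem_tangentSpace_framed γ).1 hv
  obtain ⟨T, hT⟩ := γ.exists_tangentLoop
  have hc := contDiff_euclidean.1 v.2.2.1
  let y : loops 1 E2 := ⟨fun t => !₂[v.2.1 t 2, -v.2.1 t 0], by
    rw [contDiff_euclidean]
    intro i
    fin_cases i
    · exact hc 2
    · exact (hc 0).neg, fun t => by
    have := v.2.2.2 t
    rw [one_smul] at this
    simp only [this, one_smul]⟩
  have hin : ∀ a b : E2, ⟪a, b⟫_ℝ = a 0 * b 0 + a 1 * b 1 := fun a b => by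
    simp only [PiLp.inner_apply, Fin.sum_univ_two, RCLike.inner_apply, conj_trivial]
    ring
  -- Planar variations are the primitives of the `u` with mean zero that are orthogonal to `T`, and
  -- on them the form is the `L²` pairing of `u` with the rotated framing component `y` of `v`.
  obtain ⟨c, l, hcl⟩ := exists_eq_const_add_smul (y := y) (T := T) fun u hu huT => by
    obtain ⟨U, hU⟩ := exists_primitive_loop hu
    have hd : ∀ t, deriv (planarVariation U).1.1 t = planeToSpace (u.1 t) := fun t => by
      rw [← hU]; exact deriv_loopMap _ _ _
    have hw : planarVariation U ∈ tangentSpace γ.framed := by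
      refine (mem_tangentSpace_framed γ).2 ⟨fun t => ?_, fun t => rfl, ?_⟩
      · have : (planarVariation U).2.1 t = 0 := rfl
        rw [hd, this, planeToSpace_apply]
        simp
      · refine Eq.trans (intervalIntegral.integral_congr fun t _ => ?_) huT
        simp only
        rw [hd, hin, hT, planeToSpace_apply]
        simp
    have h0 := h _ (Submodule.mem_sup_left ⟨U, hw, rfl⟩)
    rw [planarForm] at h0
    have h1 := (mul_eq_zero.1 h0).resolve_left (by norm_num)
    refine Eq.trans (intervalIntegral.integral_congr fun t _ => ?_) h1
    have h2 : (planarVariation U).2.1 t = 0 := rfl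
    simp only
    rw [hd, hin, h2, planeToSpace_apply]
    simp [y]
    ring
  have hy0 : ∀ t, v.2.1 t 2 = c 0 + l * γ.framed.T t 0 := fun t => by
    have := congrArg (fun x : E2 => x 0) (hcl t)
    simpa [y, hT] using this
  have hy1 : ∀ t, -v.2.1 t 0 = c 1 + l * γ.framed.T t 2 := fun t => by
    have := congrArg (fun x : E2 => x 1) (hcl t)
    simpa [y, hT] using this
  -- the vector tangent to the orbit with the same framing component as `v`
  have hWs : ∃ W : loops 1 E3, ∀ t, W.1 t = γ.framed.W t := by
    refine ⟨⟨fun t => !₂[-T.1 t 1, 0, T.1 t 0], ?_, fun t => ?_⟩, fun t => ?_⟩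
    · have hTc := contDiff_euclidean.1 T.2.1
      rw [contDiff_euclidean]
      intro i
      fin_cases i
      · exact (hTc 1).neg
      · exact contDiff_const
      · exact hTc 0
    · simp only [one_smul]
      rw [loops_periodic T]
    · change !₂[-T.1 t 1, 0, T.1 t 0] = _
      rw [hT, γ.W_eq]
      simp
  obtain ⟨W, hW⟩ := hWs
  set a : E3 := !₂[c 0, 0, c 1] with ha
  let crossCLM : E3 →L[ℝ] E3 := LinearMap.toContinuousLinearMap
    { toFun := fun v => cross a v
      map_add' := fun v w => by simp [cross]
      map_smul' := fun r v => by simp [cross] }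
  let r₀ : Variation := (loopMap crossCLM γ.framed.1.1, loopMap crossCLM γ.framed.1.2 + l • W)
  have hr1 : ∀ t, r₀.1.1 t = cross a (γ.framed.γ t) + 0 := fun t => (add_zero _).symm
  have hr2 : ∀ t, r₀.2.1 t = cross a (γ.framed.V t) + l • γ.framed.W t := fun t => by
    rw [← hW]; rfl
  have hr0 : r₀ ∈ verticalSpace γ.framed := (mem_verticalSpace_iff γ).2 ⟨a, 0, l, hr1, hr2⟩
  have hcomp := IsVertical.components γ hr1 hr2
  have hder : ∀ t, HasDerivAt (fun t => v.1.1 t 1 - r₀.1.1 t 1) 0 t := fun t => by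
    have e : deriv v.1.1 t 1 - deriv r₀.1.1 t 1 = 0 := by
      rw [(hcomp t).1.2.1]
      have := hv1 t
      have h0 := hy0 t
      have h1 := hy1 t
      have hTg : γ.framed.T t 0 * deriv γ.framed.γ t 2 = γ.framed.T t 2 * deriv γ.framed.γ t 0 := by
        rw [γ.T_apply, γ.T_apply]; ring
      simp only [ha, PiLp.toLp_apply, Matrix.cons_val_zero, Matrix.cons_val]
      linear_combination this - deriv γ.framed.γ t 2 * h0 + deriv γ.framed.γ t 0 * h1 - l * hTg
    rw [← e]
    exact (hasDerivAt_loop_coord v.1 t 1).sub (hasDerivAt_loop_coord r₀.1 t 1)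
  have hconst := is_const_of_deriv_eq_zero (fun t => (hder t).differentiableAt)
    (fun t => (hder t).deriv)
  -- What is left of the normal component of the curve is a translation.
  set b : E3 := !₂[0, v.1.1 0 1 - r₀.1.1 0 1, 0] with hb
  let r₁ : Variation :=
    (⟨fun _ => b, contDiff_const, fun _ => (one_smul _ _).symm⟩, 0)
  have hr1' : r₁ ∈ verticalSpace γ.framed := (mem_verticalSpace_iff γ).2 ⟨0, b, 0, fun t => by
    rw [cross_zero_left, zero_add], fun t => by rw [cross_zero_left, zero_smul, add_zero]; rfl⟩
  have hsum := add_mem hr0 hr1'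
  have e : v = (v - (r₀ + r₁)) + (r₀ + r₁) := (sub_add_cancel _ _).symm
  rw [e]
  refine add_mem (mem_planarTangentSpace γ
    (sub_mem hv (verticalSpace_le_tangentSpace γ hsum)) (fun t => ?_) fun t => ?_)
    (Submodule.mem_sup_right hsum)
  · change v.1.1 t 1 - (r₀.1.1 t 1 + b 1) = 0
    have := hconst t 0
    simp only at this
    rw [hb]
    simp
    linarith
  · change v.2.1 t - (r₀.2.1 t + 0) = 0
    rw [add_zero, sub_eq_zero]
    obtain ⟨-, k0, k1, k2⟩ := hcomp t
    have h0 := hy0 t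
    have h1 := hy1 t
    have a2 : a 2 = c 1 := rfl
    have a0 : a 0 = c 0 := rfl
    ext i
    fin_cases i
    · change v.2.1 t 0 = r₀.2.1 t 0
      rw [k0, a2]
      linarith
    · change v.2.1 t 1 = r₀.2.1 t 1
      rw [k1, hv2]
    · change v.2.1 t 2 = r₀.2.1 t 2
      rw [k2, a0, h0]

/-- The variations that move the base curve in the normal direction only. -/
noncomputable def normalTangentSpace : Submodule ℝ Variation :=
  tangentSpace γ.framed ⊓ LinearMap.ker (LinearMap.comp (loopMap spaceToPlane)
    (LinearMap.fst ℝ (loops 1 E3) (loops 1 E3)))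

theorem mem_normalTangentSpace {v : Variation} : v ∈ normalTangentSpace γ ↔
    v ∈ tangentSpace γ.framed ∧ ∀ t, v.1.1 t 0 = 0 ∧ v.1.1 t 2 = 0 := by
  rw [normalTangentSpace, Submodule.mem_inf, LinearMap.mem_ker]
  refine and_congr_right fun _ => ⟨fun h t => ?_, fun h => ?_⟩
  · have h1 : spaceToPlane (v.1.1 t) = 0 := congrFun (congrArg Subtype.val h) t
    exact ⟨congrArg (fun x : E2 => x 0) h1, congrArg (fun x : E2 => x 1) h1⟩
  · refine Subtype.ext (funext fun t => PiLp.ext fun i => ?_)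
    fin_cases i
    · exact (h t).1
    · exact (h t).2

theorem deriv_coord_eq_zero {f : loops 1 E3} {i : Fin 3} (h : ∀ t, f.1 t i = 0) (t : ℝ) :
    deriv f.1 t i = 0 := by
  rw [← (hasDerivAt_loop_coord f t i).deriv, funext h, deriv_const]

theorem planarForm_normal {v w : Variation} (hv : v ∈ normalTangentSpace γ ⊔ verticalSpace γ.framed)
    (hw : w ∈ normalTangentSpace γ ⊔ verticalSpace γ.framed) : planarForm v w = 0 := by
  have hle : normalTangentSpace γ ⊔ verticalSpace γ.framed ≤ tangentSpace γ.framed :=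
    sup_le inf_le_left (verticalSpace_le_tangentSpace γ)
  have hw' := hle hw
  obtain ⟨p, hp, r, hr, rfl⟩ := Submodule.mem_sup.1 hv
  rw [planarForm_add_left, planarForm_vertical γ hr hw', add_zero]
  obtain ⟨q, hq, r', hr', rfl⟩ := Submodule.mem_sup.1 hw
  rw [planarForm_add_right, planarForm_swap p r', planarForm_vertical γ hr'
    ((mem_normalTangentSpace γ).1 hp).1, neg_zero, add_zero]
  obtain ⟨-, hp0⟩ := (mem_normalTangentSpace γ).1 hp
  obtain ⟨-, hq0⟩ := (mem_normalTangentSpace γ).1 hq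
  rw [planarForm, intervalIntegral.integral_congr (g := fun _ => (0 : ℝ)) fun t _ => ?_,
    intervalIntegral.integral_zero, mul_zero]
  simp only
  rw [deriv_coord_eq_zero (fun t => (hp0 t).1), deriv_coord_eq_zero (fun t => (hp0 t).2),
    deriv_coord_eq_zero (fun t => (hq0 t).1), deriv_coord_eq_zero (fun t => (hq0 t).2)]
  ring

theorem sup_normal_eq :
    planarTangentSpace γ ⊔ (normalTangentSpace γ ⊔ verticalSpace γ.framed) =
      tangentSpace γ.framed := by
  refine le_antisymm (sup_le (planarTangentSpace_le γ)
    (sup_le inf_le_left (verticalSpace_le_tangentSpace γ))) fun v hv => ?_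
  obtain ⟨hv1, hv2, hv3⟩ := (mem_tangentSpace_framed γ).1 hv
  set p := planarVariation (loopMap spaceToPlane v.1) with hp
  have hd : ∀ t, deriv p.1.1 t = !₂[deriv v.1.1 t 0, 0, deriv v.1.1 t 2] := fun t => by
    have h1 : deriv p.1.1 t = planeToSpace (deriv (loopMap spaceToPlane v.1).1 t) :=
      deriv_loopMap _ _ _
    rw [h1, deriv_loopMap]
    rfl
  have hp2 : ∀ t, p.2.1 t = 0 := fun _ => rfl
  have hpT : p ∈ tangentSpace γ.framed := by
    refine (mem_tangentSpace_framed γ).2 ⟨fun t => ?_, fun t => ?_, ?_⟩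
    · rw [hd, hp2]
      simp
    · rw [hp2]; rfl
    · simp only [hd]
      exact hv3
  rw [← add_sub_cancel p v]
  refine Submodule.add_mem_sup (mem_planarTangentSpace γ hpT (fun t => rfl) hp2)
    (Submodule.mem_sup_left ((mem_normalTangentSpace γ).2 ⟨sub_mem hv hpT, fun t => ⟨?_, ?_⟩⟩))
  · exact sub_self (v.1.1 t 0)
  · exact sub_self (v.1.1 t 2)

theorem inf_normal_eq :
    planarTangentSpace γ ⊓ (normalTangentSpace γ ⊔ verticalSpace γ.framed) =
      verticalSpace γ.framed := by
  refine le_antisymm (fun v hv => ?_) (le_inf le_sup_right le_sup_right)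
  obtain ⟨hvL, hvK⟩ := hv
  obtain ⟨_, ⟨u, hu, rfl⟩, r, hr, rfl⟩ := Submodule.mem_sup.1 hvL
  refine add_mem ?_ hr
  obtain ⟨q, hq, r', hr', hqr⟩ := Submodule.mem_sup.1 hvK
  obtain ⟨-, hq0⟩ := (mem_normalTangentSpace γ).1 hq
  obtain ⟨a, b, c, h1, -⟩ := (mem_verticalSpace_iff γ).1 (sub_mem hr' hr)
  have hpq : planarVariation u = q + (r' - r) := by
    rw [← add_sub_assoc, hqr, add_sub_cancel_right]
  refine (mem_verticalSpace_iff γ).2 ⟨!₂[0, a 1, 0], !₂[b 0, 0, b 2], 0, fun t => ?_, fun t => ?_⟩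
  · have e : (planarVariation u).1.1 t = q.1.1 t + (r' - r).1.1 t := by rw [hpq]; rfl
    have hg1 : γ.framed.γ t 1 = 0 := rfl
    rw [h1] at e
    ext i
    fin_cases i
    · have := congrArg (fun x : E3 => x 0) e
      simpa [(hq0 t).1, cross, cross_apply, hg1] using this
    · change (0 : ℝ) = _
      simp [cross, cross_apply]
    · have := congrArg (fun x : E3 => x 2) e
      simpa [(hq0 t).2, cross, cross_apply, hg1] using this
  · rw [zero_smul, add_zero, γ.framed_V]
    change (0 : E3) = _
    ext i
    fin_cases i <;> simp [cross, cross_apply]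

/-- The planar directions are their own symplectic complement, and the variations in the normal
direction of the plane form an isotropic complement. -/
theorem isLagrangian_planar :
    IsLagrangian (tangentSpace γ.framed) (verticalSpace γ.framed) (planarTangentSpace γ)
      (fun v w => symplecticForm γ.framed v.fields w.fields) := by
  have hK : normalTangentSpace γ ⊔ verticalSpace γ.framed ≤ tangentSpace γ.framed :=
    sup_le inf_le_left (verticalSpace_le_tangentSpace γ)
  refine ⟨le_sup_right, planarTangentSpace_le γ, fun v hv => ⟨fun h => ?_, fun h w hw => ?_⟩,
    normalTangentSpace γ ⊔ verticalSpace γ.framed, le_sup_right, hK, fun v hv w hw => ?_,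
    sup_normal_eq γ, inf_normal_eq γ⟩
  · refine mem_planarTangentSpace_of_orthogonal γ hv fun w hw => ?_
    rw [← symplecticForm_eq_planarForm γ hv (planarTangentSpace_le γ hw)]
    exact h w hw
  · refine (symplecticForm_eq_planarForm γ hv (planarTangentSpace_le γ hw)).trans ?_
    exact planarForm_planarTangentSpace γ h hw
  · refine (symplecticForm_eq_planarForm γ (hK hv) (hK hw)).trans ?_
    exact planarForm_normal γ hv hw

end Lagrangian

/-! ### Horizontal lifts of curves -/

/-- The component of `X` that is orthogonal to the span of the orthonormal pair `F`. -/
noncomputable def horizontal (F X : ℝ → Fin 2 → ℂ) : ℝ → Fin 2 → ℂ := X - rmul F (gram F X)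

/-- The real `L²` inner product. -/
noncomputable def l2Inner (X Y : ℝ → Fin 2 → ℂ) : ℝ := (gram X Y).trace.re

section

variable {F X Y : ℝ → Fin 2 → ℂ}

theorem rmul_add_left (X Y : ℝ → Fin 2 → ℂ) (M : Matrix (Fin 2) (Fin 2) ℂ) :
    rmul (X + Y) M = rmul X M + rmul Y M := by
  ext t i
  simp only [rmul_apply, Pi.add_apply]
  ring

theorem rmul_add_right (X : ℝ → Fin 2 → ℂ) (M N : Matrix (Fin 2) (Fin 2) ℂ) :
    rmul X (M + N) = rmul X M + rmul X N := by
  ext t i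
  simp only [rmul_apply, Pi.add_apply, Matrix.add_apply]
  ring

theorem rmul_neg_right (X : ℝ → Fin 2 → ℂ) (M : Matrix (Fin 2) (Fin 2) ℂ) :
    rmul X (-M) = -rmul X M := by
  ext t i
  simp only [rmul_apply, Pi.neg_apply, Matrix.neg_apply]
  ring

theorem rmul_zero_right (X : ℝ → Fin 2 → ℂ) : rmul X 0 = 0 := by
  ext t i
  simp [rmul_apply]

theorem horizontal_eq (F X : ℝ → Fin 2 → ℂ) : horizontal F X = X + rmul F (-gram F X) := by
  rw [rmul_neg_right, horizontal, sub_eq_add_neg]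

theorem continuous_horizontal (hF : Continuous F) (hX : Continuous X) :
    Continuous (horizontal F X) := hX.sub (continuous_rmul hF _)

theorem gram_horizontal_right (hF : Continuous F) (hX : Continuous X) (h : gram F F = 1) :
    gram F (horizontal F X) = 0 := by
  rw [horizontal_eq, gram_add_right hF hX (continuous_rmul hF _), gram_rmul_right hF hF, h, one_mul,
    add_neg_cancel]

theorem gram_horizontal (hF : Continuous F) (hX : Continuous X) (hY : Continuous Y)
    (h : gram F F = 1) :
    gram (horizontal F X) (horizontal F Y) = gram X Y - gram X F * gram F Y := by
  have h1 := gram_horizontal_right hF hY h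
  conv_lhs => rw [horizontal_eq F X]
  rw [gram_add_left hX (continuous_rmul hF _) (continuous_horizontal hF hY),
    gram_rmul_left hF (continuous_horizontal hF hY), h1, mul_zero, add_zero, horizontal_eq,
    gram_add_right hX hY (continuous_rmul hF _), gram_rmul_right hX hF, mul_neg, sub_eq_add_neg]

theorem horizontal_of_gram_eq_zero (h : gram F X = 0) : horizontal F X = X := by
  rw [horizontal, h, rmul_zero_right, sub_zero]

/-- Horizontal components do not see a change of gauge. -/
theorem horizontal_rmul (hF : Continuous F) (hX : Continuous X) (h : gram F F = 1)
    {U : Matrix (Fin 2) (Fin 2) ℂ} (hU : U ∈ Matrix.unitaryGroup (Fin 2) ℂ)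
    (K : Matrix (Fin 2) (Fin 2) ℂ) :
    horizontal (rmul F U) (rmul X U + rmul F K) = rmul (horizontal F X) U := by
  have hU' : U * U.conjTranspose = 1 := Matrix.mem_unitaryGroup_iff.1 hU
  rw [horizontal_eq, horizontal_eq, gram_rmul_left hF ((continuous_rmul hX _).add
    (continuous_rmul hF _)), gram_add_right hF (continuous_rmul hX _) (continuous_rmul hF _),
    gram_rmul_right hF hX, gram_rmul_right hF hF, h, one_mul, rmul_rmul, rmul_add_left, rmul_rmul,
    mul_neg, ← mul_assoc, hU', one_mul, rmul_neg_right, rmul_add_right, neg_mul,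
    rmul_neg_right]
  abel

theorem l2Inner_rmul (hX : Continuous X) (hY : Continuous Y) {U : Matrix (Fin 2) (Fin 2) ℂ}
    (hU : U ∈ Matrix.unitaryGroup (Fin 2) ℂ) : l2Inner (rmul X U) (rmul Y U) = l2Inner X Y := by
  have hU' : U * U.conjTranspose = 1 := Matrix.mem_unitaryGroup_iff.1 hU
  rw [l2Inner, gram_rmul_left hX (continuous_rmul hY _), gram_rmul_right hX hY,
    Matrix.trace_mul_comm,
    mul_assoc, hU', mul_one, l2Inner]

theorem l2Inner_comm (X Y : ℝ → Fin 2 → ℂ) : l2Inner X Y = l2Inner Y X := by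
  rw [l2Inner, l2Inner, ← gram_conjTranspose, Matrix.trace_conjTranspose, Complex.star_def,
    Complex.conj_re]

theorem l2Inner_self (X : ℝ → Fin 2 → ℂ) (hX : Continuous X) :
    l2Inner X X = ∫ t in (0 : ℝ)..2, rowNormSq (X t) := by
  have hc : ∀ i, Continuous fun t => ‖X t i‖ ^ 2 := fun i =>
    ((continuous_pi_iff.1 hX i).norm).pow 2
  have h : ∀ t, rowNormSq (X t) = ‖X t 0‖ ^ 2 + ‖X t 1‖ ^ 2 := fun t => rfl
  simp only [h]
  rw [l2Inner, Matrix.trace_fin_two, gram_self_apply, gram_self_apply, Complex.add_re,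
    Complex.ofReal_re, Complex.ofReal_re, intervalIntegral.integral_add
      ((hc 0).intervalIntegrable _ _) ((hc 1).intervalIntegrable _ _)]

theorem rowNormSq_nonneg (v : Fin 2 → ℂ) : 0 ≤ rowNormSq v := by
  rw [rowNormSq]; positivity

theorem l2Inner_self_nonneg (hX : Continuous X) : 0 ≤ l2Inner X X := by
  rw [l2Inner_self X hX]
  exact intervalIntegral.integral_nonneg (by norm_num) fun t _ => rowNormSq_nonneg _

theorem eq_zero_of_l2Inner_self {σ : ℤˣ} (hX : Continuous X) (hp : ∀ t, X (t + 2) = σ • X t)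
    (h : l2Inner X X = 0) : X = 0 := by
  by_contra hne
  have h1 : ∃ t ∈ Icc (0 : ℝ) 2, X t ≠ 0 := by
    obtain ⟨t, ht⟩ := Function.ne_iff.1 hne
    have hper : Function.Periodic (fun t => ‖X t‖) 2 := fun t => by
      simp only [hp]
      rcases Int.units_eq_one_or σ with rfl | rfl <;> simp [Units.smul_def]
    obtain ⟨s, hs, hst⟩ := hper.exists_mem_Ico₀ two_pos t
    exact ⟨s, ⟨hs.1, hs.2.le⟩, by rwa [← norm_ne_zero_iff, ← hst, norm_ne_zero_iff]⟩
  obtain ⟨t, ht, hXt⟩ := h1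
  have hc : Continuous fun t => rowNormSq (X t) :=
    (((continuous_pi_iff.1 hX 0).norm).pow 2).add (((continuous_pi_iff.1 hX 1).norm).pow 2)
  refine (intervalIntegral.integral_pos (by norm_num) hc.continuousOn
    (fun t _ => rowNormSq_nonneg (X t)) ⟨t, ht, rowNormSq_pos hXt⟩).ne' ?_
  rw [← l2Inner_self X hX, h]

theorem l2Inner_self_eq (hF : Continuous F) (hX : Continuous X) (h : gram F F = 1) :
    l2Inner X X = l2Inner (horizontal F X) (horizontal F X) +
      ((gram F X).conjTranspose * gram F X).trace.re := by
  rw [l2Inner, l2Inner, gram_horizontal hF hX hX h, gram_conjTranspose, Matrix.trace_sub,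
    Complex.sub_re, sub_add_cancel]

theorem trace_conjTranspose_mul_self_nonneg (M : Matrix (Fin 2) (Fin 2) ℂ) :
    0 ≤ (M.conjTranspose * M).trace.re := by
  simp only [Matrix.trace_fin_two, Matrix.mul_apply, Fin.sum_univ_two, Matrix.conjTranspose_apply,
    Complex.add_re, Complex.star_def, ← Complex.normSq_eq_conj_mul_self, Complex.ofReal_re]
  have := Complex.normSq_nonneg
  nlinarith [this (M 0 0), this (M 1 0), this (M 0 1), this (M 1 1)]

/-- The trace pairing of a skew-Hermitian and a Hermitian matrix is imaginary. -/
theorem trace_skew_mul_hermitian {K M : Matrix (Fin 2) (Fin 2) ℂ} (hK : K.conjTranspose = -K)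
    (hM : M.conjTranspose = M) : (K * M).trace.re = 0 := by
  have h : star (K * M).trace = -(K * M).trace := by
    rw [← Matrix.trace_conjTranspose, Matrix.conjTranspose_mul, hK, hM, mul_neg, Matrix.trace_neg,
      Matrix.trace_mul_comm]
  have := congrArg Complex.re h
  rw [Complex.star_def, Complex.conj_re, Complex.neg_re] at this
  linarith

end

section

variable {E : Type} [NormedAddCommGroup E] [NormedSpace ℝ E] {σ τ : ℤˣ}

/-- The derivative of a family of orthonormal pairs in the direction `v` of the parameter space. -/
noncomputable def rowDeriv (v : E) (Φ : E → Stiefel ℂ σ) : E → ℝ → Fin 2 → ℂ :=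
  parDeriv v fun x => (Φ x).row

theorem Stiefel.continuous_row (Φ : Stiefel ℂ σ) : Continuous Φ.row := Φ.isFrame.contDiff.continuous

theorem Stiefel.gram_self (Φ : Stiefel ℂ σ) : gram Φ.row Φ.row = 1 := Φ.isFrame.gram_self

theorem SmoothFamily.contDiff_rowDeriv {Φ : E → Stiefel ℂ σ} (h : SmoothFamily Φ) (v : E) :
    ContDiff ℝ ∞ (Function.uncurry (rowDeriv v Φ)) := contDiff_parDeriv h v

theorem SmoothFamily.continuous_rowDeriv {Φ : E → Stiefel ℂ σ} (h : SmoothFamily Φ) (v x : E) :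
    Continuous (rowDeriv v Φ x) := (contDiff_slice (h.contDiff_rowDeriv v) x).continuous

theorem parDeriv_congr {W : Type} [NormedAddCommGroup W] [NormedSpace ℝ W] {F G : E → ℝ → W}
    {x : E} (h : ∀ᶠ y in 𝓝 x, F y = G y) (v : E) : parDeriv v F x = parDeriv v G x := by
  ext t
  have : (fun y => F y t) =ᶠ[𝓝 x] fun y => G y t := h.mono fun y hy => congrFun hy t
  rw [parDeriv, parDeriv, this.fderiv_eq]

theorem SmoothFamily.gram_rowDeriv_skew [ProperSpace E] {Φ : E → Stiefel ℂ σ} (h : SmoothFamily Φ)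
    (v x : E) : gram (rowDeriv v Φ x) (Φ x).row = -gram (Φ x).row (rowDeriv v Φ x) := by
  rw [eq_neg_iff_add_eq_zero]
  ext i j
  have h1 := fderiv_gram h h v x i j
  simp only [Stiefel.gram_self] at h1
  rw [fderiv_const_apply] at h1
  exact h1.symm

/-- Two families with the same classes differ by a smooth change of gauge. -/
theorem exists_gauge [ProperSpace E] {Φ : E → Stiefel ℂ σ} {Ψ : E → Stiefel ℂ τ}
    (hΦ : SmoothFamily Φ) (hΨ : SmoothFamily Ψ) {x : E}
    (h : ∀ᶠ y in 𝓝 x, complexCoordinates σ (Quotient.mk _ (Φ y)) =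
      complexCoordinates τ (Quotient.mk _ (Ψ y))) :
    ∃ M : E → Matrix (Fin 2) (Fin 2) ℂ, SmoothMatrix M ∧ ∀ᶠ y in 𝓝 x,
      M y ∈ Matrix.unitaryGroup (Fin 2) ℂ ∧ (Ψ y).row = rmul (Φ y).row (M y) := by
  refine ⟨fun y => gram (Φ y).row (Ψ y).row, smoothMatrix_gram hΦ hΨ, ?_⟩
  filter_upwards [h] with y hy
  obtain ⟨-, U, hU, hΨU⟩ := complexCoordinates_eq_iff.1 hy
  have : gram (Φ y).row (Ψ y).row = U := by
    rw [hΨU, gram_rmul_right (Φ y).continuous_row (Φ y).continuous_row, (Φ y).gram_self, one_mul]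
  rw [this]
  exact ⟨hU, hΨU⟩

theorem rowDeriv_gauge {Φ : E → Stiefel ℂ σ} {Ψ : E → Stiefel ℂ τ} (hΦ : SmoothFamily Φ)
    {M : E → Matrix (Fin 2) (Fin 2) ℂ} (hM : SmoothMatrix M) {x : E}
    (h : ∀ᶠ y in 𝓝 x, (Ψ y).row = rmul (Φ y).row (M y)) (v : E) :
    rowDeriv v Ψ x = rmul (rowDeriv v Φ x) (M x) +
      rmul (Φ x).row (Matrix.of fun i j => fderiv ℝ (fun x => M x i j) x v) := by
  rw [rowDeriv, parDeriv_congr h, parDeriv_rmul hΦ hM]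
  rfl

theorem horizontal_gauge {Φ : E → Stiefel ℂ σ} {Ψ : E → Stiefel ℂ τ} (hΦ : SmoothFamily Φ)
    {M : E → Matrix (Fin 2) (Fin 2) ℂ} (hM : SmoothMatrix M) {x : E}
    (h : ∀ᶠ y in 𝓝 x, M y ∈ Matrix.unitaryGroup (Fin 2) ℂ ∧ (Ψ y).row = rmul (Φ y).row (M y))
    (v : E) :
    horizontal (Ψ x).row (rowDeriv v Ψ x) =
      rmul (horizontal (Φ x).row (rowDeriv v Φ x)) (M x) := by
  rw [rowDeriv_gauge hΦ hM (h.mono fun y hy => hy.2) v, h.self_of_nhds.2]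
  exact horizontal_rmul (Φ x).continuous_row (hΦ.continuous_rowDeriv v x) (Φ x).gram_self
    h.self_of_nhds.1 _

/-- The family obtained by a unitary change of gauge. -/
noncomputable def Stiefel.gauge (Φ : Stiefel ℂ σ) {U : Matrix (Fin 2) (Fin 2) ℂ}
    (hU : U ∈ Matrix.unitaryGroup (Fin 2) ℂ) : Stiefel ℂ σ := (Φ.isFrame.rmul hU).toStiefel

theorem Stiefel.row_gauge (Φ : Stiefel ℂ σ) {U : Matrix (Fin 2) (Fin 2) ℂ}
    (hU : U ∈ Matrix.unitaryGroup (Fin 2) ℂ) : (Φ.gauge hU).row = _root_.rmul Φ.row U :=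
  IsFrame.row_toStiefel _

theorem Stiefel.mk_gauge (Φ : Stiefel ℂ σ) {U : Matrix (Fin 2) (Fin 2) ℂ}
    (hU : U ∈ Matrix.unitaryGroup (Fin 2) ℂ) :
    Quotient.mk (stiefelSetoid ℂ σ) (Φ.gauge hU) = Quotient.mk _ Φ :=
  (Stiefel.mk_eq_of_rmul (Φ.row_gauge hU)).symm

theorem SmoothFamily.gauge {Φ : E → Stiefel ℂ σ} (hΦ : SmoothFamily Φ)
    {M : E → Matrix (Fin 2) (Fin 2) ℂ} (hM : SmoothMatrix M)
    (hU : ∀ x, M x ∈ Matrix.unitaryGroup (Fin 2) ℂ) : SmoothFamily fun x => (Φ x).gauge (hU x) := by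
  simp only [SmoothFamily, Stiefel.row_gauge]
  exact contDiff_rmul_family hΦ hM

/-- A curve of orthonormal pairs is horizontal near `u` if its velocity is orthogonal to its span
there. -/
def IsHorizontalAt (Φ : ℝ → Stiefel ℂ σ) (u : ℝ) : Prop :=
  ∀ᶠ w in 𝓝 u, gram (Φ w).row (rowDeriv 1 Φ w) = 0

theorem realValued_parDeriv {F : ℝ → ℝ → Fin 2 → ℂ} (hF : ContDiff ℝ ∞ (Function.uncurry F))
    (h : ∀ u, RealValued (F u)) (u : ℝ) : RealValued (parDeriv 1 F u) := fun t k => by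
  have h1 : HasDerivAt (fun w => F w t k) (parDeriv 1 F u t k) u :=
    hasDerivAt_pi.1 (hasDerivAt_parDeriv hF u t) k
  have h2 := Complex.imCLM.hasFDerivAt.comp_hasDerivAt u h1
  have h3 : (Complex.imCLM ∘ fun w => F w t k) = fun _ => 0 := funext fun w => h w t k
  rw [h3] at h2
  exact h2.unique (hasDerivAt_const u 0)

/-- Local solvability of the linear equation `M' = -A M` for matrices, with real solutions for real
coefficients. -/
theorem exists_matrix_ode {A : ℝ → Matrix (Fin 2) (Fin 2) ℂ} (hA : SmoothMatrix A) (u₀ : ℝ) :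
    ∃ (z : ℝ → Fin 2 → Fin 2 → ℂ) (δ : ℝ), 0 < δ ∧ (∀ i j, z u₀ i j = if i = j then 1 else 0) ∧
      ContDiffOn ℝ ∞ z (Ioo (u₀ - δ) (u₀ + δ)) ∧
      (∀ u ∈ Ioo (u₀ - δ) (u₀ + δ), ∀ i j, HasDerivAt (fun w => z w i j)
        (-(A u i 0 * z u 0 j + A u i 1 * z u 1 j)) u) ∧
      ((∀ u, RealMatrix (A u)) → ∀ u i j, (z u i j).im = 0) := by
  let L : ℝ → (Fin 2 → Fin 2 → ℂ) →L[ℝ] (Fin 2 → Fin 2 → ℂ) := fun u =>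
    LinearMap.toContinuousLinearMap
      { toFun := fun y i j => -(A u i 0 * y 0 j + A u i 1 * y 1 j)
        map_add' := fun y z => by
          ext i j
          simp only [Pi.add_apply]
          ring
        map_smul' := fun c y => by
          ext i j
          simp only [Pi.smul_apply, Complex.real_smul, RingHom.id_apply]
          ring }
  have hL : ContDiff ℝ ∞ L := by
    rw [contDiff_clm_apply_iff]
    intro y
    refine contDiff_pi.2 fun i => contDiff_pi.2 fun j => ?_
    exact (((hA i 0).mul contDiff_const).add ((hA i 1).mul contDiff_const)).neg
  obtain ⟨y, δ, hδ, hy0, hy, hyd⟩ := exists_linear_ode hL u₀ fun i j => if i = j then 1 else 0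
  have hyd' : ∀ u ∈ Ioo (u₀ - δ) (u₀ + δ), ∀ i j, HasDerivAt (fun w => y w i j)
      (-(A u i 0 * y u 0 j + A u i 1 * y u 1 j)) u := fun u hu i j =>
    hasDerivAt_pi.1 (hasDerivAt_pi.1 (hyd u hu) i) j
  by_cases hr : ∀ u, RealMatrix (A u)
  · refine ⟨fun u i j => ((y u i j).re : ℂ), δ, hδ, fun i j => ?_, ?_, fun u hu i j => ?_,
      fun _ u i j => Complex.ofReal_im _⟩
    · simp only [hy0]
      split_ifs <;> simp
    · refine contDiffOn_pi.2 fun i => contDiffOn_pi.2 fun j => ?_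
      exact Complex.ofRealCLM.contDiff.comp_contDiffOn (Complex.reCLM.contDiff.comp_contDiffOn
        (contDiffOn_pi.1 (contDiffOn_pi.1 hy i) j))
    · have h := Complex.ofRealCLM.hasFDerivAt.comp_hasDerivAt u
        (Complex.reCLM.hasFDerivAt.comp_hasDerivAt u (hyd' u hu i j))
      have h0 : ∀ k l, A u k l = ((A u k l).re : ℂ) := fun k l =>
        Complex.ext rfl (by rw [hr u k l, Complex.ofReal_im])
      refine h.congr_deriv ?_
      rw [Complex.ofRealCLM_apply, Complex.reCLM_apply, h0 i 0, h0 i 1]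
      simp
  · exact ⟨y, δ, hδ, fun i j => by rw [hy0], hy, hyd', fun h => absurd h hr⟩

/-- The parallel transport of frames along a curve of orthonormal pairs, near a given time. -/
theorem exists_parallel {Φ : ℝ → Stiefel ℂ σ} (hΦ : SmoothFamily Φ) (u₀ : ℝ) :
    ∃ M : ℝ → Matrix (Fin 2) (Fin 2) ℂ, SmoothMatrix M ∧
      (∀ u, M u ∈ Matrix.unitaryGroup (Fin 2) ℂ) ∧ M u₀ = 1 ∧
      ((∀ u, RealValued (Φ u).row) → ∀ u, RealMatrix (M u)) ∧
      ∀ᶠ u in 𝓝 u₀, (Matrix.of fun i j => fderiv ℝ (fun x => M x i j) u 1) =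
        -(gram (Φ u).row (rowDeriv 1 Φ u) * M u) := by
  obtain ⟨z, δ, hδ, hz0, hz, hzd, hzr⟩ := exists_matrix_ode
    (A := fun u => gram (Φ u).row (rowDeriv 1 Φ u)) (smoothMatrix_gram hΦ (hΦ.contDiff_rowDeriv 1))
    u₀
  have hskew : ∀ u i j, star (gram (Φ u).row (rowDeriv 1 Φ u) i j) =
      -gram (Φ u).row (rowDeriv 1 Φ u) j i := fun u i j => by
    have h1 := hΦ.gram_rowDeriv_skew 1 u
    rw [← gram_conjTranspose] at h1
    have := congrFun (congrFun h1 j) i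
    rwa [Matrix.conjTranspose_apply] at this
  have hmem : u₀ ∈ Ioo (u₀ - δ) (u₀ + δ) := ⟨by linarith, by linarith⟩
  -- `z* z` is constant because `A` is skew-Hermitian.
  have hun : ∀ u ∈ Ioo (u₀ - δ) (u₀ + δ), ∀ i j,
      star (z u 0 i) * z u 0 j + star (z u 1 i) * z u 1 j = if i = j then 1 else 0 := by
    intro u hu i j
    have hd : ∀ w ∈ Ioo (u₀ - δ) (u₀ + δ), HasDerivAt
        (fun w => star (z w 0 i) * z w 0 j + star (z w 1 i) * z w 1 j) 0 w := by
      intro w hw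
      have hs : ∀ k, HasDerivAt (fun w => star (z w k i)) _ w := fun k => (hzd w hw k i).star
      refine (((hs 0).mul (hzd w hw 0 j)).add ((hs 1).mul (hzd w hw 1 j))).congr_deriv ?_
      simp only [star_neg, star_add, star_mul', hskew]
      ring
    have hc := isOpen_Ioo.is_const_of_deriv_eq_zero isPreconnected_Ioo
      (fun w hw => (hd w hw).differentiableAt.differentiableWithinAt)
      (fun w hw => (hd w hw).deriv) hu hmem
    rw [hc]
    simp only [hz0]
    fin_cases i <;> fin_cases j <;> simp
  obtain ⟨ρ, hρ, hρm, hρe⟩ := exists_smooth_retraction (Ioo_mem_nhds hmem.1 hmem.2)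
  refine ⟨fun u => Matrix.of (z (ρ u)), fun i j => ?_, fun u => ?_, ?_, fun h u i j => ?_, ?_⟩
  · exact contDiff_pi.1 (contDiff_pi.1 (hz.comp_contDiff hρ hρm) i) j
  · rw [Matrix.mem_unitaryGroup_iff', Matrix.star_eq_conjTranspose]
    ext i j
    rw [Matrix.mul_apply, Fin.sum_univ_two, Matrix.conjTranspose_apply, Matrix.conjTranspose_apply,
      Matrix.one_apply]
    exact hun _ (hρm u) i j
  · ext i j
    rw [Matrix.one_apply]
    change z (ρ u₀) i j = _
    rw [hρe.self_of_nhds]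
    exact hz0 i j
  · exact hzr (fun w => (h w).gram (realValued_parDeriv hΦ h w)) _ i j
  · filter_upwards [hρe, hρe.eventually_nhds] with u h1 h2
    ext i j
    have h3 : (fun w => Matrix.of (z (ρ w)) i j) =ᶠ[𝓝 u] fun w => z w i j :=
      h2.mono fun w hw => by simp only [hw, Matrix.of_apply]
    have hu := hρm u
    rw [h1] at hu
    have h4 := (hzd u hu i j).deriv
    rw [Matrix.of_apply, h3.fderiv_eq, Matrix.neg_apply, Matrix.mul_apply, Fin.sum_univ_two, h1]
    exact h4

theorem exists_horizontal {Φ : ℝ → Stiefel ℂ σ} (hΦ : SmoothFamily Φ) (u₀ : ℝ) :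
    ∃ (M : ℝ → Matrix (Fin 2) (Fin 2) ℂ) (hU : ∀ u, M u ∈ Matrix.unitaryGroup (Fin 2) ℂ),
      SmoothMatrix M ∧ M u₀ = 1 ∧ ((∀ u, RealValued (Φ u).row) → ∀ u, RealMatrix (M u)) ∧
      IsHorizontalAt (fun u => (Φ u).gauge (hU u)) u₀ := by
  obtain ⟨M, hM, hU, h1, hr, hd⟩ := exists_parallel hΦ u₀
  refine ⟨M, hU, hM, h1, hr, ?_⟩
  filter_upwards [hd] with u hu
  have hc := (Φ u).continuous_row
  have hc' := hΦ.continuous_rowDeriv 1 u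
  rw [rowDeriv_gauge hΦ hM (Eventually.of_forall fun y => (Φ y).row_gauge (hU y)), hu,
    Stiefel.row_gauge, gram_rmul_left hc ((continuous_rmul hc' _).add (continuous_rmul hc _)),
    gram_add_right hc (continuous_rmul hc' _) (continuous_rmul hc _), gram_rmul_right hc hc',
    gram_rmul_right hc hc, (Φ u).gram_self, one_mul, add_neg_cancel, mul_zero]

end

/-! ### The metric in complex coordinates -/

section

variable {σ τ : ℤˣ} {Γ Δ : ℝ → FramedLoop} {Ψ : ℝ → Stiefel ℂ σ} {Ξ : ℝ → Stiefel ℂ τ}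

/-- The curve `Ψ` of orthonormal pairs represents the curve `Γ` of framed loops up to
translations. -/
def Represents (Ψ : ℝ → Stiefel ℂ σ) (Γ : ℝ → FramedLoop) : Prop :=
  (∀ w t, hopfTangent (Ψ w).row t = deriv (Γ w).γ t) ∧ ∀ w t, hopfFraming (Ψ w).row t = (Γ w).V t

theorem represents_toFramed (Ψ : ℝ → Stiefel ℂ σ) : Represents Ψ fun u => (Ψ u).toFramed :=
  ⟨fun w t => ((Ψ w).deriv_toFramed t).symm, fun _ _ => rfl⟩

theorem hasDerivAt_row (hΨ : SmoothFamily Ψ) (u t : ℝ) (i : Fin 2) :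
    HasDerivAt (fun w => (Ψ w).row t i) (rowDeriv 1 Ψ u t i) u :=
  hasDerivAt_pi.1 (hasDerivAt_parDeriv hΨ u t) i

theorem Represents.deriv_velocity_fst (h : Represents Ψ Γ) (hΓ : SmoothFramedFamily Γ)
    (hΨ : SmoothFamily Ψ) (u t : ℝ) :
    deriv (velocity Γ u).1 t = dhopf₁ ((Ψ u).row t 0) ((Ψ u).row t 1) (rowDeriv 1 Ψ u t 0)
      (rowDeriv 1 Ψ u t 1) := by
  have h1 : (velocity Γ u).1 = parDeriv 1 (fun w => (Γ w).γ) u := rfl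
  have h2 : (fun (y : ℝ) s => deriv (Γ y).γ s) = fun y s => hopf₁ ((Ψ y).row s 0) ((Ψ y).row s 1) :=
    funext fun y => funext fun s => (h.1 y s).symm
  rw [h1, deriv_parDeriv hΓ.1, h2]
  exact (hasDerivAt_hopf₁ (hasDerivAt_row hΨ u t 0) (hasDerivAt_row hΨ u t 1)).deriv

theorem Represents.velocity_snd (h : Represents Ψ Γ) (hΨ : SmoothFamily Ψ) (u t : ℝ) :
    (velocity Γ u).2 t = deriv (fun w => (rowNormSq ((Ψ w).row t))⁻¹) u •
        hopf₂ ((Ψ u).row t 0) ((Ψ u).row t 1) +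
      (rowNormSq ((Ψ u).row t))⁻¹ • dhopf₂ ((Ψ u).row t 0) ((Ψ u).row t 1) (rowDeriv 1 Ψ u t 0)
        (rowDeriv 1 Ψ u t 1) := by
  have h2 : (fun w => (Γ w).V t) = fun w => (rowNormSq ((Ψ w).row t))⁻¹ •
      hopf₂ ((Ψ w).row t 0) ((Ψ w).row t 1) := funext fun w => (h.2 w t).symm
  have h3 : DifferentiableAt ℝ (fun w => (rowNormSq ((Ψ w).row t))⁻¹) u := by
    have hc : ContDiff ℝ ∞ fun w => (Ψ w).row t := by
      have := ContDiff.comp hΨ (contDiff_id.prodMk (contDiff_const (c := t)))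
      exact this
    exact (hc.rowNormSq.differentiable (by simp)).differentiableAt.inv
      (rowNormSq_pos ((Ψ u).isFrame.ne_zero t)).ne'
  change deriv (fun w => (Γ w).V t) u = _
  rw [h2, add_comm]
  exact (h3.hasDerivAt.smul (hasDerivAt_hopf₂ (hasDerivAt_row hΨ u t 0)
    (hasDerivAt_row hΨ u t 1))).deriv

theorem Represents.norm_deriv (h : Represents Ψ Γ) (u t : ℝ) :
    ‖deriv (Γ u).γ t‖ = rowNormSq ((Ψ u).row t) := by rw [← h.1, norm_hopfTangent]

theorem Represents.W_eq (h : Represents Ψ Γ) (u t : ℝ) :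
    (Γ u).W t = (rowNormSq ((Ψ u).row t))⁻¹ • hopf₃ ((Ψ u).row t 0) ((Ψ u).row t 1) :=
  hopf_W ((Ψ u).isFrame.ne_zero t) (h.1 u t) (h.2 u t)

theorem Represents.inner_velocity_snd (h : Represents Ψ Γ) (hΨ : SmoothFamily Ψ) (u t : ℝ) :
    ⟪(velocity Γ u).2 t, (Γ u).W t⟫_ℝ = -2 * (rowNormSq ((Ψ u).row t))⁻¹ *
      (star ((Ψ u).row t 0) * rowDeriv 1 Ψ u t 0 + star ((Ψ u).row t 1) * rowDeriv 1 Ψ u t 1).im :=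
        by
  have hn : rowNormSq ((Ψ u).row t) ≠ 0 := (rowNormSq_pos ((Ψ u).isFrame.ne_zero t)).ne'
  have e : rowNormSq ((Ψ u).row t) = ‖(Ψ u).row t 0‖ ^ 2 + ‖(Ψ u).row t 1‖ ^ 2 := rfl
  rw [h.velocity_snd hΨ, h.W_eq, inner_add_left, real_inner_smul_left, real_inner_smul_left,
    real_inner_smul_right, real_inner_smul_right, inner_hopf₂_hopf₃, inner_dhopf₂_hopf₃, ← e]
  field_simp
  ring

/-- In complex coordinates the metric is the `L²` metric. -/
theorem Represents.metric_velocity (h : Represents Ψ Γ) (hΓ : SmoothFramedFamily Γ)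
    (hΨ : SmoothFamily Ψ) (u : ℝ) :
    metric (Γ u) (velocity Γ u) (velocity Γ u) = l2Inner (rowDeriv 1 Ψ u) (rowDeriv 1 Ψ u) := by
  rw [l2Inner_self _ (hΨ.continuous_rowDeriv 1 u), metric, jetMetric,
    ← intervalIntegral.integral_const_mul]
  refine intervalIntegral.integral_congr fun t _ => ?_
  have hn : rowNormSq ((Ψ u).row t) ≠ 0 := (rowNormSq_pos ((Ψ u).isFrame.ne_zero t)).ne'
  have e : rowNormSq ((Ψ u).row t) = ‖(Ψ u).row t 0‖ ^ 2 + ‖(Ψ u).row t 1‖ ^ 2 := rfl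
  have e' : rowNormSq (rowDeriv 1 Ψ u t) =
    ‖rowDeriv 1 Ψ u t 0‖ ^ 2 + ‖rowDeriv 1 Ψ u t 1‖ ^ 2 := rfl
  have hj1 : (jet (Γ u) (velocity Γ u) t).1 = (rowNormSq ((Ψ u).row t))⁻¹ •
      dhopf₁ ((Ψ u).row t 0) ((Ψ u).row t 1) (rowDeriv 1 Ψ u t 0) (rowDeriv 1 Ψ u t 1) := by
    rw [← h.norm_deriv u t, ← h.deriv_velocity_fst hΓ hΨ]
    rfl
  have hj2 : (jet (Γ u) (velocity Γ u) t).2 = (velocity Γ u).2 t := rfl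
  simp only [hj1, hj2]
  rw [h.inner_velocity_snd hΨ, h.norm_deriv, real_inner_smul_left, real_inner_smul_right,
    real_inner_self_eq_norm_sq, norm_dhopf₁, ← e, ← e']
  field_simp
  ring

theorem dhopf₁_sub (z w ζ η ζ' η' : ℂ) :
    dhopf₁ z w (ζ - ζ') (η - η') = dhopf₁ z w ζ η - dhopf₁ z w ζ' η' := by
  ext i
  fin_cases i <;> simp [dhopf₁] <;> ring

/-- Coordinates of curves of framed loops with the same position and velocity have the same
velocity if they have the same position. -/
theorem Represents.rowDeriv_eq (h : Represents Ψ Γ) (h' : Represents Ξ Δ)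
    (hΓ : SmoothFramedFamily Γ) (hΔ : SmoothFramedFamily Δ) (hΨ : SmoothFamily Ψ)
    (hΞ : SmoothFamily Ξ) {u : ℝ} (e : Γ u = Δ u) (hv : velocity Γ u = velocity Δ u)
    (hr : (Ψ u).row = (Ξ u).row) : rowDeriv 1 Ψ u = rowDeriv 1 Ξ u := by
  ext t
  have hn := rowNormSq_pos ((Ξ u).isFrame.ne_zero t)
  have h1 := h.deriv_velocity_fst hΓ hΨ u t
  rw [hv, h'.deriv_velocity_fst hΔ hΞ u t, hr, eq_comm, ← sub_eq_zero, ← dhopf₁_sub] at h1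
  have h2 := h.inner_velocity_snd hΨ u t
  rw [hv, e, h'.inner_velocity_snd hΞ u t, hr] at h2
  have h3 := mul_left_cancel₀ (mul_ne_zero (by norm_num) (inv_ne_zero hn.ne')) h2
  have h4 : (star ((Ξ u).row t 0) * (rowDeriv 1 Ψ u t 0 - rowDeriv 1 Ξ u t 0) +
      star ((Ξ u).row t 1) * (rowDeriv 1 Ψ u t 1 - rowDeriv 1 Ξ u t 1)).im = 0 := by
    have : star ((Ξ u).row t 0) * (rowDeriv 1 Ψ u t 0 - rowDeriv 1 Ξ u t 0) +
      star ((Ξ u).row t 1) * (rowDeriv 1 Ψ u t 1 - rowDeriv 1 Ξ u t 1) =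
      (star ((Ξ u).row t 0) * rowDeriv 1 Ψ u t 0 + star ((Ξ u).row t 1) * rowDeriv 1 Ψ u t 1) -
      (star ((Ξ u).row t 0) * rowDeriv 1 Ξ u t 0 + star ((Ξ u).row t 1) * rowDeriv 1 Ξ u t 1) := by
      ring
    rw [this, Complex.sub_im, h3, sub_self]
  have h5 := norm_dhopf₁ ((Ξ u).row t 0) ((Ξ u).row t 1) (rowDeriv 1 Ψ u t 0 - rowDeriv 1 Ξ u t 0)
    (rowDeriv 1 Ψ u t 1 - rowDeriv 1 Ξ u t 1)
  rw [h1, h4, norm_zero] at h5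
  have hn' : 0 < ‖(Ξ u).row t 0‖ ^ 2 + ‖(Ξ u).row t 1‖ ^ 2 := hn
  have h6 : ‖rowDeriv 1 Ψ u t 0 - rowDeriv 1 Ξ u t 0‖ ^ 2 +
      ‖rowDeriv 1 Ψ u t 1 - rowDeriv 1 Ξ u t 1‖ ^ 2 = 0 := by
    have : (‖(Ξ u).row t 0‖ ^ 2 + ‖(Ξ u).row t 1‖ ^ 2) *
      (‖rowDeriv 1 Ψ u t 0 - rowDeriv 1 Ξ u t 0‖ ^ 2 +
      ‖rowDeriv 1 Ψ u t 1 - rowDeriv 1 Ξ u t 1‖ ^ 2) = 0 := by linarith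
    exact (mul_eq_zero.1 this).resolve_left hn'.ne'
  obtain ⟨h7, h8⟩ := (add_eq_zero_iff_of_nonneg (sq_nonneg _) (sq_nonneg _)).1 h6
  refine congrFun (funext (Fin.forall_fin_two.2 ⟨?_, ?_⟩)) _
  · exact sub_eq_zero.1 (norm_eq_zero.1 (pow_eq_zero_iff two_ne_zero |>.1 h7))
  · exact sub_eq_zero.1 (norm_eq_zero.1 (pow_eq_zero_iff two_ne_zero |>.1 h8))

/-- The velocity of a curve of framed loops is determined by that of its coordinates. -/
theorem velocity_toFramed_congr (hΨ : SmoothFamily Ψ) (hΞ : SmoothFamily Ξ) {u : ℝ}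
    (hr : (Ψ u).row = (Ξ u).row) (hd : rowDeriv 1 Ψ u = rowDeriv 1 Ξ u) :
    velocity (fun w => (Ψ w).toFramed) u = velocity (fun w => (Ξ w).toFramed) u := by
  have chain : ∀ (g : (Fin 2 → ℂ) → E3) (t : ℝ), DifferentiableAt ℝ g ((Ψ u).row t) →
      deriv (fun w => g ((Ψ w).row t)) u = deriv (fun w => g ((Ξ w).row t)) u := fun g t hg => by
    have h1 := hg.hasFDerivAt.comp_hasDerivAt u (hasDerivAt_parDeriv hΨ u t)
    have hg' := hg.hasFDerivAt
    rw [hr] at hg'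
    have h2 := hg'.comp_hasDerivAt u (hasDerivAt_parDeriv hΞ u t)
    refine h1.deriv.trans (Eq.trans ?_ h2.deriv.symm)
    have : parDeriv 1 (fun x => (Ψ x).row) u t = parDeriv 1 (fun x => (Ξ x).row) u t :=
      congrFun hd t
    rw [this, hr]
  have c0 : ContDiff ℝ ∞ fun v : Fin 2 → ℂ => v 0 := contDiff_apply ℝ ℂ 0
  have c1 : ContDiff ℝ ∞ fun v : Fin 2 → ℂ => v 1 := contDiff_apply ℝ ℂ 1
  refine Prod.ext (funext fun t => ?_) (funext fun t => ?_)
  · have e1 := fderiv_integral_family (contDiff_hopfTangent hΨ) 0 t u 1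
    have e2 := fderiv_integral_family (contDiff_hopfTangent hΞ) 0 t u 1
    refine e1.trans (Eq.trans (intervalIntegral.integral_congr fun s _ => ?_) e2.symm)
    exact chain (fun v => hopf₁ (v 0) (v 1)) s
      ((ContDiff.hopf₁ c0 c1).differentiable (by simp)).differentiableAt
  · refine chain (fun v => (rowNormSq v)⁻¹ • hopf₂ (v 0) (v 1)) t ?_
    exact ((contDiff_id.rowNormSq.differentiable (by simp)).differentiableAt.inv
      (rowNormSq_pos ((Ψ u).isFrame.ne_zero t)).ne').smul
      ((ContDiff.hopf₂ c0 c1).differentiable (by simp)).differentiableAt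

/-! ### The speed of a curve -/

theorem dSmooth_of_family {x : ℝ → FramedLoop} (h : SmoothFramedFamily x) : DSmooth x :=
  fun _ _ hp => isPlot_framedLoop_iff.2
    ⟨h.1.comp ((hp.contDiff.comp contDiff_fst).prodMk contDiff_snd),
      h.2.comp ((hp.contDiff.comp contDiff_fst).prodMk contDiff_snd)⟩

theorem smoothFramedFamily_of_dSmooth {x : ℝ → FramedLoop} (h : DSmooth x) :
    SmoothFramedFamily x := by
  have hp : IsPlot (fun y : EuclideanSpace ℝ (Fin 1) => y 0) :=
    ContDiff.isPlot (EuclideanSpace.proj (𝕜 := ℝ) (0 : Fin 1)).contDiff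
  have h1 := isPlot_framedLoop_iff.1 (h 1 _ hp)
  have hs : ContDiff ℝ ∞ fun q : ℝ × ℝ => ((!₂[q.1] : EuclideanSpace ℝ (Fin 1)), q.2) := by
    refine ContDiff.prodMk ?_ contDiff_snd
    rw [contDiff_euclidean]
    intro i
    fin_cases i
    exact contDiff_fst
  exact ⟨h1.1.comp hs, h1.2.comp hs⟩

theorem isLift_toFramed (hΨ : SmoothFamily Ψ) {c : ℝ → FramedModuli} {u : ℝ}
    (h : ∀ᶠ w in 𝓝 u, c w = complexCoordinates σ (Quotient.mk _ (Ψ w))) :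
    IsLift (fun w => (Ψ w).toFramed) c u :=
  ⟨dSmooth_of_family hΨ.toFramed, fun w => (Ψ w).toFramed_length, h⟩

theorem IsLift.exists_represents {c : ℝ → FramedModuli} {u : ℝ} (h : IsLift Γ c u) :
    ∃ (σ : ℤˣ) (Ψ : ℝ → Stiefel ℂ σ), SmoothFamily Ψ ∧ Represents Ψ Γ ∧
      ∀ᶠ w in 𝓝 u, c w = complexCoordinates σ (Quotient.mk _ (Ψ w)) := by
  obtain ⟨σ, Ψ, hΨ, hT, hV, -⟩ := exists_stiefel_lift (smoothFramedFamily_of_dSmooth h.1)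
  refine ⟨σ, Ψ, hΨ, ⟨fun w t => ?_, hV⟩, h.2.2.mono fun w hw => hw.trans ?_⟩
  · rw [hT, h.2.1, div_self two_ne_zero, one_smul]
  · exact (mk_toFramed_eq (hT w) (hV w)).symm

/-- The quotient metric is the `L²` metric on the horizontal part of the velocity of the
coordinates. -/
theorem speedSq_eq (hΨ : SmoothFamily Ψ) {c : ℝ → FramedModuli} {u : ℝ}
    (h : ∀ᶠ w in 𝓝 u, c w = complexCoordinates σ (Quotient.mk _ (Ψ w))) :
    speedSq c u = l2Inner (horizontal (Ψ u).row (rowDeriv 1 Ψ u))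
      (horizontal (Ψ u).row (rowDeriv 1 Ψ u)) := by
  refine IsLeast.csInf_eq ⟨?_, ?_⟩
  -- The horizontal representative attains the infimum.
  · obtain ⟨M, hU, hM, h1, -, hh⟩ := exists_horizontal hΨ u
    have hs := hΨ.gauge hM hU
    refine ⟨_, isLift_toFramed hs (h.mono fun w hw => by rw [hw, Stiefel.mk_gauge]), ?_⟩
    rw [(represents_toFramed _).metric_velocity hs.toFramed hs, ← horizontal_of_gram_eq_zero
      hh.self_of_nhds, horizontal_gauge hΨ hM (Eventually.of_forall fun w =>
        ⟨hU w, (Ψ w).row_gauge (hU w)⟩), h1, rmul_one]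
  -- Any other representative has the same horizontal part, up to a unitary matrix.
  · rintro e ⟨Γ, hΓ, rfl⟩
    obtain ⟨τ, Ξ, hΞ, hr, hc⟩ := hΓ.exists_represents
    obtain ⟨M, hM, hg⟩ := exists_gauge hΨ hΞ (h.mp (hc.mono fun w h1 h2 => h2.symm.trans h1))
    have hc := (Ξ u).continuous_row
    have hc' := hΞ.continuous_rowDeriv 1 u
    rw [hr.metric_velocity (smoothFramedFamily_of_dSmooth hΓ.1) hΞ,
      l2Inner_self_eq hc hc' (Ξ u).gram_self, horizontal_gauge hΨ hM hg,
      l2Inner_rmul (continuous_horizontal (Ψ u).continuous_row (hΨ.continuous_rowDeriv 1 u))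
        (continuous_horizontal (Ψ u).continuous_row (hΨ.continuous_rowDeriv 1 u))
        hg.self_of_nhds.1]
    exact le_add_of_nonneg_right (trace_conjTranspose_mul_self_nonneg _)

end

/-! ### First variation of the energy -/

section

variable {E W : Type} [NormedAddCommGroup E] [NormedSpace ℝ E] [NormedAddCommGroup W]
  [NormedSpace ℝ W] {σ τ : ℤˣ}

theorem parDeriv_comp {F : E → ℝ → W} (hF : ContDiff ℝ ∞ (Function.uncurry F)) {g : ℝ → E} {v : E}
    {u : ℝ} (hg : HasDerivAt g v u) : parDeriv 1 (fun w => F (g w)) u = parDeriv v F (g u) := by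
  ext t
  rw [parDeriv_eq hF]
  exact ((hasFDerivAt_family hF (g u) t).comp_hasDerivAt u hg).deriv

theorem parDeriv_add (F : E → ℝ → W) (v w x : E) :
    parDeriv (v + w) F x = parDeriv v F x + parDeriv w F x := by
  ext t
  exact map_add (fderiv ℝ (fun y => F y t) x) v w

theorem parDeriv_neg (F : E → ℝ → W) (v x : E) : parDeriv (-v) F x = -parDeriv v F x := by
  ext t
  exact map_neg (fderiv ℝ (fun y => F y t) x) v

theorem contDiff_l2Inner [ProperSpace E] {F G : E → ℝ → Fin 2 → ℂ}
    (hF : ContDiff ℝ ∞ (Function.uncurry F)) (hG : ContDiff ℝ ∞ (Function.uncurry G)) :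
    ContDiff ℝ ∞ fun x => l2Inner (F x) (G x) := by
  have h := smoothMatrix_gram hF hG
  simp only [l2Inner, Matrix.trace_fin_two]
  exact contDiff_complex_re ((h 0 0).add (h 1 1))

theorem fderiv_l2Inner [ProperSpace E] {F G : E → ℝ → Fin 2 → ℂ}
    (hF : ContDiff ℝ ∞ (Function.uncurry F)) (hG : ContDiff ℝ ∞ (Function.uncurry G)) (v x : E) :
    fderiv ℝ (fun x => l2Inner (F x) (G x)) x v =
      l2Inner (parDeriv v F x) (G x) + l2Inner (F x) (parDeriv v G x) := by
  have h := smoothMatrix_gram hF hG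
  have hd : ∀ i j, HasFDerivAt (fun x => gram (F x) (G x) i j)
      (fderiv ℝ (fun x => gram (F x) (G x) i j) x) x := fun i j =>
    ((h i j).differentiable (by simp)).differentiableAt.hasFDerivAt
  have h1 := Complex.reCLM.hasFDerivAt.comp x ((hd 0 0).add (hd 1 1))
  have h2 : (Complex.reCLM ∘ ((fun x => gram (F x) (G x) 0 0) + fun x => gram (F x) (G x) 1 1)) =
      fun x => l2Inner (F x) (G x) := funext fun y => by
    simp [l2Inner, Matrix.trace_fin_two]
  rw [h2] at h1
  rw [h1.fderiv, ContinuousLinearMap.comp_apply, add_apply, fderiv_gram hF hG,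
    fderiv_gram hF hG]
  simp only [l2Inner, Matrix.trace_fin_two, Complex.reCLM_apply, Complex.add_re]
  ring

/-- A smooth family of points of the moduli space: locally it has smooth complex coordinates. -/
def SmoothModuliFamily (P : E → FramedModuli) : Prop :=
  ∀ x, ∃ (σ : ℤˣ) (Φ : E → Stiefel ℂ σ), SmoothFamily Φ ∧
    ∀ᶠ y in 𝓝 x, P y = complexCoordinates σ (Quotient.mk _ (Φ y))

/-- The squared length of the derivative of `P` in the direction `v`. -/
noncomputable def quadraticSpeed (P : E → FramedModuli) (v x : E) : ℝ :=
  speedSq (fun w : ℝ => P (x + w • v)) 0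

theorem speedSq_congr {c d : ℝ → FramedModuli} {u : ℝ} (h : ∀ᶠ w in 𝓝 u, c w = d w) :
    speedSq c u = speedSq d u := by
  have : ∀ Γ, IsLift Γ c u ↔ IsLift Γ d u := fun Γ =>
    ⟨fun H => ⟨H.1, H.2.1, h.mp (H.2.2.mono fun w h1 h2 => h2.symm.trans h1)⟩,
      fun H => ⟨H.1, H.2.1, h.mp (H.2.2.mono fun w h1 h2 => h2.trans h1)⟩⟩
  simp only [speedSq, this]

theorem speedSq_comp {P : E → FramedModuli} {Φ : E → Stiefel ℂ σ} (hΦ : SmoothFamily Φ) {g : ℝ → E}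
    (hg : ContDiff ℝ ∞ g) {v : E} {u : ℝ} (hv : HasDerivAt g v u)
    (h : ∀ᶠ y in 𝓝 (g u), P y = complexCoordinates σ (Quotient.mk _ (Φ y))) :
    speedSq (fun w => P (g w)) u = l2Inner (horizontal (Φ (g u)).row (rowDeriv v Φ (g u)))
      (horizontal (Φ (g u)).row (rowDeriv v Φ (g u))) := by
  rw [speedSq_eq (hΦ.comp hg) (hg.continuous.continuousAt.eventually h)]
  have : rowDeriv 1 (fun x => Φ (g x)) u = rowDeriv v Φ (g u) := parDeriv_comp hΦ hv
  rw [this]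

theorem quadraticSpeed_eq {P : E → FramedModuli} {Φ : E → Stiefel ℂ σ} (hΦ : SmoothFamily Φ) {x : E}
    (h : ∀ᶠ y in 𝓝 x, P y = complexCoordinates σ (Quotient.mk _ (Φ y))) (v : E) :
    quadraticSpeed P v x = l2Inner (horizontal (Φ x).row (rowDeriv v Φ x))
      (horizontal (Φ x).row (rowDeriv v Φ x)) := by
  have hv : HasDerivAt (fun w : ℝ => x + w • v) v 0 := by
    simpa using ((hasDerivAt_id (0 : ℝ)).smul_const v).const_add x
  have e : x + (0 : ℝ) • v = x := by rw [zero_smul, add_zero]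
  have hg : ContDiff ℝ ∞ fun w : ℝ => x + w • v :=
    contDiff_const.add (contDiff_id.smul contDiff_const)
  have := speedSq_comp hΦ hg hv (P := P) (by simpa only [e] using h)
  rw [quadraticSpeed, this, e]

theorem l2Inner_horizontal (Φ : Stiefel ℂ σ) {X : ℝ → Fin 2 → ℂ} (hX : Continuous X) :
    l2Inner (horizontal Φ.row X) (horizontal Φ.row X) =
      l2Inner X X - ((gram Φ.row X).conjTranspose * gram Φ.row X).trace.re := by
  rw [l2Inner_self_eq Φ.continuous_row hX Φ.gram_self, add_sub_cancel_right]

theorem SmoothMatrix.trace_re {M : E → Matrix (Fin 2) (Fin 2) ℂ} (hM : SmoothMatrix M) :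
    ContDiff ℝ ∞ fun x => (M x).trace.re := by
  simp only [Matrix.trace_fin_two]
  exact contDiff_complex_re ((hM 0 0).add (hM 1 1))

theorem SmoothModuliFamily.contDiff_quadraticSpeed [ProperSpace E] {P : E → FramedModuli}
    (hP : SmoothModuliFamily P) (v : E) : ContDiff ℝ ∞ (quadraticSpeed P v) := by
  refine contDiff_iff_contDiffAt.2 fun x => ?_
  obtain ⟨σ, Φ, hΦ, h⟩ := hP x
  have hg := smoothMatrix_gram hΦ (hΦ.contDiff_rowDeriv v)
  have hc : ContDiff ℝ ∞ fun y => l2Inner (rowDeriv v Φ y) (rowDeriv v Φ y) -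
      ((gram (Φ y).row (rowDeriv v Φ y)).conjTranspose * gram (Φ y).row (rowDeriv v Φ y)).trace.re
        :=
    (contDiff_l2Inner (hΦ.contDiff_rowDeriv v) (hΦ.contDiff_rowDeriv v)).sub
      (hg.conjTranspose.mul hg).trace_re
  refine hc.contDiffAt.congr_of_eventuallyEq (h.eventually_nhds.mono fun y hy => ?_)
  rw [quadraticSpeed_eq hΦ hy v, l2Inner_horizontal _ (hΦ.continuous_rowDeriv v y)]

end

section

variable {σ τ : ℤˣ}

/-- The acceleration of a curve of orthonormal pairs on the Grassmannian, if the curve is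
horizontal. -/
noncomputable def acceleration (Φ : ℝ → Stiefel ℂ σ) (u : ℝ) : ℝ → Fin 2 → ℂ :=
  parDeriv 1 (rowDeriv 1 Φ) u + rmul (Φ u).row (gram (rowDeriv 1 Φ u) (rowDeriv 1 Φ u))

/-- The squared speed of the curves `P (s, ·)` of a variation. -/
noncomputable def speedDensity (P : ℝ × ℝ → FramedModuli) : ℝ × ℝ → ℝ := quadraticSpeed P (0, 1)

/-- Twice the inner product of the variation field and the velocity, by polarization. -/
noncomputable def energyFlux (P : ℝ × ℝ → FramedModuli) (u : ℝ) : ℝ :=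
  1 / 2 * (quadraticSpeed P (1, 1) (0, u) - quadraticSpeed P (-1, 1) (0, u))

/-- The integrand of the first variation of the energy, integrated by parts. -/
noncomputable def firstVariation (P : ℝ × ℝ → FramedModuli) (u : ℝ) : ℝ :=
  deriv (energyFlux P) u - fderiv ℝ (speedDensity P) (0, u) (1, 0)

variable {P : ℝ × ℝ → FramedModuli} {Φ : ℝ × ℝ → Stiefel ℂ σ}

theorem hasDerivAt_prodMk (s u : ℝ) : HasDerivAt (fun w : ℝ => (s, w)) ((0, 1) : ℝ × ℝ) u :=
  (hasDerivAt_const u s).prodMk (hasDerivAt_id u)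

theorem contDiff_prodMk_right' (s : ℝ) : ContDiff ℝ ∞ fun w : ℝ => ((s, w) : ℝ × ℝ) :=
  contDiff_const.prodMk contDiff_id

theorem SmoothModuliFamily.speedSq_slice (hP : SmoothModuliFamily P) (s u : ℝ) :
    speedSq (fun w => P (s, w)) u = speedDensity P (s, u) := by
  obtain ⟨σ, Φ, hΦ, h⟩ := hP (s, u)
  rw [speedDensity, quadraticSpeed_eq hΦ h]
  exact speedSq_comp hΦ (contDiff_prodMk_right' s) (hasDerivAt_prodMk s u) h

theorem SmoothModuliFamily.contDiff_energyFlux (hP : SmoothModuliFamily P) :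
    ContDiff ℝ ∞ (energyFlux P) :=
  contDiff_const.mul (((hP.contDiff_quadraticSpeed _).comp (contDiff_prodMk_right' 0)).sub
    ((hP.contDiff_quadraticSpeed _).comp (contDiff_prodMk_right' 0)))

theorem rowDeriv_slice (hΦ : SmoothFamily Φ) (s u : ℝ) :
    rowDeriv 1 (fun w => Φ (s, w)) u = rowDeriv (0, 1) Φ (s, u) :=
  parDeriv_comp hΦ (hasDerivAt_prodMk s u)

theorem acceleration_slice (hΦ : SmoothFamily Φ) (s u : ℝ) :
    acceleration (fun w => Φ (s, w)) u = parDeriv (0, 1) (rowDeriv (0, 1) Φ) (s, u) +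
      rmul (Φ (s, u)).row (gram (rowDeriv (0, 1) Φ (s, u)) (rowDeriv (0, 1) Φ (s, u))) := by
  have h : rowDeriv 1 (fun w => Φ (s, w)) = fun u => rowDeriv (0, 1) Φ (s, u) :=
    funext fun u => rowDeriv_slice hΦ s u
  rw [acceleration, h, parDeriv_comp (hΦ.contDiff_rowDeriv _) (hasDerivAt_prodMk s u)]

/-- The flux in horizontal coordinates. -/
theorem energyFlux_eq (hΦ : SmoothFamily Φ) {u : ℝ}
    (h : ∀ᶠ y in 𝓝 (0, u), P y = complexCoordinates σ (Quotient.mk _ (Φ y)))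
    (hh : gram (Φ (0, u)).row (rowDeriv (0, 1) Φ (0, u)) = 0) :
    energyFlux P u = 2 * l2Inner (rowDeriv (1, 0) Φ (0, u)) (rowDeriv (0, 1) Φ (0, u)) := by
  set X := rowDeriv (1, 0) Φ (0, u) with hX
  set Y := rowDeriv (0, 1) Φ (0, u) with hY
  have cX : Continuous X := hΦ.continuous_rowDeriv _ _
  have cY : Continuous Y := hΦ.continuous_rowDeriv _ _
  have c0 := (Φ (0, u)).continuous_row
  have e1 : rowDeriv (1, 1) Φ (0, u) = X + Y := by
    have : ((1, 1) : ℝ × ℝ) = (1, 0) + (0, 1) := by simp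
    rw [this]
    exact parDeriv_add _ _ _ _
  have e2 : rowDeriv (-1, 1) Φ (0, u) = (-1 : ℝ) • X + Y := by
    have : ((-1, 1) : ℝ × ℝ) = -(1, 0) + (0, 1) := by simp
    rw [this, neg_one_smul]
    exact (parDeriv_add _ _ _ _).trans (congrArg (· + Y) (parDeriv_neg _ _ _))
  have cX' : Continuous ((-1 : ℝ) • X) := cX.const_smul _
  rw [energyFlux, quadraticSpeed_eq hΦ h, quadraticSpeed_eq hΦ h, e1, e2,
    l2Inner_horizontal _ (cX.add cY), l2Inner_horizontal _ (cX'.add cY),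
    gram_add_right c0 cX cY, gram_add_right c0 cX' cY, gram_smul_right, hh, add_zero, add_zero]
  have s1 : l2Inner (X + Y) (X + Y) = l2Inner X X + 2 * l2Inner X Y + l2Inner Y Y := by
    have := l2Inner_comm Y X
    simp only [l2Inner] at this ⊢
    rw [gram_add_left cX cY (cX.add cY), gram_add_right cX cX cY, gram_add_right cY cX cY]
    simp only [Matrix.trace_add, Complex.add_re]
    linarith
  have s2 : l2Inner ((-1 : ℝ) • X + Y) ((-1 : ℝ) • X + Y) =
      l2Inner X X - 2 * l2Inner X Y + l2Inner Y Y := by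
    have := l2Inner_comm Y X
    simp only [l2Inner] at this ⊢
    rw [gram_add_left cX' cY (cX'.add cY), gram_add_right cX' cX' cY, gram_add_right cY cX' cY]
    simp only [Matrix.trace_add, Complex.add_re, gram_smul_right, gram_smul_left, Matrix.trace_smul,
      smul_eq_mul, Complex.re_ofReal_mul]
    linarith
  rw [s1, s2]
  have s3 : (((-1 : ℝ) : ℂ) • gram (Φ (0, u)).row X).conjTranspose *
      (((-1 : ℝ) : ℂ) • gram (Φ (0, u)).row X) =
      (gram (Φ (0, u)).row X).conjTranspose * gram (Φ (0, u)).row X := by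
    simp
  rw [s3]
  ring

/-- The first variation formula. -/
theorem firstVariation_eq (hΦ : SmoothFamily Φ) {u : ℝ}
    (h : ∀ᶠ y in 𝓝 (0, u), P y = complexCoordinates σ (Quotient.mk _ (Φ y)))
    (hh : IsHorizontalAt (fun w => Φ (0, w)) u) :
    firstVariation P u =
      2 * l2Inner (rowDeriv (1, 0) Φ (0, u)) (acceleration (fun w => Φ (0, w)) u) := by
  have hs := hΦ.contDiff_rowDeriv (1, 0)
  have hu := hΦ.contDiff_rowDeriv (0, 1)
  have hi : ContDiff ℝ ∞ fun q : ℝ × ℝ => (((0 : ℝ), q.1), q.2) :=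
    (contDiff_const.prodMk contDiff_fst).prodMk contDiff_snd
  have hu0 : gram (Φ (0, u)).row (rowDeriv (0, 1) Φ (0, u)) = 0 := by
    have := hh.self_of_nhds
    rwa [rowDeriv_slice hΦ] at this
  have h1 : deriv (energyFlux P) u =
      2 * (l2Inner (parDeriv (0, 1) (rowDeriv (1, 0) Φ) (0, u)) (rowDeriv (0, 1) Φ (0, u)) +
        l2Inner (rowDeriv (1, 0) Φ (0, u)) (parDeriv (0, 1) (rowDeriv (0, 1) Φ) (0, u))) := by
    have e : energyFlux P =ᶠ[𝓝 u] fun w =>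
        2 * l2Inner (rowDeriv (1, 0) Φ (0, w)) (rowDeriv (0, 1) Φ (0, w)) := by
      filter_upwards [(contDiff_prodMk_right' 0).continuous.continuousAt.eventually
        h.eventually_nhds, hh] with w hw hw'
      rw [rowDeriv_slice hΦ] at hw'
      exact energyFlux_eq hΦ hw hw'
    have hd : DifferentiableAt ℝ
        (fun y => l2Inner (rowDeriv (1, 0) Φ y) (rowDeriv (0, 1) Φ y)) (0, u) :=
      ((contDiff_l2Inner hs hu).differentiable (by simp)).differentiableAt
    have h3 := (hd.hasFDerivAt.comp_hasDerivAt u (hasDerivAt_prodMk 0 u)).const_mul (2 : ℝ)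
    rw [fderiv_l2Inner hs hu] at h3
    exact e.deriv_eq.trans h3.deriv
  have h2 : fderiv ℝ (speedDensity P) (0, u) (1, 0) =
      2 * l2Inner (parDeriv (1, 0) (rowDeriv (0, 1) Φ) (0, u)) (rowDeriv (0, 1) Φ (0, u)) := by
    have e : speedDensity P =ᶠ[𝓝 (0, u)] fun y => l2Inner (rowDeriv (0, 1) Φ y) (rowDeriv (0, 1) Φ
      y) -
        ((gram (Φ y).row (rowDeriv (0, 1) Φ y)).conjTranspose *
          gram (Φ y).row (rowDeriv (0, 1) Φ y)).trace.re := h.eventually_nhds.mono fun y hy => by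
      rw [speedDensity, quadraticSpeed_eq hΦ hy, l2Inner_horizontal _ (hΦ.continuous_rowDeriv _ y)]
    have hg := smoothMatrix_gram hΦ hu
    have hgt := (hg.conjTranspose.mul hg).trace_re
    -- The squared vertical part is minimal, hence critical, where it vanishes.
    have hmin : fderiv ℝ (fun y => ((gram (Φ y).row (rowDeriv (0, 1) Φ y)).conjTranspose *
        gram (Φ y).row (rowDeriv (0, 1) Φ y)).trace.re) (0, u) = 0 := by
      refine IsLocalMin.fderiv_eq_zero (Eventually.of_forall fun y => ?_)
      simp only [hu0, mul_zero, Matrix.trace_zero, Complex.zero_re]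
      exact trace_conjTranspose_mul_self_nonneg _
    rw [e.fderiv_eq, fderiv_fun_sub
      ((contDiff_l2Inner hu hu).differentiable (by simp)).differentiableAt
      (hgt.differentiable (by simp)).differentiableAt, hmin, sub_zero, fderiv_l2Inner hu hu,
      l2Inner_comm (rowDeriv (0, 1) Φ (0, u))]
    ring
  have h4 : parDeriv (0, 1) (rowDeriv (1, 0) Φ) = parDeriv (1, 0) (rowDeriv (0, 1) Φ) :=
    parDeriv_comm hΦ _ _
  have c0 := (Φ (0, u)).continuous_row
  have cs := hΦ.continuous_rowDeriv (1, 0) (0, u)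
  have cuu : Continuous (parDeriv (0, 1) (rowDeriv (0, 1) Φ) (0, u)) :=
    (contDiff_slice (contDiff_parDeriv hu (0, 1)) (0, u)).continuous
  -- The term of the acceleration in the span of `Φ` does not contribute.
  have h5 : (gram (rowDeriv (1, 0) Φ (0, u)) (Φ (0, u)).row *
      gram (rowDeriv (0, 1) Φ (0, u)) (rowDeriv (0, 1) Φ (0, u))).trace.re = 0 := by
    refine trace_skew_mul_hermitian ?_ (gram_conjTranspose _ _)
    rw [gram_conjTranspose, hΦ.gram_rowDeriv_skew, neg_neg]
  rw [firstVariation, h1, h2, h4, acceleration_slice hΦ, l2Inner, l2Inner, l2Inner,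
    gram_add_right cs cuu (continuous_rmul c0 _), gram_rmul_right cs c0, Matrix.trace_add,
    Complex.add_re, h5]
  ring

theorem energyFlux_eq_zero {u : ℝ} (h : ∀ᶠ w in 𝓝 u, ∀ s, P (s, w) = P (0, w)) :
    energyFlux P u = 0 := by
  have h : ∀ᶠ w in 𝓝 (0 : ℝ), ∀ s, P (s, u + w) = P (0, u + w) := by
    have hc : ContinuousAt (fun w : ℝ => u + w) 0 := (continuous_const.add
      continuous_id).continuousAt
    exact hc.eventually (p := fun w => ∀ s, P (s, w) = P (0, w)) (by simpa using h)
  have : quadraticSpeed P (1, 1) (0, u) = quadraticSpeed P (-1, 1) (0, u) := by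
    refine speedSq_congr (h.mono fun w hw => ?_)
    simp only [Prod.smul_mk, Prod.mk_add_mk, smul_eq_mul, mul_one]
    rw [hw, hw (0 + w * -1)]
  rw [energyFlux, this, sub_self, mul_zero]

/-- The derivative of the energy of a variation that is supported in a compact interval. -/
theorem SmoothModuliFamily.hasDerivAt_energy (hP : SmoothModuliFamily P) {a b : ℝ}
    (ha : ∀ᶠ w in 𝓝[<] a, ∀ s, P (s, w) = P (0, w))
    (hb : ∀ᶠ w in 𝓝[>] b, ∀ s, P (s, w) = P (0, w)) :
    HasDerivAt (fun s => ∫ u in a..b, speedSq (fun w => P (s, w)) u)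
      (-∫ u in a..b, firstVariation P u) 0 := by
  have hF : ContDiff ℝ ∞ (speedDensity P) := hP.contDiff_quadraticSpeed _
  have hflux := hP.contDiff_energyFlux
  have hF' : ContDiff ℝ ∞ (Function.uncurry fun s u => speedDensity P (s, u)) := hF
  have h1 := (hasFDerivAt_integral_family hF' a b (0 : ℝ)).differentiableAt.hasDerivAt
  have h2 : deriv (fun s => ∫ u in a..b, speedDensity P (s, u)) 0 =
      ∫ u in a..b, fderiv ℝ (speedDensity P) (0, u) (1, 0) := by
    refine (fderiv_integral_family hF' a b (0 : ℝ) 1).trans ?_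
    refine intervalIntegral.integral_congr fun u _ => ?_
    exact parDeriv_eq hF' 1 0 u
  rw [h2] at h1
  simp only [hP.speedSq_slice]
  refine h1.congr_deriv ?_
  have hcf : Continuous fun u => fderiv ℝ (speedDensity P) (0, u) (1, 0) :=
    (contDiff_fderiv_apply hF (1, 0)).continuous.comp (contDiff_prodMk_right' 0).continuous
  have hcd : Continuous (deriv (energyFlux P)) := hflux.continuous_deriv (by simp)
  -- The flux vanishes at the end points because it vanishes outside the interval.
  have hend : ∀ (S : Set ℝ) (e : ℝ), IsOpen S → (𝓝[S] e).NeBot →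
      (∀ᶠ w in 𝓝[S] e, ∀ s, P (s, w) = P (0, w)) → energyFlux P e = 0 := fun S e hS hne h => by
    have h0 : ∀ᶠ w in 𝓝[S] e, energyFlux P w = 0 := by
      filter_upwards [eventually_eventually_nhdsWithin.2 h, self_mem_nhdsWithin] with w hw hwS
      rw [hS.nhdsWithin_eq hwS] at hw
      exact energyFlux_eq_zero hw
    refine tendsto_nhds_unique (hflux.continuous.continuousAt.tendsto.mono_left
      (nhdsWithin_le_nhds (s := S))) ?_
    exact (tendsto_congr' h0).2 tendsto_const_nhds
  replace ha := hend _ a isOpen_Iio inferInstance ha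
  replace hb := hend _ b isOpen_Ioi inferInstance hb
  have hint : ∫ u in a..b, deriv (energyFlux P) u = 0 := by
    rw [intervalIntegral.integral_deriv_eq_sub
      (fun u _ => (hflux.differentiable (by simp)).differentiableAt)
      (hcd.intervalIntegrable _ _), ha, hb, sub_self]
  simp only [firstVariation]
  rw [intervalIntegral.integral_sub (hcd.intervalIntegrable _ _) (hcf.intervalIntegrable _ _), hint,
    zero_sub, neg_neg]

theorem SmoothModuliFamily.continuous_firstVariation (hP : SmoothModuliFamily P) :
    Continuous (firstVariation P) :=
  (hP.contDiff_energyFlux.continuous_deriv (by simp)).sub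
    ((contDiff_fderiv_apply (hP.contDiff_quadraticSpeed _) (1, 0)).continuous.comp
      (contDiff_prodMk_right' 0).continuous)

end

/-! ### The geodesic equation -/

section

variable {σ τ : ℤˣ}

/-- A horizontal curve of orthonormal pairs that represents `c` near `u`. -/
structure IsHorizontalLift (Φ : ℝ → Stiefel ℂ σ) (c : ℝ → FramedModuli) (u : ℝ) : Prop where
  smooth : SmoothFamily Φ
  lift : ∀ᶠ w in 𝓝 u, c w = complexCoordinates σ (Quotient.mk _ (Φ w))
  horizontal : IsHorizontalAt Φ u

variable {Φ : ℝ → Stiefel ℂ σ} {Ψ : ℝ → Stiefel ℂ τ} {c : ℝ → FramedModuli} {u : ℝ}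

theorem IsHorizontalLift.eventually (h : IsHorizontalLift Φ c u) :
    ∀ᶠ w in 𝓝 u, IsHorizontalLift Φ c w := by
  filter_upwards [h.lift.eventually_nhds, h.horizontal.eventually_nhds] with w h1 h2
  exact ⟨h.smooth, h1, h2⟩

/-- Horizontal lifts of the same curve differ by a locally constant change of gauge. -/
theorem IsHorizontalLift.exists_unitary (h : IsHorizontalLift Φ c u) (h' : IsHorizontalLift Ψ c u) :
    ∃ U ∈ Matrix.unitaryGroup (Fin 2) ℂ, (Ψ u).row = rmul (Φ u).row U ∧
      rowDeriv 1 Ψ u = rmul (rowDeriv 1 Φ u) U ∧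
      acceleration Ψ u = rmul (acceleration Φ u) U := by
  obtain ⟨M, hM, hg⟩ := exists_gauge h.smooth h'.smooth
    (h.lift.mp (h'.lift.mono fun w h1 h2 => h2.symm.trans h1))
  have hd : ∀ᶠ w in 𝓝 u, rowDeriv 1 Ψ w = rmul (rowDeriv 1 Φ w) (M w) ∧
      (Matrix.of fun i j => fderiv ℝ (fun x => M x i j) w 1) = 0 := by
    filter_upwards [hg.eventually_nhds, h.horizontal, h'.horizontal] with w hw h1 h2
    have e := horizontal_gauge h.smooth hM hw 1
    rw [horizontal_of_gram_eq_zero h1, horizontal_of_gram_eq_zero h2] at e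
    refine ⟨e, ?_⟩
    have e' := rowDeriv_gauge h.smooth hM (hw.mono fun y hy => hy.2) 1
    rw [e, left_eq_add] at e'
    have e'' := gram_rmul_right (Φ w).continuous_row (Φ w).continuous_row
      (Matrix.of fun i j => fderiv ℝ (fun x => M x i j) w 1)
    rw [e', (Φ w).gram_self, one_mul] at e''
    rw [← e'']
    ext i j
    simp [gram]
  have hU := hg.self_of_nhds.1
  have hU' : M u * (M u).conjTranspose = 1 := Matrix.mem_unitaryGroup_iff.1 hU
  have cΦ := h.smooth.continuous_rowDeriv 1 u
  refine ⟨M u, hU, hg.self_of_nhds.2, hd.self_of_nhds.1, ?_⟩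
  rw [acceleration, acceleration, parDeriv_congr (hd.mono fun w hw => hw.1),
    parDeriv_rmul (h.smooth.contDiff_rowDeriv 1) hM, hd.self_of_nhds.2, hd.self_of_nhds.1,
    hg.self_of_nhds.2, gram_rmul_left cΦ (continuous_rmul cΦ _), gram_rmul_right cΦ cΦ,
    rmul_zero_right, add_zero, rmul_add_left, rmul_rmul, rmul_rmul, ← mul_assoc, ← mul_assoc, hU',
    one_mul]

theorem exists_isHorizontalLift (hΦ : SmoothFamily Φ)
    (h : ∀ᶠ w in 𝓝 u, c w = complexCoordinates σ (Quotient.mk _ (Φ w))) :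
    ∃ Ψ : ℝ → Stiefel ℂ σ, IsHorizontalLift Ψ c u ∧ (Ψ u).row = (Φ u).row ∧
      rowDeriv 1 Ψ u = horizontal (Φ u).row (rowDeriv 1 Φ u) ∧
      ((∀ w, RealValued (Φ w).row) → ∀ w, RealValued (Ψ w).row) := by
  obtain ⟨M, hU, hM, h1, hr, hh⟩ := exists_horizontal hΦ u
  refine ⟨fun w => (Φ w).gauge (hU w), ⟨hΦ.gauge hM hU, h.mono fun w hw => by
    rw [hw, Stiefel.mk_gauge], hh⟩, ?_, ?_, fun hΦr w => ?_⟩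
  · rw [Stiefel.row_gauge, h1, rmul_one]
  · rw [← horizontal_of_gram_eq_zero hh.self_of_nhds,
      horizontal_gauge hΦ hM (Eventually.of_forall fun w => ⟨hU w, (Φ w).row_gauge (hU w)⟩), h1,
      rmul_one]
  · rw [Stiefel.row_gauge]
    exact (hΦr w).rmul (hr hΦr w)

/-- The geodesic equation for the curve `c` at `u`. -/
def GeodesicEquation (c : ℝ → FramedModuli) (u : ℝ) : Prop :=
  ∃ (σ : ℤˣ) (Φ : ℝ → Stiefel ℂ σ), IsHorizontalLift Φ c u ∧ acceleration Φ u = 0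

theorem GeodesicEquation.acceleration_eq_zero (h : GeodesicEquation c u)
    (hΨ : IsHorizontalLift Ψ c u) : acceleration Ψ u = 0 := by
  obtain ⟨σ, Φ, hΦ, h0⟩ := h
  obtain ⟨U, -, -, -, h1⟩ := hΦ.exists_unitary hΨ
  rw [h1, h0]
  ext t i
  simp [rmul_apply]

/-! ### Smooth families of points of the moduli spaces -/

theorem smoothModuliFamily_of_isPlot {E : Type} [NormedAddCommGroup E] [NormedSpace ℝ E]
    [FiniteDimensional ℝ E] {P : E → FramedModuli}
    (h : IsPlot fun y : EuclideanSpace ℝ (Fin (Module.finrank ℝ E)) => P (toEuclidean.symm y)) :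
    SmoothModuliFamily P := fun x => by
  obtain ⟨σ, Φ, hΦ, hP⟩ := exists_local_coordinates h (toEuclidean x)
  refine ⟨σ, fun y => Φ (toEuclidean y), hΦ.comp toEuclidean.contDiff, ?_⟩
  filter_upwards [toEuclidean.continuous.continuousAt.eventually hP] with y hy
  rw [← hy, ContinuousLinearEquiv.symm_apply_apply]

/-- A smooth map into an interval that is the identity near a compact subinterval. -/
theorem exists_smooth_interval_map {a a' b' b : ℝ} (ha : a < a') (hab : a' ≤ b') (hb : b' < b) :
    ∃ ρ : ℝ → ℝ, ContDiff ℝ ∞ ρ ∧ (∀ u, ρ u ∈ Ioo a b) ∧ ∀ u ∈ Icc a' b', ∀ᶠ w in 𝓝 u, ρ w = w := by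
  obtain ⟨ε, hε, hεa, hεb⟩ : ∃ ε > 0, ε ≤ a' - a ∧ ε ≤ b - b' :=
    ⟨min (a' - a) (b - b'), lt_min (by linarith) (by linarith), min_le_left _ _, min_le_right _ _⟩
  let χ : ContDiffBump ((a' + b') / 2) :=
    ⟨(b' - a') / 2 + ε / 3, (b' - a') / 2 + ε / 2, by linarith, by linarith⟩
  refine ⟨fun u => (a' + b') / 2 + χ u * (u - (a' + b') / 2), ?_, fun u => ?_, fun u hu => ?_⟩
  · exact contDiff_const.add (χ.contDiff.mul (contDiff_id.sub contDiff_const))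
  · have h0 := χ.nonneg (x := u)
    have h1 := χ.le_one (x := u)
    rcases lt_or_ge (dist u ((a' + b') / 2)) ((b' - a') / 2 + ε / 2) with hu | hu
    · rw [Real.dist_eq, abs_lt] at hu
      constructor <;> nlinarith
    · have h2 : χ u = 0 := χ.zero_of_le_dist hu
      simp only [h2, zero_mul, add_zero]
      constructor <;> linarith
  · have : u ∈ Metric.ball ((a' + b') / 2) χ.rIn := by
      rw [Metric.mem_ball, Real.dist_eq, abs_lt]
      change -((b' - a') / 2 + ε / 3) < _ ∧ _ < (b' - a') / 2 + ε / 3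
      constructor <;> linarith [hu.1, hu.2]
    filter_upwards [Metric.isOpen_ball.mem_nhds this] with w hw
    rw [χ.one_of_mem_closedBall (Metric.ball_subset_closedBall hw), one_mul, add_sub_cancel]

variable {X : Type*} [DiffeologicalSpace X]

theorem smoothModuliFamily_curve {f : X → FramedModuli} (hf : DSmooth f) {a b : ℝ} {c : ℝ → X}
    (hc : DSmooth fun u : Ioo a b => c u) {ρ : ℝ → ℝ} (hρ : ContDiff ℝ ∞ ρ)
    (hρm : ∀ u, ρ u ∈ Ioo a b) : SmoothModuliFamily fun u => f (c (ρ u)) := by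
  have h : IsPlot fun y : EuclideanSpace ℝ (Fin (Module.finrank ℝ ℝ)) =>
      ρ (toEuclidean.symm y) := ContDiff.isPlot (hρ.comp toEuclidean.symm.contDiff)
  exact smoothModuliFamily_of_isPlot
    (hf _ _ (hc _ (fun y => ⟨ρ (toEuclidean.symm y), hρm _⟩) h))

theorem smoothModuliFamily_variation {f : X → FramedModuli} (hf : DSmooth f) {a b : ℝ}
    {C : ℝ → ℝ → X} (hC : DSmooth fun p : ℝ × Ioo a b => C p.1 p.2) {ρ : ℝ → ℝ}
    (hρ : ContDiff ℝ ∞ ρ) (hρm : ∀ u, ρ u ∈ Ioo a b) :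
    SmoothModuliFamily fun x : ℝ × ℝ => f (C x.1 (ρ x.2)) := by
  have h1 : IsPlot fun y : EuclideanSpace ℝ (Fin (Module.finrank ℝ (ℝ × ℝ))) =>
      (toEuclidean.symm y : ℝ × ℝ).1 :=
    ContDiff.isPlot (contDiff_fst.comp toEuclidean.symm.contDiff)
  have h2 : IsPlot fun y : EuclideanSpace ℝ (Fin (Module.finrank ℝ (ℝ × ℝ))) =>
      ρ (toEuclidean.symm y : ℝ × ℝ).2 :=
    ContDiff.isPlot (hρ.comp (contDiff_snd.comp toEuclidean.symm.contDiff))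
  exact smoothModuliFamily_of_isPlot (hf _ _ (hC _
    (fun y => ((toEuclidean.symm y : ℝ × ℝ).1, ⟨ρ (toEuclidean.symm y : ℝ × ℝ).2, hρm _⟩))
    ⟨h1, h2⟩))

theorem exists_lift_of_dSmooth {f : X → FramedModuli} (hf : DSmooth f) {a b : ℝ} {c : ℝ → X}
    (hc : DSmooth fun u : Ioo a b => c u) {u : ℝ} (hu : u ∈ Ioo a b) :
    ∃ (σ : ℤˣ) (Φ : ℝ → Stiefel ℂ σ), SmoothFamily Φ ∧
      ∀ᶠ w in 𝓝 u, f (c w) = complexCoordinates σ (Quotient.mk _ (Φ w)) := by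
  obtain ⟨ρ, hρ, hρm, hρe⟩ := exists_smooth_interval_map hu.1 le_rfl hu.2
  obtain ⟨σ, Φ, hΦ, h⟩ := smoothModuliFamily_curve hf hc hρ hρm u
  refine ⟨σ, Φ, hΦ, ?_⟩
  filter_upwards [h, hρe u ⟨le_rfl, le_rfl⟩] with w h1 h2
  rw [← h1, h2]

theorem l2Inner_zero_right (X : ℝ → Fin 2 → ℂ) : l2Inner X 0 = 0 := by
  simp [l2Inner, gram, Matrix.trace_fin_two]

/-- The solutions of the geodesic equation are critical points of the energy. -/
theorem isGeodesic_of_geodesicEquation {a b : ℝ} (hc : DSmooth fun u : Ioo a b => c u)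
    (h : ∀ u ∈ Ioo a b, GeodesicEquation c u) : IsGeodesic id a b c := by
  refine ⟨hc, fun C hC hC0 a' b' ha hab hb hs => ?_⟩
  -- Reparametrization by `ρ` makes the variation a family that is defined for all times.
  obtain ⟨ρ, hρ, hρm, hρe⟩ := exists_smooth_interval_map ha hab hb
  have hP := smoothModuliFamily_variation dSmooth_id hC hρ hρm
  have hab' : uIcc a' b' = Icc a' b' := uIcc_of_le hab
  have hsupp : ∀ w ∈ Ioo a b, w ∉ Icc a' b' → ρ w = w → ∀ s, id (C s (ρ w)) = id (C 0 (ρ w)) :=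
    fun w hw hw' e s => by rw [e, hs s w hw hw', hC0]
  have hE := hP.hasDerivAt_energy (a := a') (b := b') ?_ ?_
  · have e1 : (fun s => ∫ u in a'..b', speedSq (fun w => id (C s (ρ w))) u) =
        fun s => ∫ u in a'..b', speedSq (fun w => id (C s w)) u := by
      refine funext fun s => intervalIntegral.integral_congr fun u hu => ?_
      rw [hab'] at hu
      exact speedSq_congr ((hρe u hu).mono fun w hw => by rw [hw])
    have e2 : ∫ u in a'..b', firstVariation (fun x : ℝ × ℝ => id (C x.1 (ρ x.2))) u = 0 := by
      refine (intervalIntegral.integral_congr (g := fun _ => (0 : ℝ)) fun u hu => ?_).trans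
        intervalIntegral.integral_zero
      rw [hab'] at hu
      obtain ⟨σ, Φ, hΦ, hl⟩ := hP (0, u)
      obtain ⟨M, hU, hM, -, -, hh⟩ :=
        exists_horizontal (hΦ.comp (contDiff_prodMk_right' 0) : SmoothFamily fun w => Φ (0, w)) u
      have hΨ : SmoothFamily fun x : ℝ × ℝ => (Φ x).gauge (hU x.2) :=
        hΦ.gauge (hM.comp contDiff_snd) fun x => hU x.2
      have hl' : ∀ᶠ y in 𝓝 ((0 : ℝ), u), id (C y.1 (ρ y.2)) =
          complexCoordinates σ (Quotient.mk _ ((Φ y).gauge (hU y.2))) :=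
        hl.mono fun y hy => hy.trans (by rw [Stiefel.mk_gauge])
      have hlift : IsHorizontalLift (fun w => (Φ (0, w)).gauge (hU w)) c u := by
        refine ⟨hΨ.comp (contDiff_prodMk_right' 0), ?_, hh⟩
        filter_upwards [(contDiff_prodMk_right' 0).continuous.continuousAt.eventually hl',
          hρe u hu] with w h1 h2
        rw [← h1, h2, hC0, id]
      simp only
      rw [firstVariation_eq hΨ hl' hh, (h u ⟨by linarith [hu.1], by linarith [hu.2]⟩
        ).acceleration_eq_zero hlift, l2Inner_zero_right, mul_zero]
    rw [e1, e2, neg_zero] at hE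
    exact hE
  · filter_upwards [nhdsWithin_le_nhds (hρe a' ⟨le_rfl, hab⟩), self_mem_nhdsWithin,
      nhdsWithin_le_nhds (Ioo_mem_nhds ha (hab.trans_lt hb))] with w h1 h2 h3
    exact hsupp w h3 (fun h => not_le.2 h2 h.1) h1
  · filter_upwards [nhdsWithin_le_nhds (hρe b' ⟨hab, le_rfl⟩), self_mem_nhdsWithin,
      nhdsWithin_le_nhds (Ioo_mem_nhds (ha.trans_le hab) hb)] with w h1 h2 h3
    exact hsupp w h3 (fun h => not_le.2 h2 h.2) h1

end

/-! ### Critical points of the energy solve the geodesic equation -/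

section

variable {σ τ : ℤˣ} {Φ : ℝ → Stiefel ℂ σ} {c : ℝ → FramedModuli} {u : ℝ}

theorem parDeriv_period {E : Type} [NormedAddCommGroup E] [NormedSpace ℝ E]
    {F : E → ℝ → Fin 2 → ℂ} (h : ∀ x t, F x (t + 2) = σ • F x t) (v x : E) (t : ℝ) :
    parDeriv v F x (t + 2) = σ • parDeriv v F x t := by
  simp only [parDeriv, h]
  rcases Int.units_eq_one_or σ with rfl | rfl
  · simp
  · simp only [Units.smul_def, Units.val_neg, Units.val_one, neg_smul, one_smul]
    rw [fderiv_fun_neg]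
    rfl

theorem rmul_period {F : ℝ → Fin 2 → ℂ} (h : ∀ t, F (t + 2) = σ • F t)
    (M : Matrix (Fin 2) (Fin 2) ℂ) (t : ℝ) : rmul F M (t + 2) = σ • rmul F M t := by
  ext i
  simp only [rmul_apply, h, Pi.smul_apply]
  rcases Int.units_eq_one_or σ with rfl | rfl <;> simp [Units.smul_def]

theorem rowDeriv_period (Φ : ℝ → Stiefel ℂ σ) (u t : ℝ) :
    rowDeriv 1 Φ u (t + 2) = σ • rowDeriv 1 Φ u t :=
  parDeriv_period (fun x => (Φ x).row_period) _ _ _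

theorem acceleration_period (Φ : ℝ → Stiefel ℂ σ) (u t : ℝ) :
    acceleration Φ u (t + 2) = σ • acceleration Φ u t := by
  rw [acceleration, Pi.add_apply, Pi.add_apply, parDeriv_period (rowDeriv_period Φ),
    rmul_period (Φ u).row_period, smul_add]

theorem contDiff_acceleration (hΦ : SmoothFamily Φ) :
    ContDiff ℝ ∞ (Function.uncurry (acceleration Φ)) :=
  (contDiff_parDeriv (hΦ.contDiff_rowDeriv 1) 1).add (contDiff_rmul_family hΦ
    (smoothMatrix_gram (hΦ.contDiff_rowDeriv 1) (hΦ.contDiff_rowDeriv 1)))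

theorem continuous_acceleration (hΦ : SmoothFamily Φ) (u : ℝ) : Continuous (acceleration Φ u) :=
  (contDiff_slice (contDiff_acceleration hΦ) u).continuous

theorem realValued_acceleration (hΦ : SmoothFamily Φ) (h : ∀ u, RealValued (Φ u).row) (u : ℝ) :
    RealValued (acceleration Φ u) := fun t i => by
  have h1 := realValued_parDeriv hΦ h
  have h2 := realValued_parDeriv (hΦ.contDiff_rowDeriv 1) h1 u t i
  have h3 := (h u).rmul ((h1 u).gram (h1 u)) t i
  rw [acceleration, Pi.add_apply, Pi.add_apply, Complex.add_im, h2, zero_add]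
  exact h3

theorem gram_acceleration (hΦ : SmoothFamily Φ) (hh : IsHorizontalAt Φ u) :
    gram (Φ u).row (acceleration Φ u) = 0 := by
  have c0 := (Φ u).continuous_row
  have hd := hΦ.contDiff_rowDeriv 1
  have h1 : gram (rowDeriv 1 Φ u) (rowDeriv 1 Φ u) +
      gram (Φ u).row (parDeriv 1 (rowDeriv 1 Φ) u) = 0 := by
    ext i j
    have e : (fun w => gram (Φ w).row (rowDeriv 1 Φ w) i j) =ᶠ[𝓝 u] fun _ => 0 :=
      hh.mono fun w hw => congrFun (congrFun hw i) j
    have := fderiv_gram hΦ hd 1 u i j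
    rw [e.fderiv_eq, fderiv_const_apply] at this
    exact this.symm
  rw [acceleration, gram_add_right c0 (contDiff_slice (contDiff_parDeriv hd 1) u).continuous
    (continuous_rmul c0 _), gram_rmul_right c0 c0, (Φ u).gram_self, one_mul, add_comm, h1]

theorem gramSchmidtMatrix_one : gramSchmidtMatrix 1 = 1 := by
  ext i j
  fin_cases i <;> fin_cases j <;> simp [gramSchmidtMatrix]

theorem rowDeriv_congr {Ψ : ℝ → Stiefel ℂ τ} (h : ∀ᶠ w in 𝓝 u, (Φ w).row = (Ψ w).row) :
    ∀ᶠ w in 𝓝 u, rowDeriv 1 Φ w = rowDeriv 1 Ψ w :=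
  h.eventually_nhds.mono fun _ hw => parDeriv_congr hw 1

theorem isHorizontalAt_congr {Ψ : ℝ → Stiefel ℂ τ} (h : ∀ᶠ w in 𝓝 u, (Φ w).row = (Ψ w).row)
    (hh : IsHorizontalAt Ψ u) : IsHorizontalAt Φ u := by
  filter_upwards [h, rowDeriv_congr h, hh] with w h1 h2 h3
  rw [h1, h2, h3]

theorem acceleration_congr {Ψ : ℝ → Stiefel ℂ τ} (h : ∀ᶠ w in 𝓝 u, (Φ w).row = (Ψ w).row) :
    acceleration Φ u = acceleration Ψ u := by
  rw [acceleration, acceleration, parDeriv_congr (rowDeriv_congr h), (rowDeriv_congr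
    h).self_of_nhds,
    h.self_of_nhds]

/-- Moving a horizontal curve in the direction of its acceleration gives orthonormalizable pairs. -/
theorem eventually_isPreframe (hΦ : SmoothFamily Φ) (hh : IsHorizontalAt Φ u) :
    ∀ᶠ y in 𝓝 ((0 : ℝ), u), IsPreframe σ ((Φ y.2).row + y.1 • acceleration Φ y.2) := by
  have hF : ContDiff ℝ ∞ (Function.uncurry fun y : ℝ × ℝ =>
      (Φ y.2).row + y.1 • acceleration Φ y.2) := by
    have h1 := ContDiff.comp hΦ (f := fun q : (ℝ × ℝ) × ℝ => (q.1.2, q.2))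
      ((contDiff_snd.comp contDiff_fst).prodMk contDiff_snd)
    have h2 := ContDiff.comp (contDiff_acceleration hΦ) (f := fun q : (ℝ × ℝ) × ℝ => (q.1.2, q.2))
      ((contDiff_snd.comp contDiff_fst).prodMk contDiff_snd)
    exact h1.add (ContDiff.smul (contDiff_fst.comp contDiff_fst) h2)
  have hp : ∀ (y : ℝ × ℝ) t, ((Φ y.2).row + y.1 • acceleration Φ y.2) (t + 2) =
      σ • ((Φ y.2).row + y.1 • acceleration Φ y.2) t := fun y t => by
    simp only [Pi.add_apply, Pi.smul_apply, (Φ y.2).row_period, acceleration_period, smul_add]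
    rw [smul_comm]
  have h0 := eventually_ne_zero hF.continuous hp (x := ((0 : ℝ), u)) fun t => by
    simpa using (Φ u).isFrame.ne_zero t
  have hh' : ∀ᶠ y in 𝓝 ((0 : ℝ), u), gram (Φ y.2).row (acceleration Φ y.2) = 0 :=
    (continuous_snd.continuousAt (x := ((0 : ℝ), u))).eventually
      (p := fun w => gram (Φ w).row (acceleration Φ w) = 0)
      (hh.eventually_nhds.mono fun w hw => gram_acceleration hΦ hw)
  filter_upwards [h0, hh'] with y h1 h2
  refine ⟨contDiff_slice hF y, hp y, h1, (Φ y.2).row, (Φ y.2).continuous_row, ?_⟩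
  rw [gram_add_right (Φ y.2).continuous_row (Φ y.2).continuous_row
    ((continuous_acceleration hΦ _).const_smul _), gram_smul_right, h2, (Φ y.2).gram_self]
  simp

/-- The function `s / (1 + s²)` has derivative `1` at `0`, and it is bounded by `1`. -/
theorem hasDerivAt_cutoff : HasDerivAt (fun s : ℝ => s / (1 + s ^ 2)) 1 0 := by
  have h := (hasDerivAt_id (0 : ℝ)).div (((hasDerivAt_id (0 : ℝ)).pow 2).const_add 1) (by simp)
  exact h.congr_deriv (by simp)

theorem abs_cutoff_lt (s : ℝ) : |s / (1 + s ^ 2)| < 1 := by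
  have hs : 0 < 1 + s ^ 2 := by positivity
  rw [abs_div, abs_of_pos hs, div_lt_one hs]
  nlinarith [sq_abs s, sq_nonneg (|s| - 1), abs_nonneg s]

variable {X : Type*} [DiffeologicalSpace X]

/-- The variation of a horizontal curve in the direction of its acceleration, cut off near `u`. -/
theorem exists_accelerated (hΦ : SmoothFamily Φ) (hh : IsHorizontalAt Φ u) {ε : ℝ} (hε : 0 < ε) :
    ∃ (η : ℝ) (Ξ : ℝ × ℝ → Stiefel ℂ σ) (β : ContDiffBump u), 0 < η ∧ η < ε ∧ β.rOut = η ∧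
      SmoothFamily Ξ ∧ ((∀ w, RealValued (Φ w).row) → ∀ y, RealValued (Ξ y).row) ∧
      (∀ s w, |w - u| < 2 * η → s = 0 ∨ β w = 0 → (Ξ (s, w)).row = (Φ w).row) ∧
      ∀ w, |w - u| < 2 * η → ∃ M : Matrix (Fin 2) (Fin 2) ℂ, ∃ r > 0,
        rowDeriv (1, 0) Ξ (0, w) = rmul (Φ w).row M + (r * β w) • acceleration Φ w := by
  obtain ⟨η, hη, hηε, hpre⟩ : ∃ η > 0, η < ε ∧ ∀ r w, |r| < 4 * η → |w - u| < 4 * η →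
      IsPreframe σ ((Φ w).row + r • acceleration Φ w) := by
    obtain ⟨δ, hδ, h⟩ := Metric.eventually_nhds_iff_ball.1 (eventually_isPreframe hΦ hh)
    refine ⟨min (δ / 4) (ε / 2), by positivity, (min_le_right _ _).trans_lt (by linarith),
      fun r w hr hw => h (r, w) ?_⟩
    have := min_le_left (δ / 4) (ε / 2)
    rw [Metric.mem_ball, Prod.dist_eq, max_lt_iff, Real.dist_eq, Real.dist_eq, sub_zero]
    constructor <;> linarith
  obtain ⟨ρ, hρ, hρm, hρe⟩ := exists_smooth_interval_map (a := u - 4 * η) (a' := u - 2 * η)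
    (b' := u + 2 * η) (b := u + 4 * η) (by linarith) (by linarith) (by linarith)
  let β : ContDiffBump u := ⟨η / 2, η, by linarith, by linarith⟩
  -- The bounded function `s / (1 + s²)` keeps the pairs independent for all real `s`.
  let r : ℝ × ℝ → ℝ := fun y => η * (y.1 / (1 + y.1 ^ 2)) * β y.2
  have hr : ContDiff ℝ ∞ r := by
    refine (contDiff_const.mul (contDiff_fst.div (contDiff_const.add (contDiff_fst.pow 2))
      fun y => ?_)).mul (β.contDiff.comp contDiff_snd)
    positivity
  have hr' : ∀ y, |r y| < 4 * η := fun y => by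
    have h1 := abs_cutoff_lt y.1
    have h2 := β.le_one (x := y.2)
    have h3 := β.nonneg (x := y.2)
    simp only [r]
    rw [abs_mul, abs_mul, abs_of_pos hη, abs_of_nonneg h3]
    have : |y.1 / (1 + y.1 ^ 2)| * β y.2 ≤ 1 := by nlinarith [abs_nonneg (y.1 / (1 + y.1 ^ 2))]
    nlinarith
  have hpre' : ∀ y : ℝ × ℝ, IsPreframe σ ((Φ (ρ y.2)).row + r y • acceleration Φ (ρ y.2)) :=
    fun y => hpre _ _ (hr' y) (abs_lt.2 ⟨by linarith [(hρm y.2).1], by linarith [(hρm y.2).2]⟩)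
  have hF : ContDiff ℝ ∞ (Function.uncurry fun y : ℝ × ℝ =>
      (Φ (ρ y.2)).row + r y • acceleration Φ (ρ y.2)) := by
    have hq : ContDiff ℝ ∞ fun q : (ℝ × ℝ) × ℝ => (ρ q.1.2, q.2) :=
      (hρ.comp (contDiff_snd.comp contDiff_fst)).prodMk contDiff_snd
    have h1 := ContDiff.comp hΦ hq
    have h2 := ContDiff.comp (contDiff_acceleration hΦ) hq
    exact h1.add (ContDiff.smul (hr.comp contDiff_fst) h2)
  have hid : ∀ w, |w - u| < 2 * η → ρ w = w := fun w hw => by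
    rw [abs_lt] at hw
    exact (hρe w ⟨by linarith, by linarith⟩).self_of_nhds
  refine ⟨η, fun y => (hpre' y).orthonormalize, β, hη, hηε, rfl, smoothFamily_orthonormalize hF
    hpre',
    fun hΦr y => (hpre' y).realValued_orthonormalize fun t i => ?_, fun s w hw hs => ?_,
    fun w hw => ?_⟩
  · have h1 := hΦr (ρ y.2) t i
    have h2 := realValued_acceleration hΦ hΦr (ρ y.2) t i
    simp [h1, h2]
  · have h0 : r (s, w) = 0 := by
      rcases hs with rfl | hs
      · simp [r]
      · simp [r, hs]
    rw [IsPreframe.row_orthonormalize, h0, hid w hw, zero_smul, add_zero, (Φ w).gram_self,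
      gramSchmidtMatrix_one, rmul_one]
  · have hG := (smoothMatrix_gram hF hF).gramSchmidt (fun y => (hpre' y).re_pos)
      fun y => (hpre' y).det_pos
    refine ⟨Matrix.of fun i j => fderiv ℝ (fun y : ℝ × ℝ => gramSchmidtMatrix
      (gram ((Φ (ρ y.2)).row + r y • acceleration Φ (ρ y.2))
        ((Φ (ρ y.2)).row + r y • acceleration Φ (ρ y.2))) i j) (0, w) (1, 0), η, hη, ?_⟩
    have h1 : rowDeriv (1, 0) (fun y => (hpre' y).orthonormalize) (0, w) = _ :=
      (parDeriv_congr (Eventually.of_forall fun y => (hpre' y).row_orthonormalize) _).trans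
        (parDeriv_rmul hF hG (1, 0) (0, w))
    have h0 : r (0, w) = 0 := by simp [r]
    have h2 : parDeriv (1, 0) (fun y : ℝ × ℝ => (Φ (ρ y.2)).row + r y • acceleration Φ (ρ y.2))
        (0, w) = (η * β w) • acceleration Φ w := by
      have hg : HasDerivAt (fun s : ℝ => (s, w)) ((1, 0) : ℝ × ℝ) 0 :=
        (hasDerivAt_id 0).prodMk (hasDerivAt_const 0 w)
      rw [← parDeriv_comp hF hg]
      ext1 t
      have h3 : HasDerivAt (fun s => r (s, w)) (η * β w) 0 := by
        have := (hasDerivAt_cutoff.const_mul η).mul_const (β w)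
        rwa [mul_one] at this
      have h4 := (h3.smul_const (acceleration Φ w t)).const_add ((Φ w).row t)
      simp only [parDeriv, Pi.add_apply, Pi.smul_apply, hid w hw]
      exact h4.deriv
    rw [h1, h2, h0, hid w hw, zero_smul, add_zero, (Φ w).gram_self, gramSchmidtMatrix_one, rmul_one,
      add_comm]

/-- Critical points of the energy solve the geodesic equation. Only variations in the direction of
the acceleration are needed. -/
theorem acceleration_eq_zero_of_isGeodesic {f : X → FramedModuli} (hf : IsInduction f) {a b : ℝ}
    {c : ℝ → X} (hc : IsGeodesic f a b c) (hu : u ∈ Ioo a b)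
    (hΦ : IsHorizontalLift Φ (f ∘ c) u)
    (hr : (∀ Ψ : Stiefel ℂ σ, complexCoordinates σ (Quotient.mk _ Ψ) ∈ range f) ∨
      (∀ w, RealValued (Φ w).row) ∧ ∀ Ψ : Stiefel ℂ σ, RealValued Ψ.row →
        complexCoordinates σ (Quotient.mk _ Ψ) ∈ range f) :
    acceleration Φ u = 0 := by
  have hfs : DSmooth f := fun n p hp => (hf.2 n p).1 hp
  obtain ⟨ε, hε, hball⟩ := Metric.eventually_nhds_iff_ball.1
    (hΦ.eventually.and (Ioo_mem_nhds hu.1 hu.2))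
  obtain ⟨η, Ξ, β, hη, hηε, hβ, hΞ, hΞr, hΞΦ, hΞd⟩ :=
    exists_accelerated hΦ.smooth hΦ.horizontal (half_pos hε)
  have hnear : ∀ w, |w - u| < 2 * η → IsHorizontalLift Φ (f ∘ c) w ∧ w ∈ Ioo a b := fun w hw =>
    hball w (by rw [Metric.mem_ball, Real.dist_eq]; linarith)
  have hrange : ∀ y, complexCoordinates σ (Quotient.mk _ (Ξ y)) ∈ range f := fun y => by
    rcases hr with hr | ⟨h1, h2⟩
    · exact hr _
    · exact h2 _ (hΞr h1 y)
  choose g hg using hrange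
  let P : ℝ × ℝ → FramedModuli := fun y => complexCoordinates σ (Quotient.mk _ (Ξ y))
  have hP : SmoothModuliFamily P := fun x => ⟨σ, Ξ, hΞ, Eventually.of_forall fun _ => rfl⟩
  classical
  -- Preimages under `f` exist where the variation has support; elsewhere the curve is kept.
  let C : ℝ → ℝ → X := fun s w => if β w = 0 then c w else g (s, w)
  have hfc : ∀ s w, |w - u| < 2 * η → s = 0 ∨ β w = 0 → f (c w) = P (s, w) := fun s w hw h => by
    have h1 := (hnear w hw).1.lift.self_of_nhds
    refine h1.trans ?_
    have : Ξ (s, w) = Φ w := Stiefel.row_injective (hΞΦ s w hw h)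
    simp only [P, this]
  have hCP : ∀ s w, |w - u| < 2 * η → f (C s w) = P (s, w) := fun s w hw => by
    by_cases h : β w = 0
    · simp only [C, if_pos h]
      exact hfc s w hw (Or.inr h)
    · simp only [C, if_neg h]
      exact hg _
  have hβ0 : ∀ w, β w ≠ 0 → |w - u| < η := fun w hw => by
    by_contra h
    refine hw (β.zero_of_le_dist ?_)
    rw [Real.dist_eq, hβ]
    exact not_lt.1 h
  have hC : DSmooth fun p : ℝ × Ioo a b => C p.1 p.2 := by
    intro n q hq
    have hq1 : ContDiff ℝ ∞ fun y => (q y).1 := IsPlot.contDiff hq.1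
    have hq2 : IsPlot fun y => ((q y).2 : ℝ) := hq.2
    have hq2' : ContDiff ℝ ∞ fun y => ((q y).2 : ℝ) := IsPlot.contDiff hq2
    refine (hf.2 n _).2 (isPlot_of_eventuallyEq fun x => ?_)
    rcases lt_or_ge (|((q x).2 : ℝ) - u|) (2 * η) with hx | hx
    · refine ⟨fun y => P ((q y).1, (q y).2), ?_, ?_⟩
      · exact dSmooth_complexCoordinates σ _ _ (isPlot_quotient_mk
          (isPlot_stiefel_iff.2 (hΞ.comp (hq1.prodMk hq2'))))
      · filter_upwards [(hq2'.continuous.sub continuous_const).abs.continuousAt.eventually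
          (gt_mem_nhds hx)] with y hy
        exact hCP _ _ hy
    · refine ⟨fun y => f (c (q y).2), hfs _ _ (hc.1 _ _ hq.2), ?_⟩
      have hx' : η < |((q x).2 : ℝ) - u| := by linarith
      filter_upwards [(hq2'.continuous.sub continuous_const).abs.continuousAt.eventually
        (lt_mem_nhds hx')] with y hy
      have : β ((q y).2 : ℝ) = 0 := by
        by_contra h
        exact absurd (hβ0 _ h) (not_lt.2 hy.le)
      simp only [Function.comp_apply, C, if_pos this]
  have hC0 : C 0 = c := funext fun w => by
    by_cases h : β w = 0
    · simp only [C, if_pos h]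
    · have hw : |w - u| < 2 * η := (hβ0 w h).trans (by linarith)
      refine hf.1 ((hCP 0 w hw).trans (hfc 0 w hw (Or.inl rfl)).symm)
  have habs : ∀ w ∈ Icc (u - η) (u + η), |w - u| < 2 * η := fun w hw =>
    abs_lt.2 ⟨by linarith [hw.1], by linarith [hw.2]⟩
  have hcrit := hc.2 C hC hC0 (u - η) (u + η) ?_ (by linarith) ?_ fun s w _ hw => ?_
  · have hE := hP.hasDerivAt_energy (a := u - η) (b := u + η) ?_ ?_
    · have e1 : (fun s => ∫ w in (u - η)..(u + η), speedSq (fun w => f (C s w)) w) =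
          fun s => ∫ w in (u - η)..(u + η), speedSq (fun w => P (s, w)) w := by
        refine funext fun s => intervalIntegral.integral_congr fun w hw => ?_
        rw [uIcc_of_le (by linarith)] at hw
        refine speedSq_congr ?_
        filter_upwards [(continuous_id.sub continuous_const).abs.continuousAt.eventually
          (gt_mem_nhds (habs w hw))] with w' hw'
        exact hCP s w' hw'
      rw [e1] at hcrit
      have hzero := neg_eq_zero.1 (hE.unique hcrit)
      -- The integrand is a positive multiple of the squared length of the acceleration.
      have hfv : ∀ w ∈ Icc (u - η) (u + η), ∃ r > 0,
          firstVariation P w = r * β w * l2Inner (acceleration Φ w) (acceleration Φ w) := by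
        intro w hw
        have hw' := habs w hw
        have hlift := (hnear w hw').1
        have heq : ∀ᶠ w' in 𝓝 w, (Ξ (0, w')).row = (Φ w').row := by
          filter_upwards [(continuous_id.sub continuous_const).abs.continuousAt.eventually
            (gt_mem_nhds hw')] with w' h'
          exact hΞΦ 0 w' h' (Or.inl rfl)
        obtain ⟨M, r, hr0, hd⟩ := hΞd w hw'
        refine ⟨2 * r, by positivity, ?_⟩
        rw [firstVariation_eq hΞ (Eventually.of_forall fun _ => rfl)
          (isHorizontalAt_congr heq hlift.horizontal), acceleration_congr heq, hd, l2Inner,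
          gram_add_left (continuous_rmul (Φ w).continuous_row _)
            ((continuous_acceleration hΦ.smooth w).const_smul _)
            (continuous_acceleration hΦ.smooth w),
          gram_rmul_left (Φ w).continuous_row (continuous_acceleration hΦ.smooth w),
          gram_acceleration hΦ.smooth hlift.horizontal, mul_zero, zero_add, gram_smul_left,
          Matrix.trace_smul, smul_eq_mul, Complex.re_ofReal_mul, l2Inner]
        ring
      have hcont := fun w => continuous_acceleration hΦ.smooth w
      refine eq_zero_of_l2Inner_self (hcont u) (acceleration_period Φ u) ?_
      by_contra hne
      have hpos : 0 < l2Inner (acceleration Φ u) (acceleration Φ u) :=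
        lt_of_le_of_ne (l2Inner_self_nonneg (hcont u)) (Ne.symm hne)
      refine (intervalIntegral.integral_pos (a := u - η) (b := u + η) (by linarith)
        hP.continuous_firstVariation.continuousOn (fun w hw => ?_)
        ⟨u, ⟨by linarith, by linarith⟩, ?_⟩).ne' hzero
      · obtain ⟨r, hr0, h⟩ := hfv w ⟨hw.1.le, hw.2⟩
        rw [h]
        exact mul_nonneg (mul_nonneg hr0.le β.nonneg) (l2Inner_self_nonneg (hcont w))
      · obtain ⟨r, hr0, h⟩ := hfv u ⟨by linarith, by linarith⟩
        rw [h, β.one_of_mem_closedBall (Metric.mem_closedBall_self β.rIn_pos.le), mul_one]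
        exact mul_pos hr0 hpos
    · filter_upwards [self_mem_nhdsWithin, nhdsWithin_le_nhds (Ioo_mem_nhds
        (show u - 2 * η < u - η by linarith) (show u - η < u by linarith))] with w h1 h2 s
      have h3 : |w - u| < 2 * η := abs_lt.2 ⟨by linarith [h2.1], by linarith [h2.2]⟩
      have h4 : β w = 0 := by
        by_contra h
        have := (abs_lt.1 (hβ0 w h)).1
        linarith [mem_Iio.1 h1]
      rw [← hfc s w h3 (Or.inr h4), ← hfc 0 w h3 (Or.inr h4)]
    · filter_upwards [self_mem_nhdsWithin, nhdsWithin_le_nhds (Ioo_mem_nhds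
        (show u < u + η by linarith) (show u + η < u + 2 * η by linarith))] with w h1 h2 s
      have h3 : |w - u| < 2 * η := abs_lt.2 ⟨by linarith [h2.1], by linarith [h2.2]⟩
      have h4 : β w = 0 := by
        by_contra h
        have := (abs_lt.1 (hβ0 w h)).2
        linarith [mem_Ioi.1 h1]
      rw [← hfc s w h3 (Or.inr h4), ← hfc 0 w h3 (Or.inr h4)]
  · exact (hnear (u - η) (habs _ ⟨le_rfl, by linarith⟩)).2.1
  · exact (hnear (u + η) (habs _ ⟨by linarith, le_rfl⟩)).2.2
  · have : β w = 0 := by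
      by_contra h
      have := abs_lt.1 (hβ0 w h)
      exact hw ⟨by linarith, by linarith⟩
    simp only [C, if_pos this]

end

/-! ### Geodesics tangent to the planar loops stay planar -/

section

variable {σ τ : ℤˣ} {Φ : ℝ → Stiefel ℂ σ} {c : ℝ → FramedModuli} {u : ℝ}

theorem eq_zero_of_linear_ode {V : Type} [NormedAddCommGroup V] [NormedSpace ℝ V]
    (L : V →L[ℝ] V) {a b w₀ : ℝ} {z : ℝ → V} (hw₀ : w₀ ∈ Ioo a b)
    (hz : ∀ w ∈ Ioo a b, HasDerivAt z (L (z w)) w) (h0 : z w₀ = 0) {w : ℝ} (hw : w ∈ Ioo a b) :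
    z w = 0 :=
  ODE_solution_unique_of_mem_Ioo (v := fun _ => L) (s := fun _ => univ) (g := fun _ => 0)
    (fun _ _ => L.lipschitz.lipschitzOnWith) hw₀ (fun t ht => ⟨hz t ht, mem_univ _⟩)
    (fun t _ => ⟨by rw [map_zero]; exact hasDerivAt_const t 0, mem_univ _⟩) h0 hw

/-- On an interval where the geodesic equation holds, the matrix `gram Φ' Φ'` is constant. -/
theorem gram_rowDeriv_const (hΦ : SmoothFamily Φ) {a b : ℝ}
    (hh : ∀ w ∈ Ioo a b, gram (Φ w).row (rowDeriv 1 Φ w) = 0)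
    (ha : ∀ w ∈ Ioo a b, acceleration Φ w = 0) {w w' : ℝ} (hw : w ∈ Ioo a b) (hw' : w' ∈ Ioo a b) :
    gram (rowDeriv 1 Φ w) (rowDeriv 1 Φ w) = gram (rowDeriv 1 Φ w') (rowDeriv 1 Φ w') := by
  have hd := hΦ.contDiff_rowDeriv 1
  ext i j
  have hs := smoothMatrix_gram hd hd i j
  refine isOpen_Ioo.is_const_of_deriv_eq_zero isPreconnected_Ioo
    (hs.differentiable (by simp)).differentiableOn (fun v hv => ?_) hw hw'
  have c0 := (Φ v).continuous_row
  have c1 := hΦ.continuous_rowDeriv 1 v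
  have h1 : parDeriv 1 (rowDeriv 1 Φ) v =
      rmul (Φ v).row (-gram (rowDeriv 1 Φ v) (rowDeriv 1 Φ v)) := by
    rw [rmul_neg_right]
    exact eq_neg_of_add_eq_zero_left (ha v hv)
  have h2 : gram (rowDeriv 1 Φ v) (Φ v).row = 0 := by
    rw [← gram_conjTranspose, hh v hv, Matrix.conjTranspose_zero]
  have h3 := fderiv_gram hd hd 1 v i j
  rw [h1, gram_rmul_left c0 c1, gram_rmul_right c1 c0, hh v hv, h2, mul_zero, zero_mul,
    Matrix.zero_apply, add_zero] at h3
  exact h3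

/-- By uniqueness for the linear equation `Φ'' = -Φ Q`, real initial data give real solutions. -/
theorem realValued_of_geodesic (hΦ : SmoothFamily Φ) {a b : ℝ}
    (hh : ∀ w ∈ Ioo a b, gram (Φ w).row (rowDeriv 1 Φ w) = 0)
    (ha : ∀ w ∈ Ioo a b, acceleration Φ w = 0) {w₀ : ℝ} (hw₀ : w₀ ∈ Ioo a b)
    (h0 : RealValued (Φ w₀).row) (h1 : RealValued (rowDeriv 1 Φ w₀)) {w : ℝ} (hw : w ∈ Ioo a b) :
    RealValued (Φ w).row ∧ RealValued (rowDeriv 1 Φ w) := by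
  set Q := gram (rowDeriv 1 Φ w₀) (rowDeriv 1 Φ w₀) with hQ
  have hQr : RealMatrix Q := h1.gram h1
  let L : (Fin 2 → ℝ) × (Fin 2 → ℝ) →L[ℝ] (Fin 2 → ℝ) × (Fin 2 → ℝ) :=
    LinearMap.toContinuousLinearMap
      { toFun := fun z => (z.2, fun i => -(z.1 0 * (Q 0 i).re + z.1 1 * (Q 1 i).re))
        map_add' := fun z z' => by
          refine Prod.ext rfl (funext fun i => ?_)
          simp only [Prod.fst_add, Prod.snd_add, Pi.add_apply]
          ring
        map_smul' := fun r z => by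
          refine Prod.ext rfl (funext fun i => ?_)
          simp only [Prod.smul_fst, Prod.smul_snd, Pi.smul_apply, smul_eq_mul, RingHom.id_apply]
          ring }
  -- The imaginary parts of `Φ` and `Φ'` at a fixed `t` solve a linear equation in the time `w`.
  have key : ∀ t, ((fun i => ((Φ w).row t i).im, fun i => (rowDeriv 1 Φ w t i).im) :
      (Fin 2 → ℝ) × (Fin 2 → ℝ)) = 0 := fun t => by
    refine eq_zero_of_linear_ode L hw₀ (z := fun w =>
      (fun i => ((Φ w).row t i).im, fun i => (rowDeriv 1 Φ w t i).im)) (fun v hv => ?_)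
      (Prod.ext (funext fun i => h0 t i) (funext fun i => h1 t i)) hw
    refine HasDerivAt.prodMk (hasDerivAt_pi.2 fun i => ?_) (hasDerivAt_pi.2 fun i => ?_)
    · exact Complex.imCLM.hasFDerivAt.comp_hasDerivAt v (hasDerivAt_row hΦ v t i)
    · have h2 : HasDerivAt (fun w => rowDeriv 1 Φ w t i) (parDeriv 1 (rowDeriv 1 Φ) v t i) v :=
        hasDerivAt_pi.1 (hasDerivAt_parDeriv (hΦ.contDiff_rowDeriv 1) v t) i
      have h3 : parDeriv 1 (rowDeriv 1 Φ) v t i = -rmul (Φ v).row Q t i := by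
        have := congrFun (congrFun (ha v hv) t) i
        rw [acceleration, gram_rowDeriv_const hΦ hh ha hv hw₀] at this
        exact eq_neg_of_add_eq_zero_left this
      refine (Complex.imCLM.hasFDerivAt.comp_hasDerivAt v h2).congr_deriv ?_
      rw [h3, rmul_apply, Complex.imCLM_apply]
      simp [hQr 0 i, hQr 1 i]
  exact ⟨fun t i => congrFun (congrArg Prod.fst (key t)) i,
    fun t i => congrFun (congrArg Prod.snd (key t)) i⟩

/-- The position and velocity of `c` at `u` are those of a curve of planar loops. -/
def IsPlanarAt (c : ℝ → FramedModuli) (u : ℝ) : Prop :=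
  ∃ (σ : ℤˣ) (Φ : ℝ → Stiefel ℂ σ), IsHorizontalLift Φ c u ∧ RealValued (Φ u).row ∧
    RealValued (rowDeriv 1 Φ u)

theorem rowDeriv_gauge_const (hΦ : SmoothFamily Φ) {U : Matrix (Fin 2) (Fin 2) ℂ}
    (hU : U ∈ Matrix.unitaryGroup (Fin 2) ℂ) (w : ℝ) :
    rowDeriv 1 (fun w => (Φ w).gauge hU) w = rmul (rowDeriv 1 Φ w) U := by
  rw [rowDeriv_gauge hΦ (SmoothMatrix.const U) (Eventually.of_forall fun y => (Φ y).row_gauge hU)]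
  have : (Matrix.of fun i j => fderiv ℝ (fun _ : ℝ => U i j) w 1) = 0 := by
    ext i j
    simp
  rw [this, rmul_zero_right, add_zero]

theorem IsHorizontalLift.gauge (h : IsHorizontalLift Φ c u) {U : Matrix (Fin 2) (Fin 2) ℂ}
    (hU : U ∈ Matrix.unitaryGroup (Fin 2) ℂ) : IsHorizontalLift (fun w => (Φ w).gauge hU) c u := by
  refine ⟨h.smooth.gauge (SmoothMatrix.const U) fun _ => hU, h.lift.mono fun w hw => by
    rw [hw, Stiefel.mk_gauge], h.horizontal.mono fun w hw => ?_⟩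
  have c0 := (Φ w).continuous_row
  have c1 := h.smooth.continuous_rowDeriv 1 w
  rw [rowDeriv_gauge_const h.smooth, Stiefel.row_gauge, gram_rmul_left c0 (continuous_rmul c1 _),
    gram_rmul_right c0 c1, hw, zero_mul, mul_zero]

theorem IsHorizontalLift.isPlanarAt (h : IsHorizontalLift Φ c u) {U : Matrix (Fin 2) (Fin 2) ℂ}
    (hU : U ∈ Matrix.unitaryGroup (Fin 2) ℂ) (h0 : RealValued (rmul (Φ u).row U))
    (h1 : RealValued (rmul (rowDeriv 1 Φ u) U)) : IsPlanarAt c u :=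
  ⟨σ, _, h.gauge hU, by rwa [Stiefel.row_gauge], by rwa [rowDeriv_gauge_const h.smooth]⟩

theorem IsPlanarAt.mem_range (h : IsPlanarAt c u) : c u ∈ range planarInclusion := by
  obtain ⟨σ, Φ, hΦ, h0, -⟩ := h
  rw [hΦ.lift.self_of_nhds]
  obtain ⟨R, hR⟩ := Stiefel.exists_toComplex h0
  exact Stiefel.HasRealSpan.mem_range ⟨R, by rw [hR]⟩

/-- Being tangent to the planar loops propagates along geodesics. -/
theorem eventually_isPlanarAt_iff {a b : ℝ} (hc : DSmooth fun u : Ioo a b => c u)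
    (h : ∀ u ∈ Ioo a b, GeodesicEquation c u) (hu : u ∈ Ioo a b) :
    ∀ᶠ w in 𝓝 u, IsPlanarAt c w ↔ IsPlanarAt c u := by
  obtain ⟨σ, Φ₀, hΦ₀, hl⟩ := exists_lift_of_dSmooth (f := id) dSmooth_id hc hu
  obtain ⟨Φ, hΦ, -⟩ := exists_isHorizontalLift hΦ₀ hl
  obtain ⟨ε, hε, hball⟩ := Metric.eventually_nhds_iff_ball.1
    (hΦ.eventually.and (Ioo_mem_nhds hu.1 hu.2))
  rw [Real.ball_eq_Ioo] at hball
  have hlift : ∀ w ∈ Ioo (u - ε) (u + ε), IsHorizontalLift Φ c w := fun w hw => (hball w hw).1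
  have hacc : ∀ w ∈ Ioo (u - ε) (u + ε), acceleration Φ w = 0 := fun w hw =>
    (h w (hball w hw).2).acceleration_eq_zero (hlift w hw)
  have key : ∀ w ∈ Ioo (u - ε) (u + ε), ∀ w' ∈ Ioo (u - ε) (u + ε), IsPlanarAt c w →
      IsPlanarAt c w' := by
    rintro w hw w' hw' ⟨τ, Ψ, hΨ, h0, h1⟩
    obtain ⟨U, hU, e0, e1, -⟩ := (hlift w hw).exists_unitary hΨ
    have hg : ∀ v ∈ Ioo (u - ε) (u + ε), IsHorizontalLift (fun w => (Φ w).gauge hU) c v :=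
      fun v hv => (hlift v hv).gauge hU
    refine ⟨σ, _, hg w' hw', realValued_of_geodesic (hg w hw).smooth
      (fun v hv => (hg v hv).horizontal.self_of_nhds)
      (fun v hv => (h v (hball v hv).2).acceleration_eq_zero (hg v hv)) hw ?_ ?_ hw'⟩
    · rwa [Stiefel.row_gauge, ← e0]
    · rwa [rowDeriv_gauge_const hΦ.smooth, ← e1]
  have hmem : u ∈ Ioo (u - ε) (u + ε) := ⟨by linarith, by linarith⟩
  filter_upwards [Ioo_mem_nhds hmem.1 hmem.2] with w hw
  exact ⟨key w hw u hmem, key u hmem w hw⟩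

theorem isPlanarAt_of_isPlanarAt {a b : ℝ} (hc : DSmooth fun u : Ioo a b => c u)
    (h : ∀ u ∈ Ioo a b, GeodesicEquation c u) (hu : u ∈ Ioo a b) (hP : IsPlanarAt c u) {w : ℝ}
    (hw : w ∈ Ioo a b) : IsPlanarAt c w := by
  have hloc : IsLocallyConstant fun v : Ioo a b => IsPlanarAt c v := by
    refine (IsLocallyConstant.iff_eventually_eq _).2 fun v => ?_
    filter_upwards [continuous_subtype_val.continuousAt.eventually
      (eventually_isPlanarAt_iff hc h v.2)] with v' hv'
    exact propext hv'
  have : PreconnectedSpace (Ioo a b) := isPreconnected_iff_preconnectedSpace.1 isPreconnected_Ioo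
  have heq := hloc.apply_eq_of_preconnectedSpace ⟨w, hw⟩ ⟨u, hu⟩
  exact heq.mpr hP

theorem exists_real_lift (hΦ : SmoothFamily Φ)
    (h : ∀ᶠ w in 𝓝 u, c w = complexCoordinates σ (Quotient.mk _ (Φ w)))
    (hr : ∀ᶠ w in 𝓝 u, c w ∈ range planarInclusion) :
    ∃ R : ℝ → Stiefel ℝ σ, SmoothFamily (fun w => (R w).toComplex) ∧
      ∀ᶠ w in 𝓝 u, c w = complexCoordinates σ (Quotient.mk _ (R w).toComplex) := by
  obtain ⟨R, hR, hΦR⟩ := exists_real_family hΦ (x := u) (by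
    filter_upwards [h, hr] with w h1 h2
    exact hasRealSpan_of_mem_range (by rwa [← h1]))
  refine ⟨R, hR, ?_⟩
  filter_upwards [h, hΦR] with w h1 h2
  rw [h1, h2]

theorem Represents.neg {Γ : ℝ → FramedLoop} (h : Represents Φ Γ)
    {U : Matrix (Fin 2) (Fin 2) ℂ} (hU : U ∈ Matrix.unitaryGroup (Fin 2) ℂ) (e : U = -1) :
    Represents (fun w => (Φ w).gauge hU) Γ := by
  have hr : ∀ w t i, ((Φ w).gauge hU).row t i = -(Φ w).row t i := fun w t i => by
    rw [Stiefel.row_gauge, e, rmul_neg_right, rmul_one]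
    rfl
  refine ⟨fun w t => ?_, fun w t => ?_⟩
  · rw [← h.1, hopfTangent, hopfTangent, hr, hr]
    simp [hopf₁]
  · rw [← h.2, hopfFraming, hopfFraming, rowNormSq, rowNormSq, hr, hr]
    simp [hopf₂]

/-- Curves of framed loops with the same position and velocity have horizontal lifts with the same
position and velocity, up to gauge. -/
theorem SameVelocity.exists_represents {d : ℝ → FramedModuli} (h : SameVelocity c d u) :
    ∃ (σ τ : ℤˣ) (Φ : ℝ → Stiefel ℂ σ) (Ψ : ℝ → Stiefel ℂ τ), SmoothFamily Φ ∧ SmoothFamily Ψ ∧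
      (∀ᶠ w in 𝓝 u, c w = complexCoordinates σ (Quotient.mk _ (Φ w))) ∧
      (∀ᶠ w in 𝓝 u, d w = complexCoordinates τ (Quotient.mk _ (Ψ w))) ∧
      (Φ u).row = (Ψ u).row ∧ rowDeriv 1 Φ u = rowDeriv 1 Ψ u := by
  obtain ⟨Γ, Δ, hΓ, hΔ, e, ev⟩ := h
  obtain ⟨σ, Φ, hΦ, hrΦ, hcΦ⟩ := hΓ.exists_represents
  obtain ⟨τ, Ψ, hΨ, hrΨ, hdΨ⟩ := hΔ.exists_represents
  have h1 : ∀ t, hopf₁ ((Ψ u).row t 0) ((Ψ u).row t 1) = hopf₁ ((Φ u).row t 0) ((Φ u).row t 1) :=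
    fun t => by
      have h1 := hrΨ.1 u t
      rw [← e, ← hrΦ.1 u t] at h1
      exact h1
  have hn : ∀ t, rowNormSq ((Ψ u).row t) = rowNormSq ((Φ u).row t) := fun t => by
    have := congrArg norm (h1 t)
    rwa [norm_hopf₁, norm_hopf₁] at this
  have h2 : ∀ t, hopf₂ ((Ψ u).row t 0) ((Ψ u).row t 1) = hopf₂ ((Φ u).row t 0) ((Φ u).row t 1) :=
    fun t => by
      have h2 := hrΨ.2 u t
      rw [← e, ← hrΦ.2 u t, hopfFraming, hopfFraming, hn] at h2
      exact smul_right_injective _ (inv_ne_zero (rowNormSq_pos ((Φ u).isFrame.ne_zero t)).ne') h2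
  have sΓ := smoothFramedFamily_of_dSmooth hΓ.1
  have sΔ := smoothFramedFamily_of_dSmooth hΔ.1
  -- The coordinates agree up to a global sign, which is a gauge transformation.
  obtain ⟨ε, hε⟩ := exists_sign_of_hopf_eq (Φ u).continuous_row (Ψ u).continuous_row
    (Φ u).isFrame.ne_zero h1 h2
  rcases Int.units_eq_one_or ε with rfl | rfl
  · have hr : (Φ u).row = (Ψ u).row := funext fun t => by rw [hε, one_smul]
    exact ⟨σ, τ, Φ, Ψ, hΦ, hΨ, hcΦ, hdΨ, hr, hrΦ.rowDeriv_eq hrΨ sΓ sΔ hΦ hΨ e ev hr⟩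
  · have hU : (-1 : Matrix (Fin 2) (Fin 2) ℂ) ∈ Matrix.unitaryGroup (Fin 2) ℂ := by
      rw [Matrix.mem_unitaryGroup_iff, star_neg, star_one, neg_mul_neg, one_mul]
    have hr : ((Φ u).gauge hU).row = (Ψ u).row := funext fun t => by
      rw [hε, Stiefel.row_gauge, rmul_neg_right, rmul_one]
      simp [Units.smul_def]
    have hΦ' := hΦ.gauge (SmoothMatrix.const (-1)) fun _ => hU
    exact ⟨σ, τ, fun w => (Φ w).gauge hU, Ψ, hΦ', hΨ, hcΦ.mono fun w hw => by
      rw [hw, Stiefel.mk_gauge], hdΨ, hr, (hrΦ.neg hU rfl).rowDeriv_eq hrΨ sΓ sΔ hΦ' hΨ e ev hr⟩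

theorem RealValued.horizontal {F X : ℝ → Fin 2 → ℂ} (hF : RealValued F) (hX : RealValued X) :
    RealValued (_root_.horizontal F X) := fun t i => by
  rw [_root_.horizontal, Pi.sub_apply, Pi.sub_apply, Complex.sub_im, hF.rmul (hF.gram hX) t i,
    sub_zero]
  exact hX t i

theorem isPlanarAt_of_sameVelocity {d : ℝ → PlanarModuli}
    (h : SameVelocity c (planarInclusion ∘ d) u) : IsPlanarAt c u := by
  obtain ⟨σ, τ, Φ, Ψ, hΦ, hΨ, hc, hd, hr, hv⟩ := h.exists_represents
  obtain ⟨R, hR, hdR⟩ := exists_real_lift hΨ hd (Eventually.of_forall fun w => ⟨d w, rfl⟩)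
  obtain ⟨M, hM, hg⟩ := exists_gauge hR hΨ (hdR.mp (hd.mono fun w h1 h2 => h2.symm.trans h1))
  obtain ⟨Φ', hΦ', h0, h1, -⟩ := exists_isHorizontalLift hΦ hc
  have hU := hg.self_of_nhds.1
  have hU' : M u * star (M u) = 1 := Matrix.mem_unitaryGroup_iff.1 hU
  have hRr : ∀ w, RealValued (R w).toComplex.row := fun w => (R w).realValued_toComplex
  refine hΦ'.isPlanarAt (Unitary.star_mem hU) ?_ ?_
  · rw [h0, hr, hg.self_of_nhds.2, rmul_rmul, hU', rmul_one]
    exact hRr u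
  · rw [h1, hr, hv, horizontal_gauge hR hM hg, rmul_rmul, hU', rmul_one]
    exact (hRr u).horizontal (realValued_parDeriv hR hRr u)

theorem geodesicEquation_of_isGeodesic {a b : ℝ} (hc : IsGeodesic id a b c) (hu : u ∈ Ioo a b) :
    GeodesicEquation c u := by
  obtain ⟨σ, Φ₀, hΦ₀, hl⟩ := exists_lift_of_dSmooth (f := id) dSmooth_id hc.1 hu
  obtain ⟨Φ, hΦ, -⟩ := exists_isHorizontalLift hΦ₀ hl
  exact ⟨σ, Φ, hΦ, acceleration_eq_zero_of_isGeodesic ⟨Function.injective_id, fun _ _ => Iff.rfl⟩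
    hc hu hΦ (Or.inl fun Ψ => ⟨_, rfl⟩)⟩

/-- Planar loops are critical under all variations if they are critical under planar ones: the
acceleration of a curve of planar loops is planar. -/
theorem geodesicEquation_of_isGeodesic_planar {a b : ℝ} {c : ℝ → PlanarModuli}
    (hc : IsGeodesic planarInclusion a b c) (hu : u ∈ Ioo a b) :
    GeodesicEquation (planarInclusion ∘ c) u := by
  obtain ⟨σ, Φ₀, hΦ₀, hl⟩ := exists_lift_of_dSmooth dSmooth_planarInclusion hc.1 hu
  obtain ⟨R, hR, hcR⟩ := exists_real_lift hΦ₀ hl (Eventually.of_forall fun w => ⟨c w, rfl⟩)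
  obtain ⟨Φ, hΦ, -, -, hreal⟩ := exists_isHorizontalLift hR hcR
  refine ⟨σ, Φ, hΦ, acceleration_eq_zero_of_isGeodesic isInduction_planarInclusion hc hu hΦ
    (Or.inr ⟨hreal fun w => (R w).realValued_toComplex, fun Ψ hΨ => ?_⟩)⟩
  obtain ⟨S, hS⟩ := Stiefel.exists_toComplex hΨ
  exact Stiefel.HasRealSpan.mem_range ⟨S, by rw [hS]⟩

theorem isGeodesic_planarInclusion_iff (a b : ℝ) (c : ℝ → PlanarModuli) :
    IsGeodesic planarInclusion a b c ↔
      DSmooth (fun u : Ioo a b => c u) ∧ IsGeodesic id a b (planarInclusion ∘ c) := by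
  constructor
  · exact fun hc => ⟨hc.1, isGeodesic_of_geodesicEquation
      (fun _ _ hp => dSmooth_planarInclusion _ _ (hc.1 _ _ hp))
      fun u hu => geodesicEquation_of_isGeodesic_planar hc hu⟩
  · rintro ⟨hc, hg⟩
    refine ⟨hc, fun C hC hC0 a' b' ha hab hb hs => ?_⟩
    exact hg.2 (fun s w => planarInclusion (C s w))
      (fun _ _ hp => dSmooth_planarInclusion _ _ (hC _ _ hp))
      (funext fun w => congrArg planarInclusion (congrFun hC0 w)) a' b' ha hab hb
      fun s w hw hw' => congrArg planarInclusion (hs s w hw hw')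

end

/-! ### Existence of planar geodesics -/

section

variable {σ : ℤˣ}

/-- A real symmetric matrix is diagonalized by a rotation. -/
theorem exists_diagonalizing_rotation {Q : Matrix (Fin 2) (Fin 2) ℂ} (hQ : Q.conjTranspose = Q)
    (hr : RealMatrix Q) :
    ∃ O ∈ Matrix.unitaryGroup (Fin 2) ℂ, RealMatrix O ∧ (O.conjTranspose * Q * O) 0 1 = 0 ∧
      (O.conjTranspose * Q * O) 1 0 = 0 := by
  obtain ⟨a, b, d, rfl⟩ : ∃ a b d : ℝ, Q = !![(a : ℂ), (b : ℂ); (b : ℂ), (d : ℂ)] := by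
    refine ⟨(Q 0 0).re, (Q 0 1).re, (Q 1 1).re, ?_⟩
    have h10 : Q 1 0 = Q 0 1 := by
      have h := congrFun (congrFun hQ 1) 0
      rw [Matrix.conjTranspose_apply, ← Complex.conj_eq_iff_im.2 (hr 0 1)] at h
      simpa using h.symm
    ext i j
    fin_cases i <;> fin_cases j <;> refine Complex.ext ?_ ?_ <;> simp [hr _ _, h10]
  -- The rotation angle is half the argument of `(a - d) / 2 + b i`.
  set z : ℂ := ⟨(a - d) / 2, b⟩ with hz
  set θ := z.arg / 2 with hθ
  have hre : ‖z‖ * Real.cos z.arg = (a - d) / 2 := Complex.norm_mul_cos_arg z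
  have him : ‖z‖ * Real.sin z.arg = b := Complex.norm_mul_sin_arg z
  have hψ : z.arg = 2 * θ := by rw [hθ]; ring
  rw [hψ] at hre him
  have hkey : Real.cos (2 * θ) * b = Real.sin (2 * θ) * ((a - d) / 2) := by
    rw [← hre, ← him]; ring
  rw [Real.cos_two_mul', Real.sin_two_mul] at hkey
  have hcs := Real.sin_sq_add_cos_sq θ
  generalize Real.cos θ = c at hkey hcs
  generalize Real.sin θ = s at hkey hcs
  have hkey' : ((c : ℂ) ^ 2 - s ^ 2) * b = 2 * s * c * ((a - d) / 2) := by exact_mod_cast hkey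
  have hcs' : (s : ℂ) ^ 2 + c ^ 2 = 1 := by exact_mod_cast hcs
  refine ⟨!![(c : ℂ), -(s : ℂ); (s : ℂ), (c : ℂ)], ?_, ?_, ?_, ?_⟩
  · rw [Matrix.mem_unitaryGroup_iff]
    ext i j
    fin_cases i <;> fin_cases j <;>
      simp [Matrix.mul_apply, Fin.sum_univ_two, Matrix.star_apply] <;> first | ring1 |
        linear_combination hcs'
  · intro i j
    fin_cases i <;> fin_cases j <;> simp
  · simp [Matrix.mul_apply, Fin.sum_univ_two, Matrix.conjTranspose_apply]
    linear_combination hkey'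
  · simp [Matrix.mul_apply, Fin.sum_univ_two, Matrix.conjTranspose_apply]
    linear_combination hkey'

theorem exists_sinc (m : ℝ) : ∃ s : ℝ → ℝ, s 0 = 0 ∧ (∀ u, m * s u = Real.sin (m * u)) ∧
    ContDiff ℝ ∞ s ∧ ∀ u, HasDerivAt s (Real.cos (m * u)) u := by
  rcases eq_or_ne m 0 with rfl | hm
  · exact ⟨id, rfl, fun u => by simp, contDiff_id, fun u => by simpa using hasDerivAt_id u⟩
  · refine ⟨fun u => Real.sin (m * u) / m, by simp, fun u => by field_simp, ?_, fun u => ?_⟩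
    · exact (Real.contDiff_sin.comp (contDiff_const.mul contDiff_id)).div_const m
    · have h := ((Real.hasDerivAt_sin (m * u)).comp u ((hasDerivAt_id u).const_mul m)).div_const m
      exact h.congr_deriv (by field_simp)

theorem parDeriv_combination (φ ξ : ℝ → Fin 2 → ℂ) {A B A' B' : ℝ → Matrix (Fin 2) (Fin 2) ℂ} {u :
    ℝ}
    (hA : ∀ i j, HasDerivAt (fun w => A w i j) (A' u i j) u)
    (hB : ∀ i j, HasDerivAt (fun w => B w i j) (B' u i j) u) :
    parDeriv 1 (fun w => rmul φ (A w) + rmul ξ (B w)) u = rmul φ (A' u) + rmul ξ (B' u) := by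
  ext1 t
  refine HasDerivAt.deriv (f := fun w => (rmul φ (A w) + rmul ξ (B w)) t) (hasDerivAt_pi.2 fun i =>
    ?_)
  simp only [Pi.add_apply, rmul_apply]
  exact (((hA 0 i).const_mul _).add ((hA 1 i).const_mul _)).add
    (((hB 0 i).const_mul _).add ((hB 1 i).const_mul _))

theorem gram_combination {φ ξ : ℝ → Fin 2 → ℂ} (hφ : Continuous φ) (hξ : Continuous ξ)
    {Λ : Matrix (Fin 2) (Fin 2) ℂ} (h1 : gram φ φ = 1) (h2 : gram φ ξ = 0) (h3 : gram ξ ξ = Λ)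
    (A B A' B' : Matrix (Fin 2) (Fin 2) ℂ) :
    gram (rmul φ A + rmul ξ B) (rmul φ A' + rmul ξ B') =
      A.conjTranspose * A' + B.conjTranspose * (Λ * B') := by
  have h2' : gram ξ φ = 0 := by rw [← gram_conjTranspose, h2, Matrix.conjTranspose_zero]
  have c := continuous_rmul hφ
  have d := continuous_rmul hξ
  rw [gram_add_left (c _) (d _) ((c _).add (d _)), gram_add_right (c _) (c _) (d _),
    gram_add_right (d _) (c _) (d _), gram_rmul_left hφ (c _), gram_rmul_left hφ (d _),
    gram_rmul_left hξ (c _), gram_rmul_left hξ (d _), gram_rmul_right hφ hφ, gram_rmul_right hφ hξ,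
    gram_rmul_right hξ hφ, gram_rmul_right hξ hξ, h1, h2, h2', h3]
  simp

/-- The diagonal matrix with given real entries. -/
noncomputable def realDiagonal (d : Fin 2 → ℝ) : Matrix (Fin 2) (Fin 2) ℂ :=
  Matrix.diagonal fun i => (d i : ℂ)

theorem realDiagonal_mul (d e : Fin 2 → ℝ) :
    realDiagonal d * realDiagonal e = realDiagonal fun i => d i * e i := by
  simp [realDiagonal, Matrix.diagonal_mul_diagonal]

theorem realDiagonal_add (d e : Fin 2 → ℝ) :
    realDiagonal d + realDiagonal e = realDiagonal fun i => d i + e i := by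
  simp [realDiagonal, Matrix.diagonal_add]

theorem realDiagonal_conjTranspose (d : Fin 2 → ℝ) :
    (realDiagonal d).conjTranspose = realDiagonal d := by
  rw [realDiagonal, Matrix.diagonal_conjTranspose]
  congr 1
  ext i
  simp

theorem realDiagonal_one : realDiagonal (fun _ => 1) = 1 := by simp [realDiagonal]

theorem realDiagonal_zero : realDiagonal (fun _ => 0) = 0 := by simp [realDiagonal]

theorem realMatrix_realDiagonal (d : Fin 2 → ℝ) : RealMatrix (realDiagonal d) := fun i j => by
  rw [realDiagonal, Matrix.diagonal_apply]
  split_ifs <;> simp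

theorem hasDerivAt_realDiagonal {d d' : ℝ → Fin 2 → ℝ} {u : ℝ}
    (h : ∀ i, HasDerivAt (fun w => d w i) (d' u i) u) (i j : Fin 2) :
    HasDerivAt (fun w => realDiagonal (d w) i j) (realDiagonal (d' u) i j) u := by
  simp only [realDiagonal, Matrix.diagonal_apply]
  split_ifs with hij
  · exact (h i).ofReal_comp
  · exact hasDerivAt_const u 0

theorem smoothMatrix_realDiagonal {d : ℝ → Fin 2 → ℝ} (h : ∀ i, ContDiff ℝ ∞ fun w => d w i) :
    SmoothMatrix fun w => realDiagonal (d w) := fun i j => by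
  simp only [realDiagonal, Matrix.diagonal_apply]
  split_ifs with hij
  · exact Complex.ofRealCLM.contDiff.comp (h i)
  · exact contDiff_const

theorem acceleration_eq {Φ : ℝ → Stiefel ℂ σ} {F G H : ℝ → ℝ → Fin 2 → ℂ} {u : ℝ}
    (h0 : ∀ᶠ w in 𝓝 u, (Φ w).row = F w) (h1 : ∀ w, parDeriv 1 F w = G w)
    (h2 : ∀ w, parDeriv 1 G w = H w) :
    rowDeriv 1 Φ u = G u ∧ acceleration Φ u = H u + rmul (F u) (gram (G u) (G u)) := by
  have hd : ∀ᶠ w in 𝓝 u, rowDeriv 1 Φ w = G w := h0.eventually_nhds.mono fun w hw =>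
    (parDeriv_congr hw 1).trans (h1 w)
  exact ⟨hd.self_of_nhds, by
    rw [acceleration, parDeriv_congr hd, h2, hd.self_of_nhds, h0.self_of_nhds]⟩

/-- The curve `φᵢ cos (mᵢ u) + ξᵢ sin (mᵢ u) / mᵢ`, for `ξ` orthogonal to `φ` with `gram ξ ξ`
diagonal with entries `mᵢ²`, is a horizontal solution of the geodesic equation. -/
theorem exists_geodesic_of_diagonal {φ ξ : ℝ → Fin 2 → ℂ} (hφ : IsFrame σ φ) (cξ : ContDiff ℝ ∞ ξ)
    (pξ : ∀ t, ξ (t + 2) = σ • ξ t) (rφ : RealValued φ) (rξ : RealValued ξ) (m : Fin 2 → ℝ)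
    (h2 : gram φ ξ = 0) (h3 : gram ξ ξ = realDiagonal fun i => m i ^ 2) :
    ∃ (Φ : ℝ → Stiefel ℂ σ) (ε : ℝ), 0 < ε ∧ SmoothFamily Φ ∧ (∀ u, RealValued (Φ u).row) ∧
      (Φ 0).row = φ ∧ rowDeriv 1 Φ 0 = ξ ∧
      ∀ u ∈ Ioo (-ε) ε, IsHorizontalAt Φ u ∧ acceleration Φ u = 0 := by
  -- `s i u` stands for `sin (mᵢ u) / mᵢ`, and for `u` if `mᵢ = 0`.
  choose s s0 ms cs ds using fun i => exists_sinc (m i)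
  have cφ := hφ.contDiff.continuous
  have cξ' := cξ.continuous
  let C : ℝ → Fin 2 → ℝ := fun u i => Real.cos (m i * u)
  let S : ℝ → Fin 2 → ℝ := fun u i => s i u
  let C' : ℝ → Fin 2 → ℝ := fun u i => -m i ^ 2 * s i u
  let C'' : ℝ → Fin 2 → ℝ := fun u i => -m i ^ 2 * Real.cos (m i * u)
  have dC : ∀ u i, HasDerivAt (fun w => C w i) (C' u i) u := fun u i => by
    refine ((Real.hasDerivAt_cos (m i * u)).comp u ((hasDerivAt_id u).const_mul (m i))).congr_deriv
      ?_
    simp only [C', ← ms i u]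
    ring
  have dS : ∀ u i, HasDerivAt (fun w => S w i) (C u i) u := fun u i => ds i u
  have dC' : ∀ u i, HasDerivAt (fun w => C' w i) (C'' u i) u := fun u i => (ds i u).const_mul _
  have pyth : ∀ u i, C u i * C u i + S u i * (m i ^ 2 * S u i) = 1 := fun u i => by
    have := Real.cos_sq_add_sin_sq (m i * u)
    rw [← ms i u] at this
    simp only [C, S]
    linarith
  let comb : (Fin 2 → ℝ) → (Fin 2 → ℝ) → ℝ → Fin 2 → ℂ := fun d e =>
    rmul φ (realDiagonal d) + rmul ξ (realDiagonal e)
  have hgram : ∀ d e d' e', gram (comb d e) (comb d' e') =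
      realDiagonal fun i => d i * d' i + e i * (m i ^ 2 * e' i) := fun d e d' e' => by
    rw [gram_combination cφ cξ' hφ.gram_self h2 h3, realDiagonal_conjTranspose,
      realDiagonal_conjTranspose, realDiagonal_mul, realDiagonal_mul, realDiagonal_mul,
      realDiagonal_add]
  let F : ℝ → ℝ → Fin 2 → ℂ := fun u => comb (C u) (S u)
  have hF1 : ∀ u, parDeriv 1 F u = comb (C' u) (C u) := fun u => parDeriv_combination φ ξ
    (A' := fun u => realDiagonal (C' u)) (B' := fun u => realDiagonal (C u))
    (hasDerivAt_realDiagonal (dC u)) (hasDerivAt_realDiagonal (dS u))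
  have hF2 : ∀ u, parDeriv 1 (fun u => comb (C' u) (C u)) u = comb (C'' u) (C' u) := fun u =>
    parDeriv_combination φ ξ (A' := fun u => realDiagonal (C'' u))
      (B' := fun u => realDiagonal (C' u)) (hasDerivAt_realDiagonal (dC' u))
      (hasDerivAt_realDiagonal (dC u))
  have hF : ContDiff ℝ ∞ (Function.uncurry F) := by
    have cC : ∀ i, ContDiff ℝ ∞ fun w => C w i := fun i =>
      Real.contDiff_cos.comp (contDiff_const.mul contDiff_id)
    exact (contDiff_rmul_family (F := fun _ => φ) (hφ.contDiff.comp contDiff_snd)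
      (smoothMatrix_realDiagonal cC)).add (contDiff_rmul_family (F := fun _ => ξ)
        (cξ.comp contDiff_snd) (smoothMatrix_realDiagonal cs))
  have pF : ∀ u t, F u (t + 2) = σ • F u t := fun u t => by
    simp only [F, comb, Pi.add_apply, rmul_period hφ.period, rmul_period pξ, smul_add]
  have F0 : F 0 = φ := by
    have e1 : C 0 = fun _ => 1 := funext fun i => by simp [C]
    have e2 : S 0 = fun _ => 0 := funext fun i => s0 i
    simp only [F, comb, e1, e2, realDiagonal_one, realDiagonal_zero, rmul_one, rmul_zero_right,
      add_zero]
  have G0 : comb (C' 0) (C 0) = ξ := by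
    have e1 : C 0 = fun _ => 1 := funext fun i => by simp [C]
    have e2 : C' 0 = fun _ => 0 := funext fun i => by simp [C', s0 i]
    simp only [comb, e1, e2, realDiagonal_one, realDiagonal_zero, rmul_one, rmul_zero_right,
      zero_add]
  -- The explicit solution may acquire common zeros, so that it is used for small times only.
  have hne := eventually_ne_zero hF.continuous pF (x := 0) (by rw [F0]; exact hφ.ne_zero)
  obtain ⟨ρ, hρ, hρm, hρe⟩ := exists_smooth_retraction hne
  have hframe : ∀ u, IsFrame σ (F (ρ u)) := fun u =>
    { contDiff := contDiff_slice hF _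
      period := pF _
      gram_self := by
        have h := hgram (C (ρ u)) (S (ρ u)) (C (ρ u)) (S (ρ u))
        simp only [pyth, realDiagonal_one] at h
        exact h
      ne_zero := hρm u }
  obtain ⟨ε, hε, hball⟩ := Metric.eventually_nhds_iff_ball.1 hρe.eventually_nhds
  let Φ : ℝ → Stiefel ℂ σ := fun u => (hframe u).toStiefel
  have hrow : ∀ u, (Φ u).row = F (ρ u) := fun u => (hframe u).row_toStiefel
  have hrow' : ∀ u ∈ Ioo (-ε) ε, ∀ᶠ w in 𝓝 u, (Φ w).row = F w := fun u hu =>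
    (hball u (by rw [Metric.mem_ball, Real.dist_eq, sub_zero]; exact abs_lt.2 hu)).mono
      fun w hw => by rw [hrow, hw]
  have hmem : (0 : ℝ) ∈ Ioo (-ε) ε := ⟨by linarith, hε⟩
  refine ⟨Φ, ε, hε, ?_, fun u => ?_, ?_, ?_, fun u hu => ⟨?_, ?_⟩⟩
  · have := ContDiff.comp hF (f := fun q : ℝ × ℝ => (ρ q.1, q.2))
      ((hρ.comp contDiff_fst).prodMk contDiff_snd)
    simp only [SmoothFamily, hrow]
    exact this
  · rw [hrow]
    intro t i
    simp only [F, comb, Pi.add_apply, Complex.add_im]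
    rw [rφ.rmul (realMatrix_realDiagonal _) t i, rξ.rmul (realMatrix_realDiagonal _) t i, add_zero]
  · rw [(hrow' 0 hmem).self_of_nhds, F0]
  · rw [(acceleration_eq (hrow' 0 hmem) hF1 hF2).1, G0]
  · filter_upwards [(hrow' u hu).eventually_nhds] with w hw
    rw [(acceleration_eq hw hF1 hF2).1, hw.self_of_nhds]
    refine (hgram _ _ _ _).trans ?_
    rw [← realDiagonal_zero]
    congr 1
    ext i
    simp only [C', C, S]
    ring
  · rw [(acceleration_eq (hrow' u hu) hF1 hF2).2, hgram]
    have e : (fun i => C' u i * C' u i + C u i * (m i ^ 2 * C u i)) = fun i => m i ^ 2 :=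
      funext fun i => by
        have := pyth u i
        simp only [C', S, C] at this ⊢
        linear_combination m i ^ 2 * this
    rw [e]
    simp only [F, comb]
    rw [rmul_add_left, rmul_rmul, rmul_rmul, realDiagonal_mul, realDiagonal_mul]
    have e1 : realDiagonal (C'' u) = -realDiagonal fun i => C u i * m i ^ 2 := by
      rw [← sub_eq_zero, sub_neg_eq_add, realDiagonal_add, ← realDiagonal_zero]
      congr 1
      ext i
      simp only [C'', C]
      ring
    have e2 : realDiagonal (C' u) = -realDiagonal fun i => S u i * m i ^ 2 := by
      rw [← sub_eq_zero, sub_neg_eq_add, realDiagonal_add, ← realDiagonal_zero]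
      congr 1
      ext i
      simp only [C', S]
      ring
    rw [e1, e2, rmul_neg_right, rmul_neg_right]
    abel

/-- Every tangent vector of the space of planar loops is the velocity of a planar geodesic. -/
theorem exists_planar_geodesic {d : ℝ → PlanarModuli} (hd : DSmooth d) :
    ∃ ε > 0, ∃ c : ℝ → PlanarModuli, IsGeodesic planarInclusion (-ε) ε c ∧ c 0 = d 0 ∧
      SameVelocity (planarInclusion ∘ c) (planarInclusion ∘ d) 0 := by
  have hd' : DSmooth fun u : Ioo (-1 : ℝ) 1 => d u := fun _ _ hp => hd _ _ hp
  have h01 : (0 : ℝ) ∈ Ioo (-1 : ℝ) 1 := ⟨by norm_num, by norm_num⟩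
  obtain ⟨σ, Φ₀, hΦ₀, hl⟩ := exists_lift_of_dSmooth dSmooth_planarInclusion hd' h01
  obtain ⟨R, hR, hdR⟩ := exists_real_lift hΦ₀ hl (Eventually.of_forall fun w => ⟨d w, rfl⟩)
  have hRr : ∀ w, RealValued (R w).toComplex.row := fun w => (R w).realValued_toComplex
  obtain ⟨Ψ, hΨ, hΨ0, -, hΨr⟩ := exists_isHorizontalLift hR hdR
  specialize hΨr hRr
  set X := rowDeriv 1 Ψ 0 with hX
  have hXr : RealValued X := realValued_parDeriv hΨ.smooth hΨr 0
  have hXc : ContDiff ℝ ∞ X := contDiff_slice (hΨ.smooth.contDiff_rowDeriv 1) 0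
  obtain ⟨O, hO, hOr, hO1, hO2⟩ :=
    exists_diagonalizing_rotation (gram_conjTranspose X X) (hXr.gram hXr)
  have hO' : O * star O = 1 := Matrix.mem_unitaryGroup_iff.1 hO
  have hξc : ContDiff ℝ ∞ (rmul X O) := contDiff_rmul hXc O
  have hgram : gram (rmul X O) (rmul X O) = O.conjTranspose * gram X X * O := by
    rw [gram_rmul_left hXc.continuous hξc.continuous, gram_rmul_right hXc.continuous hXc.continuous,
      mul_assoc]
  have hdiag : gram (rmul X O) (rmul X O) =
      realDiagonal fun i => Real.sqrt (∫ t in (0 : ℝ)..2, ‖rmul X O t i‖ ^ 2) ^ 2 := by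
    have hpos : ∀ i, 0 ≤ ∫ t in (0 : ℝ)..2, ‖rmul X O t i‖ ^ 2 := fun i =>
      intervalIntegral.integral_nonneg (by norm_num) fun _ _ => sq_nonneg _
    simp only [Real.sq_sqrt (hpos _)]
    ext i j
    rw [realDiagonal, Matrix.diagonal_apply]
    split_ifs with hij
    · rw [← hij, gram_self_apply]
    · rw [hgram]
      fin_cases i <;> fin_cases j <;> first | exact absurd rfl hij | exact hO1 | exact hO2
  have horth : gram (rmul (Ψ 0).row O) (rmul X O) = 0 := by
    rw [gram_rmul_left (Ψ 0).continuous_row hξc.continuous,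
      gram_rmul_right (Ψ 0).continuous_row hXc.continuous, hΨ.horizontal.self_of_nhds, zero_mul,
      mul_zero]
  obtain ⟨Φ, ε, hε, hΦ, hΦr, hΦ0, hΦ1, hΦg⟩ := exists_geodesic_of_diagonal
    ((Ψ 0).isFrame.rmul hO) hξc (rmul_period (rowDeriv_period Ψ 0) O) ((hΨr 0).rmul hOr)
    (hXr.rmul hOr) _ horth hdiag
  choose S hS using fun u => Stiefel.exists_toComplex (hΦr u)
  let c : ℝ → PlanarModuli := fun u => realCoordinates σ (Quotient.mk _ (S u))
  have hc : ∀ u, planarInclusion (c u) = complexCoordinates σ (Quotient.mk _ (Φ u)) := fun u => by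
    rw [planarInclusion_mk, hS]
  have hcs : DSmooth c := fun n p hp => (isInduction_planarInclusion.2 n _).2 <| by
    have h1 : IsPlot fun y => Φ (p y) := isPlot_stiefel_iff.2 (hΦ.comp hp.contDiff)
    have h2 := dSmooth_complexCoordinates σ _ _ (isPlot_quotient_mk (s := stiefelSetoid ℂ σ) h1)
    have h3 : planarInclusion ∘ c ∘ p =
      complexCoordinates σ ∘ fun y => Quotient.mk _ (Φ (p y)) := funext fun y => hc (p y)
    rw [h3]
    exact h2
  have hcs' : DSmooth fun u : Ioo (-ε) ε => c u := fun _ _ hp => hcs _ _ hp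
  refine ⟨ε, hε, c, (isGeodesic_planarInclusion_iff _ _ c).2 ⟨hcs', isGeodesic_of_geodesicEquation
    (fun _ _ hp => dSmooth_planarInclusion _ _ (hcs' _ _ hp)) fun u hu => ?_⟩, ?_, ?_⟩
  · exact ⟨σ, Φ, ⟨hΦ, Eventually.of_forall hc, (hΦg u hu).1⟩, (hΦg u hu).2⟩
  · refine planarInclusion_injective ?_
    have h1 := hΨ.lift.self_of_nhds
    rw [hc 0, h1]
    exact congrArg _ (Stiefel.mk_eq_of_rmul hΦ0).symm
  -- Undoing the rotation `O`, the lift has the position and velocity of the lift of `d`.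
  · have hOs := Unitary.star_mem hO
    have hΦ' : SmoothFamily fun w => (Φ w).gauge hOs := hΦ.gauge (SmoothMatrix.const _) fun _ => hOs
    have hr : ((Φ 0).gauge hOs).row = (Ψ 0).row := by
      rw [Stiefel.row_gauge, hΦ0, rmul_rmul, hO', rmul_one]
    refine ⟨fun w => ((Φ w).gauge hOs).toFramed, fun w => (Ψ w).toFramed,
      isLift_toFramed hΦ' (Eventually.of_forall fun w => ?_), isLift_toFramed hΨ.smooth hΨ.lift,
      congrArg Stiefel.toFramed (Stiefel.row_injective hr), velocity_toFramed_congr hΦ' hΨ.smooth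
        hr ?_⟩
    · rw [Stiefel.mk_gauge]
      exact hc w
    · rw [rowDeriv_gauge_const hΦ, hΦ1, rmul_rmul, hO', rmul_one]

/-- The planar loops form a totally geodesic submanifold. -/
theorem isTotallyGeodesic_planarInclusion : IsTotallyGeodesic planarInclusion :=
  ⟨isGeodesic_planarInclusion_iff, fun _ hd => exists_planar_geodesic hd,
    fun _ _ _ hc _ hu _ _ hv _ hw => (isPlanarAt_of_isPlanarAt hc.1
      (fun _ hu => geodesicEquation_of_isGeodesic hc hu) hu (isPlanarAt_of_sameVelocity hv)
      hw).mem_range⟩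

end

theorem proposition6p4 :
    ∃ ι : PlanarModuli → FramedModuli,
      (∀ γ : PlanarLoop, ι (Quotient.mk planarSetoid γ) = Quotient.mk FramedLoop.setoid γ.framed) ∧
      IsSubmanifoldEmbedding ι ∧
      IsTotallyGeodesic ι ∧
      (∀ γ : PlanarLoop, γ.framed.length = 2 →
        IsLagrangian (tangentSpace γ.framed) (verticalSpace γ.framed) (planarTangentSpace γ)
          (fun v w => symplecticForm γ.framed v.fields w.fields)) ∧
      (∃ (ΘR : ∀ σ, Grassmannian ℝ σ → PlanarModuli) (ΘC : ∀ σ, Grassmannian ℂ σ → FramedModuli),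
        IsCoordinateSystem ΘR ∧ IsCoordinateSystem ΘC ∧
        (∀ σ (Φ : Stiefel ℝ σ), ∃ γ, HasRealCoordinates Φ γ ∧
          ΘR σ (Quotient.mk _ Φ) = Quotient.mk planarSetoid γ) ∧
        (∀ σ (Φ : Stiefel ℂ σ), ∃ x, HasComplexCoordinates Φ x ∧
          ΘC σ (Quotient.mk _ Φ) = Quotient.mk FramedLoop.setoid x) ∧
        ∀ σ, ι ∘ ΘR σ = ΘC σ ∘ Grassmannian.inclusion σ) ∧
      (∀ γ η : PlanarLoop,
        forgetOrientation (Quotient.mk orientedPlanarSetoid γ) =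
            forgetOrientation (Quotient.mk orientedPlanarSetoid η) ↔
          Quotient.mk orientedPlanarSetoid η = Quotient.mk orientedPlanarSetoid γ ∨
          Quotient.mk orientedPlanarSetoid η = Quotient.mk orientedPlanarSetoid γ.reflect) ∧
      (∀ γ : PlanarLoop,
        Quotient.mk orientedPlanarSetoid γ.reflect ≠ Quotient.mk orientedPlanarSetoid γ) ∧
      ∀ a : OrientedPlanarModuli, ∃ U : Set OrientedPlanarModuli,
        a ∈ U ∧ IsOpen[dTopology] U ∧ IsOpenInduction (fun b : U => forgetOrientation b) := by
  exact ⟨planarInclusion, fun γ => rfl, isSubmanifoldEmbedding_planarInclusion, isTotallyGeodesic_planarInclusion,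
    fun γ _ => isLagrangian_planar γ,
    ⟨realCoordinates, complexCoordinates, isCoordinateSystem_realCoordinates,
      isCoordinateSystem_complexCoordinates,
      fun σ Φ => ⟨Φ.toPlanar, Φ.hasRealCoordinates, rfl⟩,
      fun σ Φ => ⟨Φ.toFramed, hasComplexCoordinates_toFramed Φ, rfl⟩,
      planarInclusion_realCoordinates⟩,
    forgetOrientation_eq_iff, mk_reflect_ne, exists_orientation_chart⟩
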